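/- **Conventions.** $S^1=\mathbb R/\mathbb Z$ with coordinate $\theta$ and Lebesgue measure. $\mathrm{Diff}^h(S^1)$ is the group of $C^1$-diffeomorphisms of $S^1$ with Hölder derivatives, $C^{1,h}(S^1)$ the space of $C^1$-functions on $S^1$ with Hölder derivative. A Hölder homeomorphism is one that is Hölder together with its inverse. On open surfaces "Hölder" means locally Hölder. "Compact" includes Hausdorff. $J=J^1(S^1,\mathbb R)$ is the space of one-jets of functions, with coordinates $j^1_\theta(f)\mapsto(\theta,r,f)=(\theta,f'(\theta),f(\theta))$, with the projection $\pi_2:J\to T^*S^1$, $(\theta,r,f)\mapsto(\theta,r)$, the $\mathbb R$-action (canonical flow) $\phi_t(\theta,r,f)=(\theta,r,f+t)$, and the foliation $\mathcal F$ by the fibres of $(\theta,r,f)\mapsto(\theta,f)$. The area on $T^*S^1$ is $d\theta\otimes dr$. The group $C^{1,h}(S^1)\rtimes \mathrm{Diff}^h(S^1)$, where $\varphi\in \mathrm{Diff}^h(S^1)$ acts on $C^{1,h}(S^1)$ by $h\mapsto h\circ\varphi^{-1}$, acts on $J$ by $(h,\varphi)\cdot j^1_\theta(f)=j^1_{\varphi(\theta)}(f\circ\varphi^{-1}+h)$.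 $S$ is a closed surface of genus at least $2$. An action of $\pi_1(S)$ on $S^1$ by elements of $\mathrm{Diff}^h(S^1)$ is *$H$-Fuchsian* if a Hölder homeomorphism $S^1\to\mathbb{RP}^1$ conjugates it to the action on $\mathbb{RP}^1$ given by a faithful homomorphism of $\pi_1(S)$ to $PSL(2,\mathbb R)$ with discrete cocompact image. A flow $\phi_t$ that preserves a one-dimensional foliation $\mathcal G$ of a compact space *contracts uniformly the leaves* of $\mathcal G$ if, for the distance $d_{\mathcal G}$ along the leaves coming from a leafwise continuous Riemannian metric, $$\forall\epsilon>0\ \exists\alpha>0\ \exists t_0\ \forall t\ge t_0:\quad d_{\mathcal G}(x,y)\le\alpha\implies d_{\mathcal G}(\phi_t(x),\phi_t(y))\le\epsilon .$$ A homomorphism $\rho:\pi_1(S)\to C^{1,h}(S^1)\rtimes \mathrm{Diff}^h(S^1)$ is *Anosov* if $J/\rho(\pi_1(S))$ is compact, the flow induced on it by the canonical flow contracts uniformly the leaves of $\mathcal F$, and the induced action of $\pi_1(S)$ on $S^1$ is $H$-Fuchsian. **Setting.** Let $\kappa$ be a Hölder homeomorphism of $S^1$ and $D_\kappa=\{(s,t)\in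 S^1\times S^1:\kappa(s)\ne t\}$. Let $p:M\to D_\kappa$ be a principal $\mathbb R$-bundle of class $C^{1,h}$ with a continuous connection $\nabla$ whose curvature (defined by the Stokes formula on rectangles) is $\pm f(s,t)\,ds\wedge dt$ with $f$ positive and Hölder, the sign being constant and depending on the conventions for orientation and curvature. Let $\mathcal L$ be the foliation of $M$ by the parallel lifts of the curves $t\mapsto(s,t)$. Let $\pi_1(S)$ act on $M$ by $C^1$-diffeomorphisms with Hölder derivatives that commute with the $\mathbb R$-action and preserve $\nabla$, and assume that 1. $M/\pi_1(S)$ is compact; 2. the action of $\mathbb R$ on $M/\pi_1(S)$ contracts uniformly the leaves of $\mathcal L$; 3. there are two $H$-Fuchsian actions $\rho_1,\rho_2$ of $\pi_1(S)$ on $S^1$, with $\rho_2(\gamma)=\kappa\,\rho_1(\gamma)\,\kappa^{-1}$, such that for all $\gamma\in\pi_1(S)$ and all $u\in M$ with $p(u)=(s,t)$, $p(\gamma u)=(\rho_1(\gamma)s,\rho_2(\gamma)t)$. **Theorem 8.1.** Consider the pairs $(\hat\psi,\rho)$ of a homeomorphism $\hat\psi:M\to J$ and a homomorphism $\rho:\pi_1(S)\to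 C^{1,h}(S^1)\rtimes \mathrm{Diff}^h(S^1)$ such that - $\pi_2\circ\hat\psi=\psi\circ p$ for some homeomorphism $\psi:D_\kappa\to T^*S^1$ that sends the measure $f\,ds\otimes dt$ to $d\theta\otimes dr$, - $\hat\psi$ commutes with the $\mathbb R$-actions, - $\hat\psi$ sends the leaves of $\mathcal L$ to leaves of $\mathcal F$, - $\hat\psi\circ\gamma=\rho(\gamma)\circ\hat\psi$ for all $\gamma\in\pi_1(S)$. (i) Such a pair exists. (ii) For every such pair $\rho$ is Anosov. If moreover the contraction in 2 holds with $\alpha$ independent of $\epsilon$ (that is, $\exists\alpha\,\forall\epsilon\,\exists t_0$), then so does that of the canonical flow on $J/\rho(\pi_1(S))$. (iii) The pair is unique up to $C^{1,h}(S^1)\rtimes \mathrm{Diff}^h(S^1)$: if $(\hat\psi,\rho)$ is one such pair, then the others are exactly the pairs $(g\circ\hat\psi,\ g\rho g^{-1})$ with $g\in C^{1,h}(S^1)\rtimes \mathrm{Diff}^h(S^1)$. (iv) Let such data be given for every $\lambda$ in a topological space $\Lambda$, on bundles trivialised (in class $C^{1,h}$) as $M_\lambda=D_{\kappa_\lambda}\times\mathbb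 R$ with connection forms $du+a_\lambda\,ds+b_\lambda\,dt$, and depending continuously on $\lambda$: $\kappa_\lambda(s)$ is continuous in $(\lambda,s)$, and $a_\lambda(s,t)$, $b_\lambda(s,t)$ and the curvature density $f_\lambda(s,t)$ are continuous in $(\lambda,s,t)$, $(s,t)\in D_{\kappa_\lambda}$. Then the $\hat\psi_\lambda$ as in (i) can be chosen so that $\hat\psi_\lambda(s,t,u)$ is continuous in $(\lambda,s,t,u)$. -/

import Mathlib

open Set Filter Topology MeasureTheory
open scoped NNReal LinearAlgebra.Projectivization

noncomputable section

/-! ### Regularity on the circle and on the torus -/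

/-- The circle `ℝ / ℤ`, with its usual coordinate, metric and Lebesgue probability measure. -/
abbrev S1 : Type := AddCircle (1 : ℝ)

/-- The covering map of the torus. -/
def toTorus (z : ℝ × ℝ) : S1 × S1 := ((z.1 : S1), (z.2 : S1))

/-- Hölder maps between metric spaces (some positive exponent, some constant). -/
def IsHolder {X Y : Type*} [PseudoEMetricSpace X] [PseudoEMetricSpace Y] (f : X → Y) : Prop :=
  ∃ C r : ℝ≥0, 0 < r ∧ HolderWith C r f

/-- Locally Hölder on a set (equivalently, Hölder on its compact subsets, when the set is open
in a locally compact space). -/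
def LocHolderOn {X Y : Type*} [PseudoEMetricSpace X] [PseudoEMetricSpace Y]
    (f : X → Y) (U : Set X) : Prop :=
  ∀ x ∈ U, ∃ N ∈ 𝓝 x, ∃ C r : ℝ≥0, 0 < r ∧ HolderOnWith C r f N

/-- Derivative of a real function on the circle with respect to the coordinate. -/
def sderiv (h : S1 → ℝ) (θ : S1) : ℝ := deriv (fun x : ℝ => h (θ + (x : S1))) 0

/-- The expression of `φ` near `θ`: the displacement `x` of the source is sent to the
representative in `(-1/2, 1/2]` of the displacement `φ (θ + x) - φ θ`. -/
def localRep (φ : S1 → S1) (θ : S1) (x : ℝ) : ℝ :=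
  (AddCircle.equivIoc (1 : ℝ) (-(1 / 2)) (φ (θ + (x : S1)) - φ θ) : ℝ)

/-- Derivative of a map of the circle with respect to the coordinate. -/
def cderiv (φ : S1 → S1) (θ : S1) : ℝ := deriv (localRep φ θ) 0

/-- `C¹` maps of the circle with Hölder derivative. -/
def IsC1hMap (φ : S1 → S1) : Prop :=
  (∃ F : ℝ → ℝ, ContDiff ℝ 1 F ∧ ∀ x : ℝ, ((F x : ℝ) : S1) = φ (x : S1)) ∧ IsHolder (cderiv φ)

/-- `C¹` functions on the circle with Hölder derivative. -/
def IsC1hFun (h : S1 → ℝ) : Prop :=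
  ContDiff ℝ 1 (fun x : ℝ => h (x : S1)) ∧ IsHolder (sderiv h)

/-- `C¹` functions with (locally) Hölder derivatives on an open subset of the torus. -/
def C1hOn (g : S1 × S1 → ℝ) (U : Set (S1 × S1)) : Prop :=
  (∀ z, toTorus z ∈ U → DifferentiableAt ℝ (g ∘ toTorus) z) ∧
    LocHolderOn (fderiv ℝ (g ∘ toTorus)) (toTorus ⁻¹' U)

/-- The linear form `a ds + b dt`. -/
def linForm (a b : ℝ) : ℝ × ℝ →L[ℝ] ℝ :=
  a • ContinuousLinearMap.fst ℝ ℝ ℝ + b • ContinuousLinearMap.snd ℝ ℝ ℝ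

/-! ### The derivative calculus that is needed to build the groups -/

theorem IsHolder.of_le_exp {f : S1 → ℝ} {C r s : ℝ≥0} (hf : HolderWith C r f) (h : s ≤ r) :
    ∃ C', HolderWith C' s f :=
  MemHolder.of_le ⟨C, hf⟩ h

theorem IsHolder.cont {f : S1 → ℝ} (hf : IsHolder f) : Continuous f := by
  obtain ⟨C, r, hr, h⟩ := hf
  exact h.continuous hr

theorem IsHolder.bdd {f : S1 → ℝ} (hf : IsHolder f) : ∃ B : ℝ, 0 ≤ B ∧ ∀ x, |f x| ≤ B := by
  obtain ⟨B, hB⟩ := isCompact_univ.exists_bound_of_continuousOn (f := f) hf.cont.continuousOn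
  exact ⟨|B|, abs_nonneg _, fun x => (hB x (mem_univ x)).trans (le_abs_self B)⟩

theorem IsHolder.add' {f g : S1 → ℝ} (hf : IsHolder f) (hg : IsHolder g) :
    IsHolder (fun x => f x + g x) := by
  obtain ⟨C, r, hr, hC⟩ := hf
  obtain ⟨D, s, hs, hD⟩ := hg
  obtain ⟨C', hC'⟩ := IsHolder.of_le_exp hC (min_le_left r s)
  obtain ⟨D', hD'⟩ := IsHolder.of_le_exp hD (min_le_right r s)
  exact ⟨C' + D', min r s, lt_min hr hs, hC'.add hD'⟩

theorem IsHolder.neg' {f : S1 → ℝ} (hf : IsHolder f) : IsHolder (fun x => -f x) := by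
  obtain ⟨C, r, hr, hC⟩ := hf
  refine ⟨C, r, hr, fun x y => ?_⟩
  simpa [edist_neg_neg] using hC x y

theorem IsHolder.mul' {f g : S1 → ℝ} (hf : IsHolder f) (hg : IsHolder g) :
    IsHolder (fun x => f x * g x) := by
  obtain ⟨B, hB0, hB⟩ := hf.bdd
  obtain ⟨E, hE0, hE⟩ := hg.bdd
  obtain ⟨C, r, hr, hC⟩ := hf
  obtain ⟨D, s, hs, hD⟩ := hg
  obtain ⟨C', hC'⟩ := IsHolder.of_le_exp hC (min_le_left r s)
  obtain ⟨D', hD'⟩ := IsHolder.of_le_exp hD (min_le_right r s)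
  refine ⟨B.toNNReal * D' + E.toNNReal * C', min r s, lt_min hr hs, fun x y => ?_⟩
  have h1 := hC'.dist_le x y
  have h2 := hD'.dist_le x y
  rw [Real.dist_eq] at h1 h2
  have key : dist (f x * g x) (f y * g y) ≤
      (B * D' + E * C') * dist x y ^ ((min r s : ℝ≥0) : ℝ) := by
    rw [Real.dist_eq]
    have e : f x * g x - f y * g y = f x * (g x - g y) + g y * (f x - f y) := by ring
    rw [e]
    calc |f x * (g x - g y) + g y * (f x - f y)|
        ≤ |f x| * |g x - g y| + |g y| * |f x - f y| := by
          simpa [abs_mul] using abs_add_le (f x * (g x - g y)) (g y * (f x - f y))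
      _ ≤ B * (D' * dist x y ^ ((min r s : ℝ≥0) : ℝ)) +
            E * (C' * dist x y ^ ((min r s : ℝ≥0) : ℝ)) := by
          gcongr
          · exact hB x
          · exact hE y
      _ = _ := by ring
  rw [edist_dist, edist_dist]
  have h3 : ENNReal.ofReal (dist x y) ^ ((min r s : ℝ≥0) : ℝ) =
      ENNReal.ofReal (dist x y ^ ((min r s : ℝ≥0) : ℝ)) :=
    ENNReal.ofReal_rpow_of_nonneg dist_nonneg (NNReal.coe_nonneg _)
  rw [h3, ← ENNReal.ofReal_coe_nnreal, ← ENNReal.ofReal_mul (NNReal.coe_nonneg _)]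
  exact ENNReal.ofReal_le_ofReal (by
    simpa [Real.coe_toNNReal B hB0, Real.coe_toNNReal E hE0] using key)

theorem IsHolder.comp' {f : S1 → ℝ} {φ : S1 → S1} (hf : IsHolder f) (hφ : IsHolder φ) :
    IsHolder (fun x => f (φ x)) := by
  obtain ⟨C, r, hr, hC⟩ := hf
  obtain ⟨D, s, hs, hD⟩ := hφ
  exact ⟨_, r * s, mul_pos hr hs, hC.comp hD⟩

theorem coe_localRep (φ : S1 → S1) (θ : S1) (x : ℝ) :
    ((localRep φ θ x : ℝ) : S1) = φ (θ + (x : S1)) - φ θ :=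
  AddCircle.coe_equivIoc (p := (1 : ℝ)) (a := -(1 / 2))

theorem localRep_zero (φ : S1 → S1) (θ : S1) : localRep φ θ 0 = 0 := by
  have h : (0 : ℝ) ∈ Ioc (-(1 / 2) : ℝ) (-(1 / 2) + 1) := by constructor <;> norm_num
  have := AddCircle.equivIoc_coe_of_mem (p := (1 : ℝ)) (a := -(1 / 2)) h
  simpa [localRep] using this

theorem hasDerivAt_localRep {φ : S1 → S1} {F : ℝ → ℝ}
    (hF : ∀ x : ℝ, ((F x : ℝ) : S1) = φ (x : S1)) {x d : ℝ} (hd : HasDerivAt F d x) :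
    HasDerivAt (localRep φ (x : S1)) d 0 := by
  have h1 : HasDerivAt (fun y : ℝ => F (x + y) - F x) d 0 := by
    have : HasDerivAt (fun y : ℝ => F (x + y)) d 0 := by
      have h0 : HasDerivAt F d (x + 0) := by simpa using hd
      exact h0.comp_const_add x 0
    exact this.sub_const (F x)
  refine h1.congr_of_eventuallyEq ?_
  have hc : Tendsto (fun y : ℝ => F (x + y) - F x) (𝓝 0) (𝓝 0) := by
    simpa using h1.continuousAt.tendsto
  filter_upwards [hc (Ioo_mem_nhds (show (-(1 / 2) : ℝ) < 0 by norm_num)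
    (show (0 : ℝ) < 1 / 2 by norm_num))] with y hy
  have hm : F (x + y) - F x ∈ Ioc (-(1 / 2) : ℝ) (-(1 / 2) + 1) :=
    ⟨hy.1, by have := hy.2; linarith⟩
  have := AddCircle.equivIoc_coe_of_mem (p := (1 : ℝ)) (a := -(1 / 2)) hm
  rw [localRep, ← hF x, ← AddCircle.coe_add, ← hF (x + y), ← AddCircle.coe_sub]
  exact this

theorem IsC1hMap.hasDerivAt {φ : S1 → S1} (h : IsC1hMap φ) (θ : S1) :
    HasDerivAt (localRep φ θ) (cderiv φ θ) 0 := by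
  obtain ⟨⟨F, hF, hl⟩, -⟩ := h
  obtain ⟨x, rfl⟩ := QuotientAddGroup.mk_surjective θ
  exact (hasDerivAt_localRep hl
    (hF.differentiable one_ne_zero x).hasDerivAt).differentiableAt.hasDerivAt

theorem IsC1hFun.hasDerivAt {h : S1 → ℝ} (hh : IsC1hFun h) (θ : S1) :
    HasDerivAt (fun x : ℝ => h (θ + (x : S1))) (sderiv h θ) 0 := by
  obtain ⟨x, rfl⟩ := QuotientAddGroup.mk_surjective θ
  have h0 : DifferentiableAt ℝ (fun y : ℝ => h (y : S1)) (x + 0) :=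
    hh.1.differentiable one_ne_zero _
  have h1 : HasDerivAt (fun y : ℝ => h ((x + y : ℝ) : S1)) _ 0 :=
    h0.hasDerivAt.comp_const_add x 0
  exact (h1.differentiableAt.congr_of_eventuallyEq
    (Eventually.of_forall fun y => by simp)).hasDerivAt

theorem IsC1hMap.lipschitz {φ : S1 → S1} (h : IsC1hMap φ) : IsHolder φ := by
  obtain ⟨B, hB0, hB⟩ := h.2.bdd
  obtain ⟨⟨F, hF, hl⟩, -⟩ := h
  have hd : ∀ x, deriv F x = cderiv φ (x : S1) := fun x =>
    ((hasDerivAt_localRep hl (hF.differentiable one_ne_zero x).hasDerivAt).deriv).symm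
  have hL : LipschitzWith B.toNNReal F :=
    lipschitzWith_of_nnnorm_deriv_le (hF.differentiable one_ne_zero) fun x => by
      rw [← NNReal.coe_le_coe, coe_nnnorm, Real.norm_eq_abs, Real.coe_toNNReal B hB0, hd x]
      exact hB _
  refine ⟨B.toNNReal, 1, one_pos, holderWith_one.2 (LipschitzWith.of_dist_le_mul fun θ η => ?_)⟩
  obtain ⟨x, rfl⟩ := QuotientAddGroup.mk_surjective θ
  obtain ⟨y, rfl⟩ := QuotientAddGroup.mk_surjective η
  have e1 : dist ((x : ℝ) : S1) ((y : ℝ) : S1) = |x - y - round (x - y)| := by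
    rw [dist_eq_norm, ← AddCircle.coe_sub]
    exact UnitAddCircle.norm_eq
  have e2 : φ ((y : ℝ) : S1) = φ ((y + (round (x - y) : ℝ) : ℝ) : S1) := by
    congr 1
    rw [AddCircle.coe_add, eq_comm, add_eq_left]
    simp
  change dist (φ ((x : ℝ) : S1)) (φ ((y : ℝ) : S1)) ≤
    B.toNNReal * dist ((x : ℝ) : S1) ((y : ℝ) : S1)
  rw [e2, ← hl, ← hl, dist_eq_norm, ← AddCircle.coe_sub, e1]
  have h1 := hL.dist_le_mul x (y + (round (x - y) : ℝ))
  rw [Real.dist_eq, Real.dist_eq] at h1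
  refine le_trans ?_ (le_trans h1 (le_of_eq ?_))
  · have : ‖((F x - F (y + (round (x - y) : ℝ)) : ℝ) : S1)‖ = _ := UnitAddCircle.norm_eq
    rw [this]
    have h0 := round_le (F x - F (y + (round (x - y) : ℝ))) 0
    rw [Int.cast_zero, sub_zero] at h0
    exact h0
  · congr 2
    ring

theorem cderiv_comp {φ ψ : S1 → S1} (hφ : IsC1hMap φ) (hψ : IsC1hMap ψ) (θ : S1) :
    HasDerivAt (localRep (φ ∘ ψ) θ) (cderiv φ (ψ θ) * cderiv ψ θ) 0 := by
  have e : localRep (φ ∘ ψ) θ = localRep φ (ψ θ) ∘ localRep ψ θ := by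
    funext x
    simp only [localRep, Function.comp]
    rw [show ψ θ + (((AddCircle.equivIoc (1 : ℝ) (-(1 / 2)) (ψ (θ + (x : S1)) - ψ θ) : ℝ)) : S1)
      = ψ (θ + (x : S1)) by
        rw [show (((AddCircle.equivIoc (1 : ℝ) (-(1 / 2)) (ψ (θ + (x : S1)) - ψ θ) : ℝ)) : S1)
          = _ from coe_localRep ψ θ x]
        abel]
  rw [e]
  refine HasDerivAt.comp (0 : ℝ) ?_ (hψ.hasDerivAt θ)
  rw [localRep_zero]
  exact hφ.hasDerivAt _

theorem sderiv_comp {h : S1 → ℝ} {ψ : S1 → S1} (hh : IsC1hFun h) (hψ : IsC1hMap ψ) (θ : S1) :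
    HasDerivAt (fun x : ℝ => h (ψ (θ + (x : S1)))) (sderiv h (ψ θ) * cderiv ψ θ) 0 := by
  have e : (fun x : ℝ => h (ψ (θ + (x : S1)))) =
      (fun x : ℝ => h (ψ θ + (x : S1))) ∘ localRep ψ θ := by
    funext x
    simp only [Function.comp]
    rw [coe_localRep]
    congr 1
    abel
  rw [e]
  refine HasDerivAt.comp (0 : ℝ) ?_ (hψ.hasDerivAt θ)
  rw [localRep_zero]
  exact hh.hasDerivAt _

theorem IsC1hMap.comp {φ ψ : S1 → S1} (hφ : IsC1hMap φ) (hψ : IsC1hMap ψ) :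
    IsC1hMap (φ ∘ ψ) := by
  have e : cderiv (φ ∘ ψ) = fun θ => cderiv φ (ψ θ) * cderiv ψ θ :=
    funext fun θ => (cderiv_comp hφ hψ θ).deriv
  refine ⟨?_, ?_⟩
  · obtain ⟨⟨F, hF, hFl⟩, -⟩ := hφ
    obtain ⟨⟨G, hG, hGl⟩, -⟩ := hψ
    exact ⟨F ∘ G, hF.comp hG, fun x => by simp [hFl, hGl]⟩
  · rw [e]
    exact (hφ.2.comp' hψ.lipschitz).mul' hψ.2

theorem IsC1hFun.comp {h : S1 → ℝ} {ψ : S1 → S1} (hh : IsC1hFun h) (hψ : IsC1hMap ψ) :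
    IsC1hFun (fun θ => h (ψ θ)) := by
  have e : sderiv (fun θ => h (ψ θ)) = fun θ => sderiv h (ψ θ) * cderiv ψ θ :=
    funext fun θ => (sderiv_comp hh hψ θ).deriv
  refine ⟨?_, ?_⟩
  · obtain ⟨⟨G, hG, hGl⟩, -⟩ := hψ
    have e2 : (fun x : ℝ => h (ψ (x : S1))) = (fun x : ℝ => h (x : S1)) ∘ G := by
      funext x
      simp [hGl]
    rw [e2]
    exact hh.1.comp hG
  · rw [e]
    exact (hh.2.comp' hψ.lipschitz).mul' hψ.2

theorem localRep_id (θ : S1) : localRep id θ =ᶠ[𝓝 0] id := by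
  filter_upwards [Ioo_mem_nhds (show (-(1 / 2) : ℝ) < 0 by norm_num)
    (show (0 : ℝ) < 1 / 2 by norm_num)] with y hy
  have hm : y ∈ Ioc (-(1 / 2) : ℝ) (-(1 / 2) + 1) := ⟨hy.1, by have := hy.2; linarith⟩
  have := AddCircle.equivIoc_coe_of_mem (p := (1 : ℝ)) (a := -(1 / 2)) hm
  simpa [localRep] using this

theorem cderiv_id (θ : S1) : cderiv id θ = 1 := by
  rw [cderiv, (localRep_id θ).deriv_eq, deriv_id]

theorem isC1hMap_id : IsC1hMap id := by
  refine ⟨⟨id, contDiff_id, fun x => rfl⟩, 0, 1, one_pos, ?_⟩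
  have : cderiv id = fun _ => (1 : ℝ) := funext cderiv_id
  rw [this]
  exact HolderWith.const

/-! ### The groups `Diff^h(S¹)`, `C^{1,h}(S¹)` and their semidirect product -/

/-- The group of `C¹` diffeomorphisms of the circle with Hölder derivatives. -/
def DiffH : Subgroup (S1 ≃ₜ S1) where
  carrier := {φ | IsC1hMap φ ∧ IsC1hMap φ.symm}
  mul_mem' hφ hψ := ⟨hφ.1.comp hψ.1, hψ.2.comp hφ.2⟩
  one_mem' := ⟨isC1hMap_id, isC1hMap_id⟩
  inv_mem' hφ := ⟨hφ.2, hφ.1⟩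

/-- The space of `C¹` functions on the circle with Hölder derivatives. -/
def C1h : AddSubgroup (S1 → ℝ) where
  carrier := {h | IsC1hFun h}
  add_mem' {f g} hf hg := by
    refine ⟨hf.1.add hg.1, ?_⟩
    have : sderiv (f + g) = fun θ => sderiv f θ + sderiv g θ :=
      funext fun θ => ((hf.hasDerivAt θ).add (hg.hasDerivAt θ)).deriv
    rw [this]
    exact hf.2.add' hg.2
  zero_mem' := by
    refine ⟨contDiff_const, 0, 1, one_pos, ?_⟩
    have : sderiv 0 = fun _ => (0 : ℝ) := funext fun θ => by simp [sderiv]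
    rw [this]
    exact HolderWith.const
  neg_mem' {f} hf := by
    refine ⟨hf.1.neg, ?_⟩
    have : sderiv (-f) = fun θ => -sderiv f θ := funext fun θ => (hf.hasDerivAt θ).neg.deriv
    rw [this]
    exact hf.2.neg'

/-- The action of `Diff^h(S¹)` on `C^{1,h}(S¹)` by `φ · h = h ∘ φ⁻¹`. -/
def pushAction : DiffH →* MulAut (Multiplicative C1h) where
  toFun φ :=
    { toFun := fun h => Multiplicative.ofAdd
        ⟨fun θ => (Multiplicative.toAdd h).1 (φ.1.symm θ),
          IsC1hFun.comp (Multiplicative.toAdd h).2 φ.2.2⟩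
      invFun := fun h => Multiplicative.ofAdd
        ⟨fun θ => (Multiplicative.toAdd h).1 (φ.1 θ),
          IsC1hFun.comp (Multiplicative.toAdd h).2 φ.2.1⟩
      left_inv := fun h => by
        apply Multiplicative.toAdd.injective
        apply Subtype.ext
        funext θ
        simp
      right_inv := fun h => by
        apply Multiplicative.toAdd.injective
        apply Subtype.ext
        funext θ
        simp
      map_mul' := fun _ _ => rfl }
  map_one' := rfl
  map_mul' _ _ := rfl

/-- The group `C^{1,h}(S¹) ⋊ Diff^h(S¹)`. -/
abbrev JetGroup : Type := Multiplicative C1h ⋊[pushAction] DiffH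

/-- The function component of an element of `C^{1,h}(S¹) ⋊ Diff^h(S¹)`. -/
def JetGroup.fn (g : JetGroup) : S1 → ℝ := (Multiplicative.toAdd g.left).1

/-! ### The jet space `J¹(S¹, ℝ)` and the action on it -/

/-- The space of one-jets of functions on the circle, in the coordinates
`j¹_θ(f) ↦ (θ, r, f) = (θ, f'(θ), f(θ))`. -/
abbrev Jet : Type := S1 × ℝ × ℝ

/-- The one-jet of a function. -/
def jet1 (f : S1 → ℝ) (θ : S1) : Jet := (θ, sderiv f θ, f θ)

/-- The projection of the jet space on `T*S¹`. -/
def jetToCotangent (x : Jet) : S1 × ℝ := (x.1, x.2.1)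

/-- The canonical flow `j¹(f) ↦ j¹(f + t)`. -/
def jetFlow (t : ℝ) (x : Jet) : Jet := (x.1, x.2.1, x.2.2 + t)

/-- The map `j¹_θ(f) ↦ j¹_{φ θ}(f ∘ φ⁻¹ + h)` of the jet space. -/
def jetMap (g : JetGroup) (x : Jet) : Jet :=
  (g.right.1 x.1,
    x.2.1 * cderiv g.right.1.symm (g.right.1 x.1) + sderiv g.fn (g.right.1 x.1),
    x.2.2 + g.fn (g.right.1 x.1))

theorem jetMap_jet1 (g : JetGroup) {f : S1 → ℝ} (hf : IsC1hFun f) (θ : S1) :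
    jetMap g (jet1 f θ) = jet1 (fun η => f (g.right.1.symm η) + g.fn η) (g.right.1 θ) := by
  have h1 := (sderiv_comp hf g.right.2.2 (g.right.1 θ)).add
    (IsC1hFun.hasDerivAt (Multiplicative.toAdd g.left).2 (g.right.1 θ))
  have h2 : sderiv (fun η => f (g.right.1.symm η) + g.fn η) (g.right.1 θ) = _ := h1.deriv
  simp only [jet1, jetMap, h2, Homeomorph.symm_apply_apply]
  rfl

theorem jetMap_one (x : Jet) : jetMap 1 x = x := by
  have h0 : sderiv (JetGroup.fn 1) x.1 = 0 := by
    have : JetGroup.fn 1 = fun _ => (0 : ℝ) := rfl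
    rw [this]
    simp [sderiv]
  have h1 : cderiv ((1 : JetGroup).right.1.symm) x.1 = 1 := cderiv_id x.1
  refine Prod.ext rfl (Prod.ext ?_ ?_)
  · change x.2.1 * cderiv ((1 : JetGroup).right.1.symm) x.1 + sderiv (JetGroup.fn 1) x.1 = x.2.1
    rw [h0, h1]
    ring
  · change x.2.2 + 0 = x.2.2
    ring

theorem jetMap_mul (g k : JetGroup) (x : Jet) : jetMap (g * k) x = jetMap g (jetMap k x) := by
  set η := g.right.1 (k.right.1 x.1) with hη
  have hs : g.right.1.symm η = k.right.1 x.1 := by simp [hη]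
  have h1 : cderiv ((g * k).right.1.symm) η =
      cderiv k.right.1.symm (k.right.1 x.1) * cderiv g.right.1.symm η := by
    have := (cderiv_comp k.right.2.2 g.right.2.2 η).deriv
    rw [hs] at this
    exact this
  have h2 : sderiv (g * k).fn η =
      sderiv g.fn η + sderiv k.fn (k.right.1 x.1) * cderiv g.right.1.symm η := by
    have := ((IsC1hFun.hasDerivAt (Multiplicative.toAdd g.left).2 η).add
      (sderiv_comp (Multiplicative.toAdd k.left).2 g.right.2.2 η)).deriv
    rw [hs] at this
    exact this
  have h3 : (g * k).fn η = g.fn η + k.fn (k.right.1 x.1) := by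
    have : (g * k).fn η = g.fn η + k.fn (g.right.1.symm η) := rfl
    rw [this, hs]
  refine Prod.ext rfl (Prod.ext ?_ ?_)
  · change x.2.1 * cderiv ((g * k).right.1.symm) η + sderiv (g * k).fn η =
      (x.2.1 * cderiv k.right.1.symm (k.right.1 x.1) + sderiv k.fn (k.right.1 x.1)) *
        cderiv g.right.1.symm η + sderiv g.fn η
    rw [h1, h2]
    ring
  · change x.2.2 + (g * k).fn η = x.2.2 + k.fn (k.right.1 x.1) + g.fn η
    rw [h3]
    ring

theorem continuous_jetMap (g : JetGroup) : Continuous (jetMap g) := by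
  have h1 : Continuous (cderiv g.right.1.symm) := g.right.2.2.2.cont
  have h2 : Continuous (sderiv g.fn) := (Multiplicative.toAdd g.left).2.2.cont
  have h3 : Continuous g.fn := by
    have hh : IsC1hFun g.fn := (Multiplicative.toAdd g.left).2
    exact continuous_coinduced_dom.2 hh.1.continuous
  have h4 : Continuous g.right.1 := g.right.1.continuous
  unfold jetMap
  fun_prop

/-- The action of `C^{1,h}(S¹) ⋊ Diff^h(S¹)` on the jet space by homeomorphisms. -/
def jetHom : JetGroup →* (Jet ≃ₜ Jet) where
  toFun g :=
    { toFun := jetMap g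
      invFun := jetMap g⁻¹
      left_inv := fun x => by rw [← jetMap_mul, inv_mul_cancel, jetMap_one]
      right_inv := fun x => by rw [← jetMap_mul, mul_inv_cancel, jetMap_one]
      continuous_toFun := continuous_jetMap g
      continuous_invFun := continuous_jetMap g⁻¹ }
  map_one' := Homeomorph.ext jetMap_one
  map_mul' g k := Homeomorph.ext (jetMap_mul g k)

/-! ### Quotients and contraction of foliations -/

/-- Being in the same orbit of an action by homeomorphisms. -/
def orbitSetoid {Γ X : Type*} [Group Γ] [TopologicalSpace X] (A : Γ →* (X ≃ₜ X)) : Setoid X where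
  r x y := ∃ γ, A γ x = y
  iseqv :=
    { refl := fun x => ⟨1, by simp⟩
      symm := by
        rintro x y ⟨γ, rfl⟩
        exact ⟨γ⁻¹, by rw [← Homeomorph.mul_apply, ← map_mul]; simp⟩
      trans := by
        rintro x y z ⟨γ, rfl⟩ ⟨δ, rfl⟩
        exact ⟨δ * γ, by simp⟩ }

/-- The quotient by the action is compact (in particular Hausdorff). -/
def CompactQuotient {Γ X : Type*} [Group Γ] [TopologicalSpace X] (A : Γ →* (X ≃ₜ X)) : Prop :=
  CompactSpace (Quotient (orbitSetoid A)) ∧ T2Space (Quotient (orbitSetoid A))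

/-- `LeafDist 𝒞 m x y d`: the points `x` and `y` lie on a common leaf and their distance along it
is `d`.  A one-dimensional foliation is given by the family `𝒞` of its parametrised leaves
`(c, I)`, where `c` parametrises the leaf on the interval `I`, and `m` is the leafwise Riemannian
metric: its length element along a leaf is `m (c τ) dτ`. -/
def LeafDist {X : Type*} (𝒞 : Set ((ℝ → X) × Set ℝ)) (m : X → ℝ) (x y : X) (d : ℝ) : Prop :=
  ∃ p ∈ 𝒞, ∃ τ₁ ∈ p.2, ∃ τ₂ ∈ p.2, p.1 τ₁ = x ∧ p.1 τ₂ = y ∧ d = |∫ τ in τ₁..τ₂, m (p.1 τ)|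

/-- `m` is a leafwise continuous Riemannian metric that descends to the quotient by the action. -/
structure IsLeafMetric {Γ X : Type*} [Group Γ] [TopologicalSpace X] (A : Γ →* (X ≃ₜ X))
    (𝒞 : Set ((ℝ → X) × Set ℝ)) (m : X → ℝ) : Prop where
  continuous : Continuous m
  pos : ∀ x, 0 < m x
  invariant : ∀ γ x y d, LeafDist 𝒞 m x y d → LeafDist 𝒞 m (A γ x) (A γ y) d

/-- On the quotient by the action, the flow `φ` preserves the foliation and contracts uniformly
its leaves:
`∀ ε, ∃ α, ∃ t₀, ∀ t ≥ t₀, d(x, y) ≤ α → d(φ_t x, φ_t y) ≤ ε`. -/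
def ContractsLeaves {Γ X : Type*} [Group Γ] [TopologicalSpace X] (A : Γ →* (X ≃ₜ X))
    (φ : ℝ → X → X) (𝒞 : Set ((ℝ → X) × Set ℝ)) : Prop :=
  ∃ m : X → ℝ, IsLeafMetric A 𝒞 m ∧
    ∀ ε > 0, ∃ α > 0, ∃ t₀ : ℝ, ∀ t ≥ t₀, ∀ x y d, LeafDist 𝒞 m x y d → d ≤ α →
      ∃ d' ≤ ε, LeafDist 𝒞 m (φ t x) (φ t y) d'

/-- The variant of uniform contraction in which `α` does not depend on `ε`. -/
def StronglyContractsLeaves {Γ X : Type*} [Group Γ] [TopologicalSpace X] (A : Γ →* (X ≃ₜ X))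
    (φ : ℝ → X → X) (𝒞 : Set ((ℝ → X) × Set ℝ)) : Prop :=
  ∃ m : X → ℝ, IsLeafMetric A 𝒞 m ∧
    ∃ α > 0, ∀ ε > 0, ∃ t₀ : ℝ, ∀ t ≥ t₀, ∀ x y d, LeafDist 𝒞 m x y d → d ≤ α →
      ∃ d' ≤ ε, LeafDist 𝒞 m (φ t x) (φ t y) d'

/-! ### Fuchsian and Anosov homomorphisms -/

/-- The group `PSL(2, ℝ)`. -/
abbrev PSL2R : Type := Matrix.ProjectiveSpecialLinearGroup (Fin 2) ℝ

/-- A Fuchsian homomorphism: faithful, with discrete and cocompact image in `PSL(2, ℝ)`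
(expressed through the preimage in `SL(2, ℝ)` of the image). -/
def IsFuchsian {Γ : Type*} [Group Γ] (j : Γ →* PSL2R) : Prop :=
  Function.Injective j ∧
    DiscreteTopology (j.range.comap (QuotientGroup.mk'
      (Subgroup.center (Matrix.SpecialLinearGroup (Fin 2) ℝ)))) ∧
    CompactSpace (Matrix.SpecialLinearGroup (Fin 2) ℝ ⧸ j.range.comap (QuotientGroup.mk'
      (Subgroup.center (Matrix.SpecialLinearGroup (Fin 2) ℝ))))

theorem angle_ne_zero (x : ℝ) : ![Real.cos (Real.pi * x), Real.sin (Real.pi * x)] ≠ 0 := by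
  intro h
  have h0 := congrFun h 0
  have h1 := congrFun h 1
  simp at h0 h1
  have := Real.sin_sq_add_cos_sq (Real.pi * x)
  rw [h0, h1] at this
  norm_num at this

/-- The identification of the circle `ℝ / ℤ` with the real projective line, which sends `x` to the
line with angle `π x`. -/
def circleToRP1 : S1 → ℙ ℝ (Fin 2 → ℝ) :=
  Function.Periodic.lift
    (f := fun x : ℝ => Projectivization.mk ℝ
      ![Real.cos (Real.pi * x), Real.sin (Real.pi * x)] (angle_ne_zero x))
    (c := (1 : ℝ)) (fun x => by
      rw [Projectivization.mk_eq_mk_iff']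
      refine ⟨-1, ?_⟩
      have e : Real.pi * (x + 1) = Real.pi * x + Real.pi := by ring
      funext i
      fin_cases i <;> simp [e, Real.cos_add_pi, Real.sin_add_pi])

/-- An action on the circle by `C¹` diffeomorphisms with Hölder derivatives is `H`-Fuchsian if it
is conjugate, by a homeomorphism that is Hölder as well as its inverse, to the action of a
cocompact Fuchsian group on the real projective line. -/
def IsHFuchsian {Γ : Type*} [Group Γ] (ρ : Γ →* DiffH) : Prop :=
  ∃ j : Γ →* PSL2R, IsFuchsian j ∧ ∃ h : S1 ≃ₜ S1, IsHolder h ∧ IsHolder h.symm ∧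
    ∀ γ s, circleToRP1 (h ((ρ γ).1 s)) = j γ • circleToRP1 (h s)

/-- The foliation `ℱ` of the jet space by the fibres of `j¹_θ(f) ↦ (θ, f(θ))`. -/
def jetLeaves : Set ((ℝ → Jet) × Set ℝ) :=
  {p | ∃ (θ : S1) (f : ℝ), p = (fun r => (θ, r, f), univ)}

/-- Anosov homomorphisms in `C^{1,h}(S¹) ⋊ Diff^h(S¹)`. -/
structure IsAnosov {Γ : Type*} [Group Γ] (ρ : Γ →* JetGroup) : Prop where
  compact : CompactQuotient (jetHom.comp ρ)
  contracts : ContractsLeaves (jetHom.comp ρ) jetFlow jetLeaves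
  hFuchsian : IsHFuchsian (SemidirectProduct.rightHom.comp ρ)

/-! ### Principal `ℝ`-bundles with connection over `D_κ` -/

/-- The open annulus `D_κ`, the complement of the graph of `κ`. -/
def annulus (κ : S1 → S1) : Set (S1 × S1) := {x | κ x.1 ≠ x.2}

/-- A principal `ℝ`-bundle of class `C^{1,h}` over `D_κ`, with total space `M`.  The fibre
coordinate of a local trivialisation `e` is `m ↦ (e m).2`. -/
structure PrincipalBundle (κ : S1 → S1) (M : Type*) [TopologicalSpace M] [AddAction ℝ M] where
  proj : M → S1 × S1
  proj_mem : ∀ m, proj m ∈ annulus κ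
  atlas : Set (Bundle.Trivialization ℝ proj)
  cover : ∀ x ∈ annulus κ, ∃ e ∈ atlas, x ∈ e.baseSet
  proj_vadd : ∀ (u : ℝ) (m : M), proj (u +ᵥ m) = proj m
  coord_vadd : ∀ e ∈ atlas, ∀ (u : ℝ) (m : M), proj m ∈ e.baseSet →
    (e (u +ᵥ m)).2 = (e m).2 + u
  transition : ∀ e ∈ atlas, ∀ e' ∈ atlas, ∃ g : S1 × S1 → ℝ, C1hOn g (e.baseSet ∩ e'.baseSet) ∧
    ∀ m, proj m ∈ e.baseSet ∩ e'.baseSet → (e' m).2 = (e m).2 + g (proj m)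

namespace PrincipalBundle

variable {κ : S1 → S1} {M : Type*} [TopologicalSpace M] [AddAction ℝ M]

/-- A connection form `A` on the bundle.  In the trivialisation `e`, with fibre coordinate `u`,
it is `A = du + a_e ds + b_e dt`. -/
structure Connection (P : PrincipalBundle κ M) where
  a : Bundle.Trivialization ℝ P.proj → S1 × S1 → ℝ
  b : Bundle.Trivialization ℝ P.proj → S1 × S1 → ℝ
  continuousOn_a : ∀ e ∈ P.atlas, ContinuousOn (a e) e.baseSet
  continuousOn_b : ∀ e ∈ P.atlas, ContinuousOn (b e) e.baseSet
  compat : ∀ e ∈ P.atlas, ∀ e' ∈ P.atlas, ∀ g : S1 × S1 → ℝ,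
    (∀ m, P.proj m ∈ e.baseSet ∩ e'.baseSet → (e' m).2 = (e m).2 + g (P.proj m)) →
    ∀ z, toTorus z ∈ e.baseSet ∩ e'.baseSet →
      HasFDerivAt (g ∘ toTorus)
        (linForm (a e (toTorus z) - a e' (toTorus z)) (b e (toTorus z) - b e' (toTorus z))) z

/-- `f ds ∧ dt` is the curvature of the connection, that is, the exterior derivative of the local
forms `a_e ds + b_e dt`.  As these forms are only continuous, this is expressed by the Stokes
formula on all rectangles; when they are `C¹` it says `∂a_e/∂t = ∂b_e/∂s - f`. -/
def Connection.HasCurvature {P : PrincipalBundle κ M} (A : P.Connection) (f : S1 × S1 → ℝ) :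
    Prop :=
  ∀ e ∈ P.atlas, ∀ s₀ s₁ t₀ t₁ : ℝ, s₀ ≤ s₁ → t₀ ≤ t₁ →
    (∀ s ∈ Icc s₀ s₁, ∀ t ∈ Icc t₀ t₁, toTorus (s, t) ∈ e.baseSet) →
    ((∫ s in s₀..s₁, A.a e (toTorus (s, t₀))) + (∫ t in t₀..t₁, A.b e (toTorus (s₁, t)))
      - (∫ s in s₀..s₁, A.a e (toTorus (s, t₁))) - ∫ t in t₀..t₁, A.b e (toTorus (s₀, t)))
    = ∫ s in s₀..s₁, ∫ t in t₀..t₁, f (toTorus (s, t))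

/-- The foliation `ℒ`: its leaves are the maximal parallel lifts of the curves `t ↦ (s, t)`,
parametrised by `t`, where `t` runs over the open interval of length one between two consecutive
lifts of `κ s`. -/
def leaves {P : PrincipalBundle κ M} (A : P.Connection) : Set ((ℝ → M) × Set ℝ) :=
  {p | ∃ (s : S1) (t₀ : ℝ), (t₀ : S1) = κ s ∧ p.2 = Ioo t₀ (t₀ + 1) ∧
    ∀ t ∈ Ioo t₀ (t₀ + 1), P.proj (p.1 t) = (s, (t : S1)) ∧
      ∀ e ∈ P.atlas, (s, (t : S1)) ∈ e.baseSet →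
        HasDerivAt (fun t' => (e (p.1 t')).2) (-A.b e (s, (t : S1))) t}

/-- The homeomorphism `T` of `M` commutes with the `ℝ`-action, covers `(φ₁, φ₂)`, and is of class
`C^{1,h}` (when `φ₁` and `φ₂` are): in local trivialisations it is
`(x, u) ↦ ((φ₁, φ₂) x, u + c(x))` with `c` of class `C^{1,h}`. -/
structure IsC1hAut (P : PrincipalBundle κ M) (T : M ≃ₜ M) (φ₁ φ₂ : S1 → S1) : Prop where
  map_vadd : ∀ (u : ℝ) (m : M), T (u +ᵥ m) = u +ᵥ T m
  proj_map : ∀ m, P.proj (T m) = (φ₁ (P.proj m).1, φ₂ (P.proj m).2)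
  regular : ∀ e ∈ P.atlas, ∀ e' ∈ P.atlas, ∃ c : S1 × S1 → ℝ,
    C1hOn c {x ∈ e.baseSet | (φ₁ x.1, φ₂ x.2) ∈ e'.baseSet} ∧
    ∀ m, P.proj m ∈ e.baseSet → P.proj (T m) ∈ e'.baseSet → (e' (T m)).2 = (e m).2 + c (P.proj m)

/-- `T`, which covers `(φ₁, φ₂)`, preserves the connection: `T^* A = A`. -/
def Connection.PreservedBy {P : PrincipalBundle κ M} (A : P.Connection) (T : M ≃ₜ M)
    (φ₁ φ₂ : S1 → S1) : Prop :=
  ∀ e ∈ P.atlas, ∀ e' ∈ P.atlas, ∀ c : S1 × S1 → ℝ,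
    (∀ m, P.proj m ∈ e.baseSet → P.proj (T m) ∈ e'.baseSet →
      (e' (T m)).2 = (e m).2 + c (P.proj m)) →
    ∀ z, toTorus z ∈ e.baseSet →
      (φ₁ (toTorus z).1, φ₂ (toTorus z).2) ∈ e'.baseSet →
      HasFDerivAt (c ∘ toTorus)
        (linForm
          (A.a e (toTorus z) -
            A.a e' (φ₁ (toTorus z).1, φ₂ (toTorus z).2) * cderiv φ₁ (toTorus z).1)
          (A.b e (toTorus z) -
            A.b e' (φ₁ (toTorus z).1, φ₂ (toTorus z).2) * cderiv φ₂ (toTorus z).2)) z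

end PrincipalBundle

/-! ### The data and the identification with the jet space -/

/-- The data: a principal `ℝ`-bundle over `D_κ` with a connection of positive Hölder curvature,
and an action of `Γ` with compact quotient, for which the `ℝ`-action contracts the leaves of `ℒ`,
and which covers a pair of `H`-Fuchsian actions conjugate by `κ`. -/
structure ConjugationData (Γ : Type*) [Group Γ] (κ : S1 ≃ₜ S1)
    (M : Type*) [TopologicalSpace M] [AddAction ℝ M] where
  holder_κ : IsHolder κ ∧ IsHolder κ.symm
  bundle : PrincipalBundle κ M
  conn : bundle.Connection
  /-- The density of the curvature. -/
  f : S1 × S1 → ℝ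
  f_pos : ∀ x ∈ annulus κ, 0 < f x
  f_holder : LocHolderOn f (annulus κ)
  /-- The sign `±1` relating `f ds ∧ dt` to `dA`; it depends on the conventions for the
  orientation of `D_κ` and for the sign of the curvature, which are left free. -/
  sgn : ℝ
  sgn_eq : sgn = 1 ∨ sgn = -1
  curvature : conn.HasCurvature (fun x => sgn * f x)
  act : Γ →* (M ≃ₜ M)
  ρ₁ : Γ →* DiffH
  ρ₂ : Γ →* DiffH
  hFuchsian₁ : IsHFuchsian ρ₁
  hFuchsian₂ : IsHFuchsian ρ₂
  conjugate : ∀ γ s, (ρ₂ γ).1 (κ s) = κ ((ρ₁ γ).1 s)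
  act_regular : ∀ γ, bundle.IsC1hAut (act γ) (ρ₁ γ).1 (ρ₂ γ).1
  act_conn : ∀ γ, conn.PreservedBy (act γ) (ρ₁ γ).1 (ρ₂ γ).1
  compact : CompactQuotient act
  contracts : ContractsLeaves act (fun t m => t +ᵥ m) (PrincipalBundle.leaves conn)

namespace ConjugationData

variable {Γ : Type*} [Group Γ] {κ : S1 ≃ₜ S1} {M : Type*} [TopologicalSpace M] [AddAction ℝ M]

/-- The area measure `f ds ⊗ dt` on `D_κ`. -/
def area (X : ConjugationData Γ κ M) : Measure (annulus κ) :=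
  (((volume : Measure (S1 × S1)).restrict (annulus κ)).withDensity
    (fun x => ENNReal.ofReal (X.f x))).comap Subtype.val

/-- `Ψ : M → J` is an identification, which conjugates the action on `M` to the action through
`ρ` on `J`: it lies over an area preserving homeomorphism `D_κ → T*S¹`, commutes with the
`ℝ`-actions, sends `ℒ` to `ℱ` and is equivariant. -/
structure IsConjugation (X : ConjugationData Γ κ M) (Ψ : M ≃ₜ Jet) (ρ : Γ →* JetGroup) :
    Prop where
  area_preserving : ∃ ψ : annulus κ ≃ₜ S1 × ℝ, X.area.map ψ = volume ∧
    ∀ m, jetToCotangent (Ψ m) = ψ ⟨X.bundle.proj m, X.bundle.proj_mem m⟩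
  flow : ∀ (t : ℝ) (m : M), Ψ (t +ᵥ m) = jetFlow t (Ψ m)
  leaves : ∀ p ∈ PrincipalBundle.leaves X.conn, ∃ q ∈ jetLeaves, Ψ '' (p.1 '' p.2) = q.1 '' q.2
  equivariant : ∀ γ m, Ψ (X.act γ m) = jetHom (ρ γ) (Ψ m)

end ConjugationData

end

/-! In suitable coordinates a connection of nonvanishing curvature over the annulus is the contact
form of the jet space. If the connection form is `dv - r ds`, then `(θ, r, f) = (s, r, v)` is the
required identification, so everything rests on a good fibre coordinate `v`. The antipodal section
is an isometric graph disjoint from that of `κ`. Integrating the curvature density along the fibres,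
starting from this section, gives a momentum `r` with `∂r/∂t = ±f`. By the Stokes formula `(a + r)
ds + b dt` is then closed, and once the holonomy along the section is subtracted from `r` it is
exact (`hasFDerivAt_potential`). Adding its primitive to a fibre coordinate gives `dv - r ds`
(`normalForm`).

In this normal form the leaves of `ℒ` are the curves on which `s` and `v` are constant. An
automorphism that preserves `dv - r ds` has the form `v ↦ v + g(s)` with `g' = (r ∘ γ) ρ₁(γ)' - r`,
and this is the action of an element of the jet group (`NormalForm.exists_cocycle`,
`exists_jetMap_jetChart`). Area is preserved because `dr = ±f dt` on the fibres
(`area_map_baseHomeo`).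

What is not formal is that `r` takes all real values on every fibre (`surjective_fibre`). Follow the
flow from a point over `s` and bring it back to a compact set by elements `γ n`. The convergence
property of Fuchsian groups (`IsHFuchsian.exists_limit`) and the contraction of `ℒ` show that `γ n`
sends every point other than `s` towards some `B`, while `s` itself tends to some `a ≠ B`
(`eq_of_recurrent`, `exists_expanding`). All points of the fibre over `s` are then carried to the
same point `(a, κ B)` of the annulus. By the transformation law of `r`, the derivative of `ρ₁ (γ n)`
at `s` diverges in absolute value, so a fixed interval of values of `r` near `(a, κ B)` pulls back
to arbitrarily large intervals over `s`.

For uniqueness, two identifications differ by a homeomorphism of `J` that commutes with the flow,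
preserves `ℱ` and covers an area preserving map. Such a map is `(θ, r, f) ↦ (φ θ, α r + β, f + H)`,
where `α` is, up to sign, the derivative of `φ⁻¹` (`exists_affine_form`, `exists_diffH_form`). Its
coefficients are Hölder because they solve cohomological equations over a north-south element of the
group (`IsNorthSouth.isHolder`). After division by `φ` there remain a sign `ε` and the function `∫β
- H`. The value `ε = -1` would force the cocycle along an expanding sequence to behave like `-n`
away from the expanded point too, which recurrence forbids; `ε = 1` forces `H' = β` (`transfer_eq`).
So the map belongs to the jet group.

The Anosov property is carried over by transporting leafwise metrics, first along the normal form
and then along an element of the jet group. Continuous dependence holds because the normal form is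
given by explicit integrals over unit intervals. -/

noncomputable section

/-! ### Representatives of points of the circle -/

/-- The representative in `[0, 1)` of a point of the circle. -/
def rep01 (θ : S1) : ℝ := (AddCircle.equivIco (1 : ℝ) 0 θ : ℝ)

theorem coe_rep01 (θ : S1) : ((rep01 θ : ℝ) : S1) = θ :=
  AddCircle.coe_equivIco (p := (1 : ℝ)) (a := 0)

theorem rep01_nonneg (θ : S1) : 0 ≤ rep01 θ := (AddCircle.equivIco (1 : ℝ) 0 θ).2.1

theorem rep01_lt_one (θ : S1) : rep01 θ < 1 := by
  exact lt_of_lt_of_eq (AddCircle.equivIco (1 : ℝ) 0 θ).2.2 (zero_add 1)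

theorem rep01_coe {x : ℝ} (h0 : 0 ≤ x) (h1 : x < 1) : rep01 (x : S1) = x :=
  AddCircle.equivIco_coe_of_mem (p := (1 : ℝ)) (a := 0) ⟨h0, by simpa using h1⟩

theorem rep01_pos {θ : S1} (h : θ ≠ 0) : 0 < rep01 θ := by
  refine lt_of_le_of_ne (rep01_nonneg θ) fun h0 => h ?_
  rw [← coe_rep01 θ, ← h0, AddCircle.coe_zero]

theorem rep01_mem {θ : S1} (h : θ ≠ 0) : rep01 θ ∈ Ioo (0 : ℝ) 1 :=
  ⟨rep01_pos h, rep01_lt_one θ⟩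

theorem continuousAt_rep01 {θ : S1} (h : θ ≠ 0) : ContinuousAt rep01 θ :=
  continuous_subtype_val.continuousAt.comp
    (AddCircle.continuousAt_equivIco (1 : ℝ) 0 (by simpa using h))

theorem S1.coe_eq_zero_iff {x : ℝ} : (x : S1) = 0 ↔ ∃ n : ℤ, x = n := by
  rw [AddCircle.coe_eq_zero_iff]
  simp [eq_comm]

theorem S1.coe_eq_coe_iff {x y : ℝ} : (x : S1) = (y : S1) ↔ ∃ n : ℤ, x - y = n := by
  rw [← sub_eq_zero, ← AddCircle.coe_sub, S1.coe_eq_zero_iff]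

theorem S1.coe_ne_zero {x : ℝ} (h : x ∈ Ioo (0 : ℝ) 1) : (x : S1) ≠ 0 := by
  rw [Ne, S1.coe_eq_zero_iff]
  rintro ⟨n, hn⟩
  have h1 := h.1
  have h2 := h.2
  rw [hn] at h1 h2
  norm_cast at h1 h2
  omega

theorem S1.coe_inj {x y : ℝ} (h : |x - y| < 1) (e : (x : S1) = (y : S1)) : x = y := by
  obtain ⟨n, hn⟩ := S1.coe_eq_coe_iff.1 e
  rw [hn] at h
  have h2 : |n| < 1 := by exact_mod_cast h
  have h3 : n = 0 := Int.abs_lt_one_iff.1 h2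
  rw [h3] at hn
  simp at hn
  linarith

theorem S1.continuous_coe : Continuous (fun x : ℝ => (x : S1)) := AddCircle.continuous_mk' 1

theorem S1.isOpenQuotientMap_coe : IsOpenQuotientMap (fun x : ℝ => (x : S1)) :=
  QuotientAddGroup.isOpenQuotientMap_mk

theorem S1.coe_surjective (θ : S1) : ∃ x : ℝ, (x : S1) = θ := ⟨rep01 θ, coe_rep01 θ⟩

theorem S1.dist_coe_le (x y : ℝ) : dist (x : S1) (y : S1) ≤ |x - y| := by
  rw [dist_eq_norm, ← AddCircle.coe_sub]
  have : ‖((x - y : ℝ) : S1)‖ = _ := UnitAddCircle.norm_eq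
  rw [this]
  have := round_le (x - y) 0
  simpa using this

theorem S1.exists_sub_int {x y : ℝ} : ∃ n : ℤ, |x - y - n| = dist (x : S1) (y : S1) := by
  refine ⟨round (x - y), ?_⟩
  rw [dist_eq_norm, ← AddCircle.coe_sub]
  exact UnitAddCircle.norm_eq.symm

theorem S1.dist_le_half (θ η : S1) : dist θ η ≤ 1 / 2 := by
  rw [dist_eq_norm]
  simpa using AddCircle.norm_le_half_period (1 : ℝ) (x := θ - η) one_ne_zero

/-- A continuous function without zeros on a preconnected space has constant sign. -/
theorem pos_or_neg_of_ne_zero {X : Type*} [TopologicalSpace X] [PreconnectedSpace X] {u : X → ℝ}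
    (hu : Continuous u) (h0 : ∀ x, u x ≠ 0) : (∀ x, 0 < u x) ∨ ∀ x, u x < 0 := by
  by_contra! h
  obtain ⟨⟨x, hx⟩, ⟨y, hy⟩⟩ := h
  obtain ⟨z, hz⟩ := mem_range_of_exists_le_of_exists_ge hu ⟨x, hx⟩ ⟨y, hy⟩
  exact h0 z hz

/-! ### Circle homeomorphisms are monotone -/

/-- A continuous injective function on a compact interval is strictly monotone one way or the other.
The interval is enlarged to contain `1 / 3` and `2 / 3`, whose images decide which way, uniformly in
the chosen pair of points. -/
theorem strictMonoOn_Ioo_of_injOn {R : ℝ → ℝ} (hc : ContinuousOn R (Ioo 0 1))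
    (hi : InjOn R (Ioo 0 1)) (h : R (1 / 3) < R (2 / 3)) : StrictMonoOn R (Ioo 0 1) := by
  intro x hx y hy hxy
  have hsub : Icc (min x (1 / 3)) (max y (2 / 3)) ⊆ Ioo (0 : ℝ) 1 := by
    intro z hz
    refine ⟨lt_of_lt_of_le (lt_min hx.1 (by norm_num)) hz.1,
      lt_of_le_of_lt hz.2 (max_lt hy.2 (by norm_num))⟩
  have hle : min x (1 / 3) ≤ max y (2 / 3) := (min_le_left _ _).trans (hxy.le.trans (le_max_left _ _))
  have h1 : (1 / 3 : ℝ) ∈ Icc (min x (1 / 3)) (max y (2 / 3)) :=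
    ⟨min_le_right _ _, le_trans (by norm_num) (le_max_right _ _)⟩
  have h2 : (2 / 3 : ℝ) ∈ Icc (min x (1 / 3)) (max y (2 / 3)) :=
    ⟨le_trans (min_le_right _ _) (by norm_num), le_max_right _ _⟩
  have hx' : x ∈ Icc (min x (1 / 3)) (max y (2 / 3)) :=
    ⟨min_le_left _ _, hxy.le.trans (le_max_left _ _)⟩
  have hy' : y ∈ Icc (min x (1 / 3)) (max y (2 / 3)) :=
    ⟨(min_le_left _ _).trans hxy.le, le_max_left _ _⟩
  rcases le_total (R (min x (1 / 3))) (R (max y (2 / 3))) with h3 | h3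
  · exact ContinuousOn.strictMonoOn_of_injOn_Icc hle h3 (hc.mono hsub) (hi.mono hsub) hx' hy' hxy
  · have := ContinuousOn.strictAntiOn_of_injOn_Icc hle h3 (hc.mono hsub) (hi.mono hsub) h1 h2
      (by norm_num)
    exact absurd this (not_lt.2 h.le)

/-- The displacement of a circle map from its value at `0`, with values in `[0, 1)`. -/
def disp (κ : S1 → S1) (x : ℝ) : ℝ := rep01 (κ (x : S1) - κ 0)

theorem coe_disp (κ : S1 → S1) (x : ℝ) : ((disp κ x : ℝ) : S1) = κ (x : S1) - κ 0 := coe_rep01 _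

theorem disp_mem (κ : S1 ≃ₜ S1) {x : ℝ} (hx : x ∈ Ioo (0 : ℝ) 1) : disp κ x ∈ Ioo (0 : ℝ) 1 := by
  refine rep01_mem ?_
  rw [sub_ne_zero]
  exact κ.injective.ne (S1.coe_ne_zero hx)

theorem continuousOn_disp (κ : S1 ≃ₜ S1) : ContinuousOn (disp κ) (Ioo 0 1) := by
  intro x hx
  have h : κ (x : S1) - κ 0 ≠ 0 := sub_ne_zero.2 (κ.injective.ne (S1.coe_ne_zero hx))
  have h1 : ContinuousAt (fun y : ℝ => κ (y : S1) - κ 0) x :=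
    ((κ.continuous.comp S1.continuous_coe).sub continuous_const).continuousAt
  exact (ContinuousAt.comp (f := fun y : ℝ => κ (y : S1) - κ 0)
    (continuousAt_rep01 h) h1).continuousWithinAt

theorem injOn_disp (κ : S1 ≃ₜ S1) : InjOn (disp κ) (Ioo 0 1) := by
  intro x hx y hy h
  have h1 : κ (x : S1) - κ 0 = κ (y : S1) - κ 0 := by rw [← coe_disp, ← coe_disp, h]
  have h2 := κ.injective (sub_left_injective h1)
  refine S1.coe_inj ?_ h2
  rw [abs_lt]
  constructor <;> linarith [hx.1, hx.2, hy.1, hy.2]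

theorem disp_surjOn (κ : S1 ≃ₜ S1) : SurjOn (disp κ) (Ioo 0 1) (Ioo 0 1) := by
  intro y hy
  have h0 : κ.symm (κ 0 + (y : S1)) ≠ 0 := by
    intro h
    have := congrArg κ h
    rw [κ.apply_symm_apply, add_eq_left] at this
    exact S1.coe_ne_zero hy this
  refine ⟨rep01 (κ.symm (κ 0 + (y : S1))), rep01_mem h0, ?_⟩
  rw [disp, coe_rep01, κ.apply_symm_apply, add_sub_cancel_left, rep01_coe hy.1.le hy.2]

/-- The alternative carries the order of the two test values because `circleDeg` is defined by it;
comparing two fixed values also makes the degree visibly locally constant in families. -/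
theorem disp_mono_or_anti (κ : S1 ≃ₜ S1) :
    (disp κ (1 / 3) < disp κ (2 / 3) ∧ StrictMonoOn (disp κ) (Ioo 0 1)) ∨
      (disp κ (2 / 3) < disp κ (1 / 3) ∧ StrictAntiOn (disp κ) (Ioo 0 1)) := by
  have hne : disp κ (1 / 3) ≠ disp κ (2 / 3) := fun h => by
    have := injOn_disp κ ⟨by norm_num, by norm_num⟩ ⟨by norm_num, by norm_num⟩ h
    norm_num at this
  rcases lt_or_gt_of_ne hne with h | h
  · exact Or.inl ⟨h, strictMonoOn_Ioo_of_injOn (continuousOn_disp κ) (injOn_disp κ) h⟩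
  · refine Or.inr ⟨h, ?_⟩
    have := strictMonoOn_Ioo_of_injOn (R := fun x => -disp κ x) (continuousOn_disp κ).neg
      (fun x hx y hy e => injOn_disp κ hx hy (neg_injective e)) (by simpa using h)
    intro x hx y hy hxy
    have := this hx hy hxy
    simpa using this

/-! ### Parametric integrals -/

/-- By the tube lemma the integrand is uniformly close, over the compact unit interval, to its value
at `z`. Nothing is asked of the parameter space, which will be the annulus or a product with `Λ`. -/
theorem continuousOn_integral_unit {Z : Type*} [TopologicalSpace Z] {A : Set Z} {Φ : Z → ℝ → ℝ}
    (h : ContinuousOn (fun q : Z × ℝ => Φ q.1 q.2) (A ×ˢ Icc (0 : ℝ) 1)) :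
    ContinuousOn (fun z => ∫ y in (0 : ℝ)..1, Φ z y) A := by
  intro z hz
  rw [ContinuousWithinAt, Metric.tendsto_nhds]
  intro ε hε
  obtain ⟨v, hv, hd⟩ := isCompact_Icc.mem_uniformity_of_prod (f := Φ) h hz
    (Metric.dist_mem_uniformity (half_pos hε))
  filter_upwards [hv, self_mem_nhdsWithin] with p hp hpA
  have hint : ∀ p ∈ A, IntervalIntegrable (Φ p) volume 0 1 := fun p hp => by
    refine ContinuousOn.intervalIntegrable ?_
    rw [uIcc_of_le zero_le_one]
    exact h.comp (f := fun y => (p, y)) (by fun_prop) fun y hy => ⟨hp, hy⟩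
  rw [Real.dist_eq, ← intervalIntegral.integral_sub (hint p hpA) (hint z hz)]
  have : ‖∫ y in (0 : ℝ)..1, Φ p y - Φ z y‖ ≤ ε / 2 * |1 - 0| := by
    refine intervalIntegral.norm_integral_le_of_norm_le_const fun y hy => ?_
    rw [uIoc_of_le zero_le_one] at hy
    have := hd p hp y ⟨hy.1.le, hy.2⟩
    exact (le_of_lt this)
  rw [Real.norm_eq_abs] at this
  simp at this
  linarith

/-- The integral over a variable segment starting at `0` as an integral over the unit segment. -/
theorem integral_zero_eq_unit (φ : ℝ → ℝ) (w : ℝ) :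
    ∫ y in (0 : ℝ)..w, φ y = w * ∫ y in (0 : ℝ)..1, φ (y * w) := by
  have := intervalIntegral.mul_integral_comp_mul_right (f := φ) (a := 0) (b := 1) w
  simp at this ⊢

/-! ### A rotation or reflection of the circle that avoids a given homeomorphism -/

/-- The degree of a circle homeomorphism. -/
def circleDeg (κ : S1 → S1) : ℤ :=
  if disp κ (1 / 3) < disp κ (2 / 3) then 1 else -1

theorem circleDeg_eq (κ : S1 → S1) : circleDeg κ = 1 ∨ circleDeg κ = -1 := by
  unfold circleDeg
  split_ifs <;> simp

/-- The isometry of the circle that is, on average, antipodal to `κ`. -/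
def antipodal (κ : S1 → S1) (s : S1) : S1 :=
  circleDeg κ • s + (κ 0 + ((∫ x in (0 : ℝ)..1, disp κ x : ℝ) : S1))

theorem intervalIntegrable_disp (κ : S1 ≃ₜ S1) {a b : ℝ} (ha : a ∈ Icc (0 : ℝ) 1)
    (hb : b ∈ Icc (0 : ℝ) 1) (hab : a ≤ b) : IntervalIntegrable (disp κ) volume a b := by
  rw [intervalIntegrable_iff_integrableOn_Ioo_of_le hab]
  have hsub : Ioo a b ⊆ Ioo 0 1 := Ioo_subset_Ioo ha.1 hb.2
  refine Integrable.of_bound (((continuousOn_disp κ).mono hsub).aestronglyMeasurable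
    measurableSet_Ioo) 1 (Eventually.of_forall fun x => ?_)
  rw [Real.norm_eq_abs, abs_of_nonneg (show 0 ≤ disp κ x from rep01_nonneg _)]
  exact (rep01_lt_one _).le

theorem integral_lt_of_forall_lt {g : ℝ → ℝ} {a b C : ℝ} (hab : a < b)
    (hg : IntervalIntegrable g volume a b) (h : ∀ x ∈ Ioo a b, g x < C) :
    ∫ x in a..b, g x < C * (b - a) := by
  have h1 : 0 < ∫ x in a..b, (C - g x) :=
    intervalIntegral.intervalIntegral_pos_of_pos_on
      ((intervalIntegrable_const).sub hg) (fun x hx => by linarith [h x hx]) hab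
  rw [intervalIntegral.integral_sub intervalIntegrable_const hg] at h1
  simp at h1
  linarith

theorem lt_integral_of_forall_lt {g : ℝ → ℝ} {a b C : ℝ} (hab : a < b)
    (hg : IntervalIntegrable g volume a b) (h : ∀ x ∈ Ioo a b, C < g x) :
    C * (b - a) < ∫ x in a..b, g x := by
  have := integral_lt_of_forall_lt (g := fun x => -g x) (C := -C) hab hg.neg
    (fun x hx => by linarith [h x hx])
  rw [intervalIntegral.integral_neg] at this
  linarith

theorem integral_disp_mem (κ : S1 ≃ₜ S1) : ∫ x in (0 : ℝ)..1, disp κ x ∈ Ioo (0 : ℝ) 1 := by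
  have hi := intervalIntegrable_disp κ (a := 0) (b := 1) (by simp) (by simp) zero_le_one
  constructor
  · have := lt_integral_of_forall_lt zero_lt_one hi fun x hx => (disp_mem κ hx).1
    simpa using this
  · have := integral_lt_of_forall_lt zero_lt_one hi fun x hx => (disp_mem κ hx).2
    simpa using this

/-- The constant `I` is the mean of the displacement `R` of `κ`. Splitting the mean at `x` and
bounding each half by monotonicity gives `0 < x + I - R x < 1` when `κ` preserves the orientation
and `-1 < -x + I - R x < 0` when it reverses it, so the difference is never an integer. The interest
of this section is that it has slope `±1`, although `κ` is only Hölder, and varies continuously with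
`κ`. -/
theorem antipodal_ne (κ : S1 ≃ₜ S1) (s : S1) : antipodal κ s ≠ κ s := by
  set I := ∫ x in (0 : ℝ)..1, disp κ x with hI
  have hIm : I ∈ Ioo (0 : ℝ) 1 := integral_disp_mem κ
  by_cases hs : s = 0
  · subst hs
    simp only [antipodal, smul_zero, zero_add]
    rw [← hI, Ne, add_eq_left]
    exact S1.coe_ne_zero hIm
  set x := rep01 s with hx
  have hxs : (x : S1) = s := coe_rep01 s
  have hx1 : x ∈ Ioo (0 : ℝ) 1 := rep01_mem hs
  have hi1 := intervalIntegrable_disp κ (a := 0) (b := x) (by simp) ⟨hx1.1.le, hx1.2.le⟩ hx1.1.le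
  have hi2 := intervalIntegrable_disp κ (a := x) (b := 1) ⟨hx1.1.le, hx1.2.le⟩ (by simp) hx1.2.le
  have hsum : I = (∫ y in (0 : ℝ)..x, disp κ y) + ∫ y in x..1, disp κ y :=
    (intervalIntegral.integral_add_adjacent_intervals hi1 hi2).symm
  have hR := disp_mem κ hx1
  have hk : κ s = κ 0 + (disp κ x : S1) := by rw [coe_disp, hxs]; abel
  have e : antipodal κ s - κ s = ((circleDeg κ * x + I - disp κ x : ℝ) : S1) := by
    rw [antipodal, hk, ← hI, ← hxs, AddCircle.coe_sub, AddCircle.coe_add, ← zsmul_eq_mul,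
      AddCircle.coe_zsmul]
    abel
  rw [← sub_ne_zero, e]
  rcases disp_mono_or_anti κ with ⟨h, hm⟩ | ⟨h, hm⟩
  · have hd : circleDeg κ = 1 := by rw [circleDeg, if_pos h]
    have h1 := integral_lt_of_forall_lt hx1.1 hi1 (C := disp κ x) fun y hy =>
      hm ⟨hy.1, hy.2.trans hx1.2⟩ hx1 hy.2
    have h2 := integral_lt_of_forall_lt hx1.2 hi2 (C := 1) fun y hy =>
      (disp_mem κ ⟨hx1.1.trans hy.1, hy.2⟩).2
    have h3 := lt_integral_of_forall_lt hx1.1 hi1 (C := 0) fun y hy =>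
      (disp_mem κ ⟨hy.1, hy.2.trans hx1.2⟩).1
    have h4 := lt_integral_of_forall_lt hx1.2 hi2 (C := disp κ x) fun y hy =>
      hm hx1 ⟨hx1.1.trans hy.1, hy.2⟩ hy.1
    apply S1.coe_ne_zero
    rw [hd]
    push_cast
    constructor
    · nlinarith [mul_pos hx1.1 (sub_pos.2 hR.2)]
    · nlinarith [mul_pos hR.1 (sub_pos.2 hx1.2)]
  · have hd : circleDeg κ = -1 := by rw [circleDeg, if_neg (not_lt.2 h.le)]
    have h1 := integral_lt_of_forall_lt hx1.1 hi1 (C := 1) fun y hy =>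
      (disp_mem κ ⟨hy.1, hy.2.trans hx1.2⟩).2
    have h2 := integral_lt_of_forall_lt hx1.2 hi2 (C := disp κ x) fun y hy =>
      hm hx1 ⟨hx1.1.trans hy.1, hy.2⟩ hy.1
    have h3 := lt_integral_of_forall_lt hx1.1 hi1 (C := disp κ x) fun y hy =>
      hm ⟨hy.1, hy.2.trans hx1.2⟩ hx1 hy.2
    have h4 := lt_integral_of_forall_lt hx1.2 hi2 (C := 0) fun y hy =>
      (disp_mem κ ⟨hx1.1.trans hy.1, hy.2⟩).1
    -- In the orientation reversing case the representative lies in `(-1, 0)`; a period is added to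
    -- bring it to `(0, 1)`.
    have e2 : ((((-1 : ℤ) : ℝ) * x + I - disp κ x : ℝ) : S1) =
        (((-1 : ℤ) * x + I - disp κ x + 1 : ℝ) : S1) := by
      rw [AddCircle.coe_add_period]
    rw [hd, e2]
    apply S1.coe_ne_zero
    push_cast
    constructor
    · nlinarith [mul_pos hx1.1 hR.1, mul_pos (sub_pos.2 hR.2) (sub_pos.2 hx1.2)]
    · nlinarith [mul_pos hx1.1 hR.1, mul_pos (sub_pos.2 hR.2) (sub_pos.2 hx1.2)]

end

noncomputable section

/-! ### The torus and its covering map -/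

theorem isOpenQuotientMap_toTorus : IsOpenQuotientMap toTorus :=
  S1.isOpenQuotientMap_coe.prodMap S1.isOpenQuotientMap_coe

theorem continuous_toTorus : Continuous toTorus := isOpenQuotientMap_toTorus.continuous

theorem toTorus_surjective (x : S1 × S1) : ∃ z, toTorus z = x :=
  isOpenQuotientMap_toTorus.surjective x

theorem map_nhds_toTorus (z : ℝ × ℝ) : map toTorus (𝓝 z) = 𝓝 (toTorus z) :=
  isOpenQuotientMap_toTorus.isOpenMap.map_nhds_eq continuous_toTorus.continuousAt

theorem continuousAt_of_comp_toTorus {Y : Type*} [TopologicalSpace Y] {g : S1 × S1 → Y}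
    {z : ℝ × ℝ} (h : ContinuousAt (g ∘ toTorus) z) : ContinuousAt g (toTorus z) := by
  rw [ContinuousAt, ← map_nhds_toTorus, tendsto_map'_iff]
  exact h

theorem eventually_toTorus {p : S1 × S1 → Prop} {z : ℝ × ℝ} (h : ∀ᶠ x in 𝓝 (toTorus z), p x) :
    ∀ᶠ y in 𝓝 z, p (toTorus y) :=
  continuous_toTorus.continuousAt.eventually h

theorem isOpen_annulus {κ : S1 → S1} (h : Continuous κ) : IsOpen (annulus κ) :=
  isOpen_ne_fun (h.comp continuous_fst) continuous_snd

theorem annulus_nonempty (κ : S1 → S1) : (annulus κ).Nonempty :=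
  ⟨(0, κ 0 + ((1 / 2 : ℝ) : S1)), fun h => by
    rw [left_eq_add] at h
    exact S1.coe_ne_zero ⟨by norm_num, by norm_num⟩ h⟩

@[simp]
theorem linForm_apply (a b : ℝ) (v : ℝ × ℝ) : linForm a b v = a * v.1 + b * v.2 := by
  simp [linForm]

theorem eq_linForm (L : ℝ × ℝ →L[ℝ] ℝ) : L = linForm (L (1, 0)) (L (0, 1)) := by
  ext <;> simp

theorem linForm_add (a b a' b' : ℝ) :
    linForm a b + linForm a' b' = linForm (a + a') (b + b') := by
  ext <;> simp

theorem linForm_sub (a b a' b' : ℝ) :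
    linForm a b - linForm a' b' = linForm (a - a') (b - b') := by
  ext <;> simp

theorem continuousOn_linForm {X : Type*} [TopologicalSpace X] {a b : X → ℝ} {s : Set X}
    (ha : ContinuousOn a s) (hb : ContinuousOn b s) :
    ContinuousOn (fun x => linForm (a x) (b x)) s := by
  unfold linForm
  fun_prop

/-- Partial derivatives of functions on the torus. -/
def pderiv₁ (g : S1 × S1 → ℝ) (x : S1 × S1) : ℝ := deriv (fun h : ℝ => g (x.1 + (h : S1), x.2)) 0

def pderiv₂ (g : S1 × S1 → ℝ) (x : S1 × S1) : ℝ := deriv (fun h : ℝ => g (x.1, x.2 + (h : S1))) 0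

theorem HasFDerivAt.pderiv₁_eq {g : S1 × S1 → ℝ} {z : ℝ × ℝ} {L : ℝ × ℝ →L[ℝ] ℝ}
    (h : HasFDerivAt (g ∘ toTorus) L z) : pderiv₁ g (toTorus z) = L (1, 0) := by
  have h1 : HasDerivAt (fun y : ℝ => (z.1 + y, z.2)) ((1 : ℝ), (0 : ℝ)) 0 :=
    ((hasDerivAt_id (0 : ℝ)).const_add z.1).prodMk (hasDerivAt_const (0 : ℝ) z.2)
  have h0 : HasFDerivAt (g ∘ toTorus) L (z.1 + 0, z.2) := by simpa using h
  have h2 := h0.comp_hasDerivAt (0 : ℝ) h1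
  exact h2.deriv

theorem HasFDerivAt.pderiv₂_eq {g : S1 × S1 → ℝ} {z : ℝ × ℝ} {L : ℝ × ℝ →L[ℝ] ℝ}
    (h : HasFDerivAt (g ∘ toTorus) L z) : pderiv₂ g (toTorus z) = L (0, 1) := by
  have h1 : HasDerivAt (fun y : ℝ => (z.1, z.2 + y)) ((0 : ℝ), (1 : ℝ)) 0 :=
    (hasDerivAt_const (0 : ℝ) z.1).prodMk ((hasDerivAt_id (0 : ℝ)).const_add z.2)
  have h0 : HasFDerivAt (g ∘ toTorus) L (z.1, z.2 + 0) := by simpa using h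
  have h2 := h0.comp_hasDerivAt (0 : ℝ) h1
  exact h2.deriv

/-! ### Smooth partitions of unity on open subsets of the torus -/

section Partition

open scoped Manifold ContDiff

theorem contMDiff_expTorus :
    ContMDiff 𝓘(ℝ, ℝ × ℝ) ((𝓡 1).prod (𝓡 1)) ∞
      (fun z : ℝ × ℝ => (Circle.exp (2 * Real.pi / 1 * z.1), Circle.exp (2 * Real.pi / 1 * z.2))) := by
  have h1 : ContMDiff 𝓘(ℝ, ℝ × ℝ) 𝓘(ℝ, ℝ) ∞ (fun z : ℝ × ℝ => 2 * Real.pi / 1 * z.1) :=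
    ContDiff.contMDiff (by fun_prop)
  have h2 : ContMDiff 𝓘(ℝ, ℝ × ℝ) 𝓘(ℝ, ℝ) ∞ (fun z : ℝ × ℝ => 2 * Real.pi / 1 * z.2) :=
    ContDiff.contMDiff (by fun_prop)
  exact (contMDiff_circleExp.comp h1).prodMk (contMDiff_circleExp.comp h2)

/-- The torus is transported to `Circle × Circle`, which carries a manifold structure; the open set
becomes a manifold `N` with a subordinate smooth partition of unity. Smoothness is read in the plane
because the covering map is given by smooth exponentials. -/
theorem exists_smooth_partition {D : Set (S1 × S1)} (hD : IsOpen D) {ι : Type*}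
    {B : ι → Set (S1 × S1)} (hB : ∀ i, IsOpen (B i)) (hcov : D ⊆ ⋃ i, B i) :
    ∃ χ : ι → S1 × S1 → ℝ, (∀ i z, toTorus z ∈ D → ContDiffAt ℝ 1 (χ i ∘ toTorus) z) ∧
      (∀ x ∈ D, ∃ W ∈ 𝓝 x, {i | ∃ y ∈ W, χ i y ≠ 0}.Finite) ∧
      (∀ x ∈ D, ∑ᶠ i, χ i x = 1) ∧
      ∀ i, ∀ x ∈ D, x ∉ B i → ∀ᶠ y in 𝓝 x, χ i y = 0 := by
  classical
  set E : S1 × S1 ≃ₜ Circle × Circle :=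
    (AddCircle.homeomorphCircle (T := (1 : ℝ)) one_ne_zero).prodCongr
      (AddCircle.homeomorphCircle one_ne_zero) with hE
  have hEt : ∀ z, E (toTorus z) =
      (Circle.exp (2 * Real.pi / 1 * z.1), Circle.exp (2 * Real.pi / 1 * z.2)) := by
    intro z
    simp [hE, toTorus, AddCircle.homeomorphCircle_apply, AddCircle.toCircle_apply_mk]
  let N : TopologicalSpace.Opens (Circle × Circle) := ⟨E.symm ⁻¹' D, hD.preimage E.symm.continuous⟩
  have hN : ∀ x, E x ∈ N ↔ x ∈ D := fun x => by
    change E.symm (E x) ∈ D ↔ x ∈ D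
    rw [E.symm_apply_apply]
  have : LocallyCompactSpace N := N.isOpen.locallyCompactSpace
  let U : ι → Set N := fun i => (fun x : N => E.symm x.1) ⁻¹' B i
  have hUc : Continuous (fun x : N => E.symm x.1) := E.symm.continuous.comp continuous_subtype_val
  obtain ⟨ρ, hρ⟩ := SmoothPartitionOfUnity.exists_isSubordinate ((𝓡 1).prod (𝓡 1)) (M := N)
    (s := univ) isClosed_univ U (fun i => (hB i).preimage hUc) (fun x _ => by
      obtain ⟨i, hi⟩ := mem_iUnion.1 (hcov x.2)
      exact mem_iUnion.2 ⟨i, hi⟩)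
  -- The functions are extended by zero outside `N`. Nothing is claimed about them there, and since
  -- `N` is open the extension does not affect smoothness at its points.
  let χ' : ι → Circle × Circle → ℝ := fun i x => if h : x ∈ N then ρ i ⟨x, h⟩ else 0
  have hχ' : ∀ i (x : N), χ' i x = ρ i x := fun i x => by simp [χ', x.2]
  have hnhds : ∀ x (hx : x ∈ D) (W : Set N), W ∈ 𝓝 (⟨E x, (hN x).2 hx⟩ : N) →
      ∀ᶠ y in 𝓝 x, ∃ hy : E y ∈ N, (⟨E y, hy⟩ : N) ∈ W := by
    intro x hx W hW
    have h1 : Subtype.val '' W ∈ 𝓝 (E x) :=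
      N.isOpen.isOpenEmbedding_subtypeVal.isOpenMap.image_mem_nhds hW
    filter_upwards [E.continuous.continuousAt.preimage_mem_nhds h1] with y hy
    obtain ⟨w, hw, hwy⟩ := hy
    exact ⟨hwy ▸ w.2, by convert hw; exact hwy.symm⟩
  refine ⟨fun i x => χ' i (E x), ?_, ?_, ?_, ?_⟩
  · intro i z hz
    have h1 : ContMDiffAt ((𝓡 1).prod (𝓡 1)) 𝓘(ℝ, ℝ) ∞ (χ' i) (E (toTorus z)) := by
      have h2 : ContMDiffAt ((𝓡 1).prod (𝓡 1)) 𝓘(ℝ, ℝ) ∞ (fun x : N => χ' i x)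
          ⟨E (toTorus z), (hN _).2 hz⟩ := by
        simp only [hχ']
        exact (ρ i).contMDiff.contMDiffAt
      exact contMDiffAt_subtype_iff.1 h2
    have h3 := contMDiff_expTorus.contMDiffAt (x := z)
    rw [hEt] at h1
    have h4 := ContMDiffAt.comp z h1 h3
    have h5 : ContDiffAt ℝ ∞ (χ' i ∘ fun z : ℝ × ℝ => (Circle.exp (2 * Real.pi / 1 * z.1),
      Circle.exp (2 * Real.pi / 1 * z.2))) z := contMDiffAt_iff_contDiffAt.1 h4
    have h6 : ((fun x => χ' i (E x)) ∘ toTorus) = (χ' i ∘ fun z : ℝ × ℝ =>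
        (Circle.exp (2 * Real.pi / 1 * z.1), Circle.exp (2 * Real.pi / 1 * z.2))) := by
      funext z
      simp only [Function.comp, hEt]
    rw [h6]
    exact h5.of_le (by exact_mod_cast le_top)
  · intro x hx
    obtain ⟨W, hW, hf⟩ := ρ.locallyFinite ⟨E x, (hN x).2 hx⟩
    refine ⟨_, hnhds x hx W hW, hf.subset ?_⟩
    rintro i ⟨y, ⟨hy, hyW⟩, hne⟩
    refine ⟨⟨E y, hy⟩, ?_, hyW⟩
    rw [Function.mem_support, ← hχ']
    exact hne
  · intro x hx
    have := ρ.sum_eq_one (mem_univ ⟨E x, (hN x).2 hx⟩)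
    simp only [← hχ'] at this
    exact this
  · intro i x hx hxB
    -- Subordination concerns the closed supports, so the function vanishes near the point and not
    -- only at it.
    have h1 : (⟨E x, (hN x).2 hx⟩ : N) ∉ tsupport (ρ i) := fun h => by
      have := hρ i h
      exact hxB (by simpa [U] using this)
    have h2 := hnhds x hx _ ((isClosed_tsupport (ρ i)).isOpen_compl.mem_nhds h1)
    filter_upwards [h2] with y hy
    obtain ⟨hyN, hy⟩ := hy
    have := image_eq_zero_of_notMem_tsupport hy
    rw [← hχ'] at this
    exact this

end Partition

/-! ### Global fibre coordinates -/

namespace PrincipalBundle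

variable {κ : S1 → S1} {M : Type*} [TopologicalSpace M] [AddAction ℝ M]

theorem baseSet_subset (P : PrincipalBundle κ M) (e : Bundle.Trivialization ℝ P.proj) :
    e.baseSet ⊆ annulus κ := by
  intro x hx
  have : P.proj (e.toOpenPartialHomeomorph.symm (x, 0)) = x := e.proj_symm_apply' hx
  rw [← this]
  exact P.proj_mem _

theorem exists_proj_eq (P : PrincipalBundle κ M) {x : S1 × S1} (hx : x ∈ annulus κ) :
    ∃ m, P.proj m = x := by
  obtain ⟨e, -, he⟩ := P.cover x hx
  exact ⟨_, e.proj_symm_apply' (b := x) (x := 0) he⟩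

/-- `U` is a global fibre coordinate on the bundle, in which the connection form is
`dU + a ds + b dt`. -/
structure Connection.IsCoord {P : PrincipalBundle κ M} (A : P.Connection) (U : M → ℝ)
    (a b : S1 × S1 → ℝ) : Prop where
  continuousOn_a : ContinuousOn a (annulus κ)
  continuousOn_b : ContinuousOn b (annulus κ)
  local_eq : ∀ e ∈ P.atlas, ∃ G : S1 × S1 → ℝ,
    (∀ m, P.proj m ∈ e.baseSet → U m = (e m).2 + G (P.proj m)) ∧
    ∀ z, toTorus z ∈ e.baseSet → HasFDerivAt (G ∘ toTorus)
      (linForm (A.a e (toTorus z) - a (toTorus z)) (A.b e (toTorus z) - b (toTorus z))) z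

/-- A globally defined trivialisation is already a global coordinate. In families this is used
instead of a partition of unity, so that the coordinate is the given one and varies continuously. -/
theorem Connection.isCoord_of_mem_atlas {P : PrincipalBundle κ M} (A : P.Connection)
    {e : Bundle.Trivialization ℝ P.proj} (he : e ∈ P.atlas) (hb : e.baseSet = annulus κ) :
    A.IsCoord (fun m => (e m).2) (A.a e) (A.b e) where
  continuousOn_a := hb ▸ A.continuousOn_a e he
  continuousOn_b := hb ▸ A.continuousOn_b e he
  local_eq e' he' := by
    obtain ⟨g, -, hg⟩ := P.transition e' he' e he
    have hs : e'.baseSet ∩ e.baseSet = e'.baseSet :=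
      inter_eq_left.2 (hb ▸ P.baseSet_subset e')
    have h2 := A.compat e' he' e he g hg
    rw [hs] at hg h2
    exact ⟨g, hg, h2⟩

/-- Replacing `U` by `U + V` subtracts `dV` from `a ds + b dt`, since the connection form itself
does not change. -/
theorem Connection.IsCoord.add {P : PrincipalBundle κ M} {A : P.Connection} {U : M → ℝ}
    {a b : S1 × S1 → ℝ} (h : A.IsCoord U a b) {V p q : S1 × S1 → ℝ}
    (hp : ContinuousOn p (annulus κ)) (hq : ContinuousOn q (annulus κ))
    (hV : ∀ z, toTorus z ∈ annulus κ →
      HasFDerivAt (V ∘ toTorus) (linForm (p (toTorus z)) (q (toTorus z))) z) :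
    A.IsCoord (fun m => U m + V (P.proj m)) (fun x => a x - p x) (fun x => b x - q x) where
  continuousOn_a := h.continuousOn_a.sub hp
  continuousOn_b := h.continuousOn_b.sub hq
  local_eq e he := by
    obtain ⟨G, hG, hG'⟩ := h.local_eq e he
    refine ⟨fun x => G x + V x, fun m hm => by rw [hG m hm]; ring, fun z hz => ?_⟩
    have := (hG' z hz).add (hV z (P.baseSet_subset e hz))
    rw [linForm_add] at this
    rw [sub_sub_eq_add_sub, sub_sub_eq_add_sub, add_sub_right_comm, add_sub_right_comm]
    exact this

/-- Fibre coordinates can be averaged, because two of them differ by a function on the base: the sum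
of local coordinates weighted by a partition of unity is again a fibre coordinate. Its form is the
local form minus the differential of the change of coordinate, and the local expressions agree on
overlaps. -/
theorem Connection.exists_isCoord {P : PrincipalBundle κ M} (A : P.Connection)
    (hκ : Continuous κ) : ∃ U a b, A.IsCoord U a b := by
  classical
  obtain ⟨x₀, hx₀⟩ := annulus_nonempty κ
  obtain ⟨e₀, -, -⟩ := P.cover x₀ hx₀
  have : Nonempty (Bundle.Trivialization ℝ P.proj) := ⟨e₀⟩
  have hcov := P.cover
  choose! e he hxe using hcov
  obtain ⟨χ, hχd, hχf, hχs, hχ0⟩ := exists_smooth_partition (isOpen_annulus hκ)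
    (B := fun i : annulus κ => (e i).baseSet) (fun i => (e i).open_baseSet)
    (fun x hx => mem_iUnion.2 ⟨⟨x, hx⟩, hxe x hx⟩)
  have htr := P.transition
  choose! g hg hge using htr
  set U : M → ℝ := fun m => ∑ᶠ i : annulus κ, χ i (P.proj m) * (e i m).2 with hU
  set G : Bundle.Trivialization ℝ P.proj → S1 × S1 → ℝ :=
    fun e' x => ∑ᶠ i : annulus κ, χ i x * g e' (e i) x with hGdef
  have hfin : ∀ x ∈ annulus κ, {i | χ i x ≠ 0}.Finite := by
    intro x hx
    obtain ⟨W, hW, hf⟩ := hχf x hx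
    exact hf.subset fun i hi => ⟨x, mem_of_mem_nhds hW, hi⟩
  have hfin' : ∀ x ∈ annulus κ, ∀ c : annulus κ → ℝ,
      (Function.support fun i => χ i x * c i).Finite := fun x hx c =>
    (hfin x hx).subset fun i hi => left_ne_zero_of_mul hi
  have hzero : ∀ (i : annulus κ) (x : S1 × S1), x ∈ annulus κ → x ∉ (e i).baseSet → χ i x = 0 := fun i x hx hi =>
    (hχ0 i x hx hi).self_of_nhds
  -- Relative to any chart the average is the chart coordinate plus the weighted mean of the
  -- transition functions, because the weights add up to one.
  have hUG : ∀ e' ∈ P.atlas, ∀ m, P.proj m ∈ e'.baseSet → U m = (e' m).2 + G e' (P.proj m) := by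
    intro e' he' m hm
    have hx := P.proj_mem m
    have h1 : (e' m).2 = ∑ᶠ i : annulus κ, χ i (P.proj m) * (e' m).2 := by
      rw [← finsum_mul, hχs _ hx, one_mul]
    rw [h1]
    simp only [hU, hGdef]
    rw [← finsum_add_distrib (hfin' _ hx _) (hfin' _ hx _)]
    refine finsum_congr fun i => ?_
    by_cases hi : P.proj m ∈ (e i).baseSet
    · rw [hge e' he' (e i) (he i i.2) m ⟨hm, hi⟩]
      ring
    · rw [hzero i _ hx hi]
      ring
  -- The differential of a transition function is the difference of the two local connection forms,
  -- which is continuous.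
  have hgC1 : ∀ e' ∈ P.atlas, ∀ i : annulus κ, ∀ z, toTorus z ∈ e'.baseSet ∩ (e i).baseSet →
      ContDiffAt ℝ 1 (g e' (e i) ∘ toTorus) z := by
    intro e' he' i z hz
    have hO : IsOpen (toTorus ⁻¹' (e'.baseSet ∩ (e i).baseSet)) :=
      (e'.open_baseSet.inter (e i).open_baseSet).preimage continuous_toTorus
    rw [contDiffAt_one_iff]
    refine ⟨_, _, hO.mem_nhds hz, ?_, A.compat e' he' (e i) (he i i.2) _
      (hge e' he' (e i) (he i i.2))⟩
    refine ContinuousOn.comp (g := fun x => linForm (A.a e' x - A.a (e i) x)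
      (A.b e' x - A.b (e i) x)) (t := e'.baseSet ∩ (e i).baseSet) ?_
      continuous_toTorus.continuousOn (mapsTo_preimage _ _)
    exact continuousOn_linForm
      (((A.continuousOn_a e' he').mono inter_subset_left).sub
        ((A.continuousOn_a _ (he i i.2)).mono inter_subset_right))
      (((A.continuousOn_b e' he').mono inter_subset_left).sub
        ((A.continuousOn_b _ (he i i.2)).mono inter_subset_right))
  have hGC1 : ∀ e' ∈ P.atlas, ∀ z, toTorus z ∈ e'.baseSet → ContDiffAt ℝ 1 (G e' ∘ toTorus) z := by
    intro e' he' z hz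
    have hx := P.baseSet_subset e' hz
    obtain ⟨W, hW, hf⟩ := hχf _ hx
    have hterm : ∀ i, ContDiffAt ℝ 1 (fun y => χ i (toTorus y) * g e' (e i) (toTorus y)) z := by
      intro i
      -- The transition function is controlled only on the overlap. At any other point the weight
      -- vanishes in a neighbourhood, so the product is locally zero.
      by_cases hi : toTorus z ∈ (e i).baseSet
      · exact (hχd i z hx).mul (hgC1 e' he' i z ⟨hz, hi⟩)
      · refine (contDiffAt_const (c := (0 : ℝ))).congr_of_eventuallyEq ?_
        filter_upwards [eventually_toTorus (hχ0 i _ hx hi)] with y hy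
        rw [hy, zero_mul]
    have hsum : ContDiffAt ℝ 1 (fun y => ∑ i ∈ hf.toFinset,
        χ i (toTorus y) * g e' (e i) (toTorus y)) z := ContDiffAt.sum fun i _ => hterm i
    refine hsum.congr_of_eventuallyEq ?_
    filter_upwards [eventually_toTorus hW] with y hy
    simp only [hGdef, Function.comp]
    refine finsum_eq_sum_of_support_subset _ fun i hi => ?_
    rw [Finite.coe_toFinset]
    exact ⟨_, hy, left_ne_zero_of_mul hi⟩
  have hGd : ∀ e' ∈ P.atlas, ∀ z, toTorus z ∈ e'.baseSet → HasFDerivAt (G e' ∘ toTorus)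
      (linForm (pderiv₁ (G e') (toTorus z)) (pderiv₂ (G e') (toTorus z))) z := by
    intro e' he' z hz
    have h1 := ((hGC1 e' he' z hz).differentiableAt one_ne_zero).hasFDerivAt
    rw [h1.pderiv₁_eq, h1.pderiv₂_eq, ← eq_linForm]
    exact h1
  -- On an overlap `G e₁ = G e₂ + g e₁ e₂`, and uniqueness of the differential turns this into
  -- equality of the corrected coefficients.
  have hdiff : ∀ e₁ ∈ P.atlas, ∀ e₂ ∈ P.atlas, ∀ x ∈ e₁.baseSet ∩ e₂.baseSet,
      A.a e₁ x - pderiv₁ (G e₁) x = A.a e₂ x - pderiv₁ (G e₂) x ∧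
      A.b e₁ x - pderiv₂ (G e₁) x = A.b e₂ x - pderiv₂ (G e₂) x := by
    intro e₁ h₁ e₂ h₂ x hx
    obtain ⟨z, rfl⟩ := toTorus_surjective x
    have hgz := A.compat e₁ h₁ e₂ h₂ _ (hge e₁ h₁ e₂ h₂) z hx
    have h3 := (hGd e₂ h₂ z hx.2).add hgz
    rw [linForm_add] at h3
    have hO : IsOpen (e₁.baseSet ∩ e₂.baseSet) := e₁.open_baseSet.inter e₂.open_baseSet
    have h4 : (G e₁ ∘ toTorus) =ᶠ[𝓝 z] (G e₂ ∘ toTorus + g e₁ e₂ ∘ toTorus) := by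
      filter_upwards [eventually_toTorus (hO.mem_nhds hx)] with y hy
      obtain ⟨m, hm⟩ := P.exists_proj_eq (P.baseSet_subset _ hy.1)
      have e1 := hUG e₁ h₁ m (by rw [hm]; exact hy.1)
      have e2 := hUG e₂ h₂ m (by rw [hm]; exact hy.2)
      have e3 := hge e₁ h₁ e₂ h₂ m (by rw [hm]; exact hy)
      rw [hm] at e1 e2 e3
      simp only [Function.comp, Pi.add_apply]
      linarith
    have h5 := h3.congr_of_eventuallyEq h4
    have h6 := h5.unique (hGd e₁ h₁ z hx.1)
    have h7 := congrArg (fun L => L (1, 0)) h6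
    have h8 := congrArg (fun L => L (0, 1)) h6
    simp at h7 h8
    constructor <;> linarith
  have hcont : ∀ e' ∈ P.atlas, ∀ z, toTorus z ∈ e'.baseSet →
      ContinuousAt (pderiv₁ (G e')) (toTorus z) ∧ ContinuousAt (pderiv₂ (G e')) (toTorus z) := by
    intro e' he' z hz
    have h1 : ContinuousAt (fderiv ℝ (G e' ∘ toTorus)) z :=
      ((hGC1 e' he' z hz).fderiv_right (m := 0) (by simp)).continuousAt
    have h2 : ∀ᶠ y in 𝓝 z, toTorus y ∈ e'.baseSet :=
      eventually_toTorus (e'.open_baseSet.mem_nhds hz)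
    constructor
    · refine continuousAt_of_comp_toTorus ?_
      have h3 : ContinuousAt (fun y => fderiv ℝ (G e' ∘ toTorus) y (1, 0)) z :=
        h1.clm_apply continuousAt_const
      refine h3.congr ?_
      filter_upwards [h2] with y hy
      rw [(hGd e' he' y hy).fderiv]
      simp
    · refine continuousAt_of_comp_toTorus ?_
      have h3 : ContinuousAt (fun y => fderiv ℝ (G e' ∘ toTorus) y (0, 1)) z :=
        h1.clm_apply continuousAt_const
      refine h3.congr ?_
      filter_upwards [h2] with y hy
      rw [(hGd e' he' y hy).fderiv]
      simp
  refine ⟨U, fun x => A.a (e x) x - pderiv₁ (G (e x)) x,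
    fun x => A.b (e x) x - pderiv₂ (G (e x)) x, ?_, ?_, ?_⟩
  · intro x hx
    obtain ⟨z, rfl⟩ := toTorus_surjective x
    set e' := e (toTorus z) with he'
    have hm : e' ∈ P.atlas := he _ hx
    have hz : toTorus z ∈ e'.baseSet := hxe _ hx
    have h1 : ContinuousAt (fun x => A.a e' x - pderiv₁ (G e') x) (toTorus z) :=
      ((A.continuousOn_a e' hm).continuousAt (e'.open_baseSet.mem_nhds hz)).sub
        (hcont e' hm z hz).1
    refine (h1.congr ?_).continuousWithinAt
    filter_upwards [e'.open_baseSet.mem_nhds hz] with y hy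
    have hyD := P.baseSet_subset e' hy
    exact (hdiff e' hm (e y) (he y hyD) y ⟨hy, hxe y hyD⟩).1
  · intro x hx
    obtain ⟨z, rfl⟩ := toTorus_surjective x
    set e' := e (toTorus z) with he'
    have hm : e' ∈ P.atlas := he _ hx
    have hz : toTorus z ∈ e'.baseSet := hxe _ hx
    have h1 : ContinuousAt (fun x => A.b e' x - pderiv₂ (G e') x) (toTorus z) :=
      ((A.continuousOn_b e' hm).continuousAt (e'.open_baseSet.mem_nhds hz)).sub
        (hcont e' hm z hz).2
    refine (h1.congr ?_).continuousWithinAt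
    filter_upwards [e'.open_baseSet.mem_nhds hz] with y hy
    have hyD := P.baseSet_subset e' hy
    exact (hdiff e' hm (e y) (he y hyD) y ⟨hy, hxe y hyD⟩).2
  · intro e' he'
    refine ⟨G e', hUG e' he', fun z hz => ?_⟩
    have hzD := P.baseSet_subset e' hz
    have h1 := hdiff e' he' _ (he _ hzD) _ ⟨hz, hxe _ hzD⟩
    convert hGd e' he' z hz using 2
    · linarith [h1.1]
    · linarith [h1.2]

end PrincipalBundle

end

/-! ### Global fibre coordinates: trivialisation, leaves and automorphisms -/

noncomputable section

namespace PrincipalBundle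

variable {κ : S1 → S1} {M : Type*} [TopologicalSpace M] [AddAction ℝ M]

theorem continuous_proj (P : PrincipalBundle κ M) : Continuous P.proj := by
  rw [continuous_iff_continuousAt]
  intro m
  obtain ⟨e, -, he⟩ := P.cover _ (P.proj_mem m)
  exact e.continuousAt_proj (e.mem_source.2 he)

namespace Connection.IsCoord

variable {P : PrincipalBundle κ M} {A : P.Connection} {U : M → ℝ} {a b : S1 × S1 → ℝ}

theorem vadd (h : A.IsCoord U a b) (u : ℝ) (m : M) : U (u +ᵥ m) = U m + u := by
  obtain ⟨e, he, hm⟩ := P.cover _ (P.proj_mem m)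
  obtain ⟨G, hG, -⟩ := h.local_eq e he
  rw [hG m hm, hG (u +ᵥ m) (by rwa [P.proj_vadd]), P.coord_vadd e he u m hm, P.proj_vadd]
  ring

theorem continuousAt_of_local {e : Bundle.Trivialization ℝ P.proj}
    {G : S1 × S1 → ℝ} {α β : S1 × S1 → ℝ} (hG : ∀ z, toTorus z ∈ e.baseSet →
      HasFDerivAt (G ∘ toTorus) (linForm (α (toTorus z)) (β (toTorus z))) z)
    {x : S1 × S1} (hx : x ∈ e.baseSet) : ContinuousAt G x := by
  obtain ⟨z, rfl⟩ := toTorus_surjective x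
  exact continuousAt_of_comp_toTorus (hG z hx).continuousAt

theorem continuous (h : A.IsCoord U a b) : Continuous U := by
  rw [continuous_iff_continuousAt]
  intro m
  obtain ⟨e, he, hm⟩ := P.cover _ (P.proj_mem m)
  obtain ⟨G, hG, hG'⟩ := h.local_eq e he
  have h1 : ContinuousAt (fun m => (e m).2 + G (P.proj m)) m := by
    refine ContinuousAt.add ?_ ?_
    · exact continuousAt_snd.comp (e.continuousAt (e.mem_source.2 hm))
    · exact ContinuousAt.comp (f := P.proj) (g := G) (continuousAt_of_local
        (α := fun x => A.a e x - a x) (β := fun x => A.b e x - b x) hG' hm)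
        P.continuous_proj.continuousAt
  refine h1.congr ?_
  filter_upwards [P.continuous_proj.continuousAt.preimage_mem_nhds
    (e.open_baseSet.mem_nhds hm)] with m' hm'
  exact (hG m' hm').symm

theorem ext (h : A.IsCoord U a b) {m m' : M} (hp : P.proj m = P.proj m') (hU : U m = U m') :
    m = m' := by
  obtain ⟨e, he, hm⟩ := P.cover _ (P.proj_mem m)
  obtain ⟨G, hG, -⟩ := h.local_eq e he
  have hm' : P.proj m' ∈ e.baseSet := hp ▸ hm
  have h1 := hG m hm
  have h2 := hG m' hm'
  rw [hU, h2, hp] at h1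
  refine e.injOn (e.mem_source.2 hm) (e.mem_source.2 hm') ?_
  change e m = e m'
  refine Prod.ext ?_ (by linarith)
  rw [e.coe_fst (e.mem_source.2 hm), e.coe_fst (e.mem_source.2 hm'), hp]

theorem exists_eq (h : A.IsCoord U a b) {x : S1 × S1} (hx : x ∈ annulus κ) (u : ℝ) :
    ∃ m, P.proj m = x ∧ U m = u := by
  obtain ⟨m, hm⟩ := P.exists_proj_eq hx
  refine ⟨(u - U m) +ᵥ m, by rw [P.proj_vadd, hm], ?_⟩
  rw [h.vadd]
  ring

/-- The point with given projection and fibre coordinate. -/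
def point (h : A.IsCoord U a b) (q : annulus κ × ℝ) : M :=
  (h.exists_eq q.1.2 q.2).choose

theorem proj_point (h : A.IsCoord U a b) (q : annulus κ × ℝ) : P.proj (h.point q) = q.1 :=
  (h.exists_eq q.1.2 q.2).choose_spec.1

theorem coord_point (h : A.IsCoord U a b) (q : annulus κ × ℝ) : U (h.point q) = q.2 :=
  (h.exists_eq q.1.2 q.2).choose_spec.2

/-- The trivialisation of the bundle given by a global fibre coordinate. -/
def homeo (h : A.IsCoord U a b) : M ≃ₜ annulus κ × ℝ where
  toFun m := (⟨P.proj m, P.proj_mem m⟩, U m)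
  invFun := h.point
  left_inv m := h.ext (h.proj_point _) (h.coord_point _)
  right_inv q := Prod.ext (Subtype.ext (h.proj_point q)) (h.coord_point q)
  continuous_toFun := (P.continuous_proj.subtype_mk _).prodMk h.continuous
  continuous_invFun := by
    rw [continuous_iff_continuousAt]
    intro q
    obtain ⟨e, he, hq⟩ := P.cover _ q.1.2
    obtain ⟨G, hG, hG'⟩ := h.local_eq e he
    have hGc : ContinuousAt G q.1.1 := continuousAt_of_local
        (α := fun x => A.a e x - a x) (β := fun x => A.b e x - b x) hG' hq
    have h1 : ContinuousAt (fun q : annulus κ × ℝ => ((q.1 : S1 × S1), q.2 - G q.1)) q := by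
      refine ContinuousAt.prodMk (by fun_prop) (continuousAt_snd.sub ?_)
      exact ContinuousAt.comp (f := fun q : annulus κ × ℝ => (q.1 : S1 × S1)) (g := G) hGc
        (by fun_prop)
    have h2 : ContinuousAt (fun q : annulus κ × ℝ =>
        e.toOpenPartialHomeomorph.symm ((q.1 : S1 × S1), q.2 - G q.1)) q :=
      ContinuousAt.comp (g := e.toOpenPartialHomeomorph.symm)
        (f := fun q : annulus κ × ℝ => ((q.1 : S1 × S1), q.2 - G q.1))
        (e.toOpenPartialHomeomorph.continuousAt_symm (e.mem_target.2 hq)) h1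
    refine h2.congr ?_
    have h3 : ContinuousAt (fun q : annulus κ × ℝ => (q.1 : S1 × S1)) q := by fun_prop
    filter_upwards [h3.preimage_mem_nhds (e.open_baseSet.mem_nhds hq)] with q' hq'
    have hp : P.proj (e.toOpenPartialHomeomorph.symm ((q'.1 : S1 × S1), q'.2 - G q'.1)) = q'.1 :=
      e.proj_symm_apply' hq'
    refine h.ext ?_ ?_
    · rw [h.proj_point, hp]
    · rw [h.coord_point, hG _ (by rw [hp]; exact hq'), hp, e.apply_symm_apply' hq']
      ring

/-- Along a fibre the change of coordinate `G` contributes its `t`-derivative, which is the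
difference of the two coefficients of `dt`; the local coefficient cancels. -/
theorem hasDerivAt_leaf (h : A.IsCoord U a b) {p : (ℝ → M) × Set ℝ} {s : S1} {t₀ : ℝ}
    (hp : ∀ t ∈ Ioo t₀ (t₀ + 1), P.proj (p.1 t) = (s, (t : S1)) ∧
      ∀ e ∈ P.atlas, (s, (t : S1)) ∈ e.baseSet →
        HasDerivAt (fun t' => (e (p.1 t')).2) (-A.b e (s, (t : S1))) t)
    {t : ℝ} (ht : t ∈ Ioo t₀ (t₀ + 1)) :
    HasDerivAt (fun t' => U (p.1 t')) (-b (s, (t : S1))) t := by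
  obtain ⟨e, he, hx⟩ := P.cover (s, (t : S1)) (by rw [← (hp t ht).1]; exact P.proj_mem _)
  obtain ⟨G, hG, hG'⟩ := h.local_eq e he
  obtain ⟨x, rfl⟩ := S1.coe_surjective s
  have h1 := hG' (x, t) hx
  have h2 : HasDerivAt (fun y : ℝ => (x, y)) ((0 : ℝ), (1 : ℝ)) t :=
    (hasDerivAt_const t x).prodMk (hasDerivAt_id t)
  have h3 := h1.comp_hasDerivAt t h2
  have h4 := ((hp t ht).2 e he hx).add h3
  have h5 : -A.b e ((x : S1), (t : S1)) + (linForm (A.a e (toTorus (x, t)) - a (toTorus (x, t)))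
      (A.b e (toTorus (x, t)) - b (toTorus (x, t)))) ((0 : ℝ), (1 : ℝ)) =
      -b ((x : S1), (t : S1)) := by
    rw [linForm_apply]
    simp only [toTorus]
    ring
  rw [h5] at h4
  refine h4.congr_of_eventuallyEq ?_
  have hc : Continuous fun y : ℝ => ((x : S1), (y : S1)) :=
    continuous_const.prodMk S1.continuous_coe
  filter_upwards [isOpen_Ioo.mem_nhds ht,
    hc.continuousAt.preimage_mem_nhds (e.open_baseSet.mem_nhds hx)] with y hy hye
  have h6 := (hp y hy).1
  have h7 := hG (p.1 y) (by rw [h6]; exact hye)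
  rw [h6] at h7
  exact h7

/-- A curve over `t ↦ (s, t)` on which the fibre coordinate has derivative `-b` is a leaf. -/
theorem mem_leaves (h : A.IsCoord U a b) {c : ℝ → M} {s : S1} {t₀ : ℝ} (h0 : (t₀ : S1) = κ s)
    (hp : ∀ t ∈ Ioo t₀ (t₀ + 1), P.proj (c t) = (s, (t : S1)))
    (hd : ∀ t ∈ Ioo t₀ (t₀ + 1), HasDerivAt (fun t' => U (c t')) (-b (s, (t : S1))) t) :
    (c, Ioo t₀ (t₀ + 1)) ∈ leaves A := by
  refine ⟨s, t₀, h0, rfl, fun t ht => ⟨hp t ht, fun e he hx => ?_⟩⟩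
  obtain ⟨G, hG, hG'⟩ := h.local_eq e he
  obtain ⟨x, rfl⟩ := S1.coe_surjective s
  have h1 := hG' (x, t) hx
  have h2 : HasDerivAt (fun y : ℝ => (x, y)) ((0 : ℝ), (1 : ℝ)) t :=
    (hasDerivAt_const t x).prodMk (hasDerivAt_id t)
  have h3 := h1.comp_hasDerivAt t h2
  have h4 := (hd t ht).sub h3
  have h5 : -b ((x : S1), (t : S1)) - (linForm (A.a e (toTorus (x, t)) - a (toTorus (x, t)))
      (A.b e (toTorus (x, t)) - b (toTorus (x, t)))) ((0 : ℝ), (1 : ℝ)) =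
      -A.b e ((x : S1), (t : S1)) := by
    rw [linForm_apply]
    simp only [toTorus]
    ring
  rw [h5] at h4
  refine h4.congr_of_eventuallyEq ?_
  have hc : Continuous fun y : ℝ => ((x : S1), (y : S1)) :=
    continuous_const.prodMk S1.continuous_coe
  filter_upwards [isOpen_Ioo.mem_nhds ht,
    hc.continuousAt.preimage_mem_nhds (e.open_baseSet.mem_nhds hx)] with y hy hye
  have h6 := hp y hy
  have h7 := hG (c y) (by rw [h6]; exact hye)
  rw [h6] at h7
  change (e (c y)).2 = U (c y) - G ((x : S1), (y : S1))
  rw [h7]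
  ring

/-- The expression of a connection preserving automorphism in a global fibre coordinate. -/
theorem exists_cocycle (h : A.IsCoord U a b) {T : M ≃ₜ M} {φ₁ φ₂ : S1 → S1}
    (hφ₁ : IsC1hMap φ₁) (hφ₂ : IsC1hMap φ₂) (hT : P.IsC1hAut T φ₁ φ₂)
    (hA : A.PreservedBy T φ₁ φ₂) :
    ∃ c : S1 × S1 → ℝ, (∀ m, U (T m) = U m + c (P.proj m)) ∧
      ∀ z, toTorus z ∈ annulus κ → HasFDerivAt (c ∘ toTorus)
        (linForm (a (toTorus z) - a (φ₁ (toTorus z).1, φ₂ (toTorus z).2) * cderiv φ₁ (toTorus z).1)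
          (b (toTorus z) - b (φ₁ (toTorus z).1, φ₂ (toTorus z).2) * cderiv φ₂ (toTorus z).2)) z := by
  classical
  -- Both `T` and `U` are compatible with the `ℝ`-action, so `U ∘ T - U` is constant on the fibres
  -- of the bundle and defines a function `c` on the base.
  have hex : ∀ x ∈ annulus κ, ∃ v, ∀ m, P.proj m = x → U (T m) = U m + v := by
    intro x hx
    obtain ⟨m₀, hm₀⟩ := P.exists_proj_eq hx
    refine ⟨U (T m₀) - U m₀, fun m hm => ?_⟩
    have : m = (U m - U m₀) +ᵥ m₀ := h.ext (by rw [P.proj_vadd, hm, hm₀]) (by rw [h.vadd]; ring)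
    rw [this, hT.map_vadd, h.vadd, h.vadd]
    ring
  choose! c hc using hex
  refine ⟨c, fun m => hc _ (P.proj_mem m) m rfl, fun z hz => ?_⟩
  obtain ⟨e, he, hx⟩ := P.cover _ hz
  obtain ⟨m₀, hm₀⟩ := P.exists_proj_eq hz
  have hTm : P.proj (T m₀) = (φ₁ (toTorus z).1, φ₂ (toTorus z).2) := by rw [hT.proj_map, hm₀]
  obtain ⟨e', he', hx'⟩ := P.cover _ (P.proj_mem (T m₀))
  rw [hTm] at hx'
  obtain ⟨G, hG, hGd⟩ := h.local_eq e he
  obtain ⟨G', hG', hGd'⟩ := h.local_eq e' he'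
  obtain ⟨k, -, hk⟩ := hT.regular e he e' he'
  have hkd := hA e he e' he' k hk z hx hx'
  obtain ⟨⟨F₁, hF₁, hl₁⟩, -⟩ := id hφ₁
  obtain ⟨⟨F₂, hF₂, hl₂⟩, -⟩ := id hφ₂
  have hd₁ : HasDerivAt F₁ (cderiv φ₁ (z.1 : S1)) z.1 := by
    have h0 := (hF₁.differentiable one_ne_zero z.1).hasDerivAt
    rwa [← (hasDerivAt_localRep hl₁ h0).deriv] at h0
  have hd₂ : HasDerivAt F₂ (cderiv φ₂ (z.2 : S1)) z.2 := by
    have h0 := (hF₂.differentiable one_ne_zero z.2).hasDerivAt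
    rwa [← (hasDerivAt_localRep hl₂ h0).deriv] at h0
  have htt : ∀ y : ℝ × ℝ, toTorus (F₁ y.1, F₂ y.2) = (φ₁ (toTorus y).1, φ₂ (toTorus y).2) :=
    fun y => by simp only [toTorus, hl₁, hl₂]
  have hcomp : HasFDerivAt (fun y : ℝ × ℝ => (F₁ y.1, F₂ y.2)) _ z :=
    (hd₁.hasFDerivAt.comp z hasFDerivAt_fst).prodMk (hd₂.hasFDerivAt.comp z hasFDerivAt_snd)
  have hGd2 := (hGd' (F₁ z.1, F₂ z.2) (by rw [htt]; exact hx')).comp z hcomp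
  have hfin := (hkd.add hGd2).sub (hGd z hx)
  -- Locally `c` is the cocycle `k` of the charts, corrected by the changes of coordinate at the
  -- target and at the source. The chain rule for lifts of `φ₁` and `φ₂` then gives its
  -- differential.
  have e1 : (c ∘ toTorus) =ᶠ[𝓝 z] ((k ∘ toTorus + (G' ∘ toTorus) ∘
      fun y : ℝ × ℝ => (F₁ y.1, F₂ y.2)) - G ∘ toTorus) := by
    have hφc : Continuous fun x : S1 × S1 => (φ₁ x.1, φ₂ x.2) := by
      obtain ⟨C₁, r₁, hr₁, h₁⟩ := hφ₁.lipschitz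
      obtain ⟨C₂, r₂, hr₂, h₂⟩ := hφ₂.lipschitz
      exact ((h₁.continuous hr₁).comp continuous_fst).prodMk
        ((h₂.continuous hr₂).comp continuous_snd)
    filter_upwards [eventually_toTorus (e.open_baseSet.mem_nhds hx),
      eventually_toTorus (hφc.continuousAt.preimage_mem_nhds (e'.open_baseSet.mem_nhds hx'))]
      with y hy hy'
    obtain ⟨m, hm⟩ := P.exists_proj_eq (P.baseSet_subset e hy)
    have hTm : P.proj (T m) = (φ₁ (toTorus y).1, φ₂ (toTorus y).2) := by rw [hT.proj_map, hm]
    have h1 := hc _ (P.baseSet_subset e hy) m hm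
    have h2 := hG m (by rw [hm]; exact hy)
    have h3 := hG' (T m) (by rw [hTm]; exact hy')
    have h4 := hk m (by rw [hm]; exact hy) (by rw [hTm]; exact hy')
    simp only [Function.comp, Pi.add_apply, Pi.sub_apply, htt]
    rw [hTm] at h3
    rw [hm] at h2 h4
    linarith
  refine (hfin.congr_of_eventuallyEq e1).congr_fderiv ?_
  rw [htt]
  ext
  · simp [toTorus]
    ring
  · simp [toTorus]
    ring

end Connection.IsCoord

end PrincipalBundle

end

noncomputable section

/-! ### Integration along the fibres of the annulus -/

/-- The signed displacement, inside the fibre of the annulus, from the antipodal section. -/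
def fiberCoord (κ : S1 → S1) (x : S1 × S1) : ℝ :=
  rep01 (x.2 - κ x.1) - rep01 (antipodal κ x.1 - κ x.1)

/-- The integral of `b dt` along the fibre of the annulus from the antipodal section. -/
def vint (κ : S1 → S1) (b : S1 × S1 → ℝ) (x : S1 × S1) : ℝ :=
  ∫ y in (0 : ℝ)..fiberCoord κ x, b (x.1, antipodal κ x.1 + (y : S1))

theorem continuous_antipodal (κ : S1 → S1) : Continuous (antipodal κ) := by
  unfold antipodal
  fun_prop

section fiber

variable (κ : S1 ≃ₜ S1)

theorem coe_fiberCoord (κ : S1 → S1) (x : S1 × S1) :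
    ((fiberCoord κ x : ℝ) : S1) = x.2 - antipodal κ x.1 := by
  rw [fiberCoord, AddCircle.coe_sub, coe_rep01, coe_rep01]
  abel

theorem mem_annulus_iff (κ : S1 → S1) (x : S1 × S1) : x ∈ annulus κ ↔ x.2 - κ x.1 ≠ 0 := by
  rw [sub_ne_zero, annulus, mem_ofPred_eq, ne_comm]

theorem continuousOn_fiberCoord : ContinuousOn (fiberCoord κ) (annulus κ) := by
  intro x hx
  refine ContinuousAt.continuousWithinAt ?_
  refine ContinuousAt.sub ?_ ?_
  · refine ContinuousAt.comp (f := fun x : S1 × S1 => x.2 - κ x.1)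
      (continuousAt_rep01 ((mem_annulus_iff κ x).1 hx)) ?_
    exact (continuous_snd.sub (κ.continuous.comp continuous_fst)).continuousAt
  · refine ContinuousAt.comp (f := fun x : S1 × S1 => antipodal κ x.1 - κ x.1)
      (continuousAt_rep01 (sub_ne_zero.2 (antipodal_ne κ _))) ?_
    exact (((continuous_antipodal κ).comp continuous_fst).sub
      (κ.continuous.comp continuous_fst)).continuousAt

/-- Points on the fibre, in terms of the displacement from the antipodal section. -/
theorem rep01_antipodal_add {s : S1} {y : ℝ}
    (h0 : 0 < rep01 (antipodal κ s - κ s) + y) (h1 : rep01 (antipodal κ s - κ s) + y < 1) :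
    rep01 (antipodal κ s + (y : S1) - κ s) = rep01 (antipodal κ s - κ s) + y := by
  conv_lhs => rw [show antipodal κ s + (y : S1) - κ s =
    ((rep01 (antipodal κ s - κ s) + y : ℝ) : S1) by rw [AddCircle.coe_add, coe_rep01]; abel]
  exact rep01_coe h0.le h1

theorem antipodal_add_mem {s : S1} {y : ℝ}
    (h0 : 0 < rep01 (antipodal κ s - κ s) + y) (h1 : rep01 (antipodal κ s - κ s) + y < 1) :
    (s, antipodal κ s + (y : S1)) ∈ annulus κ := by
  rw [mem_annulus_iff]
  intro h
  have := rep01_antipodal_add κ h0 h1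
  simp only at h
  rw [h, show rep01 0 = 0 by simpa using rep01_coe (x := 0) le_rfl one_pos] at this
  linarith

theorem fiberCoord_antipodal_add {s : S1} {y : ℝ}
    (h0 : 0 < rep01 (antipodal κ s - κ s) + y) (h1 : rep01 (antipodal κ s - κ s) + y < 1) :
    fiberCoord κ (s, antipodal κ s + (y : S1)) = y := by
  rw [fiberCoord, rep01_antipodal_add κ h0 h1]
  ring

theorem antipodal_rep_mem (s : S1) : rep01 (antipodal κ s - κ s) ∈ Ioo (0 : ℝ) 1 :=
  rep01_mem (sub_ne_zero.2 (antipodal_ne κ s))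

theorem fiberCoord_bounds {x : S1 × S1} (hx : x ∈ annulus κ) :
    rep01 (antipodal κ x.1 - κ x.1) + fiberCoord κ x ∈ Ioo (0 : ℝ) 1 := by
  rw [fiberCoord, add_sub_cancel]
  exact rep01_mem ((mem_annulus_iff κ x).1 hx)

theorem uIcc_fiberCoord_bounds {x : S1 × S1} (hx : x ∈ annulus κ) {y : ℝ}
    (hy : y ∈ uIcc 0 (fiberCoord κ x)) :
    rep01 (antipodal κ x.1 - κ x.1) + y ∈ Ioo (0 : ℝ) 1 := by
  have h1 := antipodal_rep_mem κ x.1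
  have h2 := fiberCoord_bounds κ hx
  rcases mem_uIcc.1 hy with h | h
  · exact ⟨by linarith [h1.1, h.1], by linarith [h2.2, h.2]⟩
  · exact ⟨by linarith [h2.1, h.1], by linarith [h1.2, h.2]⟩

theorem segment_mem_annulus {x : S1 × S1} (hx : x ∈ annulus κ) {y : ℝ}
    (hy : y ∈ uIcc 0 (fiberCoord κ x)) : (x.1, antipodal κ x.1 + (y : S1)) ∈ annulus κ :=
  antipodal_add_mem κ (uIcc_fiberCoord_bounds κ hx hy).1 (uIcc_fiberCoord_bounds κ hx hy).2

theorem mul_mem_uIcc {y w : ℝ} (hy : y ∈ Icc (0 : ℝ) 1) : y * w ∈ uIcc 0 w := by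
  rcases le_total 0 w with h | h
  · rw [uIcc_of_le h]
    exact ⟨mul_nonneg hy.1 h, by nlinarith [hy.2]⟩
  · rw [uIcc_of_ge h]
    exact ⟨by nlinarith [hy.2], mul_nonpos_of_nonneg_of_nonpos hy.1 h⟩

/-- Rescaling to the unit segment moves the variable endpoint into the integrand, where
`continuousOn_integral_unit` applies; the segment stays inside the annulus. -/
theorem continuousOn_vint {b : S1 × S1 → ℝ} (hb : ContinuousOn b (annulus κ)) :
    ContinuousOn (vint κ b) (annulus κ) := by
  have e : vint κ b = fun x => fiberCoord κ x *
      ∫ y in (0 : ℝ)..1, b (x.1, antipodal κ x.1 + ((y * fiberCoord κ x : ℝ) : S1)) := by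
    funext x
    exact integral_zero_eq_unit (fun y => b (x.1, antipodal κ x.1 + (y : S1))) _
  rw [e]
  refine (continuousOn_fiberCoord κ).mul (continuousOn_integral_unit ?_)
  refine hb.comp (f := fun q : (S1 × S1) × ℝ =>
    (q.1.1, antipodal κ q.1.1 + ((q.2 * fiberCoord κ q.1 : ℝ) : S1))) ?_ ?_
  · refine ContinuousOn.prodMk (by fun_prop) (ContinuousOn.add ?_ ?_)
    · exact ((continuous_antipodal κ).comp (continuous_fst.comp continuous_fst)).continuousOn
    · refine S1.continuous_coe.comp_continuousOn (continuousOn_snd.mul ?_)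
      exact (continuousOn_fiberCoord κ).comp continuousOn_fst fun q hq => hq.1
  · rintro ⟨x, y⟩ ⟨hx, hy⟩
    exact segment_mem_annulus κ hx (mul_mem_uIcc hy)

theorem fiberCoord_antipodal (κ : S1 → S1) (s : S1) : fiberCoord κ (s, antipodal κ s) = 0 := by
  simp [fiberCoord]

theorem vint_antipodal (κ : S1 → S1) (b : S1 × S1 → ℝ) (s : S1) :
    vint κ b (s, antipodal κ s) = 0 := by
  simp [vint, fiberCoord_antipodal]

/-- Near a point `(x₀, y₀)` of the plane over the annulus, `t₀ + deg κ * (x - x₀)` is a lift of the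
antipodal section for which the fibre coordinate is the difference of the second coordinates. -/
theorem coe_lift_antipodal (κ : S1 → S1) {x₀ y₀ : ℝ} {t₀ : ℝ}
    (ht : t₀ = y₀ - fiberCoord κ (toTorus (x₀, y₀))) (x : ℝ) :
    ((t₀ + circleDeg κ * (x - x₀) : ℝ) : S1) = antipodal κ (x : S1) := by
  have h := coe_fiberCoord κ (toTorus (x₀, y₀))
  have h2 : (t₀ : S1) = antipodal κ (x₀ : S1) := by
    rw [ht, AddCircle.coe_sub, h]
    simp only [toTorus]
    abel
  rw [AddCircle.coe_add, h2, ← zsmul_eq_mul, AddCircle.coe_zsmul, AddCircle.coe_sub, antipodal,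
    antipodal, smul_sub]
  abel

/-- The two sides agree modulo integers, and their difference is continuous and vanishes at the
centre, so it vanishes nearby. -/
theorem eventually_fiberCoord {x₀ y₀ : ℝ} (h : toTorus (x₀, y₀) ∈ annulus κ) {t₀ : ℝ}
    (ht : t₀ = y₀ - fiberCoord κ (toTorus (x₀, y₀))) :
    ∀ᶠ z in 𝓝 (x₀, y₀), toTorus z ∈ annulus κ ∧
      fiberCoord κ (toTorus z) = z.2 - (t₀ + circleDeg κ * (z.1 - x₀)) := by
  have hD : ∀ᶠ z in 𝓝 (x₀, y₀), toTorus z ∈ annulus κ :=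
    eventually_toTorus ((isOpen_annulus κ.continuous).mem_nhds h)
  have hc1 : ContinuousAt (fun z : ℝ × ℝ => fiberCoord κ (toTorus z)) (x₀, y₀) :=
    ((continuousOn_fiberCoord κ).continuousAt ((isOpen_annulus κ.continuous).mem_nhds h)).comp
      continuous_toTorus.continuousAt
  have hc2 : ContinuousAt (fun z : ℝ × ℝ => fiberCoord κ (toTorus z) -
      (z.2 - (t₀ + circleDeg κ * (z.1 - x₀)))) (x₀, y₀) := hc1.sub (by fun_prop)
  have h0 : fiberCoord κ (toTorus (x₀, y₀)) - (y₀ - (t₀ + circleDeg κ * (x₀ - x₀))) = 0 := by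
    rw [ht]
    ring
  have h1 := hc2.eventually (Metric.ball_mem_nhds _ one_pos)
  filter_upwards [hD, h1] with z hz hz1
  refine ⟨hz, ?_⟩
  rw [h0, dist_zero_right, Real.norm_eq_abs] at hz1
  refine S1.coe_inj hz1 ?_
  rw [coe_fiberCoord, AddCircle.coe_sub, coe_lift_antipodal κ ht]
  rfl

theorem vint_eq_integral {b : S1 × S1 → ℝ} {z : ℝ × ℝ} {T : ℝ}
    (hT : (T : S1) = antipodal κ (z.1 : S1)) (hw : fiberCoord κ (toTorus z) = z.2 - T) :
    vint κ b (toTorus z) = ∫ y in T..z.2, b (toTorus (z.1, y)) := by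
  have := intervalIntegral.integral_comp_add_left (a := 0) (b := fiberCoord κ (toTorus z))
    (fun y => b (toTorus (z.1, y))) T
  rw [hw, add_zero, add_sub_cancel] at this
  rw [← this, vint, hw]
  simp only [toTorus, AddCircle.coe_add, hT]

/-- The lift `t₀` of the antipodal point is common to all points of the vertical segment. This
permits arguments that start on the section and move along the fibre. -/
theorem lift_segment_mem {x₀ y₀ : ℝ} (h : toTorus (x₀, y₀) ∈ annulus κ) {t₀ : ℝ}
    (ht : t₀ = y₀ - fiberCoord κ (toTorus (x₀, y₀))) {y : ℝ} (hy : y ∈ uIcc t₀ y₀) :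
    toTorus (x₀, y) ∈ annulus κ ∧ t₀ = y - fiberCoord κ (toTorus (x₀, y)) := by
  have h1 : y - t₀ ∈ uIcc 0 (fiberCoord κ (toTorus (x₀, y₀))) := by
    have h2 : fiberCoord κ (toTorus (x₀, y₀)) = y₀ - t₀ := by rw [ht]; ring
    rw [h2]
    rcases mem_uIcc.1 hy with h | h <;> rw [mem_uIcc]
    · left; constructor <;> linarith [h.1, h.2]
    · right; constructor <;> linarith [h.1, h.2]
  have h2 := coe_lift_antipodal κ ht x₀
  have h3 : antipodal κ (x₀ : S1) + ((y - t₀ : ℝ) : S1) = (y : S1) := by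
    rw [← h2, ← AddCircle.coe_add]
    congr 1
    ring
  have hb := uIcc_fiberCoord_bounds κ h h1
  have h4 := antipodal_add_mem κ hb.1 hb.2
  have h5 := fiberCoord_antipodal_add κ hb.1 hb.2
  change ((x₀ : S1), antipodal κ (x₀ : S1) + _) ∈ _ at h4
  change fiberCoord κ ((x₀ : S1), antipodal κ (x₀ : S1) + _) = _ at h5
  rw [h3] at h4 h5
  refine ⟨h4, ?_⟩
  change t₀ = y - fiberCoord κ ((x₀ : S1), (y : S1))
  rw [h5]
  ring

/-- With a fixed lift of the antipodal point the vertical integral is an ordinary integral with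
variable upper limit near `y₀`, and the fundamental theorem of calculus applies. -/
theorem hasDerivAt_vint {b : S1 × S1 → ℝ} (hb : ContinuousOn b (annulus κ)) {x₀ y₀ : ℝ}
    (h : toTorus (x₀, y₀) ∈ annulus κ) :
    HasDerivAt (fun y => vint κ b (toTorus (x₀, y))) (b (toTorus (x₀, y₀))) y₀ := by
  obtain ⟨t₀, ht⟩ : ∃ t₀, t₀ = y₀ - fiberCoord κ (toTorus (x₀, y₀)) := ⟨_, rfl⟩
  have hc : Continuous fun y : ℝ => (x₀, y) := by fun_prop
  have hev := hc.continuousAt.eventually (eventually_fiberCoord κ h ht)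
  have hbc : ∀ y, toTorus (x₀, y) ∈ annulus κ → ContinuousAt (fun y => b (toTorus (x₀, y))) y :=
    fun y hy => ContinuousAt.comp (f := fun y => toTorus (x₀, y)) (hb.continuousAt
      ((isOpen_annulus κ.continuous).mem_nhds hy)) (continuous_toTorus.comp hc).continuousAt
  have h1 : HasDerivAt (fun y => ∫ y' in t₀..y, b (toTorus (x₀, y'))) (b (toTorus (x₀, y₀))) y₀ := by
    refine intervalIntegral.integral_hasDerivAt_right ?_ ?_ (hbc y₀ h)
    · exact ContinuousOn.intervalIntegrable fun y hy =>
        (hbc y (lift_segment_mem κ h ht hy).1).continuousWithinAt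
    · have hO : IsOpen {y : ℝ | toTorus (x₀, y) ∈ annulus κ} :=
        (isOpen_annulus κ.continuous).preimage (continuous_toTorus.comp hc)
      exact ContinuousOn.stronglyMeasurableAtFilter hO
        (fun y hy => (hbc y hy).continuousWithinAt) _ h
  refine h1.congr_of_eventuallyEq ?_
  filter_upwards [hev] with y hy
  refine vint_eq_integral κ (z := (x₀, y)) ?_ ?_
  · have := coe_lift_antipodal κ ht x₀
    simpa using this
  · have := hy.2
    simpa using this

end fiber

/-! ### Closed continuous one-forms in the plane -/

/-- A continuous one-form in the plane whose integral over the boundaries of small rectangles is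
zero has a local primitive. -/
theorem exists_local_primitive {α β : ℝ × ℝ → ℝ} {O : Set (ℝ × ℝ)} (hO : IsOpen O)
    (hα : ContinuousOn α O) (hβ : ContinuousOn β O)
    (hS : ∀ s₀ s₁ t₀ t₁ : ℝ, s₀ ≤ s₁ → t₀ ≤ t₁ →
      (∀ s ∈ Icc s₀ s₁, ∀ t ∈ Icc t₀ t₁, (s, t) ∈ O) →
      (∫ s in s₀..s₁, α (s, t₀)) + (∫ t in t₀..t₁, β (s₁, t)) =
        (∫ t in t₀..t₁, β (s₀, t)) + ∫ s in s₀..s₁, α (s, t₁))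
    {z₀ : ℝ × ℝ} (hz₀ : z₀ ∈ O) :
    ∃ W : ℝ × ℝ → ℝ, ∀ᶠ z in 𝓝 z₀, HasFDerivAt W (linForm (α z) (β z)) z := by
  obtain ⟨δ, hδ, hb⟩ := Metric.isOpen_iff.1 hO z₀ hz₀
  obtain ⟨x₀, y₀⟩ := z₀
  have hbox : ∀ x y, x ∈ Ioo (x₀ - δ) (x₀ + δ) → y ∈ Ioo (y₀ - δ) (y₀ + δ) → (x, y) ∈ O := by
    intro x y hx hy
    apply hb
    rw [Metric.mem_ball, Prod.dist_eq, max_lt_iff, Real.dist_eq, Real.dist_eq, abs_lt, abs_lt]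
    refine ⟨⟨?_, ?_⟩, ?_, ?_⟩ <;> linarith [hx.1, hx.2, hy.1, hy.2]
  set x₁ := x₀ - δ / 2 with hx₁
  set y₁ := y₀ - δ / 2 with hy₁
  -- The form is integrated along the bottom side from the corner `(x₁, y₁)` and then vertically.
  let W : ℝ → ℝ → ℝ := fun x y => (∫ s in x₁..x, α (s, y₁)) + ∫ t in y₁..y, β (x, t)
  have hαc : ∀ z ∈ O, ContinuousAt α z := fun z hz => hα.continuousAt (hO.mem_nhds hz)
  have hβc : ∀ z ∈ O, ContinuousAt β z := fun z hz => hβ.continuousAt (hO.mem_nhds hz)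
  have hX : ∀ x ∈ Ioo x₁ (x₀ + δ / 2), ∀ s ∈ uIcc x₁ x, s ∈ Ioo (x₀ - δ) (x₀ + δ) := by
    intro x hx s hs
    rw [uIcc_of_le hx.1.le] at hs
    exact ⟨by linarith [hs.1], by linarith [hs.2, hx.2]⟩
  have hY : ∀ y ∈ Ioo y₁ (y₀ + δ / 2), ∀ t ∈ uIcc y₁ y, t ∈ Ioo (y₀ - δ) (y₀ + δ) := by
    intro x hx s hs
    rw [uIcc_of_le hx.1.le] at hs
    exact ⟨by linarith [hs.1], by linarith [hs.2, hx.2]⟩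
  have hy₁m : y₁ ∈ Ioo (y₀ - δ) (y₀ + δ) := ⟨by linarith, by linarith⟩
  have hx₁m : x₁ ∈ Ioo (x₀ - δ) (x₀ + δ) := ⟨by linarith, by linarith⟩
  have hbox2 : ∀ᶠ z : ℝ × ℝ in 𝓝 (x₀, y₀), z.1 ∈ Ioo x₁ (x₀ + δ / 2) ∧ z.2 ∈ Ioo y₁ (y₀ + δ / 2) :=
    (continuousAt_fst.eventually (Ioo_mem_nhds (by simp [x₁, hδ]) (by simp [hδ]))).and
      (continuousAt_snd.eventually (Ioo_mem_nhds (by simp [y₁, hδ]) (by simp [hδ])))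
  have hd2 : ∀ x ∈ Ioo x₁ (x₀ + δ / 2), ∀ y ∈ Ioo y₁ (y₀ + δ / 2),
      HasDerivAt (W x) (β (x, y)) y := by
    intro x hx y hy
    have hxm := hX x hx x right_mem_uIcc
    have hcx : ∀ t ∈ Ioo (y₀ - δ) (y₀ + δ), ContinuousAt (fun t => β (x, t)) t := fun t ht =>
      ContinuousAt.comp (f := fun t => (x, t)) (hβc _ (hbox x t hxm ht)) (by fun_prop)
    have : HasDerivAt (fun y => ∫ t in y₁..y, β (x, t)) (β (x, y)) y := by
      refine intervalIntegral.integral_hasDerivAt_right ?_ ?_ (hcx y (hY y hy y right_mem_uIcc))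
      · exact ContinuousOn.intervalIntegrable fun t ht =>
          (hcx t (hY y hy t ht)).continuousWithinAt
      · exact ContinuousOn.stronglyMeasurableAtFilter isOpen_Ioo
          (fun t ht => (hcx t ht).continuousWithinAt) _ (hY y hy y right_mem_uIcc)
    exact this.const_add _
  -- The hypothesis on rectangles exchanges this path for the one that goes up first and then along
  -- the horizontal through `y`, for which the `x`-derivative is immediate.
  have hd1 : ∀ x ∈ Ioo x₁ (x₀ + δ / 2), ∀ y ∈ Ioo y₁ (y₀ + δ / 2),
      HasDerivAt (fun x => W x y) (α (x, y)) x := by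
    intro x hx y hy
    have hym := hY y hy y right_mem_uIcc
    have hcy : ∀ s ∈ Ioo (x₀ - δ) (x₀ + δ), ContinuousAt (fun s => α (s, y)) s := fun s hs =>
      ContinuousAt.comp (f := fun s => (s, y)) (hαc _ (hbox s y hs hym)) (by fun_prop)
    have h1 : HasDerivAt (fun x => (∫ t in y₁..y, β (x₁, t)) + ∫ s in x₁..x, α (s, y))
        (α (x, y)) x := by
      refine HasDerivAt.const_add _ ?_
      refine intervalIntegral.integral_hasDerivAt_right ?_ ?_ (hcy x (hX x hx x right_mem_uIcc))
      · exact ContinuousOn.intervalIntegrable fun t ht =>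
          (hcy t (hX x hx t ht)).continuousWithinAt
      · exact ContinuousOn.stronglyMeasurableAtFilter isOpen_Ioo
          (fun t ht => (hcy t ht).continuousWithinAt) _ (hX x hx x right_mem_uIcc)
    refine h1.congr_of_eventuallyEq ?_
    filter_upwards [isOpen_Ioo.mem_nhds hx] with x' hx'
    refine hS x₁ x' y₁ y hx'.1.le hy.1.le fun s hs t ht => ?_
    exact hbox s t (hX x' hx' s (by rw [uIcc_of_le hx'.1.le]; exact hs))
      (hY y hy t (by rw [uIcc_of_le hy.1.le]; exact ht))
  refine ⟨fun z => W z.1 z.2, ?_⟩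
  filter_upwards [hbox2.eventually_nhds] with z hz
  have hzO : z ∈ O := hbox z.1 z.2 (hX _ hz.self_of_nhds.1 _ right_mem_uIcc)
    (hY _ hz.self_of_nhds.2 _ right_mem_uIcc)
  -- Both partial derivatives exist nearby and are continuous at the point, hence total
  -- differentiability.
  have key := hasStrictFDerivAt_uncurry_coprod (𝕜 := ℝ) (u := z) (f := W)
    (f₁ := fun x y => ContinuousLinearMap.toSpanSingleton ℝ (α (x, y)))
    (f₂ := fun x y => ContinuousLinearMap.toSpanSingleton ℝ (β (x, y)))
    (by filter_upwards [hz] with v hv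
        exact (hd1 v.1 hv.1 v.2 hv.2).hasFDerivAt)
    (by filter_upwards [hz] with v hv
        exact (hd2 v.1 hv.1 v.2 hv.2).hasFDerivAt)
    (by
      have : Continuous fun c : ℝ => ContinuousLinearMap.toSpanSingleton ℝ c :=
        (ContinuousLinearMap.toSpanSingletonCLE (𝕜 := ℝ) (E := ℝ)).continuous
      exact this.continuousAt.comp (hαc z hzO))
    (by
      have : Continuous fun c : ℝ => ContinuousLinearMap.toSpanSingleton ℝ c :=
        (ContinuousLinearMap.toSpanSingletonCLE (𝕜 := ℝ) (E := ℝ)).continuous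
      exact this.continuousAt.comp (hβc z hzO))
  have h2 := key.hasFDerivAt
  refine h2.congr_fderiv ?_
  ext <;> simp [Function.HasUncurry.uncurry]

end

noncomputable section

/-! ### Normalised fibre coordinates -/

/-- The restriction of `a ds + b dt` to the antipodal section. -/
def sectionForm (κ : S1 → S1) (a b : S1 × S1 → ℝ) (x : ℝ) : ℝ :=
  a ((x : S1), antipodal κ (x : S1)) + circleDeg κ * b ((x : S1), antipodal κ (x : S1))

/-- The holonomy of the connection `du + a ds + b dt` along the antipodal section. -/
def sectionHol (κ : S1 → S1) (a b : S1 × S1 → ℝ) : ℝ := ∫ x in (0 : ℝ)..1, sectionForm κ a b x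

/-- A primitive of `sectionForm` up to a multiple of the coordinate. -/
def sectionPrim (κ : S1 → S1) (a b : S1 × S1 → ℝ) (x : ℝ) : ℝ :=
  (∫ y in (0 : ℝ)..x, sectionForm κ a b y) - sectionHol κ a b * x

/-- The momentum coordinate. -/
def momentum (κ : S1 → S1) (a b F : S1 × S1 → ℝ) (x : S1 × S1) : ℝ :=
  vint κ F x - sectionHol κ a b

/-- The function that has to be added to a fibre coordinate to normalise it. -/
def potential (κ : S1 → S1) (a b : S1 × S1 → ℝ) (x : S1 × S1) : ℝ :=
  sectionPrim κ a b (rep01 x.1) + vint κ b x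

section

variable (κ : S1 ≃ₜ S1) {a b : S1 × S1 → ℝ}

theorem antipodal_mem_annulus (s : S1) : (s, antipodal κ s) ∈ annulus κ :=
  (antipodal_ne κ s).symm

theorem continuous_sectionForm (ha : ContinuousOn a (annulus κ)) (hb : ContinuousOn b (annulus κ)) :
    Continuous (sectionForm κ a b) := by
  have h : Continuous fun x : ℝ => ((x : S1), antipodal κ (x : S1)) :=
    S1.continuous_coe.prodMk ((continuous_antipodal κ).comp S1.continuous_coe)
  exact (ha.comp_continuous h fun x => antipodal_mem_annulus κ _).add
    (continuous_const.mul (hb.comp_continuous h fun x => antipodal_mem_annulus κ _))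

theorem periodic_sectionForm (κ : S1 → S1) (a b : S1 × S1 → ℝ) :
    Function.Periodic (sectionForm κ a b) 1 := by
  intro x
  simp only [sectionForm, AddCircle.coe_add_period]

/-- The integral of the section form over a period is the holonomy, and the linear term removes
exactly this increment. -/
theorem periodic_sectionPrim (ha : ContinuousOn a (annulus κ)) (hb : ContinuousOn b (annulus κ)) :
    Function.Periodic (sectionPrim κ a b) 1 := by
  intro x
  have hc := continuous_sectionForm κ ha hb
  have h1 := intervalIntegral.integral_add_adjacent_intervals
    (hc.intervalIntegrable (μ := volume) 0 x) (hc.intervalIntegrable x (x + 1))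
  have h2 := (periodic_sectionForm κ a b).intervalIntegral_add_eq x 0
  rw [zero_add] at h2
  rw [sectionPrim, sectionPrim, ← h1, h2, sectionHol]
  ring

theorem sectionPrim_rep01 (ha : ContinuousOn a (annulus κ)) (hb : ContinuousOn b (annulus κ))
    (x : ℝ) : sectionPrim κ a b (rep01 (x : S1)) = sectionPrim κ a b x := by
  have h : rep01 (x : S1) = x - ⌊x⌋ * 1 := by
    have h1 : ((Int.fract x : ℝ) : S1) = (x : S1) := AddCircle.coe_fract x
    rw [← h1, rep01_coe (Int.fract_nonneg x) (Int.fract_lt_one x), mul_one]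
    rfl
  rw [h, (periodic_sectionPrim κ ha hb).sub_int_mul_eq]

theorem hasDerivAt_sectionPrim (ha : ContinuousOn a (annulus κ)) (hb : ContinuousOn b (annulus κ))
    (x : ℝ) : HasDerivAt (fun y : ℝ => sectionPrim κ a b (rep01 (y : S1)))
      (sectionForm κ a b x - sectionHol κ a b) x := by
  have hc := continuous_sectionForm κ ha hb
  simp only [sectionPrim_rep01 κ ha hb]
  have h1 := intervalIntegral.integral_hasDerivAt_right (hc.intervalIntegrable 0 x)
    (hc.stronglyMeasurableAtFilter volume (𝓝 x)) hc.continuousAt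
  have h2 := h1.sub ((hasDerivAt_id x).const_mul (sectionHol κ a b))
  rw [mul_one] at h2
  exact h2

theorem continuousOn_momentum {F : S1 × S1 → ℝ} (hF : ContinuousOn F (annulus κ)) :
    ContinuousOn (momentum κ a b F) (annulus κ) :=
  (continuousOn_vint κ hF).sub continuousOn_const

theorem hasDerivAt_momentum {F : S1 × S1 → ℝ} (hF : ContinuousOn F (annulus κ)) {x₀ y₀ : ℝ}
    (h : toTorus (x₀, y₀) ∈ annulus κ) :
    HasDerivAt (fun y => momentum κ a b F (toTorus (x₀, y))) (F (toTorus (x₀, y₀))) y₀ :=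
  (hasDerivAt_vint κ hF h).sub_const _

end

namespace PrincipalBundle.Connection.IsCoord

variable {κ : S1 ≃ₜ S1} {M : Type*} [TopologicalSpace M] [AddAction ℝ M]
  {P : PrincipalBundle κ M} {A : P.Connection} {U : M → ℝ} {a b F : S1 × S1 → ℝ}

/-- The momentum has vertical derivative `F`, so its increments between the two horizontal sides of
a rectangle integrate to the curvature. Adding it to the coefficient of `ds` makes the boundary
integrals vanish. The Stokes formula is available in a chart; `G` carries the primitive over to the
global coordinate. -/
theorem exists_local_primitive (h : A.IsCoord U a b) (hF : ContinuousOn F (annulus κ))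
    (hc : A.HasCurvature F) {z₀ : ℝ × ℝ} (hz₀ : toTorus z₀ ∈ annulus κ) :
    ∃ W : ℝ × ℝ → ℝ, ∀ᶠ z in 𝓝 z₀, HasFDerivAt W
      (linForm (a (toTorus z) + momentum κ a b F (toTorus z)) (b (toTorus z))) z := by
  obtain ⟨e, he, hx⟩ := P.cover _ hz₀
  obtain ⟨G, hG, hGd⟩ := h.local_eq e he
  have hsub := P.baseSet_subset e
  have hO : IsOpen (toTorus ⁻¹' e.baseSet) := e.open_baseSet.preimage continuous_toTorus
  have hm : ContinuousOn (fun z => momentum κ a b F (toTorus z)) (toTorus ⁻¹' e.baseSet) :=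
    (continuousOn_momentum κ hF).comp continuous_toTorus.continuousOn fun z hz => hsub hz
  have hae : ContinuousOn (fun z => A.a e (toTorus z)) (toTorus ⁻¹' e.baseSet) :=
    (A.continuousOn_a e he).comp continuous_toTorus.continuousOn fun z hz => hz
  have hbe : ContinuousOn (fun z => A.b e (toTorus z)) (toTorus ⁻¹' e.baseSet) :=
    (A.continuousOn_b e he).comp continuous_toTorus.continuousOn fun z hz => hz
  obtain ⟨W, hW⟩ := _root_.exists_local_primitive
    (α := fun z => A.a e (toTorus z) + momentum κ a b F (toTorus z))
    (β := fun z => A.b e (toTorus z)) hO (hae.add hm) hbe (by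
      intro s₀ s₁ t₀ t₁ hs ht hR
      have h1 := hc e he s₀ s₁ t₀ t₁ hs ht hR
      have hline : ∀ {g : ℝ × ℝ → ℝ} (_ : ContinuousOn g (toTorus ⁻¹' e.baseSet)) t,
          t ∈ Icc t₀ t₁ → IntervalIntegrable (fun s => g (s, t)) volume s₀ s₁ := by
        intro g hg t ht'
        refine ContinuousOn.intervalIntegrable ?_
        rw [uIcc_of_le hs]
        exact hg.comp (f := fun s => (s, t)) (by fun_prop) fun s hs' => hR s hs' t ht'
      have h2 : ∀ s ∈ uIcc s₀ s₁, (∫ t in t₀..t₁, F (toTorus (s, t))) =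
          momentum κ a b F (toTorus (s, t₁)) - momentum κ a b F (toTorus (s, t₀)) := by
        intro s hs'
        rw [uIcc_of_le hs] at hs'
        refine intervalIntegral.integral_eq_sub_of_hasDerivAt
          (f := fun t => momentum κ a b F (toTorus (s, t))) (fun t ht' => ?_) ?_
        · rw [uIcc_of_le ht] at ht'
          exact hasDerivAt_momentum κ hF (hsub (hR s hs' t ht'))
        · refine ContinuousOn.intervalIntegrable ?_
          rw [uIcc_of_le ht]
          exact (hF.comp continuous_toTorus.continuousOn (s := toTorus ⁻¹' e.baseSet)
            fun z hz => hsub hz).comp (f := fun t => (s, t)) (by fun_prop)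
            fun t ht' => hR s hs' t ht'
      rw [intervalIntegral.integral_congr h2, intervalIntegral.integral_sub
        (hline hm t₁ (right_mem_Icc.2 ht)) (hline hm t₀ (left_mem_Icc.2 ht))] at h1
      rw [intervalIntegral.integral_add (hline hae t₀ (left_mem_Icc.2 ht))
        (hline hm t₀ (left_mem_Icc.2 ht)), intervalIntegral.integral_add
        (hline hae t₁ (right_mem_Icc.2 ht)) (hline hm t₁ (right_mem_Icc.2 ht))]
      linarith) hx
  refine ⟨fun z => W z - G (toTorus z), ?_⟩
  filter_upwards [hW, eventually_toTorus (e.open_baseSet.mem_nhds hx)] with z hz hze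
  have h1 := hz.sub (hGd z hze)
  refine h1.congr_fderiv ?_
  rw [linForm_sub]
  congr 1 <;> ring

/-- The potential is a primitive of `(a + momentum) ds + b dt`. -/
theorem hasFDerivAt_potential (h : A.IsCoord U a b) (hF : ContinuousOn F (annulus κ))
    (hc : A.HasCurvature F) {z₀ : ℝ × ℝ} (hz₀ : toTorus z₀ ∈ annulus κ) :
    HasFDerivAt (potential κ a b ∘ toTorus)
      (linForm (a (toTorus z₀) + momentum κ a b F (toTorus z₀)) (b (toTorus z₀))) z₀ := by
  obtain ⟨x₀, y₀⟩ := z₀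
  obtain ⟨t₀, ht⟩ : ∃ t₀, t₀ = y₀ - fiberCoord κ (toTorus (x₀, y₀)) := ⟨_, rfl⟩
  set V := potential κ a b ∘ toTorus with hV
  set L : ℝ × ℝ → (ℝ × ℝ →L[ℝ] ℝ) := fun z =>
    linForm (a (toTorus z) + momentum κ a b F (toTorus z)) (b (toTorus z)) with hL
  have hVy : ∀ x y, toTorus (x, y) ∈ annulus κ →
      HasDerivAt (fun y => V (x, y)) (b (toTorus (x, y))) y := fun x y hxy =>
    (hasDerivAt_vint κ h.continuousOn_b hxy).const_add (sectionPrim κ a b (rep01 (x : S1)))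
  -- near each point, `V` differs from a local primitive by a function of the first coordinate
  have hloc : ∀ y, toTorus (x₀, y) ∈ annulus κ → ∃ (W : ℝ × ℝ → ℝ) (q : ℝ → ℝ) (δ : ℝ), 0 < δ ∧
      ∀ z ∈ Metric.ball (x₀, y) δ, HasFDerivAt W (L z) z ∧ V z = W z + q z.1 := by
    intro y hy
    obtain ⟨W, hW⟩ := h.exists_local_primitive hF hc hy
    obtain ⟨δ, hδ, hb⟩ := Metric.eventually_nhds_iff_ball.1
      (hW.and (eventually_toTorus ((isOpen_annulus κ.continuous).mem_nhds hy)))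
    refine ⟨W, fun x => V (x, y) - W (x, y), δ, hδ, fun z hz => ⟨(hb z hz).1, ?_⟩⟩
    have hz' : dist z.1 x₀ < δ ∧ dist z.2 y < δ := by
      rw [Metric.mem_ball, Prod.dist_eq, max_lt_iff] at hz
      exact hz
    have hmem : ∀ t ∈ Metric.ball y δ, (z.1, t) ∈ Metric.ball (x₀, y) δ := by
      intro t ht
      rw [Metric.mem_ball, Prod.dist_eq, max_lt_iff]
      exact ⟨hz'.1, ht⟩
    have hd : ∀ t ∈ Metric.ball y δ, HasDerivAt (fun t => V (z.1, t) - W (z.1, t)) 0 t := by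
      intro t ht
      obtain ⟨h1, h2⟩ := hb _ (hmem t ht)
      have h3 : HasDerivAt (fun t : ℝ => (z.1, t)) ((0 : ℝ), (1 : ℝ)) t :=
        (hasDerivAt_const t z.1).prodMk (hasDerivAt_id t)
      have h4 := h1.comp_hasDerivAt t h3
      have h5 := (hVy z.1 t h2).sub h4
      rwa [show b (toTorus (z.1, t)) - L (z.1, t) ((0 : ℝ), (1 : ℝ)) = 0 by simp [hL]] at h5
    have := Metric.isOpen_ball.is_const_of_deriv_eq_zero (𝕜 := ℝ)
      (convex_ball y δ).isPreconnected
      (fun t ht => (hd t ht).differentiableAt.differentiableWithinAt)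
      (fun t ht => (hd t ht).deriv) (Metric.mem_ball.2 hz'.2) (Metric.mem_ball_self hδ)
    change V (z.1, z.2) = W (z.1, z.2) + _
    linarith
  -- Having the right differential at `(x₀, y')` amounts to `q' = 0` at `x₀`, a condition that does
  -- not involve `y'`. Hence the property is locally constant along the fibre.
  have hstep : ∀ y, toTorus (x₀, y) ∈ annulus κ → ∀ᶠ y' in 𝓝 y,
      (HasFDerivAt V (L (x₀, y')) (x₀, y') ↔ HasFDerivAt V (L (x₀, y)) (x₀, y)) := by
    intro y hy
    obtain ⟨W, q, δ, hδ, hW⟩ := hloc y hy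
    have hev : ∀ y' ∈ Metric.ball y δ, (x₀, y') ∈ Metric.ball (x₀, y) δ := by
      intro y' hy'
      rw [Metric.mem_ball, Prod.dist_eq, max_lt_iff]
      exact ⟨by simpa using hδ, hy'⟩
    have key : ∀ y' ∈ Metric.ball y δ,
        (HasFDerivAt V (L (x₀, y')) (x₀, y') ↔ HasDerivAt q 0 x₀) := by
      intro y' hy'
      have hz := hev y' hy'
      have heq : V =ᶠ[𝓝 (x₀, y')] fun z => W z + q z.1 := by
        filter_upwards [Metric.isOpen_ball.mem_nhds hz] with z hz
        exact (hW z hz).2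
      constructor
      · intro h1
        have h2 := (h1.congr_of_eventuallyEq heq.symm).sub (hW _ hz).1
        have h3 : HasDerivAt (fun x : ℝ => (x, y')) ((1 : ℝ), (0 : ℝ)) x₀ :=
          (hasDerivAt_id x₀).prodMk (hasDerivAt_const x₀ y')
        have h4 := h2.comp_hasDerivAt x₀ h3
        simp only [sub_self] at h4
        refine h4.congr_of_eventuallyEq (Eventually.of_forall fun x => ?_)
        simp [Function.comp]
      · intro h1
        have h2 : HasFDerivAt (fun z : ℝ × ℝ => q z.1)
            ((0 : ℝ) • ContinuousLinearMap.fst ℝ ℝ ℝ) (x₀, y') :=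
          HasDerivAt.comp_hasFDerivAt (f := Prod.fst) (x₀, y') h1 hasFDerivAt_fst
        have h3 := ((hW _ hz).1.add h2).congr_of_eventuallyEq heq
        simpa using h3
    filter_upwards [Metric.ball_mem_nhds y hδ] with y' hy'
    rw [key y' hy', key y (Metric.mem_ball_self hδ)]
  -- The starting point lies on the antipodal section, where the potential reduces to `sectionPrim`.
  have hbase : HasFDerivAt V (L (x₀, t₀)) (x₀, t₀) := by
    obtain ⟨hD0, ht0⟩ := lift_segment_mem κ hz₀ ht (left_mem_uIcc (a := t₀) (b := y₀))
    obtain ⟨W, q, δ, hδ, hW⟩ := hloc t₀ hD0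
    set T : ℝ → ℝ := fun x => t₀ + circleDeg κ * (x - x₀) with hT
    have hTx : T x₀ = t₀ := by simp [hT]
    have hTd : HasDerivAt T (circleDeg κ) x₀ := by
      have := (((hasDerivAt_id x₀).sub_const x₀).const_mul (circleDeg κ : ℝ)).const_add t₀
      rwa [mul_one] at this
    have hTc : HasDerivAt (fun x => (x, T x)) ((1 : ℝ), (circleDeg κ : ℝ)) x₀ :=
      (hasDerivAt_id x₀).prodMk hTd
    have hVT : ∀ x, V (x, T x) = sectionPrim κ a b (rep01 (x : S1)) := by
      intro x
      have h1 : toTorus (x, T x) = ((x : S1), antipodal κ (x : S1)) :=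
        Prod.ext rfl (coe_lift_antipodal κ ht x)
      simp only [hV, Function.comp, potential, h1, vint_antipodal, add_zero]
    have hat : toTorus (x₀, t₀) = ((x₀ : S1), antipodal κ (x₀ : S1)) := by
      rw [← hTx]
      exact Prod.ext rfl (coe_lift_antipodal κ ht x₀)
    have hself : (x₀, t₀) ∈ Metric.ball (x₀, t₀) δ := Metric.mem_ball_self hδ
    -- Differentiating `V = W + q` along the section: there the momentum is minus the holonomy, so
    -- the derivative of `W` along the section is that of `sectionPrim`, and `q` has derivative
    -- zero.
    have hq : HasDerivAt q 0 x₀ := by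
      have h1 := (hW _ hself).1
      rw [← hTx] at h1
      have h2 := h1.comp_hasDerivAt x₀ hTc
      have h3 := (hasDerivAt_sectionPrim κ h.continuousOn_a h.continuousOn_b x₀).sub h2
      have h4 : sectionForm κ a b x₀ - sectionHol κ a b -
          (L (x₀, T x₀)) ((1 : ℝ), (circleDeg κ : ℝ)) = 0 := by
        simp only [hL, linForm_apply, hTx, hat, momentum, vint_antipodal, sectionForm]
        ring
      rw [h4] at h3
      refine h3.congr_of_eventuallyEq ?_
      have hcx : ContinuousAt (fun x => (x, T x)) x₀ := hTc.continuousAt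
      have hball : Metric.ball (x₀, t₀) δ ∈ 𝓝 (x₀, T x₀) := by
        rw [hTx]
        exact Metric.ball_mem_nhds _ hδ
      filter_upwards [hcx.preimage_mem_nhds hball] with x hx
      have h5 := (hW _ hx).2
      rw [hVT] at h5
      simp only [Pi.sub_apply, Function.comp]
      simp only at h5
      linarith
    have heq : V =ᶠ[𝓝 (x₀, t₀)] fun z => W z + q z.1 := by
      filter_upwards [Metric.isOpen_ball.mem_nhds hself] with z hz
      exact (hW z hz).2
    have h2 : HasFDerivAt (fun z : ℝ × ℝ => q z.1)
        ((0 : ℝ) • ContinuousLinearMap.fst ℝ ℝ ℝ) (x₀, t₀) :=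
      HasDerivAt.comp_hasFDerivAt (f := Prod.fst) (x₀, t₀) hq hasFDerivAt_fst
    have h3 := ((hW _ hself).1.add h2).congr_of_eventuallyEq heq
    simpa using h3
  let S : uIcc t₀ y₀ → Prop := fun y => HasFDerivAt V (L (x₀, y)) (x₀, (y : ℝ))
  -- The property is propagated from the section to the given point by connectedness of the vertical
  -- segment.
  have hlc : IsLocallyConstant S := by
    rw [IsLocallyConstant.iff_eventually_eq]
    intro y
    have h1 := hstep y (lift_segment_mem κ hz₀ ht y.2).1
    filter_upwards [continuous_subtype_val.continuousAt.eventually h1] with y' hy'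
    exact propext hy'
  have hpc : PreconnectedSpace (uIcc t₀ y₀) := Subtype.preconnectedSpace isPreconnected_uIcc
  have hfin := hlc.apply_eq_of_isPreconnected (s := univ) isPreconnected_univ
    (mem_univ ⟨t₀, left_mem_uIcc⟩) (mem_univ ⟨y₀, right_mem_uIcc⟩)
  have : S ⟨t₀, left_mem_uIcc⟩ := hbase
  rw [hfin] at this
  exact this

/-- The normalised fibre coordinate, in which the connection form is `dv - r ds`, where `r` is the
momentum. -/
theorem normalise (h : A.IsCoord U a b) (hF : ContinuousOn F (annulus κ))
    (hc : A.HasCurvature F) :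
    A.IsCoord (fun m => U m + potential κ a b (P.proj m)) (fun x => -momentum κ a b F x)
      (fun _ => 0) := by
  have h1 := h.add (V := potential κ a b)
    (p := fun x => a x + momentum κ a b F x) (q := b)
    (h.continuousOn_a.add (continuousOn_momentum κ hF)) h.continuousOn_b
    fun z hz => h.hasFDerivAt_potential hF hc hz
  convert h1 using 2
  · ring
  · ring

end PrincipalBundle.Connection.IsCoord

end

noncomputable section

/-! ### The projective line as a circle -/

/-- The chordal distance to `0` on the circle. -/
def sinAbs : S1 → ℝ :=
  Function.Periodic.lift (f := fun x : ℝ => |Real.sin (Real.pi * x)|) (c := (1 : ℝ)) (fun x => by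
    change |Real.sin (Real.pi * (x + 1))| = _
    rw [show Real.pi * (x + 1) = Real.pi * x + Real.pi by ring, Real.sin_add_pi, abs_neg])

theorem sinAbs_coe (x : ℝ) : sinAbs (x : S1) = |Real.sin (Real.pi * x)| := rfl

theorem continuous_sinAbs : Continuous sinAbs :=
  continuous_coinduced_dom.2 (by
    change Continuous fun x : ℝ => |Real.sin (Real.pi * x)|
    fun_prop)

theorem sinAbs_nonneg (θ : S1) : 0 ≤ sinAbs θ := by
  obtain ⟨x, rfl⟩ := S1.coe_surjective θ
  exact abs_nonneg _

theorem exists_abs_eq_dist (θ η : S1) : ∃ x : ℝ, (x : S1) = θ - η ∧ |x| = dist θ η := by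
  obtain ⟨x, rfl⟩ := S1.coe_surjective θ
  obtain ⟨y, rfl⟩ := S1.coe_surjective η
  obtain ⟨n, hn⟩ := S1.exists_sub_int (x := x) (y := y)
  refine ⟨x - y - n, ?_, hn⟩
  rw [← AddCircle.coe_sub, S1.coe_eq_coe_iff]
  exact ⟨-n, by push_cast; ring⟩

/-- Jordan's inequality for the sine on `[0, π / 2]`. Together with the upper bound below it makes
the chordal distance comparable with the metric of the circle. -/
theorem two_mul_dist_le_sinAbs (θ η : S1) : 2 * dist θ η ≤ sinAbs (θ - η) := by
  obtain ⟨x, hx, hd⟩ := exists_abs_eq_dist θ η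
  rw [← hx, sinAbs_coe, ← hd]
  have h : |x| ≤ 1 / 2 := hd ▸ S1.dist_le_half θ η
  have := Real.mul_abs_le_abs_sin (x := Real.pi * x) (by
    rw [abs_mul, abs_of_pos Real.pi_pos]
    nlinarith [Real.pi_pos])
  rw [abs_mul, abs_of_pos Real.pi_pos] at this
  refine le_trans (le_of_eq ?_) this
  field_simp

theorem sinAbs_le_pi_mul_dist (θ η : S1) : sinAbs (θ - η) ≤ Real.pi * dist θ η := by
  obtain ⟨x, hx, hd⟩ := exists_abs_eq_dist θ η
  rw [← hx, sinAbs_coe, ← hd]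
  refine Real.abs_sin_le_abs.trans (le_of_eq ?_)
  rw [abs_mul, abs_of_pos Real.pi_pos]

theorem sinAbs_sub_pos {θ η : S1} (h : θ ≠ η) : 0 < sinAbs (θ - η) :=
  lt_of_lt_of_le (by have := dist_pos.2 h; positivity) (two_mul_dist_le_sinAbs θ η)

theorem exists_polar (v : Fin 2 → ℝ) :
    ∃ k x : ℝ, v 0 = k * Real.cos (Real.pi * x) ∧ v 1 = k * Real.sin (Real.pi * x) := by
  refine ⟨‖(⟨v 0, v 1⟩ : ℂ)‖, Complex.arg ⟨v 0, v 1⟩ / Real.pi, ?_, ?_⟩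
  · rw [mul_div_cancel₀ _ Real.pi_ne_zero, Complex.norm_mul_cos_arg]
  · rw [mul_div_cancel₀ _ Real.pi_ne_zero, Complex.norm_mul_sin_arg]

/-- The map `φ` of the circle is the projective action of a matrix with entries `a b c d`. -/
def IsProjAction (a b c d : ℝ) (φ : S1 → S1) : Prop :=
  ∀ x y : ℝ, φ (x : S1) = (y : S1) → ∃ k : ℝ,
    a * Real.cos (Real.pi * x) + b * Real.sin (Real.pi * x) = k * Real.cos (Real.pi * y) ∧
    c * Real.cos (Real.pi * x) + d * Real.sin (Real.pi * x) = k * Real.sin (Real.pi * y)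

theorem isProjAction_of_smul {g : Matrix.SpecialLinearGroup (Fin 2) ℝ} {φ : S1 → S1}
    (h : ∀ θ, circleToRP1 (φ θ) = (g : PSL2R) • circleToRP1 θ) :
    IsProjAction (g.1 0 0) (g.1 0 1) (g.1 1 0) (g.1 1 1) φ := by
  intro x y hxy
  have h1 := h (x : S1)
  rw [hxy, Matrix.ProjectiveSpecialLinearGroup.smul_proj_mk] at h1
  change Projectivization.mk ℝ _ _ = g • Projectivization.mk ℝ _ _ at h1
  rw [Projectivization.smul_mk, Projectivization.mk_eq_mk_iff'] at h1
  obtain ⟨k, hk⟩ := h1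
  have hk0 : k ≠ 0 := by
    rintro rfl
    rw [zero_smul] at hk
    exact angle_ne_zero y hk.symm
  have e0 := congrFun hk 0
  have e1 := congrFun hk 1
  change k * (g.1.mulVec _ 0) = _ at e0
  change k * (g.1.mulVec _ 1) = _ at e1
  simp only [Matrix.mulVec, dotProduct, Fin.sum_univ_two, Matrix.cons_val_zero,
    Matrix.cons_val_one] at e0 e1
  refine ⟨k⁻¹, ?_, ?_⟩
  · rw [← e0, inv_mul_cancel_left₀ hk0]
  · rw [← e1, inv_mul_cancel_left₀ hk0]

/-- The sine of the difference of two angles is the area spanned by the unit vectors, and a linear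
map multiplies areas by its determinant. -/
theorem cross_eq {a b c d x x' y y' k k' : ℝ}
    (h0 : a * Real.cos (Real.pi * x) + b * Real.sin (Real.pi * x) = k * Real.cos (Real.pi * y))
    (h1 : c * Real.cos (Real.pi * x) + d * Real.sin (Real.pi * x) = k * Real.sin (Real.pi * y))
    (h0' : a * Real.cos (Real.pi * x') + b * Real.sin (Real.pi * x') = k' * Real.cos (Real.pi * y'))
    (h1' : c * Real.cos (Real.pi * x') + d * Real.sin (Real.pi * x')
      = k' * Real.sin (Real.pi * y')) :
    k * k' * Real.sin (Real.pi * (y - y')) = (a * d - b * c) * Real.sin (Real.pi * (x - x')) := by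
  simp only [mul_sub, Real.sin_sub]
  linear_combination (Real.sin (Real.pi * y) * k) * (-1) * (h0') + Real.cos (Real.pi * y) * k * h1'
    + (-1) * (c * Real.cos (Real.pi * x') + d * Real.sin (Real.pi * x')) * (-1) * (h0)
    + (a * Real.cos (Real.pi * x') + b * Real.sin (Real.pi * x')) * (-1) * h1

/-- The iterates of `φ` converge to `p`, exponentially in a Hölder sense and locally uniformly,
on the complement of `q`. -/
structure ContractsTo (φ : S1 → S1) (p q : S1) : Prop where
  ne : p ≠ q
  fixed : φ p = p
  contr : ∀ θ, θ ≠ q → ∃ N ∈ 𝓝 θ, p ∈ N ∧ ∃ C η r : ℝ, 0 ≤ C ∧ 0 < η ∧ η < 1 ∧ 0 < r ∧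
    ∀ (n : ℕ), ∀ y ∈ N, ∀ z ∈ N, dist (φ^[n] y) (φ^[n] z) ≤ C * η ^ n * dist y z ^ r

theorem IsProjAction.fixed {a b c d : ℝ} {φ : S1 → S1} (h : IsProjAction a b c d φ) {ν p : ℝ}
    (hν : ν ≠ 0)
    (h0 : a * Real.cos (Real.pi * p) + b * Real.sin (Real.pi * p) = ν * Real.cos (Real.pi * p))
    (h1 : c * Real.cos (Real.pi * p) + d * Real.sin (Real.pi * p) = ν * Real.sin (Real.pi * p)) :
    φ (p : S1) = (p : S1) := by
  obtain ⟨y, hy⟩ := S1.coe_surjective (φ (p : S1))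
  obtain ⟨k, e0, e1⟩ := h p y hy.symm
  rw [h0] at e0
  rw [h1] at e1
  have hs : ν * Real.sin (Real.pi * (p - y)) = 0 := by
    rw [mul_sub, Real.sin_sub]
    have hpy := Real.sin_sq_add_cos_sq (Real.pi * p)
    linear_combination Real.cos (Real.pi * y) * e1 - Real.sin (Real.pi * y) * e0
  have h3 : sinAbs (φ (p : S1) - (p : S1)) = 0 := by
    rw [← hy, ← AddCircle.coe_sub, sinAbs_coe, show Real.pi * (y - p) = -(Real.pi * (p - y)) by ring,
      Real.sin_neg, abs_neg, (mul_eq_zero.1 hs).resolve_left hν, abs_zero]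
  by_contra hne
  exact (sinAbs_sub_pos hne).ne' h3

/-- Apply `cross_eq` to the pairs `(θ, η)`, `(θ, q)` and `(η, q)`, where `q` is an eigendirection.
The unknown scale factors of the images of `θ` and `η` cancel in the product, which leaves `ν ^ 2`
and two sines of modulus at most one. -/
theorem IsProjAction.sinAbs_le {a b c d : ℝ} {φ : S1 → S1} (h : IsProjAction a b c d φ)
    (hdet : a * d - b * c = 1) {ν q : ℝ} (hν : ν ≠ 0)
    (h0 : a * Real.cos (Real.pi * q) + b * Real.sin (Real.pi * q) = ν * Real.cos (Real.pi * q))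
    (h1 : c * Real.cos (Real.pi * q) + d * Real.sin (Real.pi * q) = ν * Real.sin (Real.pi * q))
    (θ η : S1) :
    sinAbs (φ θ - φ η) * (sinAbs (θ - (q : S1)) * sinAbs (η - (q : S1))) ≤
      ν ^ 2 * sinAbs (θ - η) := by
  obtain ⟨x, rfl⟩ := S1.coe_surjective θ
  obtain ⟨x', rfl⟩ := S1.coe_surjective η
  obtain ⟨y, hy⟩ := S1.coe_surjective (φ (x : S1))
  obtain ⟨y', hy'⟩ := S1.coe_surjective (φ (x' : S1))
  obtain ⟨k, e0, e1⟩ := h x y hy.symm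
  obtain ⟨k', e0', e1'⟩ := h x' y' hy'.symm
  have c1 := cross_eq e0 e1 e0' e1'
  have c2 := cross_eq e0 e1 h0 h1
  have c3 := cross_eq e0' e1' h0 h1
  rw [hdet, one_mul] at c1 c2 c3
  rw [← hy, ← hy']
  simp only [← AddCircle.coe_sub, sinAbs_coe]
  rw [← c1, ← c2, ← c3]
  simp only [abs_mul]
  have b1 := Real.abs_sin_le_one (Real.pi * (y - q))
  have b2 := Real.abs_sin_le_one (Real.pi * (y' - q))
  have b3 : |Real.sin (Real.pi * (y - q))| * |Real.sin (Real.pi * (y' - q))| ≤ 1 :=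
    mul_le_one₀ b1 (abs_nonneg _) b2
  have hn : |ν| * |ν| = ν ^ 2 := by rw [abs_mul_abs_self, sq]
  calc _ = (ν ^ 2 * (|k| * |k'| * |Real.sin (Real.pi * (y - y'))|)) *
        (|Real.sin (Real.pi * (y - q))| * |Real.sin (Real.pi * (y' - q))|) := by
        rw [← hn]; ring
    _ ≤ _ := mul_le_of_le_one_right (by positivity) b3

theorem IsHolder.exists_dist_le {f : S1 → S1} (h : IsHolder f) :
    ∃ C r : ℝ, 0 ≤ C ∧ 0 < r ∧ ∀ x y, dist (f x) (f y) ≤ C * dist x y ^ r := by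
  obtain ⟨C, r, hr, h⟩ := h
  exact ⟨C, r, C.2, hr, fun x y => h.dist_le x y⟩

/-- An eigendirection of eigenvalue less than one in modulus is projectively repelling. Away from it
the preceding estimate contracts chords by `ν ^ (2 * n)`, and the Hölder conjugacy turns this into
an exponential Hölder contraction with rate `(ν ^ 2) ^ r₂`. -/
theorem contractsTo_of_isProjAction {h : S1 ≃ₜ S1} (hh : IsHolder h) (hh' : IsHolder h.symm)
    {φ : S1 → S1} {a b c d : ℕ → ℝ}
    (hA : ∀ n, IsProjAction (a n) (b n) (c n) (d n) (fun θ => h (φ^[n] (h.symm θ))))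
    (hdet : ∀ n, a n * d n - b n * c n = 1) {ν q p : ℝ} (hν : ν ≠ 0) (hν1 : |ν| < 1)
    (h0 : ∀ n, a n * Real.cos (Real.pi * q) + b n * Real.sin (Real.pi * q)
      = ν ^ n * Real.cos (Real.pi * q))
    (h1 : ∀ n, c n * Real.cos (Real.pi * q) + d n * Real.sin (Real.pi * q)
      = ν ^ n * Real.sin (Real.pi * q))
    (hp : φ (h.symm (p : S1)) = h.symm (p : S1)) (hpq : (p : S1) ≠ (q : S1)) :
    ContractsTo φ (h.symm (p : S1)) (h.symm (q : S1)) := by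
  refine ⟨fun e => hpq (h.symm.injective e), hp, fun θ hθ => ?_⟩
  have hθq : h θ ≠ (q : S1) := fun e => hθ (by rw [← e, h.symm_apply_apply])
  -- The neighbourhood is the set of points at chordal distance more than `δ` from the repelling
  -- point; `δ` is taken so small that it contains both `θ` and the attracting fixed point.
  set δ := min (sinAbs (h θ - (q : S1))) (sinAbs ((p : S1) - (q : S1))) / 2 with hδ
  have hm : 0 < min (sinAbs (h θ - (q : S1))) (sinAbs ((p : S1) - (q : S1))) :=
    lt_min (sinAbs_sub_pos hθq) (sinAbs_sub_pos hpq)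
  have hδ0 : 0 < δ := half_pos hm
  have hδm : δ < min (sinAbs (h θ - (q : S1))) (sinAbs ((p : S1) - (q : S1))) := half_lt_self hm
  obtain ⟨C₁, r₁, hC₁, hr₁, H₁⟩ := hh.exists_dist_le
  obtain ⟨C₂, r₂, hC₂, hr₂, H₂⟩ := hh'.exists_dist_le
  have hN : IsOpen {y : S1 | δ < sinAbs (h y - (q : S1))} :=
    isOpen_lt continuous_const
      (continuous_sinAbs.comp (h.continuous.sub continuous_const))
  refine ⟨{y : S1 | δ < sinAbs (h y - (q : S1))}, hN.mem_nhds (hδm.trans_le (min_le_left _ _)), ?_,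
    C₂ * (Real.pi * C₁ / δ ^ 2) ^ r₂, (ν ^ 2) ^ r₂, r₁ * r₂, by positivity, by positivity, ?_,
    by positivity, ?_⟩
  · change δ < sinAbs (h (h.symm (p : S1)) - (q : S1))
    rw [h.apply_symm_apply]
    exact hδm.trans_le (min_le_right _ _)
  · refine Real.rpow_lt_one (sq_nonneg _) ?_ hr₂
    rw [← sq_abs]
    exact pow_lt_one₀ (abs_nonneg _) hν1 two_ne_zero
  · intro n y hy z hz
    replace hy : δ < sinAbs (h y - (q : S1)) := hy
    replace hz : δ < sinAbs (h z - (q : S1)) := hz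
    have e := (hA n).sinAbs_le (hdet n) (pow_ne_zero n hν) (h0 n) (h1 n) (h y) (h z)
    simp only [h.symm_apply_apply] at e
    have e2 : dist (h (φ^[n] y)) (h (φ^[n] z)) ≤
        Real.pi * C₁ / δ ^ 2 * (ν ^ 2) ^ n * dist y z ^ r₁ := by
      have hd := two_mul_dist_le_sinAbs (h (φ^[n] y)) (h (φ^[n] z))
      have hd2 : sinAbs (h y - h z) ≤ Real.pi * (C₁ * dist y z ^ r₁) :=
        (sinAbs_le_pi_mul_dist _ _).trans (by gcongr; exact H₁ _ _)
      have hd0 : 0 ≤ dist (h (φ^[n] y)) (h (φ^[n] z)) := dist_nonneg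
      have hs : sinAbs (h (φ^[n] y) - h (φ^[n] z)) * δ ^ 2 ≤
          sinAbs (h (φ^[n] y) - h (φ^[n] z)) *
            (sinAbs (h y - (q : S1)) * sinAbs (h z - (q : S1))) := by
        rw [sq]
        exact mul_le_mul_of_nonneg_left (mul_le_mul hy.le hz.le hδ0.le (sinAbs_nonneg _))
          (sinAbs_nonneg _)
      have e3 : dist (h (φ^[n] y)) (h (φ^[n] z)) * δ ^ 2 ≤
          (ν ^ 2) ^ n * (Real.pi * (C₁ * dist y z ^ r₁)) := by
        calc _ ≤ sinAbs (h (φ^[n] y) - h (φ^[n] z)) * δ ^ 2 := by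
              gcongr; linarith
          _ ≤ _ := hs
          _ ≤ _ := e
          _ = (ν ^ 2) ^ n * sinAbs (h y - h z) := by rw [← pow_mul, ← pow_mul, mul_comm n 2]
          _ ≤ _ := by gcongr
      rw [show Real.pi * C₁ / δ ^ 2 * (ν ^ 2) ^ n * dist y z ^ r₁
        = (ν ^ 2) ^ n * (Real.pi * (C₁ * dist y z ^ r₁)) / δ ^ 2 by ring,
        le_div_iff₀ (by positivity)]
      exact e3
    have e4 := H₂ (h (φ^[n] y)) (h (φ^[n] z))
    simp only [h.symm_apply_apply] at e4
    refine e4.trans ?_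
    calc _ ≤ C₂ * (Real.pi * C₁ / δ ^ 2 * (ν ^ 2) ^ n * dist y z ^ r₁) ^ r₂ := by gcongr
      _ = _ := by
        have hp0 : 0 ≤ dist y z ^ r₁ := Real.rpow_nonneg dist_nonneg _
        rw [Real.mul_rpow (by positivity) hp0, Real.mul_rpow (by positivity) (by positivity),
          ← Real.rpow_mul dist_nonneg, Real.rpow_pow_comm (sq_nonneg ν)]
        ring

/-! ### Convergence property of Fuchsian groups -/

/-- A homeomorphism of the circle with north-south dynamics. -/
def IsNorthSouth (φ : S1 ≃ₜ S1) : Prop :=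
  ∃ p q, ContractsTo φ p q ∧ ContractsTo φ.symm q p

theorem exists_eigenvector {a b c d ν : ℝ} (hdet : a * d - b * c = 1)
    (hν : ν ^ 2 - (a + d) * ν + 1 = 0) : ∃ x : ℝ,
    a * Real.cos (Real.pi * x) + b * Real.sin (Real.pi * x) = ν * Real.cos (Real.pi * x) ∧
    c * Real.cos (Real.pi * x) + d * Real.sin (Real.pi * x) = ν * Real.sin (Real.pi * x) := by
  have : (Matrix.of ![![a - ν, b], ![c, d - ν]]).det = 0 := by
    rw [Matrix.det_fin_two_of]
    linear_combination hdet + hν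
  obtain ⟨v, hv, h⟩ := Matrix.exists_mulVec_eq_zero_iff.2 this
  obtain ⟨k, x, h0, h1⟩ := exists_polar v
  have hk : k ≠ 0 := by
    rintro rfl
    apply hv
    funext i
    fin_cases i <;> simp_all
  have e0 := congrFun h 0
  have e1 := congrFun h 1
  simp [Matrix.mulVec, dotProduct, Fin.sum_univ_two, h0, h1] at e0 e1
  refine ⟨x, mul_left_cancel₀ hk ?_, mul_left_cancel₀ hk ?_⟩
  · linear_combination e0
  · linear_combination e1

/-- The unit vector with angle `π x`. -/
def angleVec (x : ℝ) : Fin 2 → ℝ := ![Real.cos (Real.pi * x), Real.sin (Real.pi * x)]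

theorem mulVec_angleVec_iff {A : Matrix (Fin 2) (Fin 2) ℝ} {x ν : ℝ} :
    A.mulVec (angleVec x) = ν • angleVec x ↔
      A 0 0 * Real.cos (Real.pi * x) + A 0 1 * Real.sin (Real.pi * x) = ν * Real.cos (Real.pi * x) ∧
      A 1 0 * Real.cos (Real.pi * x) + A 1 1 * Real.sin (Real.pi * x)
        = ν * Real.sin (Real.pi * x) := by
  constructor
  · intro h
    have e0 := congrFun h 0
    have e1 := congrFun h 1
    simp [Matrix.mulVec, dotProduct, Fin.sum_univ_two, angleVec] at e0 e1
    exact ⟨e0, e1⟩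
  · rintro ⟨e0, e1⟩
    funext i
    fin_cases i <;> simpa [Matrix.mulVec, dotProduct, Fin.sum_univ_two, angleVec]

/-- The eigenvalues of the lift are `ν` at `q` and its inverse at `p`, and the `n`-th powers of the
lift represent the iterates. So `q` repels and `p` attracts. -/
theorem contractsTo_of_lift {Γ : Type*} [Group Γ] {ρ : Γ →* DiffH} {j : Γ →* PSL2R} {h : S1 ≃ₜ S1}
    (hh : IsHolder h) (hh' : IsHolder h.symm)
    (hj : ∀ γ s, circleToRP1 (h ((ρ γ).1 s)) = j γ • circleToRP1 (h s)) {γ : Γ}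
    {g : Matrix.SpecialLinearGroup (Fin 2) ℝ} (hg : (g : PSL2R) = j γ) {ν p q : ℝ} (hν : ν ≠ 0)
    (hν1 : |ν| < 1) (hq : g.1.mulVec (angleVec q) = ν • angleVec q)
    (hp : g.1.mulVec (angleVec p) = ν⁻¹ • angleVec p) :
    ContractsTo (ρ γ).1 (h.symm (p : S1)) (h.symm (q : S1)) := by
  have hit : ∀ n : ℕ, ∀ s, (ρ γ).1^[n] s = (ρ (γ ^ n)).1 s := by
    intro n
    induction n with
    | zero => intro s; simp
    | succ n ih =>
      intro s
      rw [Function.iterate_succ_apply', ih, pow_succ', map_mul]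
      rfl
  have hA : ∀ n : ℕ, IsProjAction ((g ^ n).1 0 0) ((g ^ n).1 0 1) ((g ^ n).1 1 0) ((g ^ n).1 1 1)
      (fun θ => h ((ρ γ).1^[n] (h.symm θ))) := by
    intro n
    refine isProjAction_of_smul fun θ => ?_
    have e : ((g ^ n : Matrix.SpecialLinearGroup (Fin 2) ℝ) : PSL2R) = j (γ ^ n) := by
      rw [map_pow, ← hg]; rfl
    rw [e, hit, hj, h.apply_symm_apply]
  have hpow : ∀ n : ℕ, (g ^ n).1.mulVec (angleVec q) = ν ^ n • angleVec q := by
    intro n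
    induction n with
    | zero => simp
    | succ n ih =>
      rw [pow_succ]
      change (((g ^ n).1 * g.1).mulVec _) = _
      rw [← Matrix.mulVec_mulVec, hq, Matrix.mulVec_smul, ih, smul_smul, pow_succ, mul_comm]
  have hdet : ∀ n : ℕ, (g ^ n).1 0 0 * (g ^ n).1 1 1 - (g ^ n).1 0 1 * (g ^ n).1 1 0 = 1 := by
    intro n
    rw [← Matrix.det_fin_two]
    exact (g ^ n).2
  have hfix : (ρ γ).1 (h.symm (p : S1)) = h.symm (p : S1) := by
    have := (hA 1).fixed (inv_ne_zero hν) (p := p) (by rw [pow_one]; exact (mulVec_angleVec_iff.1 hp).1)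
      (by rw [pow_one]; exact (mulVec_angleVec_iff.1 hp).2)
    exact (h.symm_apply_apply _).symm.trans (congrArg h.symm this)
  refine contractsTo_of_isProjAction hh hh' hA hdet hν hν1
    (fun n => (mulVec_angleVec_iff.1 (hpow n)).1) (fun n => (mulVec_angleVec_iff.1 (hpow n)).2)
    hfix ?_
  intro e
  have h0 := mulVec_angleVec_iff.1 hq
  have h1 := mulVec_angleVec_iff.1 hp
  have c := cross_eq h0.1 h0.2 h0.1 h0.2
  obtain ⟨n, hn⟩ := S1.coe_eq_coe_iff.1 e
  have hs : |Real.sin (Real.pi * (p - q))| = 0 := by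
    have := sinAbs_coe (p - q)
    rw [AddCircle.coe_sub, e, sub_self] at this
    rw [← this, ← AddCircle.coe_zero, sinAbs_coe]
    simp
  rw [abs_eq_zero, mul_sub, Real.sin_sub] at hs
  -- If `p` and `q` were the same direction, one vector would have both eigenvalues. The scalar
  -- product of the two unit vectors is then `±1`, so `ν⁻¹ = ν`, against `|ν| < 1`.
  have k : (ν⁻¹ - ν) * (Real.cos (Real.pi * p) * Real.cos (Real.pi * q) +
      Real.sin (Real.pi * p) * Real.sin (Real.pi * q)) = 0 := by
    linear_combination (g.1 0 1 - g.1 1 0) * hs - Real.cos (Real.pi * q) * h1.1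
      - Real.sin (Real.pi * q) * h1.2 + Real.cos (Real.pi * p) * h0.1
      + Real.sin (Real.pi * p) * h0.2
  have hc : (Real.cos (Real.pi * p) * Real.cos (Real.pi * q) +
      Real.sin (Real.pi * p) * Real.sin (Real.pi * q)) ^ 2 = 1 := by
    have a1 := Real.sin_sq_add_cos_sq (Real.pi * p)
    have a2 := Real.sin_sq_add_cos_sq (Real.pi * q)
    have : (Real.sin (Real.pi * p) * Real.cos (Real.pi * q) -
      Real.cos (Real.pi * p) * Real.sin (Real.pi * q)) ^ 2 = 0 := by rw [hs]; ring
    linear_combination (-1) * this + a1 * (Real.sin (Real.pi * q) ^ 2 + Real.cos (Real.pi * q) ^ 2) + a2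
  rcases mul_eq_zero.1 k with k | k
  · have : ν * ν = 1 := by
      have := congrArg (· * ν) k
      simp only [sub_mul, inv_mul_cancel₀ hν, zero_mul] at this
      linarith
    have h2 : |ν| * |ν| = 1 := by rw [abs_mul_abs_self, this]
    nlinarith [abs_nonneg ν]
  · rw [k] at hc
    norm_num at hc

/-- A matrix of determinant one whose trace exceeds two in modulus is hyperbolic: it has real
eigenvalues `ν` and `ν⁻¹`, and the roles of the eigendirections are exchanged for the inverse. -/
theorem isNorthSouth_of_trace {Γ : Type*} [Group Γ] {ρ : Γ →* DiffH} {j : Γ →* PSL2R}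
    {h : S1 ≃ₜ S1} (hh : IsHolder h) (hh' : IsHolder h.symm)
    (hj : ∀ γ s, circleToRP1 (h ((ρ γ).1 s)) = j γ • circleToRP1 (h s)) {γ : Γ}
    {g : Matrix.SpecialLinearGroup (Fin 2) ℝ} (hg : (g : PSL2R) = j γ)
    (ht : 2 < |g.1 0 0 + g.1 1 1|) : IsNorthSouth (ρ γ).1 := by
  have hdet : g.1 0 0 * g.1 1 1 - g.1 0 1 * g.1 1 0 = 1 := by
    rw [← Matrix.det_fin_two]
    exact g.2
  set t := g.1 0 0 + g.1 1 1 with htd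
  obtain ⟨ν, hν, hν0, hν1⟩ : ∃ ν : ℝ, ν ^ 2 - t * ν + 1 = 0 ∧ ν ≠ 0 ∧ |ν| < 1 := by
    have ht2 : 0 ≤ t ^ 2 - 4 := by
      rw [← sq_abs]
      nlinarith
    set s := √(t ^ 2 - 4)
    have hs : s ^ 2 = t ^ 2 - 4 := Real.sq_sqrt ht2
    have hprod : (t - s) / 2 * ((t + s) / 2) = 1 := by linarith
    have habs : |(t - s) / 2| * |(t + s) / 2| = 1 := by rw [← abs_mul, hprod, abs_one]
    have hsum : 2 < |(t - s) / 2| + |(t + s) / 2| := by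
      refine ht.trans_le (le_trans (le_of_eq ?_) (abs_add_le _ _))
      congr 1; ring
    -- The two roots have product one and moduli adding up to more than two, so one of them has
    -- modulus less than one.
    by_cases h1 : |(t - s) / 2| < 1
    · refine ⟨(t - s) / 2, by linear_combination hs / 4, ?_, h1⟩
      intro e; rw [e] at hprod; norm_num at hprod
    · refine ⟨(t + s) / 2, by linear_combination hs / 4, ?_, ?_⟩
      · intro e; rw [e] at hprod; norm_num at hprod
      · by_contra h2
        push Not at h1 h2
        nlinarith
  obtain ⟨q, hq⟩ := exists_eigenvector hdet hν
  obtain ⟨p, hp⟩ := exists_eigenvector (ν := ν⁻¹) hdet (by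
    field_simp
    linear_combination hν)
  have hq' := mulVec_angleVec_iff.2 hq
  have hp' := mulVec_angleVec_iff.2 hp
  have inv : ∀ {x c : ℝ}, c ≠ 0 → g.1.mulVec (angleVec x) = c • angleVec x →
      (g⁻¹).1.mulVec (angleVec x) = c⁻¹ • angleVec x := by
    intro x c hc hx
    have : (g⁻¹).1.mulVec (g.1.mulVec (angleVec x)) = angleVec x := by
      rw [Matrix.mulVec_mulVec]
      have : (g⁻¹).1 * g.1 = (1 : Matrix (Fin 2) (Fin 2) ℝ) := by
        have := congrArg Subtype.val (inv_mul_cancel g)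
        exact this
      rw [this, Matrix.one_mulVec]
    rw [hx, Matrix.mulVec_smul] at this
    rw [← this, smul_smul, inv_mul_cancel₀ hc, one_smul, this]
  refine ⟨h.symm (p : S1), h.symm (q : S1), contractsTo_of_lift hh hh' hj hg hν0 hν1 hq' hp', ?_⟩
  have := contractsTo_of_lift hh hh' hj (γ := γ⁻¹) (g := g⁻¹) (by rw [map_inv, ← hg]; rfl) hν0 hν1
    (q := p) (p := q) (by simpa using inv (inv_ne_zero hν0) hp') (inv hν0 hq')
  rw [map_inv] at this
  exact this

/-- The preimage of the image in `SL(2, ℝ)` is a discrete subgroup, hence closed, so it meets the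
compact set of matrices with bounded entries in a finite set. Injectivity of `j` brings the
finiteness back to the group. -/
theorem IsFuchsian.finite_bounded {Γ : Type*} [Group Γ] {j : Γ →* PSL2R} (hj : IsFuchsian j)
    (R : ℝ) : {γ : Γ | ∃ g : Matrix.SpecialLinearGroup (Fin 2) ℝ, (g : PSL2R) = j γ ∧
      ∀ i k, |g.1 i k| ≤ R}.Finite := by
  obtain ⟨hinj, hd, -⟩ := hj
  set H := j.range.comap (QuotientGroup.mk'
      (Subgroup.center (Matrix.SpecialLinearGroup (Fin 2) ℝ))) with hH
  have hcl : IsClosed (H : Set (Matrix.SpecialLinearGroup (Fin 2) ℝ)) := Subgroup.isClosed_of_discrete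
  have hK : IsCompact {g : Matrix.SpecialLinearGroup (Fin 2) ℝ | ∀ i k, |g.1 i k| ≤ R} := by
    have h1 : IsCompact {A : Matrix (Fin 2) (Fin 2) ℝ | ∀ i k, A i k ∈ Icc (-R) R} := by
      have := isCompact_univ_pi (s := fun _ : Fin 2 => Set.pi univ fun _ : Fin 2 => Icc (-R) R)
        (fun _ => isCompact_univ_pi fun _ => isCompact_Icc)
      refine (this.of_isClosed_subset ?_ ?_)
      · simp only [Set.ofPred_forall]
        refine isClosed_iInter fun i => isClosed_iInter fun k => ?_
        exact isClosed_Icc.preimage (continuous_id.matrix_elem i k)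
      · intro A hA i _ k _
        exact hA i k
    have h2 := (Matrix.SpecialLinearGroup.isClosedEmbedding_val
      (n := Fin 2) (R := ℝ)).isCompact_preimage h1
    refine h2.of_isClosed_subset ?_ fun g hg i k => abs_le.1 (hg i k)
    simp only [Set.ofPred_forall]
    refine isClosed_iInter fun i => isClosed_iInter fun k => isClosed_le ?_ continuous_const
    exact (Matrix.SpecialLinearGroup.isClosedEmbedding_val.continuous.matrix_elem i k).abs
  have hfin : {x : H | ∀ i k, |x.1.1 i k| ≤ R}.Finite :=
    (hcl.isClosedEmbedding_subtypeVal.isCompact_preimage hK).finite_of_discrete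
  refine (hfin.image fun x : H => (x.1 : PSL2R)).preimage (f := j) hinj.injOn |>.subset ?_
  rintro γ ⟨g, hg, hb⟩
  refine ⟨⟨g, ?_⟩, hb, hg⟩
  rw [hH, Subgroup.mem_comap]
  exact ⟨γ, hg.symm⟩

theorem Ultrafilter.exists_tendsto_of_abs_le {ι : Type*} (𝒰 : Ultrafilter ι) {f : ι → ℝ} {R : ℝ}
    (h : ∀ i, |f i| ≤ R) : ∃ x, Tendsto f 𝒰 (𝓝 x) := by
  obtain ⟨x, -, hx⟩ := (isCompact_Icc (a := -R) (b := R)).ultrafilter_le_nhds' (𝒰.map f)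
    (Filter.mem_map.2 (Filter.univ_mem' fun i => abs_le.1 (h i)))
  exact ⟨x, hx⟩

theorem Ultrafilter.exists_tendsto {ι X : Type*} [TopologicalSpace X] [CompactSpace X]
    (𝒰 : Ultrafilter ι) (f : ι → X) : ∃ x, Tendsto f 𝒰 (𝓝 x) :=
  ⟨(𝒰.map f).lim, (𝒰.map f).le_nhds_lim⟩

/-- A nonzero singular matrix of size two has rank one. -/
theorem exists_rank_one {a b c d : ℝ} (hdet : a * d - b * c = 0)
    (hne : a ≠ 0 ∨ b ≠ 0 ∨ c ≠ 0 ∨ d ≠ 0) : ∃ k α β : ℝ, k ≠ 0 ∧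
    a = -(k * Real.cos (Real.pi * β) * Real.sin (Real.pi * α)) ∧
    b = k * Real.cos (Real.pi * β) * Real.cos (Real.pi * α) ∧
    c = -(k * Real.sin (Real.pi * β) * Real.sin (Real.pi * α)) ∧
    d = k * Real.sin (Real.pi * β) * Real.cos (Real.pi * α) := by
  have key : ∀ l β u v : ℝ, (a = l * Real.cos (Real.pi * β) * u) →
      (b = l * Real.cos (Real.pi * β) * v) → (c = l * Real.sin (Real.pi * β) * u) →
      (d = l * Real.sin (Real.pi * β) * v) → ∃ k α β : ℝ, k ≠ 0 ∧
    a = -(k * Real.cos (Real.pi * β) * Real.sin (Real.pi * α)) ∧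
    b = k * Real.cos (Real.pi * β) * Real.cos (Real.pi * α) ∧
    c = -(k * Real.sin (Real.pi * β) * Real.sin (Real.pi * α)) ∧
    d = k * Real.sin (Real.pi * β) * Real.cos (Real.pi * α) := by
    intro l β u v ha hb hc hd
    -- The row `(u, v)` is written as a multiple of `(-sin, cos)`, so that `α` is the direction of
    -- the kernel, while `β` is that of the image.
    obtain ⟨m, α, h0, h1⟩ := exists_polar ![v, -u]
    simp only [Matrix.cons_val_zero, Matrix.cons_val_one] at h0 h1
    have hu : u = -(m * Real.sin (Real.pi * α)) := by linarith
    refine ⟨l * m, α, β, ?_, ?_, ?_, ?_, ?_⟩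
    · intro hlm
      have e1 : l * u = 0 := by rw [hu]; linear_combination (-Real.sin (Real.pi * α)) * hlm
      have e2 : l * v = 0 := by rw [h0]; linear_combination (Real.cos (Real.pi * α)) * hlm
      rcases hne with h | h | h | h
      · exact h (by rw [ha]; linear_combination Real.cos (Real.pi * β) * e1)
      · exact h (by rw [hb]; linear_combination Real.cos (Real.pi * β) * e2)
      · exact h (by rw [hc]; linear_combination Real.sin (Real.pi * β) * e1)
      · exact h (by rw [hd]; linear_combination Real.sin (Real.pi * β) * e2)
    · rw [ha, hu]; ring
    · rw [hb, h0]; ring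
    · rw [hc, hu]; ring
    · rw [hd, h0]; ring
  by_cases h1 : a = 0 ∧ c = 0
  · obtain ⟨l, β, e0, e1⟩ := exists_polar ![b, d]
    simp only [Matrix.cons_val_zero, Matrix.cons_val_one] at e0 e1
    exact key l β 0 1 (by simp [h1.1]) (by simp [e0]) (by simp [h1.2]) (by simp [e1])
  · obtain ⟨l, β, e0, e1⟩ := exists_polar ![a, c]
    simp only [Matrix.cons_val_zero, Matrix.cons_val_one] at e0 e1
    have hb : ∃ v, b = a * v ∧ d = c * v := by
      by_cases ha : a = 0
      · have hc : c ≠ 0 := fun hc => h1 ⟨ha, hc⟩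
        refine ⟨d / c, ?_, by field_simp⟩
        have : b * c = 0 := by rw [ha] at hdet; linarith
        rw [(mul_eq_zero.1 this).resolve_right hc, ha, zero_mul]
      · exact ⟨b / a, by field_simp, by field_simp; linarith⟩
    obtain ⟨v, hb, hd⟩ := hb
    exact key l β 1 v (by simp [e0]) (by rw [hb, e0]) (by simp [e1]) (by rw [hd, e1])

/-- Lifts of a diverging sequence to `SL(2, ℝ)` tend to infinity in norm. After normalisation they
converge along the ultrafilter to a matrix of rank one, which sends every direction outside its
kernel `α` to its image `β`. When `α ≠ β` the limit has nonzero trace, so the traces of the lifts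
diverge and the elements are eventually hyperbolic. -/
theorem IsHFuchsian.exists_limit {Γ : Type*} [Group Γ] {ρ : Γ →* DiffH} (hρ : IsHFuchsian ρ)
    (γ : ℕ → Γ) (𝒰 : Ultrafilter ℕ) (hγ : ∀ δ, ∀ᶠ n in (𝒰 : Filter ℕ), γ n ≠ δ) :
    ∃ A B : S1, (∀ s, s ≠ A → Tendsto (fun n => (ρ (γ n)).1 s) 𝒰 (𝓝 B)) ∧
      (A ≠ B → ∀ᶠ n in (𝒰 : Filter ℕ), IsNorthSouth (ρ (γ n)).1) := by
  obtain ⟨j, hF, h, hh, hh', hj⟩ := hρ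
  have hlift : ∀ n, ∃ g : Matrix.SpecialLinearGroup (Fin 2) ℝ, (g : PSL2R) = j (γ n) :=
    fun n => QuotientGroup.mk_surjective _
  choose g hg using hlift
  set R : ℕ → ℝ := fun n => |(g n).1 0 0| + |(g n).1 0 1| + |(g n).1 1 0| + |(g n).1 1 1| with hR
  have hle : ∀ n i k, |(g n).1 i k| ≤ R n := by
    intro n i k
    have h1 := abs_nonneg ((g n).1 0 0)
    have h2 := abs_nonneg ((g n).1 0 1)
    have h3 := abs_nonneg ((g n).1 1 0)
    have h4 := abs_nonneg ((g n).1 1 1)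
    fin_cases i <;> fin_cases k <;> simp [hR] <;> linarith
  have hdet : ∀ n, (g n).1 0 0 * (g n).1 1 1 - (g n).1 0 1 * (g n).1 1 0 = 1 := by
    intro n
    rw [← Matrix.det_fin_two]
    exact (g n).2
  -- Only finitely many group elements have a lift of bounded size, and the sequence leaves each of
  -- them.
  have hRtop : Tendsto R 𝒰 atTop := by
    refine tendsto_atTop.2 fun C => ?_
    by_contra hcon
    have h1 : ∀ᶠ n in (𝒰 : Filter ℕ), ¬ C ≤ R n := Ultrafilter.eventually_not.2 hcon
    have h2 := (Filter.eventually_all_finite (hF.finite_bounded C)).2 fun δ _ => hγ δ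
    obtain ⟨n, hn1, hn2⟩ := (h1.and h2).exists
    exact hn2 (γ n) ⟨g n, hg n, fun i k => (hle n i k).trans (not_le.1 hn1).le⟩ rfl
  have hRpos : ∀ n, 0 < R n := by
    intro n
    refine lt_of_le_of_ne (by positivity) fun e => ?_
    have hz : ∀ i k, (g n).1 i k = 0 := fun i k =>
      abs_eq_zero.1 (le_antisymm ((hle n i k).trans e.symm.le) (abs_nonneg _))
    have := hdet n
    simp [hz] at this
  have hlim : ∀ i k, ∃ x, Tendsto (fun n => (g n).1 i k / R n) 𝒰 (𝓝 x) := fun i k =>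
    𝒰.exists_tendsto_of_abs_le (R := 1) fun n => by
      rw [abs_div, abs_of_pos (hRpos n), div_le_one (hRpos n)]
      exact hle n i k
  choose N hN using hlim
  -- The determinant of the normalised lift is `(R n)⁻¹ ^ 2`, which tends to zero.
  have hNdet : N 0 0 * N 1 1 - N 0 1 * N 1 0 = 0 := by
    have h1 := ((hN 0 0).mul (hN 1 1)).sub ((hN 0 1).mul (hN 1 0))
    have h2 : Tendsto (fun n => (R n)⁻¹ * (R n)⁻¹) 𝒰 (𝓝 0) := by
      simpa using hRtop.inv_tendsto_atTop.mul hRtop.inv_tendsto_atTop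
    refine tendsto_nhds_unique h1 (h2.congr fun n => ?_)
    have := (hRpos n).ne'
    field_simp
    exact (hdet n).symm
  -- The normalisation by the sum of the moduli of the entries survives in the limit, which
  -- therefore is not the zero matrix.
  have hNne : N 0 0 ≠ 0 ∨ N 0 1 ≠ 0 ∨ N 1 0 ≠ 0 ∨ N 1 1 ≠ 0 := by
    by_contra hcon
    push Not at hcon
    have h1 := (((hN 0 0).abs.add (hN 0 1).abs).add (hN 1 0).abs).add (hN 1 1).abs
    rw [hcon.1, hcon.2.1, hcon.2.2.1, hcon.2.2.2] at h1
    have h2 : Tendsto (fun _ : ℕ => (1 : ℝ)) 𝒰 (𝓝 (|0| + |0| + |0| + |0|)) := by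
      refine h1.congr fun n => ?_
      have := (hRpos n).ne'
      simp only [abs_div, abs_of_pos (hRpos n)]
      rw [← add_div, ← add_div, ← add_div]
      exact div_self this
    have := tendsto_nhds_unique h2 tendsto_const_nhds
    norm_num at this
  obtain ⟨k, α, β, hk, e00, e01, e10, e11⟩ := exists_rank_one hNdet hNne
  have hact : ∀ n, IsProjAction ((g n).1 0 0) ((g n).1 0 1) ((g n).1 1 0) ((g n).1 1 1)
      (fun θ => h ((ρ (γ n)).1 (h.symm θ))) := fun n => by
    refine isProjAction_of_smul fun θ => ?_
    rw [hg, hj, h.apply_symm_apply]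
  refine ⟨h.symm (α : S1), h.symm (β : S1), fun s hs => ?_, fun hAB => ?_⟩
  · obtain ⟨x, hx⟩ := S1.coe_surjective (h s)
    have hsin : Real.sin (Real.pi * (x - α)) ≠ 0 := by
      intro h0
      have h1 : sinAbs (h s - (α : S1)) = 0 := by
        rw [← hx, ← AddCircle.coe_sub, sinAbs_coe, h0, abs_zero]
      exact (sinAbs_sub_pos (fun e => hs (by rw [← e, h.symm_apply_apply]))).ne' h1
    obtain ⟨L, hL⟩ := 𝒰.exists_tendsto (fun n => h ((ρ (γ n)).1 s))
    have hLβ : L = (β : S1) := by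
      choose y hy using fun n => S1.coe_surjective (h ((ρ (γ n)).1 s))
      choose c hc0 hc1 using fun n => hact n x (y n) (by
        rw [hx, hy]
        exact congrArg (fun t => h ((ρ (γ n)).1 t)) (h.symm_apply_apply s))
      -- The image vector, divided by `R n`, tends to the limit matrix applied to the direction `x`,
      -- namely `k sin(π (x - α))` times the unit vector of direction `β`.
      have t0 : Tendsto (fun n => c n / R n * Real.cos (Real.pi * y n)) 𝒰
          (𝓝 (k * Real.sin (Real.pi * (x - α)) * Real.cos (Real.pi * β))) := by
        have := ((hN 0 0).mul_const (Real.cos (Real.pi * x))).add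
          ((hN 0 1).mul_const (Real.sin (Real.pi * x)))
        convert this using 1
        · funext n
          rw [div_mul_eq_mul_div, ← hc0 n]; ring
        · rw [e00, e01, mul_sub, Real.sin_sub]; ring_nf
      have t1 : Tendsto (fun n => c n / R n * Real.sin (Real.pi * y n)) 𝒰
          (𝓝 (k * Real.sin (Real.pi * (x - α)) * Real.sin (Real.pi * β))) := by
        have := ((hN 1 0).mul_const (Real.cos (Real.pi * x))).add
          ((hN 1 1).mul_const (Real.sin (Real.pi * x)))
        convert this using 1
        · funext n
          rw [div_mul_eq_mul_div, ← hc1 n]; ring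
        · rw [e10, e11, mul_sub, Real.sin_sub]; ring_nf
      -- The length of the image vector has a nonzero limit. Hence, in the following step, vanishing
      -- of the product of length and chordal distance to `β` forces the distance to vanish.
      have t2 : Tendsto (fun n => |c n / R n|) 𝒰 (𝓝 |k * Real.sin (Real.pi * (x - α))|) := by
        have := ((t0.pow 2).add (t1.pow 2)).sqrt
        simp only [← Real.sqrt_sq_eq_abs]
        convert this using 1
        · funext n
          congr 1
          linear_combination (-(c n / R n) ^ 2) * (Real.sin_sq_add_cos_sq (Real.pi * y n))
        · congr 2
          linear_combination (-(k * Real.sin (Real.pi * (x - α))) ^ 2) *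
            (Real.sin_sq_add_cos_sq (Real.pi * β))
      have t3 : Tendsto (fun n => |c n / R n| * sinAbs (h ((ρ (γ n)).1 s) - (β : S1))) 𝒰 (𝓝 0) := by
        have := ((t1.mul_const (Real.cos (Real.pi * β))).sub
          (t0.mul_const (Real.sin (Real.pi * β)))).abs
        convert this using 1
        · funext n
          rw [← hy n, ← AddCircle.coe_sub, sinAbs_coe, ← abs_mul, mul_sub, Real.sin_sub]
          ring_nf
        · rw [show k * Real.sin (Real.pi * (x - α)) * Real.sin (Real.pi * β) *
            Real.cos (Real.pi * β) - k * Real.sin (Real.pi * (x - α)) * Real.cos (Real.pi * β) *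
            Real.sin (Real.pi * β) = 0 by ring, abs_zero]
      have t4 := t2.mul ((continuous_sinAbs.comp
        (continuous_id.sub (continuous_const (y := (β : S1))))).tendsto L |>.comp hL)
      have := tendsto_nhds_unique t4 t3
      rcases mul_eq_zero.1 this with h0 | h0
      · exact absurd (abs_eq_zero.1 h0) (mul_ne_zero hk hsin)
      · by_contra hne
        exact (sinAbs_sub_pos hne).ne' h0
    have := (h.symm.continuous.tendsto L).comp hL
    rw [hLβ] at this
    refine this.congr fun n => ?_
    simp
  · have htr : N 0 0 + N 1 1 ≠ 0 := by
      rw [e00, e11]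
      intro h0
      have h1 : k * Real.sin (Real.pi * (β - α)) = 0 := by
        rw [mul_sub, Real.sin_sub]; linear_combination h0
      have h2 : sinAbs ((β : S1) - (α : S1)) = 0 := by
        rw [← AddCircle.coe_sub, sinAbs_coe, (mul_eq_zero.1 h1).resolve_left hk, abs_zero]
      exact (sinAbs_sub_pos (fun e => hAB (by rw [e]))).ne' h2
    have t1 := ((hN 0 0).add (hN 1 1)).abs
    have t2 := hRtop.atTop_mul_pos (abs_pos.2 htr) t1
    filter_upwards [t2.eventually_gt_atTop 2] with n hn
    refine isNorthSouth_of_trace hh hh' hj (hg n) (hn.trans_le (le_of_eq ?_))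
    rw [← add_div, abs_div, abs_of_pos (hRpos n), mul_div_cancel₀ _ (hRpos n).ne']

noncomputable section

/-! ### Hölder estimates -/

section holder

variable {X Y : Type*} [PseudoMetricSpace X] [PseudoMetricSpace Y]

theorem holderOnWith_of_dist_le {f : X → Y} {C r : ℝ} (hC : 0 ≤ C) (hr : 0 ≤ r) {N : Set X}
    (h : ∀ y ∈ N, ∀ z ∈ N, dist (f y) (f z) ≤ C * dist y z ^ r) :
    HolderOnWith C.toNNReal r.toNNReal f N := by
  intro y hy z hz
  rw [edist_dist, edist_dist, Real.coe_toNNReal r hr,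
    ENNReal.ofReal_rpow_of_nonneg dist_nonneg hr, ← ENNReal.ofReal_coe_nnreal (p := C.toNNReal),
    Real.coe_toNNReal C hC, ← ENNReal.ofReal_mul hC]
  exact ENNReal.ofReal_le_ofReal (h y hy z hz)

/-- Local Hölder continuity at a point, with real constants. -/
def HolderNear (f : X → Y) (x : X) : Prop :=
  ∃ N ∈ 𝓝 x, ∃ C r : ℝ, 0 ≤ C ∧ 0 < r ∧ ∀ y ∈ N, ∀ z ∈ N, dist (f y) (f z) ≤ C * dist y z ^ r

theorem locHolderOn_iff {f : X → Y} {U : Set X} :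
    LocHolderOn f U ↔ ∀ x ∈ U, HolderNear f x := by
  constructor
  · intro h x hx
    obtain ⟨N, hN, C, r, hr, h⟩ := h x hx
    exact ⟨N, hN, C, r, C.2, hr, fun y hy z hz => h.dist_le hy hz⟩
  · intro h x hx
    obtain ⟨N, hN, C, r, hC, hr, h⟩ := h x hx
    exact ⟨N, hN, C.toNNReal, r.toNNReal, Real.toNNReal_pos.2 hr,
      holderOnWith_of_dist_le hC hr.le h⟩

theorem HolderNear.continuousAt {f : X → Y} {x : X} (h : HolderNear f x) : ContinuousAt f x := by
  obtain ⟨N, hN, C, r, hC, hr, h⟩ := h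
  have := (holderOnWith_of_dist_le hC hr.le h).continuousOn (Real.toNNReal_pos.2 hr)
  exact this.continuousAt hN

theorem isHolder_of_dist_le {f : X → Y} {C r : ℝ} (hC : 0 ≤ C) (hr : 0 < r)
    (h : ∀ y z, dist (f y) (f z) ≤ C * dist y z ^ r) : IsHolder f :=
  ⟨C.toNNReal, r.toNNReal, Real.toNNReal_pos.2 hr, holderOnWith_univ.1
    (holderOnWith_of_dist_le hC hr.le fun y _ z _ => h y z)⟩

/-- For distances at most one a Hölder bound may be weakened to a smaller exponent, so two bounds
can share their constant and exponent. -/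
theorem rpow_le_max {C₁ C₂ r₁ r₂ d : ℝ} (hC₁ : 0 ≤ C₁) (hr : 0 ≤ min r₁ r₂) (hd0 : 0 ≤ d)
    (hd : d ≤ 1) : C₁ * d ^ r₁ ≤ max C₁ C₂ * d ^ min r₁ r₂ := by
  have h1 : d ^ r₁ ≤ d ^ min r₁ r₂ :=
    Real.rpow_le_rpow_of_exponent_ge' hd0 hd hr (min_le_left _ _)
  exact mul_le_mul (le_max_left _ _) h1 (Real.rpow_nonneg hd0 _) (hC₁.trans (le_max_left _ _))

theorem IsHolder.exists_dist_le_real {f : X → Y} (h : IsHolder f) :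
    ∃ C r : ℝ, 0 ≤ C ∧ 0 < r ∧ ∀ y z, dist (f y) (f z) ≤ C * dist y z ^ r := by
  obtain ⟨C, r, hr, h⟩ := h
  exact ⟨C, r, C.2, hr, fun x y => h.dist_le x y⟩

theorem rpow_le_max' {C₁ C₂ r₁ r₂ d : ℝ} (hC₂ : 0 ≤ C₂) (hr : 0 ≤ min r₁ r₂) (hd0 : 0 ≤ d)
    (hd : d ≤ 1) : C₂ * d ^ r₂ ≤ max C₁ C₂ * d ^ min r₁ r₂ := by
  rw [max_comm, min_comm] at *
  exact rpow_le_max hC₂ hr hd0 hd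

theorem HolderNear.comp {Z : Type*} [PseudoMetricSpace Z] {f : Y → Z} {g : X → Y} {x : X}
    (hf : HolderNear f (g x)) (hg : HolderNear g x) : HolderNear (fun y => f (g y)) x := by
  have hc := hg.continuousAt
  obtain ⟨N, hN, C, r, hC, hr, hf⟩ := hf
  obtain ⟨N', hN', C', r', hC', hr', hg⟩ := hg
  refine ⟨N' ∩ g ⁻¹' N, inter_mem hN' (hc hN), C * C' ^ r, r' * r, by positivity, by positivity,
    fun y hy z hz => (hf _ hy.2 _ hz.2).trans ?_⟩
  rw [mul_assoc, Real.rpow_mul dist_nonneg, ← Real.mul_rpow hC' (Real.rpow_nonneg dist_nonneg _)]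
  gcongr
  exact hg y hy.1 z hz.1

theorem holderNear_of_lipschitz {f : X → Y} {x : X} {C : ℝ} (hC : 0 ≤ C) {N : Set X} (hN : N ∈ 𝓝 x)
    (h : ∀ y ∈ N, ∀ z ∈ N, dist (f y) (f z) ≤ C * dist y z) : HolderNear f x :=
  ⟨N, hN, C, 1, hC, one_pos, fun y hy z hz => by rw [Real.rpow_one]; exact h y hy z hz⟩

theorem IsHolder.holderNear {f : X → Y} (h : IsHolder f) (x : X) : HolderNear f x := by
  obtain ⟨C, r, hC, hr, h⟩ := h.exists_dist_le_real
  exact ⟨univ, univ_mem, C, r, hC, hr, fun y _ z _ => h y z⟩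

theorem HolderNear.prodMk {Z : Type*} [PseudoMetricSpace Z] {f : X → Y} {g : X → Z} {x : X}
    (hf : HolderNear f x) (hg : HolderNear g x) : HolderNear (fun y => (f y, g y)) x := by
  obtain ⟨N, hN, C, r, hC, hr, hf⟩ := hf
  obtain ⟨N', hN', C', r', hC', hr', hg⟩ := hg
  refine ⟨N ∩ N' ∩ Metric.ball x (1 / 2), inter_mem (inter_mem hN hN')
    (Metric.ball_mem_nhds x (by norm_num)), max C C', min r r', le_max_of_le_left hC,
    lt_min hr hr', fun y hy z hz => ?_⟩
  have hd : dist y z ≤ 1 := by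
    have h1 := Metric.mem_ball.1 hy.2
    have h2 := Metric.mem_ball.1 hz.2
    linarith [dist_triangle_right y z x]
  rw [Prod.dist_eq, max_le_iff]
  exact ⟨(hf y hy.1.1 z hz.1.1).trans (rpow_le_max hC (lt_min hr hr').le dist_nonneg hd),
    (hg y hy.1.2 z hz.1.2).trans (rpow_le_max' hC' (lt_min hr hr').le dist_nonneg hd)⟩

/-- Multiplication of reals is Lipschitz near `(f x, g x)`; compose it with the Hölder pair `(f,
g)`. -/
theorem HolderNear.mul {f g : X → ℝ} {x : X} (hf : HolderNear f x) (hg : HolderNear g x) :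
    HolderNear (fun y => f y * g y) x := by
  have hm : HolderNear (fun p : ℝ × ℝ => p.1 * p.2) (f x, g x) := by
    set B := |f x| + |g x| + 1 with hB
    have hB0 : 0 ≤ B := by positivity
    refine holderNear_of_lipschitz (C := B + B) (by positivity)
      (Metric.ball_mem_nhds _ one_pos) fun y hy z hz => ?_
    have key : ∀ p ∈ Metric.ball (f x, g x) (1 : ℝ), |p.1| ≤ B ∧ |p.2| ≤ B := by
      intro p hp
      rw [Metric.mem_ball, Prod.dist_eq, max_lt_iff, Real.dist_eq, Real.dist_eq] at hp
      have h1 := abs_sub_abs_le_abs_sub p.1 (f x)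
      have h2 := abs_sub_abs_le_abs_sub p.2 (g x)
      have h3 := abs_nonneg (f x)
      have h4 := abs_nonneg (g x)
      simp only at hp
      constructor <;> linarith [hp.1, hp.2]
    have h1 := key y hy
    have h2 := key z hz
    have d1 : |y.1 - z.1| ≤ dist y z := by rw [Prod.dist_eq, ← Real.dist_eq]; exact le_max_left _ _
    have d2 : |y.2 - z.2| ≤ dist y z := by rw [Prod.dist_eq, ← Real.dist_eq]; exact le_max_right _ _
    rw [Real.dist_eq, show y.1 * y.2 - z.1 * z.2 = y.1 * (y.2 - z.2) + z.2 * (y.1 - z.1) by ring,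
      add_mul]
    refine (abs_add_le _ _).trans ?_
    rw [abs_mul, abs_mul]
    exact add_le_add (mul_le_mul h1.1 d2 (abs_nonneg _) hB0)
      (mul_le_mul h2.2 d1 (abs_nonneg _) hB0)
  exact HolderNear.comp (g := fun y => (f y, g y)) hm (hf.prodMk hg)

theorem HolderNear.add {f g : X → ℝ} {x : X} (hf : HolderNear f x) (hg : HolderNear g x) :
    HolderNear (fun y => f y + g y) x := by
  have hm : HolderNear (fun p : ℝ × ℝ => p.1 + p.2) (f x, g x) := by
    refine holderNear_of_lipschitz (C := 2) (by norm_num) univ_mem fun y _ z _ => ?_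
    have d1 : |y.1 - z.1| ≤ dist y z := by rw [Prod.dist_eq, ← Real.dist_eq]; exact le_max_left _ _
    have d2 : |y.2 - z.2| ≤ dist y z := by rw [Prod.dist_eq, ← Real.dist_eq]; exact le_max_right _ _
    rw [Real.dist_eq, show y.1 + y.2 - (z.1 + z.2) = (y.1 - z.1) + (y.2 - z.2) by ring]
    refine (abs_add_le _ _).trans ?_
    linarith
  exact HolderNear.comp (g := fun y => (f y, g y)) hm (hf.prodMk hg)

theorem holderNear_const (c : Y) (x : X) : HolderNear (fun _ : X => c) x :=
  holderNear_of_lipschitz le_rfl univ_mem fun y _ z _ => by simp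

/-- A map which is Hölder near each point of the circle is Hölder. -/
theorem isHolder_of_holderNear {f : S1 → Y} (h : ∀ θ, HolderNear f θ) : IsHolder f := by
  have hc : Continuous f := continuous_iff_continuousAt.2 fun θ => (h θ).continuousAt
  obtain ⟨B, hB⟩ := Metric.isBounded_iff.1 (isCompact_univ.image hc).isBounded
  replace hB : ∀ y z, dist (f y) (f z) ≤ B := fun y z =>
    hB (mem_image_of_mem f (mem_univ y)) (mem_image_of_mem f (mem_univ z))
  have hB0 : 0 ≤ B := dist_nonneg.trans (hB 0 0)
  have hd1 : ∀ y z : S1, dist y z ≤ 1 := fun y z => (S1.dist_le_half y z).trans (by norm_num)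
  have key : ∃ C r : ℝ, 0 ≤ C ∧ 0 < r ∧ ∀ y ∈ (univ : Set S1), ∀ z,
      dist (f y) (f z) ≤ C * dist y z ^ r := by
    refine isCompact_univ.induction_on (p := fun A => ∃ C r : ℝ, 0 ≤ C ∧ 0 < r ∧ ∀ y ∈ A, ∀ z,
      dist (f y) (f z) ≤ C * dist y z ^ r) ?_ ?_ ?_ ?_
    · exact ⟨0, 1, le_rfl, one_pos, fun y hy => absurd hy (notMem_empty y)⟩
    · rintro s t hst ⟨C, r, hC, hr, h⟩
      exact ⟨C, r, hC, hr, fun y hy => h y (hst hy)⟩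
    · rintro s t ⟨C, r, hC, hr, h⟩ ⟨C', r', hC', hr', h'⟩
      refine ⟨max C C', min r r', le_max_of_le_left hC, lt_min hr hr', fun y hy z => ?_⟩
      rcases hy with hy | hy
      · exact (h y hy z).trans (rpow_le_max hC (lt_min hr hr').le dist_nonneg (hd1 y z))
      · exact (h' y hy z).trans (rpow_le_max' hC' (lt_min hr hr').le dist_nonneg (hd1 y z))
    · intro θ _
      obtain ⟨N, hN, C, r, hC, hr, h⟩ := h θ
      obtain ⟨ε, hε, hN⟩ := Metric.mem_nhds_iff.1 hN
      refine ⟨Metric.ball θ (ε / 2), mem_nhdsWithin_of_mem_nhds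
        (Metric.ball_mem_nhds θ (half_pos hε)), C + B / (ε / 2) ^ r, r, by positivity, hr,
        fun y hy z => ?_⟩
      have hq : 0 ≤ B / (ε / 2) ^ r := by positivity
      have hdr : 0 ≤ dist y z ^ r := Real.rpow_nonneg dist_nonneg _
      rw [add_mul]
      -- Here `z` is any point of the circle. Near `y` the local bound applies; far from it the
      -- oscillation of `f` is at most `B`, which the factor `dist y z ^ r` absorbs.
      by_cases hz : dist y z < ε / 2
      · have hy' : y ∈ N := hN (Metric.ball_subset_ball (by linarith) hy)
        have hz' : z ∈ N := hN (by
          rw [Metric.mem_ball] at hy ⊢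
          linarith [dist_triangle z y θ, dist_comm y z])
        exact (h y hy' z hz').trans (le_add_of_nonneg_right (mul_nonneg hq hdr))
      · refine (hB y z).trans (le_add_of_nonneg_of_le (mul_nonneg hC hdr) ?_)
        rw [div_mul_eq_mul_div, le_div_iff₀ (by positivity)]
        gcongr
        exact not_lt.1 hz
  obtain ⟨C, r, hC, hr, h⟩ := key
  exact isHolder_of_dist_le hC hr fun y z => h y (mem_univ y) z

/-- Integrals of Hölder functions that depend on a parameter. -/
theorem holderNear_integral_unit {G : X × ℝ → ℝ} {x : X}
    (h : ∀ u ∈ Icc (0 : ℝ) 1, HolderNear G (x, u)) :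
    HolderNear (fun y => ∫ u in (0 : ℝ)..1, G (y, u)) x := by
  -- Compactness of the unit interval gives a neighbourhood, a constant and an exponent that serve
  -- for all `u` at once.
  have key : ∃ N ∈ 𝓝 x, ∃ C r : ℝ, 0 ≤ C ∧ 0 < r ∧ ∀ y ∈ N, ∀ z ∈ N, ∀ u ∈ Icc (0 : ℝ) 1,
      ContinuousAt G (y, u) ∧ dist (G (y, u)) (G (z, u)) ≤ C * dist y z ^ r := by
    refine isCompact_Icc.induction_on (p := fun A => ∃ N ∈ 𝓝 x, ∃ C r : ℝ, 0 ≤ C ∧ 0 < r ∧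
      ∀ y ∈ N, ∀ z ∈ N, ∀ u ∈ A,
      ContinuousAt G (y, u) ∧ dist (G (y, u)) (G (z, u)) ≤ C * dist y z ^ r) ?_ ?_ ?_ ?_
    · exact ⟨univ, univ_mem, 0, 1, le_rfl, one_pos, fun y _ z _ u hu => absurd hu (notMem_empty u)⟩
    · rintro s t hst ⟨N, hN, C, r, hC, hr, h⟩
      exact ⟨N, hN, C, r, hC, hr, fun y hy z hz u hu => h y hy z hz u (hst hu)⟩
    · rintro s t ⟨N, hN, C, r, hC, hr, h⟩ ⟨N', hN', C', r', hC', hr', h'⟩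
      refine ⟨N ∩ N' ∩ Metric.ball x (1 / 2), inter_mem (inter_mem hN hN')
        (Metric.ball_mem_nhds x (by norm_num)), max C C', min r r', le_max_of_le_left hC,
        lt_min hr hr', fun y hy z hz u hu => ?_⟩
      have hd : dist y z ≤ 1 := by
        have h1 := Metric.mem_ball.1 hy.2
        have h2 := Metric.mem_ball.1 hz.2
        linarith [dist_triangle_right y z x]
      rcases hu with hu | hu
      · obtain ⟨h1, h2⟩ := h y hy.1.1 z hz.1.1 u hu
        exact ⟨h1, h2.trans (rpow_le_max hC (lt_min hr hr').le dist_nonneg hd)⟩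
      · obtain ⟨h1, h2⟩ := h' y hy.1.2 z hz.1.2 u hu
        exact ⟨h1, h2.trans (rpow_le_max' hC' (lt_min hr hr').le dist_nonneg hd)⟩
    · intro u hu
      obtain ⟨N, hN, C, r, hC, hr, hG⟩ := h u hu
      obtain ⟨V, hV, W, hW, hVW⟩ := mem_nhds_prod_iff.1 hN
      refine ⟨interior W, mem_nhdsWithin_of_mem_nhds (interior_mem_nhds.2 hW), interior V,
        interior_mem_nhds.2 hV, C, r, hC, hr, fun y hy z hz u' hu' => ?_⟩
      have hmem : ∀ y ∈ interior V, (y, u') ∈ N := fun y hy =>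
        hVW ⟨interior_subset hy, interior_subset hu'⟩
      refine ⟨?_, ?_⟩
      · refine HolderNear.continuousAt ⟨N, ?_, C, r, hC, hr, hG⟩
        exact mem_of_superset (prod_mem_nhds (isOpen_interior.mem_nhds hy)
          (isOpen_interior.mem_nhds hu'))
          ((Set.prod_mono interior_subset interior_subset).trans hVW)
      · have := hG _ (hmem y hy) _ (hmem z hz)
        rwa [Prod.dist_eq (x := (y, u')), dist_self, max_eq_left dist_nonneg] at this
  obtain ⟨N, hN, C, r, hC, hr, h⟩ := key
  refine ⟨N, hN, C, r, hC, hr, fun y hy z hz => ?_⟩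
  have hi : ∀ y ∈ N, IntervalIntegrable (fun u => G (y, u)) volume 0 1 := by
    intro y hy
    refine ContinuousOn.intervalIntegrable fun u hu => ?_
    rw [uIcc_of_le zero_le_one] at hu
    exact ((h y hy y hy u hu).1.comp (f := fun u => (y, u)) (by fun_prop)).continuousWithinAt
  rw [dist_eq_norm, ← intervalIntegral.integral_sub (hi y hy) (hi z hz)]
  refine (intervalIntegral.norm_integral_le_of_norm_le_const (C := C * dist y z ^ r) fun u hu => ?_).trans
    (by simp)
  rw [uIoc_of_le zero_le_one] at hu
  rw [← dist_eq_norm]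
  exact (h y hy z hz u (Ioc_subset_Icc_self hu)).2

end holder

end

/-! ### Hölder regularity of fibre coordinates and of vertical integrals -/

noncomputable section

theorem S1.norm_coe_of_abs_le {x : ℝ} (h : |x| ≤ 1 / 2) : ‖(x : S1)‖ = |x| :=
  (AddCircle.norm_coe_eq_abs_iff (1 : ℝ) one_ne_zero).2 (by simpa using h)

theorem dist_antipodal (κ : S1 → S1) (s s' : S1) :
    dist (antipodal κ s) (antipodal κ s') = dist s s' := by
  rw [antipodal, antipodal, dist_add_right, dist_eq_norm, dist_eq_norm, ← smul_sub]
  rcases circleDeg_eq κ with h | h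
  · simp [h]
  · simpa [h] using norm_sub_rev s' s

theorem dist_fst_le {X Y : Type*} [PseudoMetricSpace X] [PseudoMetricSpace Y] (x y : X × Y) :
    dist x.1 y.1 ≤ dist x y := le_max_left _ _

theorem dist_snd_le {X Y : Type*} [PseudoMetricSpace X] [PseudoMetricSpace Y] (x y : X × Y) :
    dist x.2 y.2 ≤ dist x y := le_max_right _ _

/-- Modulo integers the fibre coordinate is `t` minus the antipodal section, in which `κ` no longer
appears and which is Lipschitz. For values that differ by at most `1 / 2` the distance on the line
is that on the circle. -/
theorem holderNear_fiberCoord (κ : S1 ≃ₜ S1) {x : S1 × S1} (hx : x ∈ annulus κ) :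
    HolderNear (fiberCoord κ) x := by
  have hc : ContinuousAt (fiberCoord κ) x :=
    (continuousOn_fiberCoord κ).continuousAt ((isOpen_annulus κ.continuous).mem_nhds hx)
  refine holderNear_of_lipschitz (C := 2) (by norm_num)
    (hc (Metric.ball_mem_nhds _ (show (0 : ℝ) < 1 / 4 by norm_num))) fun y hy z hz => ?_
  have h1 : |fiberCoord κ y - fiberCoord κ z| ≤ 1 / 2 := by
    rw [← Real.dist_eq]
    have h1 := Metric.mem_ball.1 (mem_preimage.1 hy)
    have h2 := Metric.mem_ball.1 (mem_preimage.1 hz)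
    linarith [dist_triangle_right (fiberCoord κ y) (fiberCoord κ z) (fiberCoord κ x)]
  rw [Real.dist_eq, ← S1.norm_coe_of_abs_le h1, AddCircle.coe_sub, coe_fiberCoord, coe_fiberCoord,
    show y.2 - antipodal κ y.1 - (z.2 - antipodal κ z.1) =
      (y.2 - z.2) - (antipodal κ y.1 - antipodal κ z.1) by abel]
  refine (norm_sub_le _ _).trans ?_
  rw [← dist_eq_norm, ← dist_eq_norm, dist_antipodal]
  linarith [dist_fst_le y z, dist_snd_le y z]

/-- After rescaling to the unit interval this is a product of the Lipschitz fibre coordinate with an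
integral of Hölder functions, to which `holderNear_integral_unit` applies. -/
theorem holderNear_vint (κ : S1 ≃ₜ S1) {b : S1 × S1 → ℝ} (hb : LocHolderOn b (annulus κ))
    {x : S1 × S1} (hx : x ∈ annulus κ) : HolderNear (vint κ b) x := by
  have e : vint κ b = fun x => fiberCoord κ x *
      ∫ y in (0 : ℝ)..1, b (x.1, antipodal κ x.1 + ((y * fiberCoord κ x : ℝ) : S1)) := by
    funext x
    exact integral_zero_eq_unit (fun y => b (x.1, antipodal κ x.1 + (y : S1))) _
  rw [e]
  refine (holderNear_fiberCoord κ hx).mul (holderNear_integral_unit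
    (G := fun q : (S1 × S1) × ℝ =>
      b (q.1.1, antipodal κ q.1.1 + ((q.2 * fiberCoord κ q.1 : ℝ) : S1))) fun u hu => ?_)
  have hfst : HolderNear (fun q : (S1 × S1) × ℝ => q.1) (x, u) :=
    holderNear_of_lipschitz zero_le_one univ_mem fun y _ z _ => by
      rw [one_mul]; exact dist_fst_le y z
  have hfst1 : HolderNear (fun q : (S1 × S1) × ℝ => q.1.1) (x, u) :=
    holderNear_of_lipschitz zero_le_one univ_mem fun y _ z _ => by
      rw [one_mul]; exact (dist_fst_le _ _).trans (dist_fst_le y z)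
  have hsnd : HolderNear (fun q : (S1 × S1) × ℝ => q.2) (x, u) :=
    holderNear_of_lipschitz zero_le_one univ_mem fun y _ z _ => by
      rw [one_mul]; exact dist_snd_le y z
  have hw : HolderNear (fun q : (S1 × S1) × ℝ => q.2 * fiberCoord κ q.1) (x, u) :=
    hsnd.mul (HolderNear.comp (g := fun q : (S1 × S1) × ℝ => q.1) (holderNear_fiberCoord κ hx) hfst)
  have hadd : HolderNear (fun p : S1 × ℝ => antipodal κ p.1 + ((p.2 : ℝ) : S1))
      (x.1, u * fiberCoord κ x) :=
    holderNear_of_lipschitz (C := 2) (by norm_num) univ_mem fun y _ z _ => by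
      refine (dist_add_add_le _ _ _ _).trans ?_
      rw [dist_antipodal]
      have := S1.dist_coe_le (x := y.2) (y := z.2)
      rw [← Real.dist_eq] at this
      linarith [dist_fst_le y z, dist_snd_le y z]
  have hcomp := HolderNear.comp (g := fun q : (S1 × S1) × ℝ => (q.1.1, q.2 * fiberCoord κ q.1))
    hadd (hfst1.prodMk hw)
  exact HolderNear.comp (f := b) (locHolderOn_iff.1 hb _
    (segment_mem_annulus κ hx (mul_mem_uIcc hu))) (hfst1.prodMk hcomp)

/-! ### Normal forms -/

namespace ConjugationData

variable {Γ : Type*} [Group Γ] {κ : S1 ≃ₜ S1} {M : Type*} [TopologicalSpace M] [AddAction ℝ M]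

/-- A fibre coordinate `v` in which the connection form is `dv - r ds`. -/
structure NormalForm (X : ConjugationData Γ κ M) (v : M → ℝ) (r : S1 × S1 → ℝ) : Prop where
  isCoord : X.conn.IsCoord v (fun x => -r x) (fun _ => 0)
  hasDerivAt : ∀ x₀ y₀ : ℝ, toTorus (x₀, y₀) ∈ annulus κ →
    HasDerivAt (fun y => r (toTorus (x₀, y))) (X.sgn * X.f (toTorus (x₀, y₀))) y₀
  antipodal_eq : ∃ c₀, ∀ s, r (s, antipodal κ s) = c₀
  holder : LocHolderOn r (annulus κ)

variable (X : ConjugationData Γ κ M)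

theorem continuousOn_f : ContinuousOn X.f (annulus κ) := fun x hx =>
  (locHolderOn_iff.1 X.f_holder x hx).continuousAt.continuousWithinAt

theorem sgn_ne : X.sgn ≠ 0 := by
  rcases X.sgn_eq with h | h <;> norm_num [h]

/-- The potential removes the coefficient of `dt` and leaves `-r` as that of `ds`. On the antipodal
section the vertical integral is zero, so there the momentum is constant, equal to minus the
holonomy. -/
theorem normalForm {U : M → ℝ} {a b : S1 × S1 → ℝ} (hU : X.conn.IsCoord U a b) :
    X.NormalForm (fun m => U m + potential κ a b (X.bundle.proj m))
      (momentum κ a b fun x => X.sgn * X.f x) := by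
  have hF : ContinuousOn (fun x => X.sgn * X.f x) (annulus κ) :=
    continuousOn_const.mul X.continuousOn_f
  refine ⟨hU.normalise hF X.curvature, fun x₀ y₀ h => hasDerivAt_momentum κ hF h,
    ⟨-sectionHol κ a b, fun s => by simp [momentum, vint_antipodal]⟩, ?_⟩
  rw [locHolderOn_iff]
  intro x hx
  have hFh : LocHolderOn (fun x => X.sgn * X.f x) (annulus κ) := by
    rw [locHolderOn_iff]
    exact fun x hx => (holderNear_const X.sgn x).mul (locHolderOn_iff.1 X.f_holder x hx)
  exact (holderNear_vint κ hFh hx).add (holderNear_const (-sectionHol κ a b) x)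

namespace NormalForm

variable {X} {v : M → ℝ} {r : S1 × S1 → ℝ}

theorem continuousOn (N : X.NormalForm v r) : ContinuousOn r (annulus κ) := fun x hx =>
  (locHolderOn_iff.1 N.holder x hx).continuousAt.continuousWithinAt

end NormalForm

end ConjugationData

end

noncomputable section

/-! ### Fibres of the annulus -/

theorem exists_lift_Ioo {t : S1} {t₀ : ℝ} (h : (t₀ : S1) ≠ t) :
    ∃ y ∈ Ioo t₀ (t₀ + 1), (y : S1) = t := by
  have h1 := rep01_mem (θ := t - (t₀ : S1)) (sub_ne_zero.2 h.symm)
  refine ⟨t₀ + rep01 (t - (t₀ : S1)), ⟨by linarith [h1.1], by linarith [h1.2]⟩, ?_⟩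
  rw [AddCircle.coe_add, coe_rep01]
  abel

theorem coe_ne_coe_of_mem_Ioo {t₀ y : ℝ} (h : y ∈ Ioo t₀ (t₀ + 1)) : (t₀ : S1) ≠ (y : S1) := by
  intro e
  have h1 : ((y - t₀ : ℝ) : S1) = 0 := by rw [AddCircle.coe_sub, e, sub_self]
  exact S1.coe_ne_zero ⟨by linarith [h.1], by linarith [h.2]⟩ h1

theorem mem_annulus_of_Ioo {κ : S1 → S1} {s : S1} {t₀ y : ℝ} (h₀ : (t₀ : S1) = κ s)
    (h : y ∈ Ioo t₀ (t₀ + 1)) : (s, (y : S1)) ∈ annulus κ := by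
  change κ s ≠ (y : S1)
  rw [← h₀]
  exact coe_ne_coe_of_mem_Ioo h

/-- A function whose derivative along the fibres of the annulus vanishes is constant on them. -/
theorem eq_of_hasDerivAt_fibre {κ : S1 → S1} {c : S1 × S1 → ℝ}
    (h : ∀ x₀ y₀ : ℝ, toTorus (x₀, y₀) ∈ annulus κ →
      HasDerivAt (fun y => c (toTorus (x₀, y))) 0 y₀) {s t t' : S1}
    (ht : (s, t) ∈ annulus κ) (ht' : (s, t') ∈ annulus κ) : c (s, t) = c (s, t') := by
  obtain ⟨x, rfl⟩ := S1.coe_surjective s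
  obtain ⟨t₀, h₀⟩ := S1.coe_surjective (κ (x : S1))
  obtain ⟨y, hy, rfl⟩ := exists_lift_Ioo (t := t) (t₀ := t₀) (by rw [h₀]; exact ht)
  obtain ⟨y', hy', rfl⟩ := exists_lift_Ioo (t := t') (t₀ := t₀) (by rw [h₀]; exact ht')
  exact isOpen_Ioo.is_const_of_deriv_eq_zero (𝕜 := ℝ) isPreconnected_Ioo
    (f := fun y : ℝ => c (toTorus (x, y)))
    (fun z hz => (h x z (mem_annulus_of_Ioo h₀ hz)).differentiableAt.differentiableWithinAt)
    (fun z hz => (h x z (mem_annulus_of_Ioo h₀ hz)).deriv) hy hy'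

theorem IsC1hFun.of_hasDerivAt {g D : S1 → ℝ} (hD : IsHolder D)
    (h : ∀ s, HasDerivAt (fun x : ℝ => g (s + (x : S1))) (D s) 0) : IsC1hFun g := by
  have h1 : ∀ x : ℝ, HasDerivAt (fun y : ℝ => g (y : S1)) (D (x : S1)) x := by
    intro x
    have := (h (x : S1))
    have h2 : HasDerivAt (fun y : ℝ => g ((x + y : ℝ) : S1)) (D (x : S1)) 0 := by
      simpa only [AddCircle.coe_add] using this
    have h3 : HasDerivAt (fun y : ℝ => g ((x + (y - x) : ℝ) : S1)) (D (x : S1)) x := by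
      refine HasDerivAt.comp_sub_const (f := fun y : ℝ => g ((x + y : ℝ) : S1)) x x ?_
      rwa [sub_self]
    simpa using h3
  refine ⟨contDiff_one_iff_deriv.2 ⟨fun x => (h1 x).differentiableAt, ?_⟩, ?_⟩
  · rw [show deriv (fun y : ℝ => g (y : S1)) = fun x : ℝ => D (x : S1) from
      funext fun x => (h1 x).deriv]
    exact hD.cont.comp S1.continuous_coe
  · rw [show sderiv g = D from funext fun s => (h s).deriv]
    exact hD

namespace ConjugationData.NormalForm

variable {Γ : Type*} [Group Γ] {κ : S1 ≃ₜ S1} {M : Type*} [TopologicalSpace M] [AddAction ℝ M]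
  {X : ConjugationData Γ κ M} {v : M → ℝ} {r : S1 × S1 → ℝ}

/-- The momentum is strictly monotone along the fibres, up to the sign of the curvature. -/
theorem strictMonoOn (N : X.NormalForm v r) {s : S1} {t₀ : ℝ} (h₀ : (t₀ : S1) = κ s) :
    StrictMonoOn (fun y : ℝ => X.sgn * r (s, (y : S1))) (Ioo t₀ (t₀ + 1)) := by
  obtain ⟨x, rfl⟩ := S1.coe_surjective s
  have hd : ∀ y ∈ Ioo t₀ (t₀ + 1), HasDerivAt (fun y : ℝ => X.sgn * r ((x : S1), (y : S1)))
      (X.f (toTorus (x, y))) y := by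
    intro y hy
    have h1 := (N.hasDerivAt x y (mem_annulus_of_Ioo h₀ hy)).const_mul X.sgn
    refine h1.congr_deriv ?_
    rcases X.sgn_eq with h | h <;> rw [h] <;> ring
  refine strictMonoOn_of_deriv_pos (convex_Ioo _ _)
    (fun y hy => (hd y hy).continuousAt.continuousWithinAt) fun y hy => ?_
  rw [interior_Ioo] at hy
  rw [(hd y hy).deriv]
  exact X.f_pos _ (mem_annulus_of_Ioo h₀ hy)

theorem injective_fibre (N : X.NormalForm v r) {s t t' : S1} (ht : (s, t) ∈ annulus κ)
    (ht' : (s, t') ∈ annulus κ) (h : r (s, t) = r (s, t')) : t = t' := by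
  obtain ⟨t₀, h₀⟩ := S1.coe_surjective (κ s)
  obtain ⟨y, hy, rfl⟩ := exists_lift_Ioo (t := t) (t₀ := t₀) (by rw [h₀]; exact ht)
  obtain ⟨y', hy', rfl⟩ := exists_lift_Ioo (t := t') (t₀ := t₀) (by rw [h₀]; exact ht')
  rw [(N.strictMonoOn h₀).injOn hy hy' (by simp only [h])]

theorem act_mem_annulus (X : ConjugationData Γ κ M) (γ : Γ) {s t : S1} (h : (s, t) ∈ annulus κ) :
    ((X.ρ₁ γ).1 s, (X.ρ₂ γ).1 t) ∈ annulus κ := by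
  change κ ((X.ρ₁ γ).1 s) ≠ (X.ρ₂ γ).1 t
  rw [← X.conjugate]
  exact fun e => h ((X.ρ₂ γ).1.injective e)

/-- Invariance of `dv - r ds` leaves no `dt` term in the differential of `v ∘ γ - v`, so this
difference depends on `s` only; its `ds` term is the transformation law of `r`, valid at every `t`
of the fibre. -/
theorem exists_cocycle (N : X.NormalForm v r) (γ : Γ) : ∃ g : S1 → ℝ, IsC1hFun g ∧
    (∀ m, v (X.act γ m) = v m + g (X.bundle.proj m).1) ∧
    ∀ s t, (s, t) ∈ annulus κ →
      sderiv g s = r ((X.ρ₁ γ).1 s, (X.ρ₂ γ).1 t) * cderiv (X.ρ₁ γ).1 s - r (s, t) := by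
  obtain ⟨c, hc, hd⟩ := N.isCoord.exists_cocycle (X.ρ₁ γ).2.1 (X.ρ₂ γ).2.1 (X.act_regular γ)
    (X.act_conn γ)
  have hfib : ∀ {s t t' : S1}, (s, t) ∈ annulus κ → (s, t') ∈ annulus κ → c (s, t) = c (s, t') := by
    refine eq_of_hasDerivAt_fibre fun x₀ y₀ h => ?_
    have h1 : HasDerivAt (fun y : ℝ => (x₀, y)) ((0 : ℝ), (1 : ℝ)) y₀ :=
      (hasDerivAt_const y₀ x₀).prodMk (hasDerivAt_id y₀)
    have h2 := (hd _ h).comp_hasDerivAt y₀ h1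
    simpa [Function.comp_def] using h2
  set g : S1 → ℝ := fun s => c (s, antipodal κ s) with hg
  have hder : ∀ s t, (s, t) ∈ annulus κ → HasDerivAt (fun x : ℝ => g (s + (x : S1)))
      (r ((X.ρ₁ γ).1 s, (X.ρ₂ γ).1 t) * cderiv (X.ρ₁ γ).1 s - r (s, t)) 0 := by
    intro s t hst
    obtain ⟨x₀, rfl⟩ := S1.coe_surjective s
    obtain ⟨y₀, rfl⟩ := S1.coe_surjective t
    have h1 : HasDerivAt (fun x : ℝ => (x₀ + x, y₀)) ((1 : ℝ), (0 : ℝ)) 0 :=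
      ((hasDerivAt_id (0 : ℝ)).const_add x₀).prodMk (hasDerivAt_const 0 y₀)
    have h2 := HasFDerivAt.comp_hasDerivAt (f := fun x : ℝ => (x₀ + x, y₀)) (0 : ℝ)
      (by rw [add_zero]; exact hd (x₀, y₀) hst) h1
    have h3 : HasDerivAt (fun x : ℝ => c (toTorus (x₀ + x, y₀)))
      (r ((X.ρ₁ γ).1 (x₀ : S1), (X.ρ₂ γ).1 (y₀ : S1)) * cderiv (X.ρ₁ γ).1 (x₀ : S1)
        - r ((x₀ : S1), (y₀ : S1))) 0 := by
      refine HasDerivAt.congr_deriv (f := fun x : ℝ => c (toTorus (x₀ + x, y₀))) h2 ?_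
      simp [toTorus]
      ring
    refine h3.congr_of_eventuallyEq ?_
    have hev : ∀ᶠ x : ℝ in 𝓝 0, toTorus (x₀ + x, y₀) ∈ annulus κ := by
      refine h1.continuousAt.eventually (eventually_toTorus ?_)
      simp only [add_zero]
      exact (isOpen_annulus κ.continuous).mem_nhds hst
    filter_upwards [hev] with x hx
    rw [← AddCircle.coe_add]
    exact hfib (antipodal_mem_annulus κ _) hx
  obtain ⟨c₀, hc₀⟩ := N.antipodal_eq
  -- The derivative is evaluated at the point of the antipodal section, where `r (s, t)` is constant
  -- and all remaining maps are Hölder in `s`.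
  have hD : IsHolder fun s => r ((X.ρ₁ γ).1 s, (X.ρ₂ γ).1 (antipodal κ s)) *
      cderiv (X.ρ₁ γ).1 s - r (s, antipodal κ s) := by
    refine isHolder_of_holderNear fun s => ?_
    simp only [hc₀]
    have hτ : HolderNear (antipodal κ) s := holderNear_of_lipschitz zero_le_one univ_mem
      fun y _ z _ => by rw [one_mul, dist_antipodal]
    have h1 : HolderNear (fun s => ((X.ρ₁ γ).1 s, (X.ρ₂ γ).1 (antipodal κ s))) s :=
      ((X.ρ₁ γ).2.1.lipschitz.holderNear s).prodMk
        (HolderNear.comp (f := (X.ρ₂ γ).1) ((X.ρ₂ γ).2.1.lipschitz.holderNear _) hτ)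
    exact ((HolderNear.comp (f := r)
      (g := fun s => ((X.ρ₁ γ).1 s, (X.ρ₂ γ).1 (antipodal κ s))) (locHolderOn_iff.1 N.holder _
      (act_mem_annulus X γ (antipodal_mem_annulus κ s))) h1).mul
      ((X.ρ₁ γ).2.1.2.holderNear s)).add (holderNear_const (-c₀) s)
  refine ⟨g, .of_hasDerivAt hD fun s => hder s _ (antipodal_mem_annulus κ s), fun m => ?_,
    fun s t hst => (hder s t hst).deriv⟩
  rw [hc]
  congr 1
  exact hfib (X.bundle.proj_mem m) (antipodal_mem_annulus κ _)

theorem _root_.cderiv_symm_mul (φ : DiffH) (s : S1) :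
    cderiv φ.1.symm (φ.1 s) * cderiv φ.1 s = 1 := by
  have h1 := (cderiv_comp φ.2.2 φ.2.1 s).deriv
  have h2 : (φ.1.symm ∘ φ.1 : S1 → S1) = id := funext fun x => φ.1.symm_apply_apply x
  rw [h2] at h1
  rw [← h1]
  exact cderiv_id s

theorem _root_.cderiv_ne_zero (φ : DiffH) (s : S1) : cderiv φ.1 s ≠ 0 :=
  right_ne_zero_of_mul_eq_one (cderiv_symm_mul φ s)

/-- The map of the bundle to the jet space given by the normal form. -/
def _root_.ConjugationData.jetChart (X : ConjugationData Γ κ M) (v : M → ℝ) (r : S1 × S1 → ℝ)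
    (m : M) : Jet :=
  ((X.bundle.proj m).1, r (X.bundle.proj m), v m)

/-- The element is `(g ∘ ρ₁(γ)⁻¹, ρ₁(γ))`: the transformation law of `r` is the rule by which
derivatives of functions change under such an element. -/
theorem exists_jetMap_jetChart (N : X.NormalForm v r) (γ : Γ) : ∃ G : JetGroup, G.right = X.ρ₁ γ ∧
    ∀ m, X.jetChart v r (X.act γ m) = jetMap G (X.jetChart v r m) := by
  obtain ⟨g, hg, hv, hd⟩ := N.exists_cocycle γ
  refine ⟨⟨Multiplicative.ofAdd ⟨fun θ => g ((X.ρ₁ γ).1.symm θ), hg.comp (X.ρ₁ γ).2.2⟩, X.ρ₁ γ⟩,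
    rfl, fun m => ?_⟩
  have hp := (X.act_regular γ).proj_map m
  set s := (X.bundle.proj m).1
  have h1 : sderiv (fun θ => g ((X.ρ₁ γ).1.symm θ)) ((X.ρ₁ γ).1 s) =
      sderiv g s * cderiv (X.ρ₁ γ).1.symm ((X.ρ₁ γ).1 s) := by
    have := (sderiv_comp hg (X.ρ₁ γ).2.2 ((X.ρ₁ γ).1 s)).deriv
    rwa [Homeomorph.symm_apply_apply] at this
  have h2 := hd s (X.bundle.proj m).2 (X.bundle.proj_mem m)
  have h3 := cderiv_symm_mul (X.ρ₁ γ) s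
  refine Prod.ext ?_ (Prod.ext ?_ ?_)
  · simp only [jetChart, jetMap, hp]
    rfl
  · simp only [jetChart, jetMap, JetGroup.fn]
    change r _ = r (X.bundle.proj m) * cderiv (X.ρ₁ γ).1.symm ((X.ρ₁ γ).1 s) +
      sderiv (fun θ => g ((X.ρ₁ γ).1.symm θ)) ((X.ρ₁ γ).1 s)
    rw [h1, h2, hp, sub_mul, mul_assoc, mul_comm (cderiv (X.ρ₁ γ).1 s), h3]
    ring
  · simp only [jetChart, jetMap, JetGroup.fn, hv]
    change v m + g s = v m + g ((X.ρ₁ γ).1.symm ((X.ρ₁ γ).1 s))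
    rw [Homeomorph.symm_apply_apply]

end ConjugationData.NormalForm

end

/-! ### Compact fundamental sets -/

noncomputable section

/-- A cocompact action on a locally compact space has a compact fundamental set. -/
theorem CompactQuotient.exists_isCompact {Γ X : Type*} [Group Γ] [TopologicalSpace X]
    [WeaklyLocallyCompactSpace X] {A : Γ →* (X ≃ₜ X)} (h : CompactQuotient A) :
    ∃ K : Set X, IsCompact K ∧ ∀ x, ∃ γ, A γ x ∈ K := by
  have hc := h.1
  let q : X → Quotient (orbitSetoid A) := Quotient.mk _
  -- The projection to the quotient is open because the saturation of an open set is the union of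
  -- its translates. A finite cover of the quotient by images of compact neighbourhoods then gives
  -- the compact set.
  have hq : ∀ U : Set X, IsOpen U → IsOpen (q '' U) := by
    intro U hU
    have e : q ⁻¹' (q '' U) = ⋃ γ, (A γ) ⁻¹' U := by
      ext x
      simp only [mem_preimage, mem_image, mem_iUnion]
      constructor
      · rintro ⟨y, hy, hyx⟩
        obtain ⟨γ, hγ⟩ := Quotient.exact hyx.symm
        exact ⟨γ, by rwa [hγ]⟩
      · rintro ⟨γ, hγ⟩
        exact ⟨A γ x, hγ, (Quotient.sound (show ∃ δ, A δ x = A γ x from ⟨γ, rfl⟩)).symm⟩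
    refine isQuotientMap_quot_mk.isOpen_preimage.1 ?_
    change IsOpen (q ⁻¹' (q '' U))
    rw [e]
    exact isOpen_iUnion fun γ => hU.preimage (A γ).continuous
  choose K hK hKx using fun x : X => exists_compact_mem_nhds x
  obtain ⟨F, hF⟩ := isCompact_univ.elim_finite_subcover (fun x => q '' interior (K x))
    (fun x => hq _ isOpen_interior) (by
      intro y _
      obtain ⟨x, rfl⟩ := Quotient.exists_rep y
      exact mem_iUnion.2 ⟨x, x, mem_interior_iff_mem_nhds.2 (hKx x), rfl⟩)
  refine ⟨⋃ x ∈ F, K x, F.isCompact_biUnion fun x _ => hK x, fun x => ?_⟩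
  obtain ⟨y, hy⟩ := mem_iUnion.1 (hF (mem_univ (q x)))
  obtain ⟨hyF, z, hz, hzx⟩ := mem_iUnion.1 hy
  obtain ⟨γ, hγ⟩ := Quotient.exact hzx.symm
  refine ⟨γ, ?_⟩
  rw [hγ]
  exact mem_biUnion hyF (interior_subset hz)

namespace ConjugationData.NormalForm

variable {Γ : Type*} [Group Γ] {κ : S1 ≃ₜ S1} {M : Type*} [TopologicalSpace M] [AddAction ℝ M]
  {X : ConjugationData Γ κ M} {v : M → ℝ} {r : S1 × S1 → ℝ}

theorem locallyCompactSpace (N : X.NormalForm v r) : LocallyCompactSpace M := by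
  have : LocallyCompactSpace (annulus κ) := (isOpen_annulus κ.continuous).locallyCompactSpace
  exact N.isCoord.homeo.isClosedEmbedding.locallyCompactSpace

theorem t2Space (N : X.NormalForm v r) : T2Space M :=
  N.isCoord.homeo.isClosedEmbedding.isEmbedding.t2Space

/-! ### Leaves in normal form -/

/-- The form `dv - r ds` restricts to `dv` on the curves with `s` fixed, so being parallel means
that `v` is constant. -/
theorem mem_leaves_iff (N : X.NormalForm v r) (p : (ℝ → M) × Set ℝ) :
    p ∈ PrincipalBundle.leaves X.conn ↔ ∃ (s : S1) (t₀ v₀ : ℝ), (t₀ : S1) = κ s ∧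
      p.2 = Ioo t₀ (t₀ + 1) ∧
      ∀ t ∈ Ioo t₀ (t₀ + 1), X.bundle.proj (p.1 t) = (s, (t : S1)) ∧ v (p.1 t) = v₀ := by
  constructor
  · rintro ⟨s, t₀, h₀, h2, hp⟩
    refine ⟨s, t₀, v (p.1 (t₀ + 1 / 2)), h₀, h2, fun t ht => ⟨(hp t ht).1, ?_⟩⟩
    have hd : ∀ t ∈ Ioo t₀ (t₀ + 1), HasDerivAt (fun t' => v (p.1 t')) 0 t := fun t ht => by
      simpa using N.isCoord.hasDerivAt_leaf hp ht
    exact isOpen_Ioo.is_const_of_deriv_eq_zero (𝕜 := ℝ) isPreconnected_Ioo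
      (f := fun t' => v (p.1 t'))
      (fun z hz => (hd z hz).differentiableAt.differentiableWithinAt)
      (fun z hz => (hd z hz).deriv) ht ⟨by linarith, by linarith⟩
  · rintro ⟨s, t₀, v₀, h₀, h2, hp⟩
    have := N.isCoord.mem_leaves (c := p.1) h₀ (fun t ht => (hp t ht).1) fun t ht => by
      rw [neg_zero]
      refine (hasDerivAt_const t v₀).congr_of_eventuallyEq ?_
      filter_upwards [isOpen_Ioo.mem_nhds ht] with t' ht'
      exact (hp t' ht').2
    rw [← h2] at this
    exact this

open Classical in
/-- The point of the bundle over `x` with coordinate `v₀`, for `x` in the annulus. -/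
def pt (N : X.NormalForm v r) (x : S1 × S1) (v₀ : ℝ) : M :=
  if h : x ∈ annulus κ then N.isCoord.homeo.symm (⟨x, h⟩, v₀)
  else N.isCoord.homeo.symm (⟨(x.1, antipodal κ x.1), antipodal_mem_annulus κ x.1⟩, v₀)

theorem proj_pt (N : X.NormalForm v r) {x : S1 × S1} {v₀ : ℝ} (h : x ∈ annulus κ) :
    X.bundle.proj (N.pt x v₀) = x := by
  rw [pt, dif_pos h]
  exact N.isCoord.proj_point _

theorem coord_pt (N : X.NormalForm v r) {x : S1 × S1} {v₀ : ℝ} (h : x ∈ annulus κ) :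
    v (N.pt x v₀) = v₀ := by
  rw [pt, dif_pos h]
  exact N.isCoord.coord_point _

theorem continuousOn_pt (N : X.NormalForm v r) :
    ContinuousOn (fun q : (S1 × S1) × ℝ => N.pt q.1 q.2) {q | q.1 ∈ annulus κ} := by
  rw [continuousOn_iff_continuous_domRestrict]
  have h : Continuous fun q : {q : (S1 × S1) × ℝ | q.1 ∈ annulus κ} =>
      N.isCoord.homeo.symm (⟨q.1.1, q.2⟩, q.1.2) :=
    N.isCoord.homeo.symm.continuous.comp
      (((continuous_fst.comp continuous_subtype_val).subtype_mk _).prodMk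
        (continuous_snd.comp continuous_subtype_val))
  refine h.congr fun q => ?_
  have hq : q.1.1 ∈ annulus κ := q.2
  simp only [domRestrict_apply, pt, dif_pos hq]

theorem eq_pt (N : X.NormalForm v r) (m : M) : N.pt (X.bundle.proj m) (v m) = m :=
  N.isCoord.ext (N.proj_pt (X.bundle.proj_mem m)) (N.coord_pt (X.bundle.proj_mem m))

theorem continuousOn_leaf (N : X.NormalForm v r) {s : S1} {t₀ : ℝ} (h₀ : (t₀ : S1) = κ s)
    (v₀ : ℝ) : ContinuousOn (fun t : ℝ => N.pt (s, (t : S1)) v₀) (Ioo t₀ (t₀ + 1)) :=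
  N.continuousOn_pt.comp (f := fun t : ℝ => ((s, (t : S1)), v₀))
    ((continuous_const.prodMk S1.continuous_coe).prodMk continuous_const).continuousOn
    fun _ ht => mem_annulus_of_Ioo h₀ ht

/-- Two points of a leaf, in normal form. -/
theorem leafDist_iff (N : X.NormalForm v r) {m : M → ℝ} {x y : M} {d : ℝ} :
    LeafDist (PrincipalBundle.leaves X.conn) m x y d ↔ ∃ (s : S1) (t₀ v₀ : ℝ), (t₀ : S1) = κ s ∧
      ∃ τ₁ ∈ Ioo t₀ (t₀ + 1), ∃ τ₂ ∈ Ioo t₀ (t₀ + 1), N.pt (s, (τ₁ : S1)) v₀ = x ∧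
        N.pt (s, (τ₂ : S1)) v₀ = y ∧ d = |∫ τ in τ₁..τ₂, m (N.pt (s, (τ : S1)) v₀)| := by
  constructor
  · rintro ⟨p, hp, τ₁, h₁, τ₂, h₂, hx, hy, hd⟩
    obtain ⟨s, t₀, v₀, h₀, hI, hc⟩ := (N.mem_leaves_iff p).1 hp
    rw [hI] at h₁ h₂
    have he : ∀ t ∈ Ioo t₀ (t₀ + 1), p.1 t = N.pt (s, (t : S1)) v₀ := fun t ht => by
      rw [← (hc t ht).1, ← (hc t ht).2, N.eq_pt]
    refine ⟨s, t₀, v₀, h₀, τ₁, h₁, τ₂, h₂, by rw [← he _ h₁, hx], by rw [← he _ h₂, hy], ?_⟩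
    rw [hd]
    congr 1
    refine intervalIntegral.integral_congr fun t ht => ?_
    rw [he t ((ordConnected_Ioo.uIcc_subset h₁ h₂) ht)]
  · rintro ⟨s, t₀, v₀, h₀, τ₁, h₁, τ₂, h₂, hx, hy, hd⟩
    refine ⟨(fun t : ℝ => N.pt (s, (t : S1)) v₀, Ioo t₀ (t₀ + 1)),
      (N.mem_leaves_iff _).2 ⟨s, t₀, v₀, h₀, rfl, fun t ht =>
      ⟨N.proj_pt (mem_annulus_of_Ioo h₀ ht), N.coord_pt (mem_annulus_of_Ioo h₀ ht)⟩⟩,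
      τ₁, h₁, τ₂, h₂, hx, hy, hd⟩

/-- The points of the leaves close to a compact set stay in a compact set. -/
theorem exists_isCompact_leafDist (N : X.NormalForm v r) {m : M → ℝ} (hm : Continuous m)
    (hpos : ∀ x, 0 < m x) {C : Set M} (hC : IsCompact C) : ∃ C' : Set M, IsCompact C' ∧
      ∃ ε > 0, ∀ x ∈ C, ∀ y d, LeafDist (PrincipalBundle.leaves X.conn) m x y d → d ≤ ε → y ∈ C' := by
  rcases C.eq_empty_or_nonempty with rfl | hne
  · exact ⟨∅, isCompact_empty, 1, one_pos, fun x hx => absurd hx (notMem_empty x)⟩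
  have hpr := X.bundle.continuous_proj
  have hcd : Continuous fun x : M => dist (κ (X.bundle.proj x).1) (X.bundle.proj x).2 :=
    (κ.continuous.comp (continuous_fst.comp hpr)).dist (continuous_snd.comp hpr)
  obtain ⟨x₀, -, hx₀⟩ := hC.exists_isMinOn hne hcd.continuousOn
  -- Half of the least distance, over `C`, from `t` to `κ s`: displacements of `t` by at most `δ`
  -- remain in the annulus.
  set δ := dist (κ (X.bundle.proj x₀).1) (X.bundle.proj x₀).2 / 2 with hδ
  have hδ0 : 0 < δ := half_pos (dist_pos.2 (X.bundle.proj_mem x₀))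
  have hmin : ∀ x ∈ C, 2 * δ ≤ dist (κ (X.bundle.proj x).1) (X.bundle.proj x).2 := fun x hx => by
    rw [hδ, mul_div_cancel₀ _ two_ne_zero]
    exact hx₀ hx
  have hshift : ∀ x ∈ C, ∀ y : ℝ, |y| ≤ δ →
      ((X.bundle.proj x).1, (X.bundle.proj x).2 + (y : S1)) ∈ annulus κ := by
    intro x hx y hy e
    have h1 := hmin x hx
    simp only at e
    rw [e] at h1
    have h2 := S1.dist_coe_le (x := y) (y := 0)
    rw [sub_zero] at h2
    have h3 : dist ((X.bundle.proj x).2 + (y : S1)) (X.bundle.proj x).2 = dist (y : S1) (0 : ℝ) := by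
      rw [AddCircle.coe_zero, dist_eq_norm, dist_eq_norm, add_sub_cancel_left, sub_zero]
    linarith
  -- the thickening of `C` along the leaves
  let Φ : M × ℝ → M := fun q =>
    N.pt ((X.bundle.proj q.1).1, (X.bundle.proj q.1).2 + (q.2 : S1)) (v q.1)
  have hΦ : ContinuousOn Φ (C ×ˢ Icc (-δ) δ) := by
    refine N.continuousOn_pt.comp (f := fun q : M × ℝ =>
      (((X.bundle.proj q.1).1, (X.bundle.proj q.1).2 + (q.2 : S1)), v q.1)) ?_ ?_
    · have hv := N.isCoord.continuous
      have hs := S1.continuous_coe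
      exact Continuous.continuousOn (by fun_prop)
    · rintro ⟨x, y⟩ ⟨hx, hy⟩
      exact hshift x hx y (abs_le.2 hy)
  have hC' : IsCompact (Φ '' (C ×ˢ Icc (-δ) δ)) := (hC.prod isCompact_Icc).image_of_continuousOn hΦ
  have hne' : (Φ '' (C ×ˢ Icc (-δ) δ)).Nonempty :=
    (hne.prod (nonempty_Icc.2 (by linarith))).image _
  -- The metric is bounded below by its minimum on the compact thickening. A curve that leaves the
  -- thickening has length at least `m z₀ * δ`, and `ε` is half of this.
  obtain ⟨z₀, -, hz₀⟩ := hC'.exists_isMinOn hne' hm.continuousOn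
  refine ⟨_, hC', m z₀ * δ / 2, by have := hpos z₀; positivity, fun x hx y d hd hdε => ?_⟩
  obtain ⟨s, t₀, v₀, h₀, τ₁, h₁, τ₂, h₂, hx1, hy1, hd1⟩ := N.leafDist_iff.1 hd
  have hpx : X.bundle.proj x = (s, (τ₁ : S1)) := by
    rw [← hx1, N.proj_pt (mem_annulus_of_Ioo h₀ h₁)]
  have hvx : v x = v₀ := by rw [← hx1, N.coord_pt (mem_annulus_of_Ioo h₀ h₁)]
  have hmem : ∀ τ, |τ - τ₁| ≤ δ → N.pt (s, (τ : S1)) v₀ ∈ Φ '' (C ×ˢ Icc (-δ) δ) := by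
    intro τ hτ
    refine ⟨(x, τ - τ₁), ⟨hx, abs_le.1 hτ⟩, ?_⟩
    simp only [Φ, hpx, hvx]
    rw [← AddCircle.coe_add, add_sub_cancel]
  by_contra hy
  have hfar : δ < |τ₂ - τ₁| := by
    by_contra hle
    exact hy (hy1 ▸ hmem τ₂ (not_lt.1 hle))
  have hcont : ∀ a ∈ Ioo t₀ (t₀ + 1), ∀ b ∈ Ioo t₀ (t₀ + 1),
      IntervalIntegrable (fun τ : ℝ => m (N.pt (s, (τ : S1)) v₀)) volume a b := by
    intro a ha b hb
    refine ContinuousOn.intervalIntegrable ?_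
    exact (hm.comp_continuousOn (N.continuousOn_leaf h₀ v₀)).mono
      (ordConnected_Ioo.uIcc_subset ha hb)
  have hz0 := hpos z₀
  -- Only a subsegment of length `δ` next to `τ₁` is used for the lower bound, since the rest of the
  -- curve may lie outside the thickening; positivity of `m` takes care of the rest.
  have key : ∀ a b : ℝ, a ∈ Ioo t₀ (t₀ + 1) → b ∈ Ioo t₀ (t₀ + 1) → a ≤ b →
      ∀ c, c ∈ Icc a (b - δ) → (∀ τ ∈ Icc c (c + δ), |τ - τ₁| ≤ δ) →
      m z₀ * δ ≤ ∫ τ in a..b, m (N.pt (s, (τ : S1)) v₀) := by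
    intro a b ha hb hab c hc hτ
    have hcI : c ∈ Ioo t₀ (t₀ + 1) := ⟨ha.1.trans_le hc.1, by linarith [hc.2, hb.2]⟩
    have hcI' : c + δ ∈ Ioo t₀ (t₀ + 1) := ⟨by linarith [ha.1, hc.1], by linarith [hc.2, hb.2]⟩
    have e1 := intervalIntegral.integral_add_adjacent_intervals (hcont a ha c hcI)
      (hcont c hcI (c + δ) hcI')
    have e2 := intervalIntegral.integral_add_adjacent_intervals (hcont a ha (c + δ) hcI')
      (hcont (c + δ) hcI' b hb)
    have n1 : 0 ≤ ∫ τ in a..c, m (N.pt (s, (τ : S1)) v₀) :=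
      intervalIntegral.integral_nonneg hc.1 fun τ _ => (hpos _).le
    have n2 : 0 ≤ ∫ τ in (c + δ)..b, m (N.pt (s, (τ : S1)) v₀) :=
      intervalIntegral.integral_nonneg (by linarith [hc.2]) fun τ _ => (hpos _).le
    have n3 : ∫ τ in c..(c + δ), m z₀ ≤ ∫ τ in c..(c + δ), m (N.pt (s, (τ : S1)) v₀) :=
      intervalIntegral.integral_mono_on (by linarith) (by simp) (hcont c hcI _ hcI')
        fun τ hτ' => hz₀ (hmem τ (hτ τ hτ'))
    rw [intervalIntegral.integral_const, add_sub_cancel_left, smul_eq_mul] at n3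
    linarith
  have hbig : m z₀ * δ ≤ d := by
    rw [hd1]
    rcases le_total τ₁ τ₂ with hle | hle
    · rw [abs_of_nonneg (sub_nonneg.2 hle)] at hfar
      refine (key τ₁ τ₂ h₁ h₂ hle τ₁ ⟨le_rfl, by linarith⟩ fun τ hτ => ?_).trans (le_abs_self _)
      rw [abs_le]
      constructor <;> linarith [hτ.1, hτ.2]
    · rw [abs_of_nonpos (sub_nonpos.2 hle)] at hfar
      rw [intervalIntegral.integral_symm, abs_neg]
      refine (key τ₂ τ₁ h₂ h₁ hle (τ₁ - δ) ⟨by linarith, le_rfl⟩ fun τ hτ => ?_).trans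
        (le_abs_self _)
      rw [abs_le]
      constructor <;> linarith [hτ.1, hτ.2]
  nlinarith

end ConjugationData.NormalForm

end

/-! ### Recurrence, expanding sequences and surjectivity of the momentum -/

noncomputable section

instance : Infinite S1 :=
  Set.infinite_univ_iff.1 (((Ioo_infinite (zero_lt_one (α := ℝ))).image (f := fun x : ℝ => (x : S1))
    fun x hx y hy e => S1.coe_inj (by
      rw [abs_lt]; constructor <;> linarith [hx.1, hx.2, hy.1, hy.2]) e).mono (subset_univ _))

namespace ConjugationData.NormalForm

variable {Γ : Type*} [Group Γ] {κ : S1 ≃ₜ S1} {M : Type*} [TopologicalSpace M] [AddAction ℝ M]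
  {X : ConjugationData Γ κ M} {v : M → ℝ} {r : S1 × S1 → ℝ}

/-- The second action is the conjugate of the first by `κ`, so its limit points are the images of
`A` and `B`. -/
theorem tendsto_ρ₂ {l : Filter ℕ} {γ : ℕ → Γ} {A B : S1}
    (h : ∀ s, s ≠ A → Tendsto (fun n => (X.ρ₁ (γ n)).1 s) l (𝓝 B)) {t : S1} (ht : κ A ≠ t) :
    Tendsto (fun n => (X.ρ₂ (γ n)).1 t) l (𝓝 (κ B)) := by
  have h1 := h (κ.symm t) fun e => ht (by rw [← e, κ.apply_symm_apply])
  refine ((κ.continuous.tendsto B).comp h1).congr fun n => ?_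
  rw [Function.comp, ← X.conjugate, κ.apply_symm_apply]

/-- A point whose forward orbit recurs to a compact set under a sequence of elements of the group
lies over the repelling point of this sequence. -/
theorem eq_of_recurrent (N : X.NormalForm v r) {γ : ℕ → Γ} {T : ℕ → ℝ} {l : Ultrafilter ℕ}
    (hT : Tendsto T l atTop) {x : M} {C : Set M} (hC : IsCompact C)
    (hx : ∀ᶠ n in (l : Filter ℕ), X.act (γ n) (T n +ᵥ x) ∈ C) {A B : S1}
    (hAB : ∀ s, s ≠ A → Tendsto (fun n => (X.ρ₁ (γ n)).1 s) l (𝓝 B)) :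
    (X.bundle.proj x).1 = A := by
  have := N.t2Space
  -- the orbit of a point with `s ≠ A` and `t ≠ κ A` cannot recur
  have hno : ∀ y : M, (X.bundle.proj y).1 ≠ A → κ A ≠ (X.bundle.proj y).2 → ∀ C : Set M,
      IsCompact C → ¬ ∀ᶠ n in (l : Filter ℕ), X.act (γ n) (T n +ᵥ y) ∈ C := by
    intro y h1 h2 C hC hy
    obtain ⟨z, -, hz⟩ := hC.ultrafilter_le_nhds'
      (l.map fun n => X.act (γ n) (T n +ᵥ y)) hy
    have hz' : Tendsto (fun n => X.act (γ n) (T n +ᵥ y)) l (𝓝 z) := hz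
    have hp := (X.bundle.continuous_proj.tendsto z).comp hz'
    have e1 := (continuous_fst.tendsto (X.bundle.proj z)).comp hp
    have e2 := (continuous_snd.tendsto (X.bundle.proj z)).comp hp
    have hpn : ∀ n, X.bundle.proj (X.act (γ n) (T n +ᵥ y)) =
        ((X.ρ₁ (γ n)).1 (X.bundle.proj y).1, (X.ρ₂ (γ n)).1 (X.bundle.proj y).2) := fun n => by
      rw [(X.act_regular (γ n)).proj_map, X.bundle.proj_vadd]
    have f1 : (X.bundle.proj z).1 = B := tendsto_nhds_unique e1
      ((hAB _ h1).congr fun n => by simp only [Function.comp, hpn])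
    have f2 : (X.bundle.proj z).2 = κ B := tendsto_nhds_unique e2
      ((tendsto_ρ₂ hAB h2).congr fun n => by simp only [Function.comp, hpn])
    exact X.bundle.proj_mem z (by rw [f1, f2])
  by_contra hA
  -- A point with both coordinates off the repelling pair is pushed to `(B, κ B)`, outside the
  -- annulus, and cannot recur. There remains the case in which only `t` is repelling.
  have ht : κ A = (X.bundle.proj x).2 := by
    by_contra ht
    exact hno x hA ht C hC hx
  obtain ⟨m, hm, hcontr⟩ := X.contracts
  -- In this case `x` is replaced by a nearby point of its leaf, whose second coordinate is no
  -- longer `κ A`. The contraction keeps its forward orbit within `ε` of that of `x`, so it also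
  -- recurs to a compact set.
  obtain ⟨C', hC', ε, hε, hthick⟩ := N.exists_isCompact_leafDist hm.continuous hm.pos hC
  obtain ⟨α, hα, t₁, hcontr⟩ := hcontr ε hε
  obtain ⟨t₀, h₀⟩ := S1.coe_surjective (κ (X.bundle.proj x).1)
  obtain ⟨τ, hτ, hτx⟩ := exists_lift_Ioo (t := (X.bundle.proj x).2) (t₀ := t₀)
    (by rw [h₀]; exact X.bundle.proj_mem x)
  set s := (X.bundle.proj x).1 with hs
  have hxpt : N.pt (s, (τ : S1)) (v x) = x := by rw [hτx]; exact N.eq_pt x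
  -- a nearby point on the leaf
  obtain ⟨τ', hτ', hne, hd⟩ : ∃ τ' ∈ Ioo t₀ (t₀ + 1), τ' ≠ τ ∧
      |∫ y in τ..τ', m (N.pt (s, (y : S1)) (v x))| ≤ α := by
    have hcont := hm.continuous.comp_continuousOn (N.continuousOn_leaf h₀ (v x))
    have h1 : HasDerivAt (fun u => ∫ y in τ..u, m (N.pt (s, (y : S1)) (v x)))
        (m (N.pt (s, (τ : S1)) (v x))) τ := by
      refine intervalIntegral.integral_hasDerivAt_right (by simp) ?_
        (hcont.continuousAt (isOpen_Ioo.mem_nhds hτ))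
      exact hcont.stronglyMeasurableAtFilter isOpen_Ioo τ hτ
    have h2 := h1.continuousAt.abs
    have h3 : ∀ᶠ u in 𝓝 τ, |∫ y in τ..u, m (N.pt (s, (y : S1)) (v x))| < α :=
      h2.eventually_lt continuousAt_const (by simpa using hα)
    obtain ⟨u, hu, hu2⟩ := ((h3.and (isOpen_Ioo.mem_nhds hτ)).filter_mono
      (nhdsWithin_le_nhds (s := {τ}ᶜ))).and self_mem_nhdsWithin |>.exists
    exact ⟨u, hu.2, hu2, hu.1.le⟩
  set y := N.pt (s, (τ' : S1)) (v x) with hy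
  have hpy : X.bundle.proj y = (s, (τ' : S1)) := N.proj_pt (mem_annulus_of_Ioo h₀ hτ')
  refine hno y (by rw [hpy]; exact hA) ?_ C' hC' ?_
  · rw [hpy, ht, ← hτx]
    intro e
    refine hne (S1.coe_inj ?_ e).symm
    rw [abs_lt]
    constructor <;> linarith [hτ.1, hτ.2, hτ'.1, hτ'.2]
  · filter_upwards [hx, hT.eventually_ge_atTop t₁] with n hn hTn
    have hxy : LeafDist (PrincipalBundle.leaves X.conn) m x y
        |∫ y in τ..τ', m (N.pt (s, (y : S1)) (v x))| :=
      N.leafDist_iff.2 ⟨s, t₀, v x, h₀, τ, hτ, τ', hτ', hxpt, rfl, rfl⟩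
    obtain ⟨d', hd', hL⟩ := hcontr (T n) hTn x y _ hxy hd
    exact hthick _ hn _ _ (hm.invariant (γ n) _ _ _ hL) hd'

/-- For every point `s` of the circle, the group contains a sequence that expands at `s`. -/
structure IsExpanding (X : ConjugationData Γ κ M) (γ : ℕ → Γ) (l : Ultrafilter ℕ)
    (s a B : S1) : Prop where
  ne : a ≠ B
  tendsto : ∀ s', s' ≠ s → Tendsto (fun n => (X.ρ₁ (γ n)).1 s') l (𝓝 B)
  tendsto_self : Tendsto (fun n => (X.ρ₁ (γ n)).1 s) l (𝓝 a)
  diverge : ∀ δ, ∀ᶠ n in (l : Filter ℕ), γ n ≠ δ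

/-- Flow a point over `s` for time `n` and bring it back to a compact set by `γ n`. As `v` is
bounded there, the cocycle at `s` is `-n` up to a constant, so `γ n` diverges; `eq_of_recurrent`
identifies the repelling point with `s`. A limit of the returned points lies in the annulus over
`(a, κ B)`, whence `a ≠ B`. The bound holds for all points over `s` because the cocycle depends on
`s` only. -/
theorem exists_expanding (N : X.NormalForm v r) (s : S1) : ∃ γ l a B, IsExpanding X γ l s a B ∧
    Tendsto (fun n : ℕ => (n : ℝ)) l atTop ∧ ∃ C : ℝ, ∀ m, (X.bundle.proj m).1 = s → ∀ n : ℕ, |v (X.act (γ n) m) - v m + n| ≤ C := by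
  have := N.t2Space
  have := N.locallyCompactSpace
  obtain ⟨K, hK, hKx⟩ := X.compact.exists_isCompact
  obtain ⟨x, hx⟩ := X.bundle.exists_proj_eq (antipodal_mem_annulus κ s)
  have hxs : (X.bundle.proj x).1 = s := by rw [hx]
  choose γ hγ using fun n : ℕ => hKx ((n : ℝ) +ᵥ x)
  set l : Ultrafilter ℕ := Filter.hyperfilter ℕ with hl
  have hT : Tendsto (fun n : ℕ => (n : ℝ)) l atTop :=
    tendsto_natCast_atTop_atTop.mono_left Nat.hyperfilter_le_atTop
  obtain ⟨R, hR⟩ := hK.exists_bound_of_continuousOn (f := v) N.isCoord.continuous.continuousOn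
  have hvn : ∀ n : ℕ, v (X.act (γ n) ((n : ℝ) +ᵥ x)) = v (X.act (γ n) x) + n := fun n => by
    rw [(X.act_regular (γ n)).map_vadd, N.isCoord.vadd]
  have hdiv : ∀ δ, ∀ᶠ n in (l : Filter ℕ), γ n ≠ δ := by
    intro δ
    by_contra hcon
    have h1 : ∀ᶠ n in (l : Filter ℕ), ¬ γ n ≠ δ := Ultrafilter.eventually_not.2 hcon
    obtain ⟨n, hn1, hn2⟩ := (h1.and (hT.eventually_gt_atTop (R - v (X.act δ x)))).exists
    have h2 := hR _ (hγ n)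
    rw [hvn, not_not.1 hn1, Real.norm_eq_abs] at h2
    have := (abs_le.1 h2).2
    linarith
  obtain ⟨A, B, hAB, -⟩ := X.hFuchsian₁.exists_limit γ l hdiv
  have hA : s = A := by
    rw [← hxs]
    exact N.eq_of_recurrent hT hK (Eventually.of_forall hγ) hAB
  subst hA
  obtain ⟨z, -, hz⟩ := hK.ultrafilter_le_nhds' (l.map fun n : ℕ => X.act (γ n) ((n : ℝ) +ᵥ x))
    (Filter.mem_map.2 (Filter.univ_mem' hγ))
  have hz' : Tendsto (fun n : ℕ => X.act (γ n) ((n : ℝ) +ᵥ x)) l (𝓝 z) := hz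
  have hp := (X.bundle.continuous_proj.tendsto z).comp hz'
  have e1 := (continuous_fst.tendsto (X.bundle.proj z)).comp hp
  have e2 := (continuous_snd.tendsto (X.bundle.proj z)).comp hp
  have hpn : ∀ n : ℕ, X.bundle.proj (X.act (γ n) ((n : ℝ) +ᵥ x)) =
      ((X.ρ₁ (γ n)).1 s, (X.ρ₂ (γ n)).1 (antipodal κ s)) := fun n => by
    rw [(X.act_regular (γ n)).proj_map, X.bundle.proj_vadd, hx]
  have f2 : (X.bundle.proj z).2 = κ B := tendsto_nhds_unique e2
    ((tendsto_ρ₂ hAB (antipodal_ne κ s).symm).congr fun n => by simp only [Function.comp, hpn])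
  refine ⟨γ, l, (X.bundle.proj z).1, B, ⟨fun e => X.bundle.proj_mem z (by rw [e, f2]), hAB,
    e1.congr fun n => by simp only [Function.comp, hpn], hdiv⟩, hT, R + |v x|, fun m hm n => ?_⟩
  obtain ⟨g, -, hg, -⟩ := N.exists_cocycle (γ n)
  have h2 := hR _ (hγ n)
  rw [hvn, hg, hxs, Real.norm_eq_abs] at h2
  rw [hg, hm, show v m + g s - v m + n = (v x + g s + n) - v x by ring]
  exact (abs_sub _ _).trans (by linarith)

/-- Solving `r (s', t) = w` for `t`, near a given solution. -/
theorem exists_preimage_near (N : X.NormalForm v r) {a : S1} {y : ℝ}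
    (hD : (a, (y : S1)) ∈ annulus κ) {η : ℝ} (hη : 0 < η) :
    ∃ V ∈ 𝓝 (r (a, (y : S1))), ∀ᶠ s' in 𝓝 a, ∀ w ∈ V, ∃ u : ℝ, |u - y| < η ∧
      (s', (u : S1)) ∈ annulus κ ∧ r (s', (u : S1)) = w := by
  obtain ⟨t₀, h₀, hy⟩ : ∃ t₀ : ℝ, (t₀ : S1) = κ a ∧ y ∈ Ioo t₀ (t₀ + 1) := by
    obtain ⟨t₁, h₁⟩ := S1.coe_surjective (κ a)
    obtain ⟨y', hy', e⟩ := exists_lift_Ioo (t := (y : S1)) (t₀ := t₁) (by rw [h₁]; exact hD)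
    refine ⟨t₁ + (y - y'), ?_, ⟨by linarith [hy'.1], by linarith [hy'.2]⟩⟩
    rw [AddCircle.coe_add, AddCircle.coe_sub, e, sub_self, add_zero, h₁]
  have hmono := N.strictMonoOn h₀
  obtain ⟨y₁, k₁, b₁⟩ := exists_between (show max t₀ (y - η) < y from max_lt hy.1 (by linarith))
  obtain ⟨y₂, b₂, k₂⟩ := exists_between
    (show y < min (t₀ + 1) (y + η) from lt_min hy.2 (by linarith))
  rw [max_lt_iff] at k₁
  rw [lt_min_iff] at k₂
  have m₁ : y₁ ∈ Ioo t₀ (t₀ + 1) := ⟨k₁.1, b₁.trans hy.2⟩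
  have m₂ : y₂ ∈ Ioo t₀ (t₀ + 1) := ⟨hy.1.trans b₂, k₂.1⟩
  set ρ : S1 → ℝ → ℝ := fun s' u => X.sgn * r (s', (u : S1)) with hρ
  have c₁ : ρ a y₁ < ρ a y := hmono m₁ hy b₁
  have c₂ : ρ a y < ρ a y₂ := hmono hy m₂ b₂
  -- The admissible values lie strictly inside the range of `r` between `y₁` and `y₂`. The margin
  -- survives a small change of `s'`, and the intermediate value theorem solves the equation.
  refine ⟨{w | (ρ a y₁ + ρ a y) / 2 < X.sgn * w ∧ X.sgn * w < (ρ a y + ρ a y₂) / 2}, ?_, ?_⟩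
  · refine (IsOpen.inter (isOpen_lt continuous_const (continuous_const.mul continuous_id))
      (isOpen_lt (continuous_const.mul continuous_id) continuous_const)).mem_nhds ⟨?_, ?_⟩
    · change (ρ a y₁ + ρ a y) / 2 < ρ a y
      linarith
    · change ρ a y < (ρ a y + ρ a y₂) / 2
      linarith
  · have hcont : ∀ u ∈ Ioo t₀ (t₀ + 1), ContinuousAt (fun s' => ρ s' u) a := fun u hu =>
      continuousAt_const.mul (ContinuousAt.comp (f := fun s' : S1 => (s', (u : S1)))
        (N.continuousOn.continuousAt
          ((isOpen_annulus κ.continuous).mem_nhds (mem_annulus_of_Ioo h₀ hu))) (by fun_prop))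
    have hseg : ∀ᶠ s' in 𝓝 a, ∀ u ∈ Icc y₁ y₂, (s', (u : S1)) ∈ annulus κ := by
      refine isCompact_Icc.eventually_forall_of_forall_eventually fun u hu => ?_
      have hc : Continuous fun z : S1 × ℝ => (z.1, (z.2 : S1)) :=
        continuous_fst.prodMk (S1.continuous_coe.comp continuous_snd)
      exact ((isOpen_annulus κ.continuous).preimage hc).mem_nhds
        (mem_annulus_of_Ioo h₀ ⟨m₁.1.trans_le hu.1, hu.2.trans_lt m₂.2⟩)
    filter_upwards [hseg, (hcont y₁ m₁).eventually_lt continuousAt_const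
      (show ρ a y₁ < (ρ a y₁ + ρ a y) / 2 by linarith), continuousAt_const.eventually_lt
      (hcont y₂ m₂) (show (ρ a y + ρ a y₂) / 2 < ρ a y₂ by linarith)] with s' hs' h1 h2 w hw
    have hcs : ContinuousOn (ρ s') (Icc y₁ y₂) :=
      continuousOn_const.mul (N.continuousOn.comp (f := fun u : ℝ => (s', (u : S1)))
        (continuous_const.prodMk S1.continuous_coe).continuousOn fun u hu => hs' u hu)
    obtain ⟨u, hu, huw⟩ := intermediate_value_Icc (by linarith) hcs
      ⟨(h1.trans hw.1).le, (hw.2.trans h2).le⟩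
    refine ⟨u, abs_lt.2 ⟨by linarith [hu.1], by linarith [hu.2]⟩, hs' u hu,
      mul_left_cancel₀ X.sgn_ne huw⟩

/-- The momentum takes all values along each fibre. -/
theorem surjective_fibre (N : X.NormalForm v r) (s : S1) (q : ℝ) :
    ∃ t, (s, t) ∈ annulus κ ∧ r (s, t) = q := by
  obtain ⟨γ, l, a, B, hE, -⟩ := N.exists_expanding s
  choose g hg1 hg2 hg using fun n => N.exists_cocycle (γ n)
  -- all points of the fibre over `s` converge to the same point of the annulus
  have hlim : ∀ t, (s, t) ∈ annulus κ →
      Tendsto (fun n => r ((X.ρ₁ (γ n)).1 s, (X.ρ₂ (γ n)).1 t)) l (𝓝 (r (a, κ B))) := by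
    intro t ht
    have hD : (a, κ B) ∈ annulus κ := fun e => hE.ne (κ.injective e)
    have h1 := N.continuousOn.continuousAt ((isOpen_annulus κ.continuous).mem_nhds hD)
    exact h1.tendsto.comp (hE.tendsto_self.prodMk_nhds (tendsto_ρ₂ hE.tendsto ht))
  have hD : (a, κ B) ∈ annulus κ := fun e => hE.ne (κ.injective e)
  -- the images of the fibres near `a` contain a fixed neighbourhood
  obtain ⟨V, hV, hVs⟩ : ∃ V ∈ 𝓝 (r (a, κ B)), ∀ᶠ s' in 𝓝 a, ∀ w ∈ V, ∃ t, (s', t) ∈ annulus κ ∧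
      r (s', t) = w := by
    obtain ⟨y, hyB⟩ := S1.coe_surjective (κ B)
    rw [← hyB] at hD ⊢
    obtain ⟨V, hV, h⟩ := N.exists_preimage_near hD one_pos
    refine ⟨V, hV, h.mono fun s' hs' w hw => ?_⟩
    obtain ⟨u, -, hu⟩ := hs' w hw
    exact ⟨(u : S1), hu⟩
  -- the derivatives diverge
  obtain ⟨t', ht', hne⟩ : ∃ t', (s, t') ∈ annulus κ ∧ t' ≠ antipodal κ s := by
    obtain ⟨t₀, h₀⟩ := S1.coe_surjective (κ s)
    by_contra hcon
    push Not at hcon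
    have m₁ : t₀ + 1 / 3 ∈ Ioo t₀ (t₀ + 1) := ⟨by linarith, by linarith⟩
    have m₂ : t₀ + 2 / 3 ∈ Ioo t₀ (t₀ + 1) := ⟨by linarith, by linarith⟩
    have e1 := hcon _ (mem_annulus_of_Ioo h₀ m₁)
    have e2 := hcon _ (mem_annulus_of_Ioo h₀ m₂)
    have := S1.coe_inj (by rw [abs_lt]; constructor <;> linarith) (e1.trans e2.symm)
    linarith
  have hτ := antipodal_mem_annulus κ s
  have hρ : r (s, antipodal κ s) - r (s, t') ≠ 0 := fun e =>
    hne (N.injective_fibre hτ ht' (sub_eq_zero.1 e)).symm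
  -- Subtracting the transformation law of `r` at two points of one fibre eliminates the cocycle and
  -- expresses the inverse of the derivative by differences of momenta. The two image points have
  -- the same limit, so these tend to zero.
  have hDn : ∀ n, (cderiv (X.ρ₁ (γ n)).1 s)⁻¹ =
      (r ((X.ρ₁ (γ n)).1 s, (X.ρ₂ (γ n)).1 (antipodal κ s)) -
        r ((X.ρ₁ (γ n)).1 s, (X.ρ₂ (γ n)).1 t')) / (r (s, antipodal κ s) - r (s, t')) := fun n => by
    have h1 := hg n s _ hτ
    have h2 := hg n s _ ht'
    have h3 := cderiv_ne_zero (X.ρ₁ (γ n)) s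
    rw [eq_div_iff hρ, inv_mul_eq_div, div_eq_iff h3]
    linarith
  have hD0 : Tendsto (fun n => (cderiv (X.ρ₁ (γ n)).1 s)⁻¹) l (𝓝 0) := by
    have := ((hlim _ hτ).sub (hlim _ ht')).div_const (r (s, antipodal κ s) - r (s, t'))
    rw [sub_self, zero_div] at this
    exact this.congr fun n => (hDn n).symm
  -- The sequence consists of the values that `r` must take at the image under `γ n` of a point over
  -- `s` with momentum `q`. The correction is multiplied by the inverse derivative, so these values
  -- enter the fixed set `V`.
  have hw : Tendsto (fun n => r ((X.ρ₁ (γ n)).1 s, (X.ρ₂ (γ n)).1 (antipodal κ s)) +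
      (q - r (s, antipodal κ s)) * (cderiv (X.ρ₁ (γ n)).1 s)⁻¹) l (𝓝 (r (a, κ B))) := by
    simpa using (hlim _ hτ).add (hD0.const_mul (q - r (s, antipodal κ s)))
  obtain ⟨n, hn1, hn2⟩ := ((hE.tendsto_self.eventually hVs).and (hw hV)).exists
  obtain ⟨t, ht, hrt⟩ := hn1 _ hn2
  have hst : (s, (X.ρ₂ (γ n)).1.symm t) ∈ annulus κ := by
    intro e
    apply ht
    simp only at e ⊢
    rw [← X.conjugate, e, Homeomorph.apply_symm_apply]
  refine ⟨_, hst, ?_⟩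
  have h1 := hg n s _ hτ
  have h2 := hg n s _ hst
  rw [Homeomorph.apply_symm_apply, hrt] at h2
  have h3 := cderiv_ne_zero (X.ρ₁ (γ n)) s
  have h4 : (q - r (s, antipodal κ s)) * (cderiv (X.ρ₁ (γ n)).1 s)⁻¹ * cderiv (X.ρ₁ (γ n)).1 s =
    q - r (s, antipodal κ s) := by rw [mul_assoc, inv_mul_cancel₀ h3, mul_one]
  rw [add_mul, h4] at h2
  linarith

/-- Some element of the group has north-south dynamics. -/
theorem exists_isNorthSouth (N : X.NormalForm v r) : ∃ γ, IsNorthSouth (X.ρ₁ γ).1 := by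
  obtain ⟨γ, l, a, B, hE, -⟩ := N.exists_expanding 0
  -- A fixed `γ m` with `ρ₁(γ m) 0 ≠ B` is used to move the attracting point: the products `(γ m)⁻¹
  -- γ n` still repel from `0` and attract to a point different from `0`.
  obtain ⟨m, hm⟩ := (hE.tendsto_self.eventually_ne hE.ne).exists
  have hact : ∀ n s, (X.ρ₁ ((γ m)⁻¹ * γ n)).1 s =
      (X.ρ₁ (γ m)).1.symm ((X.ρ₁ (γ n)).1 s) := fun n s => by
    rw [map_mul, map_inv]
    rfl
  obtain ⟨A, B', hAB, hNS⟩ := X.hFuchsian₁.exists_limit (fun n => (γ m)⁻¹ * γ n) l fun δ => by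
    filter_upwards [hE.diverge (γ m * δ)] with n hn e
    exact hn (by rw [← e, mul_inv_cancel_left])
  have hB : ∀ s, s ≠ 0 → Tendsto (fun n => (X.ρ₁ ((γ m)⁻¹ * γ n)).1 s) l
      (𝓝 ((X.ρ₁ (γ m)).1.symm B)) := fun s hs => by
    simp only [hact]
    exact ((X.ρ₁ (γ m)).1.symm.continuous.tendsto B).comp (hE.tendsto s hs)
  have ha : Tendsto (fun n => (X.ρ₁ ((γ m)⁻¹ * γ n)).1 0) l (𝓝 ((X.ρ₁ (γ m)).1.symm a)) := by
    simp only [hact]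
    exact ((X.ρ₁ (γ m)).1.symm.continuous.tendsto a).comp hE.tendsto_self
  -- A point other than `A` and `0` has a limit by both descriptions, which identifies the
  -- attracting point. If `A` were not `0`, the limit at `0` would contradict `a ≠ B`.
  obtain ⟨s', hs'⟩ := (Set.toFinite {A, (0 : S1)}).infinite_compl.nonempty
  simp only [mem_compl_iff, mem_insert_iff, mem_singleton_iff, not_or] at hs'
  have e1 : B' = (X.ρ₁ (γ m)).1.symm B := tendsto_nhds_unique (hAB s' hs'.1) (hB s' hs'.2)
  have e2 : A = 0 := by
    by_contra hA
    have := tendsto_nhds_unique (hAB 0 (Ne.symm hA)) ha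
    rw [e1] at this
    exact hE.ne ((X.ρ₁ (γ m)).1.symm.injective this).symm
  have hne : A ≠ B' := by
    rw [e1, e2]
    intro e
    apply hm
    rw [e, Homeomorph.apply_symm_apply]
  obtain ⟨n, hn⟩ := (hNS hne).exists
  exact ⟨_, hn⟩

end ConjugationData.NormalForm

end

/-! ### The homeomorphism onto the jet space and its properties -/

noncomputable section

/-- The jet group acts faithfully, as the zero section alone shows. Hence elements given by an
equivariance multiply correctly and form a homomorphism. -/
theorem jetMap_injective {g k : JetGroup} (h : ∀ x, jetMap g x = jetMap k x) : g = k := by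
  have hr : g.right = k.right := Subtype.ext (Homeomorph.ext fun θ =>
    congrArg Prod.fst (h (θ, 0, 0)))
  refine SemidirectProduct.ext ?_ hr
  apply Multiplicative.toAdd.injective
  apply Subtype.ext
  funext θ
  have h1 := congrArg (fun x : Jet => x.2.2) (h (g.right.1.symm θ, 0, 0))
  simp only [jetMap, zero_add] at h1
  rw [← hr, Homeomorph.apply_symm_apply] at h1
  exact h1

/-- An equivariance by elements of the jet group defines a homomorphism. -/
theorem exists_hom_of_equivariant {Γ M : Type*} [Group Γ] [TopologicalSpace M]
    {A : Γ →* (M ≃ₜ M)} {Ψ : M ≃ₜ Jet}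
    (h : ∀ γ, ∃ G : JetGroup, ∀ m, Ψ (A γ m) = jetMap G (Ψ m)) :
    ∃ ρ : Γ →* JetGroup, ∀ γ m, Ψ (A γ m) = jetHom (ρ γ) (Ψ m) := by
  choose G hG using h
  refine ⟨MonoidHom.mk' G fun γ δ => jetMap_injective fun x => ?_, hG⟩
  obtain ⟨m, rfl⟩ := Ψ.surjective x
  rw [jetMap_mul, ← hG, ← hG, ← hG, map_mul]
  rfl

/-- Change of variables on a fibre. -/
theorem lintegral_fibre {t₀ : ℝ} {R f : ℝ → ℝ} (hR : ∀ y ∈ Ioo t₀ (t₀ + 1),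
      HasDerivAt R (f y) y) (hinj : InjOn R (Ioo t₀ (t₀ + 1)))
    (hsurj : R '' Ioo t₀ (t₀ + 1) = univ) (E : Set ℝ) (hE : MeasurableSet E) :
    ∫⁻ y in Ioc t₀ (t₀ + 1), ENNReal.ofReal |f y| * E.indicator 1 (R y) = volume E := by
  rw [← restrict_Ioo_eq_restrict_Ioc, ← lintegral_image_eq_lintegral_abs_deriv_mul measurableSet_Ioo
    (fun y hy => (hR y hy).hasDerivWithinAt) hinj, hsurj, Measure.restrict_univ,
    lintegral_indicator_one hE]

namespace ConjugationData.NormalForm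

variable {Γ : Type*} [Group Γ] {κ : S1 ≃ₜ S1} {M : Type*} [TopologicalSpace M] [AddAction ℝ M]
  {X : ConjugationData Γ κ M} {v : M → ℝ} {r : S1 × S1 → ℝ}

/-- The identification of the annulus with the cotangent bundle given by the momentum. -/
def baseHomeo (N : X.NormalForm v r) : annulus κ ≃ₜ S1 × ℝ where
  toFun x := (x.1.1, r x.1)
  invFun q := ⟨(q.1, (N.surjective_fibre q.1 q.2).choose),
    (N.surjective_fibre q.1 q.2).choose_spec.1⟩
  left_inv x := by
    have h := (N.surjective_fibre x.1.1 (r x.1)).choose_spec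
    exact Subtype.ext (Prod.ext rfl (N.injective_fibre h.1 x.2 h.2))
  right_inv q := Prod.ext rfl (N.surjective_fibre q.1 q.2).choose_spec.2
  continuous_toFun := (continuous_fst.comp continuous_subtype_val).prodMk
    (continuousOn_iff_continuous_domRestrict.1 N.continuousOn)
  continuous_invFun := by
    refine Continuous.subtype_mk (continuous_fst.prodMk ?_) _
    rw [continuous_iff_continuousAt]
    rintro ⟨s, q⟩
    obtain ⟨ht, hq⟩ := (N.surjective_fibre s q).choose_spec
    set t := (N.surjective_fibre s q).choose with htd
    obtain ⟨y, hy⟩ := S1.coe_surjective t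
    rw [Metric.continuousAt_iff']
    intro ε hε
    -- The equation `r (p.1, ·) = p.2` has a solution close to `t` for nearby data, and by strict
    -- monotonicity it is the only one; this is continuity of the inverse.
    obtain ⟨V, hV, hs⟩ := N.exists_preimage_near (a := s) (y := y) (by rw [hy]; exact ht) hε
    rw [hy, hq] at hV
    filter_upwards [continuousAt_fst.eventually hs, continuousAt_snd hV] with p hp hpV
    obtain ⟨u, hu, huD, hur⟩ := hp _ hpV
    have h := (N.surjective_fibre p.1 p.2).choose_spec
    have e := N.injective_fibre h.1 huD (h.2.trans hur.symm)
    change dist (N.surjective_fibre p.1 p.2).choose t < ε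
    rw [e, ← hy]
    exact lt_of_le_of_lt (S1.dist_coe_le u y) hu

/-- The identification of the bundle with the jet space given by the normal form. -/
def jetHomeo (N : X.NormalForm v r) : M ≃ₜ Jet :=
  (N.isCoord.homeo.trans (N.baseHomeo.prodCongr (Homeomorph.refl ℝ))).trans
    (Homeomorph.prodAssoc S1 ℝ ℝ)

theorem jetHomeo_apply (N : X.NormalForm v r) (m : M) : N.jetHomeo m = X.jetChart v r m := rfl

/-- By Tonelli it suffices to treat one fibre. There `t ↦ r (s, t)` is a bijection onto the line
whose derivative has absolute value `f`, so it sends `f dt` to Lebesgue measure. -/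
theorem area_map_baseHomeo (N : X.NormalForm v r) : X.area.map N.baseHomeo = volume := by
  have hann : MeasurableSet (annulus κ) := (isOpen_annulus κ.continuous).measurableSet
  refine Measure.ext fun E hE => ?_
  have hpre : MeasurableSet (N.baseHomeo ⁻¹' E) := N.baseHomeo.measurable hE
  set B : Set (S1 × S1) := Subtype.val '' (N.baseHomeo ⁻¹' E) with hB
  have hBm : MeasurableSet B := hann.subtype_image hpre
  have hBa : B ⊆ annulus κ := by
    rintro _ ⟨x, -, rfl⟩
    exact x.2
  have hmemB : ∀ x ∈ annulus κ, (x ∈ B ↔ (x.1, r x) ∈ E) := by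
    intro x hx
    constructor
    · rintro ⟨y, hy, rfl⟩
      exact hy
    · intro h
      exact ⟨⟨x, hx⟩, h, rfl⟩
  have hfm : Measurable ((annulus κ).indicator fun x => ENNReal.ofReal (X.f x)) := by
    classical
    rw [← Set.piecewise_eq_indicator]
    exact ContinuousOn.measurable_piecewise
      (ENNReal.continuous_ofReal.comp_continuousOn X.continuousOn_f) continuousOn_const hann
  rw [Measure.map_apply N.baseHomeo.measurable hE, ConjugationData.area,
    (MeasurableEmbedding.subtype_coe hann).comap_apply, withDensity_apply _ hBm,
    Measure.restrict_restrict hBm, inter_eq_left.2 hBa, ← lintegral_indicator hBm]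
  have e1 : B.indicator (fun x => ENNReal.ofReal (X.f x)) =
      B.indicator ((annulus κ).indicator fun x => ENNReal.ofReal (X.f x)) := by
    rw [Set.indicator_indicator, inter_eq_left.2 hBa]
  rw [e1, Measure.volume_eq_prod, lintegral_prod _ (hfm.indicator hBm).aemeasurable,
    Measure.volume_eq_prod, Measure.prod_apply hE, ← e1]
  refine lintegral_congr fun s => ?_
  obtain ⟨t₀, h₀⟩ := S1.coe_surjective (κ s)
  rw [← lintegral_fibre (R := fun y : ℝ => r (s, (y : S1)))
    (f := fun y => X.sgn * X.f (s, (y : S1))) (t₀ := t₀) ?_ ?_ ?_ _ (measurable_prodMk_left hE)]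
  rotate_left
  · intro y hy
    obtain ⟨x, rfl⟩ := S1.coe_surjective s
    exact N.hasDerivAt x y (mem_annulus_of_Ioo h₀ hy)
  · intro y hy y' hy' e
    exact (N.strictMonoOn h₀).injOn hy hy' (by simp only at e ⊢; rw [e])
  · refine eq_univ_of_forall fun q => ?_
    obtain ⟨t, ht, htq⟩ := N.surjective_fibre s q
    obtain ⟨y, hy, rfl⟩ := exists_lift_Ioo (t := t) (t₀ := t₀) (by rw [h₀]; exact ht)
    exact ⟨y, hy, htq⟩
  have e2 := UnitAddCircle.lintegral_preimage t₀
    (fun t => B.indicator (fun x => ENNReal.ofReal (X.f x)) (s, t))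
  rw [← e2, ← restrict_Ioo_eq_restrict_Ioc]
  refine setLIntegral_congr_fun measurableSet_Ioo fun y hy => ?_
  have hy' := mem_annulus_of_Ioo h₀ hy
  have habs : |X.sgn * X.f (s, (y : S1))| = X.f (s, (y : S1)) := by
    rw [abs_mul, abs_of_pos (X.f_pos _ hy')]
    rcases X.sgn_eq with h | h <;> simp [h]
  change B.indicator (fun x => ENNReal.ofReal (X.f x)) (s, (y : S1)) =
    ENNReal.ofReal |X.sgn * X.f (s, (y : S1))| *
      (Prod.mk s ⁻¹' E).indicator 1 (r (s, (y : S1)))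
  rw [habs]
  by_cases hE' : (s, r (s, (y : S1))) ∈ E
  · rw [indicator_of_mem ((hmemB _ hy').2 hE'),
      indicator_of_mem (show r (s, (y : S1)) ∈ Prod.mk s ⁻¹' E from hE'), Pi.one_apply, mul_one]
  · rw [indicator_of_notMem (fun h => hE' ((hmemB _ hy').1 h)),
      indicator_of_notMem (show r (s, (y : S1)) ∉ Prod.mk s ⁻¹' E from hE'), mul_zero]

/-- On a leaf `s` and `v` are fixed and only the momentum varies. Surjectivity of the momentum makes
the image the whole fibre of `ℱ` and not only an interval in it. -/
theorem jetHomeo_image_leaf (N : X.NormalForm v r) {c : ℝ → M} {s : S1} {t₀ v₀ : ℝ}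
    (h₀ : (t₀ : S1) = κ s)
    (hc : ∀ t ∈ Ioo t₀ (t₀ + 1), X.bundle.proj (c t) = (s, (t : S1)) ∧ v (c t) = v₀) :
    N.jetHomeo '' (c '' Ioo t₀ (t₀ + 1)) = range fun q : ℝ => ((s, q, v₀) : Jet) := by
  ext x
  constructor
  · rintro ⟨_, ⟨t, ht, rfl⟩, rfl⟩
    obtain ⟨h1, h2⟩ := hc t ht
    refine ⟨r (s, (t : S1)), ?_⟩
    simp only [jetHomeo_apply, jetChart, h1, h2]
  · rintro ⟨q, rfl⟩
    obtain ⟨t, ht, htq⟩ := N.surjective_fibre s q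
    obtain ⟨y, hy, rfl⟩ := exists_lift_Ioo (t := t) (t₀ := t₀) (by rw [h₀]; exact ht)
    obtain ⟨h1, h2⟩ := hc y hy
    refine ⟨_, ⟨y, hy, rfl⟩, ?_⟩
    simp only [jetHomeo_apply, jetChart, h1, h2, htq]

/-- The existence of an identification with the jet space. -/
theorem exists_isConjugation (N : X.NormalForm v r) :
    ∃ ρ : Γ →* JetGroup, X.IsConjugation N.jetHomeo ρ ∧ ∀ γ, (ρ γ).right = X.ρ₁ γ := by
  choose G hG hG' using N.exists_jetMap_jetChart
  obtain ⟨ρ, hρ⟩ := exists_hom_of_equivariant (A := X.act) (Ψ := N.jetHomeo)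
    fun γ => ⟨G γ, hG' γ⟩
  refine ⟨ρ, ⟨⟨N.baseHomeo, N.area_map_baseHomeo, fun m => rfl⟩, fun t m => ?_, fun p hp => ?_,
    hρ⟩, fun γ => ?_⟩
  · simp only [jetHomeo_apply, jetChart, jetFlow, X.bundle.proj_vadd, N.isCoord.vadd]
  · obtain ⟨s, t₀, v₀, h₀, hI, hc⟩ := (N.mem_leaves_iff p).1 hp
    refine ⟨(fun q => (s, q, v₀), univ), ⟨s, v₀, rfl⟩, ?_⟩
    rw [hI, N.jetHomeo_image_leaf h₀ hc, image_univ]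
  · rw [← hG γ]
    refine congrArg _ (jetMap_injective fun x => ?_)
    obtain ⟨m, rfl⟩ := N.jetHomeo.surjective x
    exact (hρ γ m).symm.trans (hG' γ m)

end ConjugationData.NormalForm

end

noncomputable section

/-! ### Lifts of homeomorphisms of the circle, and Lebesgue measure -/

/-- Two continuous lifts of the same map of the circle differ by a constant near the point. -/
theorem HasDerivAt.of_coe_eq {f g : ℝ → ℝ} {x d : ℝ} (hg : HasDerivAt g d x)
    (hf : ContinuousAt f x) (h : ∀ᶠ y in 𝓝 x, ((f y : ℝ) : S1) = ((g y : ℝ) : S1)) :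
    HasDerivAt f d x := by
  have h1 : ∀ᶠ y in 𝓝 x, |(f y - g y) - (f x - g x)| < 1 := by
    have : Tendsto (fun y => |(f y - g y) - (f x - g x)|) (𝓝 x) (𝓝 |(f x - g x) - (f x - g x)|) :=
      ((hf.sub hg.continuousAt).sub continuousAt_const).abs
    rw [sub_self, abs_zero] at this
    exact this.eventually_lt_const one_pos
  refine (hg.add_const (f x - g x)).congr_of_eventuallyEq ?_
  filter_upwards [h, h1] with y hy hy1
  have h2 := S1.coe_inj (x := f y - g y) (y := f x - g x) hy1 (by
    rw [AddCircle.coe_sub, AddCircle.coe_sub, hy, h.self_of_nhds, sub_self, sub_self])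
  linarith

/-- On `(0, 1)` the covering map is injective, so integrals over the image may be computed on the
line. -/
theorem lintegral_coe_image {I : Set ℝ} (hI : IsOpen I) (hI01 : I ⊆ Ioo 0 1) (G : S1 → ENNReal) :
    ∫⁻ θ in (fun x : ℝ => (x : S1)) '' I, G θ = ∫⁻ y in I, G (y : S1) := by
  have hop : IsOpen ((fun x : ℝ => (x : S1)) '' I) := S1.isOpenQuotientMap_coe.isOpenMap I hI
  rw [← lintegral_indicator hop.measurableSet, ← UnitAddCircle.lintegral_preimage 0, zero_add,
    ← restrict_Ioo_eq_restrict_Ioc]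
  have h1 : ∀ y ∈ Ioo (0 : ℝ) 1, ((fun x : ℝ => (x : S1)) '' I).indicator G (y : S1) =
      I.indicator (fun y : ℝ => G (y : S1)) y := by
    intro y hy
    by_cases h : y ∈ I
    · rw [indicator_of_mem h, indicator_of_mem (mem_image_of_mem _ h)]
    · rw [indicator_of_notMem h, indicator_of_notMem]
      rintro ⟨z, hz, e⟩
      have := S1.coe_inj (x := z) (y := y) (by
        rw [abs_lt]; constructor <;> linarith [(hI01 hz).1, (hI01 hz).2, hy.1, hy.2]) e
      exact h (this ▸ hz)
  rw [setLIntegral_congr_fun measurableSet_Ioo h1, lintegral_indicator hI.measurableSet,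
    Measure.restrict_restrict hI.measurableSet, inter_eq_left.2 hI01]

theorem volume_coe_image {I : Set ℝ} (hI : IsOpen I) (hI01 : I ⊆ Ioo 0 1) :
    volume ((fun x : ℝ => (x : S1)) '' I) = volume I := by
  have := lintegral_coe_image hI hI01 fun _ => 1
  simpa using this

theorem image_coe_eq (χ : S1 ≃ₜ S1) (I : Set ℝ) :
    χ '' ((fun x : ℝ => (x : S1)) '' I) =
      (fun θ => χ 0 + θ) '' ((fun x : ℝ => (x : S1)) '' (disp χ '' I)) := by
  simp only [image_image]
  refine image_congr fun x _ => ?_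
  rw [coe_disp]
  abel

theorem disp_image_Ioo (χ : S1 ≃ₜ S1) {x : ℝ} (hx : x ∈ Ioo (0 : ℝ) 1) :
    (disp χ '' Ioo 0 x = Ioo 0 (disp χ x) ∧ disp χ (1 / 3) < disp χ (2 / 3)) ∨
      (disp χ '' Ioo 0 x = Ioo (disp χ x) 1 ∧ disp χ (2 / 3) < disp χ (1 / 3)) := by
  rcases disp_mono_or_anti χ with ⟨h0, h⟩ | ⟨h0, h⟩
  · refine Or.inl ⟨?_, h0⟩
    ext y
    constructor
    · rintro ⟨z, hz, rfl⟩
      have hz' : z ∈ Ioo (0 : ℝ) 1 := ⟨hz.1, hz.2.trans hx.2⟩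
      exact ⟨(disp_mem χ hz').1, h hz' hx hz.2⟩
    · intro hy
      obtain ⟨z, hz, rfl⟩ := disp_surjOn χ ⟨hy.1, hy.2.trans (disp_mem χ hx).2⟩
      exact ⟨z, ⟨hz.1, (h.lt_iff_lt hz hx).1 hy.2⟩, rfl⟩
  · refine Or.inr ⟨?_, h0⟩
    ext y
    constructor
    · rintro ⟨z, hz, rfl⟩
      have hz' : z ∈ Ioo (0 : ℝ) 1 := ⟨hz.1, hz.2.trans hx.2⟩
      exact ⟨h hz' hx hz.2, (disp_mem χ hz').2⟩
    · intro hy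
      obtain ⟨z, hz, rfl⟩ := disp_surjOn χ ⟨(disp_mem χ hx).1.trans hy.1, hy.2⟩
      exact ⟨z, ⟨hz.1, (h.lt_iff_gt hx hz).1 hy.1⟩, rfl⟩

/-- A homeomorphism of the circle that sends Lebesgue measure to a measure with continuous density
is of class `C¹`. -/
theorem exists_lift_of_volume_image {χ : S1 ≃ₜ S1} {w : S1 → ℝ} (hw : Continuous w)
    (hpos : ∀ θ, 0 < w θ)
    (h : ∀ B : Set S1, IsOpen B → volume (χ '' B) = ∫⁻ θ in B, ENNReal.ofReal (w θ)) :
    ∃ (ε : ℝ) (F : ℝ → ℝ), (ε = 1 ∨ ε = -1) ∧ (∀ x : ℝ, HasDerivAt F (ε * w (x : S1)) x) ∧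
      ∀ x : ℝ, ((F x : ℝ) : S1) = χ (x : S1) := by
  have hwc : Continuous fun x : ℝ => w (x : S1) := hw.comp S1.continuous_coe
  set W : ℝ → ℝ := fun x => ∫ y in (0 : ℝ)..x, w (y : S1) with hW
  have hWd : ∀ x : ℝ, HasDerivAt W (w (x : S1)) x := fun x =>
    intervalIntegral.integral_hasDerivAt_right (hwc.intervalIntegrable 0 x)
      (hwc.stronglyMeasurableAtFilter volume (𝓝 x)) hwc.continuousAt
  -- The measure hypothesis, applied to the arc from `0` to `x`, gives the length of its image as
  -- the primitive `W x` of the density.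
  have hvol : ∀ x ∈ Ioo (0 : ℝ) 1, volume (disp χ '' Ioo 0 x) = ENNReal.ofReal (W x) := by
    intro x hx
    have hsub : Ioo 0 x ⊆ Ioo (0 : ℝ) 1 := Ioo_subset_Ioo_right hx.2.le
    have h1 := h _ (S1.isOpenQuotientMap_coe.isOpenMap _ (isOpen_Ioo (a := (0 : ℝ)) (b := x)))
    rw [lintegral_coe_image isOpen_Ioo hsub, image_coe_eq, image_add_left, measure_preimage_add]
      at h1
    have hop : IsOpen (disp χ '' Ioo 0 x) := by
      rcases disp_image_Ioo χ hx with ⟨e, -⟩ | ⟨e, -⟩ <;> rw [e] <;> exact isOpen_Ioo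
    have hop1 : disp χ '' Ioo 0 x ⊆ Ioo 0 1 := by
      rintro _ ⟨y, hy, rfl⟩
      exact disp_mem χ (hsub hy)
    rw [volume_coe_image hop hop1] at h1
    rw [h1]
    change _ = ENNReal.ofReal (∫ y in (0 : ℝ)..x, w (y : S1))
    rw [intervalIntegral.integral_of_le hx.1.le, ← restrict_Ioo_eq_restrict_Ioc,
      ofReal_integral_eq_lintegral_ofReal]
    · rw [restrict_Ioo_eq_restrict_Ioc, ← IntegrableOn,
        ← intervalIntegrable_iff_integrableOn_Ioc_of_le hx.1.le]
      exact hwc.intervalIntegrable 0 x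
    · exact Eventually.of_forall fun y => (hpos _).le
  have hW0 : ∀ x ∈ Ioo (0 : ℝ) 1, 0 ≤ W x := fun x hx =>
    intervalIntegral.integral_nonneg hx.1.le fun y _ => (hpos _).le
  -- The image of `(0, x)` under the displacement is an initial interval or a final one according to
  -- the orientation. So the displacement is `W x` or `1 - W x`, and the latter is `-W x` modulo
  -- integers.
  obtain ⟨ε, hε, hd⟩ : ∃ ε : ℝ, (ε = 1 ∨ ε = -1) ∧ ∀ x ∈ Ioo (0 : ℝ) 1,
      ((disp χ x : ℝ) : S1) = ((ε * W x : ℝ) : S1) := by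
    rcases disp_mono_or_anti χ with ⟨h0, -⟩ | ⟨h0, -⟩
    · refine ⟨1, Or.inl rfl, fun x hx => ?_⟩
      have h1 := hvol x hx
      rcases disp_image_Ioo χ hx with ⟨e, -⟩ | ⟨-, h2⟩
      · rw [e, Real.volume_Ioo, sub_zero, ENNReal.ofReal_eq_ofReal_iff (disp_mem χ hx).1.le
          (hW0 x hx)] at h1
        rw [h1, one_mul]
      · exact absurd h0 h2.not_gt
    · refine ⟨-1, Or.inr rfl, fun x hx => ?_⟩
      have h1 := hvol x hx
      rcases disp_image_Ioo χ hx with ⟨-, h2⟩ | ⟨e, -⟩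
      · exact absurd h0 h2.not_gt
      · rw [e, Real.volume_Ioo, ENNReal.ofReal_eq_ofReal_iff
          (sub_nonneg.2 (disp_mem χ hx).2.le) (hW0 x hx)] at h1
        rw [← h1, S1.coe_eq_coe_iff]
        exact ⟨1, by push_cast; ring⟩
  obtain ⟨c, hc⟩ := S1.coe_surjective (χ 0)
  set F : ℝ → ℝ := fun x => c + ε * W x with hF
  have hFd : ∀ x : ℝ, HasDerivAt F (ε * w (x : S1)) x := fun x =>
    ((hWd x).const_mul ε).const_add c
  have hFc : Continuous F := continuous_iff_continuousAt.2 fun x => (hFd x).continuousAt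
  -- the lift on the unit interval
  have hF01 : ∀ x ∈ Icc (0 : ℝ) 1, ((F x : ℝ) : S1) = χ (x : S1) := by
    have h1 : ∀ x ∈ Ioo (0 : ℝ) 1, ((F x : ℝ) : S1) = χ (x : S1) := fun x hx => by
      rw [hF, AddCircle.coe_add, ← hd x hx, hc, coe_disp]
      abel
    have h2 : IsClosed {x : ℝ | ((F x : ℝ) : S1) = χ (x : S1)} :=
      isClosed_eq (S1.continuous_coe.comp hFc) (χ.continuous.comp S1.continuous_coe)
    have h3 := h2.closure_subset_iff.2 (show Ioo (0 : ℝ) 1 ⊆ _ from h1)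
    rw [closure_Ioo zero_ne_one] at h3
    exact h3
  have hper : Function.Periodic (fun x : ℝ => w (x : S1)) 1 := fun x => by
    simp only [AddCircle.coe_add_period]
  -- The density is periodic, so `F` increases by the same amount over every period; this amount is
  -- an integer because both ends of the unit interval represent the same point. The lift extends
  -- from `[0, 1]` to the line.
  have hstep : ∀ x, F (x + 1) - F x = F 1 - F 0 := by
    intro x
    have h1 := intervalIntegral.integral_add_adjacent_intervals
      (hwc.intervalIntegrable (μ := volume) 0 x) (hwc.intervalIntegrable x (x + 1))
    have h2 := hper.intervalIntegral_add_eq x 0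
    rw [zero_add] at h2
    simp only [hF, hW]
    rw [← h1, h2, intervalIntegral.integral_same]
    ring
  obtain ⟨k, hk⟩ : ∃ k : ℤ, F 1 - F 0 = k := S1.coe_eq_coe_iff.1 (by
    rw [hF01 1 (by simp), hF01 0 (by simp), AddCircle.coe_period, AddCircle.coe_zero])
  have hint : ∀ (n : ℤ) (x : ℝ), ((F (x + n) : ℝ) : S1) = ((F x : ℝ) : S1) := by
    intro n x
    induction n with
    | zero => simp
    | succ n ih =>
      rw [← ih, S1.coe_eq_coe_iff]
      refine ⟨k, ?_⟩
      push_cast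
      rw [← add_assoc, hstep, hk]
    | pred n ih =>
      rw [← ih, eq_comm, S1.coe_eq_coe_iff]
      refine ⟨k, ?_⟩
      have := hstep (x + ((-n - 1 : ℤ) : ℝ))
      rw [← hk, ← this]
      push_cast
      ring_nf
  refine ⟨ε, F, hε, hFd, fun x => ?_⟩
  have h1 := hint ⌊x⌋ (Int.fract x)
  rw [Int.fract_add_floor, hF01 _ ⟨Int.fract_nonneg x, (Int.fract_lt_one x).le⟩] at h1
  rw [h1]
  exact congrArg χ (AddCircle.coe_fract x)

end

noncomputable section

/-! ### Homeomorphisms of the jet space that preserve its structures -/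

/-- The homeomorphism `T` of the jet space commutes with the canonical flow, preserves the foliation
and covers an area preserving homeomorphism of the cotangent bundle. -/
structure IsJetTransfer (T : Jet ≃ₜ Jet) : Prop where
  area : ∃ ψ : S1 × ℝ ≃ₜ S1 × ℝ, (volume : Measure (S1 × ℝ)).map ψ = volume ∧
    ∀ x, jetToCotangent (T x) = ψ (jetToCotangent x)
  flow : ∀ t x, T (jetFlow t x) = jetFlow t (T x)
  leaves : ∀ θ f, ∃ θ' f', T '' range (fun r : ℝ => ((θ, r, f) : Jet)) =
    range (fun r : ℝ => ((θ', r, f') : Jet))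

namespace IsJetTransfer

variable {T : Jet ≃ₜ Jet}

theorem symm (h : IsJetTransfer T) : IsJetTransfer T.symm := by
  obtain ⟨ψ, hψ, hT⟩ := h.area
  refine ⟨⟨ψ.symm, ?_, fun x => ?_⟩, fun t x => ?_, fun θ f => ?_⟩
  · conv_lhs => rw [← hψ]
    rw [Measure.map_map ψ.symm.measurable ψ.measurable]
    simp
  · obtain ⟨y, rfl⟩ := T.surjective x
    rw [T.symm_apply_apply, hT, ψ.symm_apply_apply]
  · obtain ⟨y, rfl⟩ := T.surjective x
    rw [← h.flow, T.symm_apply_apply, T.symm_apply_apply]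
  · obtain ⟨⟨θ₁, r₁, f₁⟩, hy⟩ := T.surjective (θ, 0, f)
    obtain ⟨θ', f', hL⟩ := h.leaves θ₁ f₁
    have h1 : ((θ, 0, f) : Jet) ∈ range (fun r : ℝ => ((θ', r, f') : Jet)) := by
      rw [← hL, ← hy]
      exact mem_image_of_mem _ ⟨r₁, rfl⟩
    obtain ⟨r, hr⟩ := h1
    simp only [Prod.mk.injEq] at hr
    refine ⟨θ₁, f₁, ?_⟩
    rw [← hr.1, ← hr.2.2, ← hL, image_image]
    simp

/-- Preservation of `ℱ` makes the outer components independent of `r`, covering a map of the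
cotangent bundle makes the middle one independent of `f`, and the flow makes the last one a
translation in `f`. -/
theorem exists_form (h : IsJetTransfer T) : ∃ (φ : S1 → S1) (R : S1 → ℝ → ℝ) (H : S1 → ℝ),
    Continuous φ ∧ Continuous (fun x : S1 × ℝ => R x.1 x.2) ∧ Continuous H ∧
      ∀ θ r f, T (θ, r, f) = (φ θ, R θ r, f + H θ) := by
  obtain ⟨ψ, -, hT⟩ := h.area
  refine ⟨fun θ => (T (θ, 0, 0)).1, fun θ r => (T (θ, r, 0)).2.1, fun θ => (T (θ, 0, 0)).2.2,
    by fun_prop, by fun_prop, by fun_prop, fun θ r f => ?_⟩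
  obtain ⟨θ', f', hL⟩ := h.leaves θ f
  have h1 : ∀ r, ∃ q, T (θ, r, f) = (θ', q, f') := fun r => by
    have : T (θ, r, f) ∈ range (fun r : ℝ => ((θ', r, f') : Jet)) := by
      rw [← hL]
      exact mem_image_of_mem _ ⟨r, rfl⟩
    obtain ⟨q, hq⟩ := this
    exact ⟨q, hq.symm⟩
  obtain ⟨q, hq⟩ := h1 r
  obtain ⟨q₀, hq₀⟩ := h1 0
  have hfl := h.flow f (θ, 0, 0)
  simp only [jetFlow, zero_add] at hfl
  have e1 : T (θ, r, f) = ((T (θ, 0, f)).1, (T (θ, r, f)).2.1, (T (θ, 0, f)).2.2) := by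
    rw [hq, hq₀]
  have e2 : (T (θ, r, f)).2.1 = (T (θ, r, 0)).2.1 := by
    have := (hT (θ, r, f)).trans (hT (θ, r, 0)).symm
    exact congrArg Prod.snd this
  rw [e1, e2, hfl, add_comm f]

/-- A strip over `φ⁻¹(B)` of height `r₂ - r₁` goes to a region over `B` with vertical sections of
length `|R r₂ - R r₁|`. As `B` is arbitrary, this length is proportional to `r₂ - r₁` at each `θ`,
and a monotone function with this property is affine. -/
theorem exists_affine_form (h : IsJetTransfer T) : ∃ (φ : S1 ≃ₜ S1) (α β H : S1 → ℝ),
    Continuous α ∧ Continuous β ∧ Continuous H ∧ (∀ θ, α θ ≠ 0) ∧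
      (∀ θ r f, T (θ, r, f) = (φ θ, α θ * r + β θ, f + H θ)) ∧
      ∀ B : Set S1, MeasurableSet B →
        volume (φ.symm '' B) = ∫⁻ θ in B, ENNReal.ofReal |α (φ.symm θ)| := by
  obtain ⟨φ₀, R, H, hφ₀, hR, hH, hT⟩ := h.exists_form
  obtain ⟨φ₁, R₁, H₁, hφ₁, hR₁, hH₁, hT₁⟩ := h.symm.exists_form
  have hinv : ∀ θ r, φ₁ (φ₀ θ) = θ ∧ R₁ (φ₀ θ) (R θ r) = r := fun θ r => by
    have := T.symm_apply_apply (θ, r, 0)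
    rw [hT, hT₁] at this
    exact ⟨congrArg Prod.fst this, congrArg (fun x : Jet => x.2.1) this⟩
  have hinv' : ∀ θ, φ₀ (φ₁ θ) = θ := fun θ => by
    have := T.apply_symm_apply (θ, 0, 0)
    rw [hT₁, hT] at this
    exact congrArg Prod.fst this
  let φ : S1 ≃ₜ S1 := ⟨⟨φ₀, φ₁, fun θ => (hinv θ 0).1, hinv'⟩, hφ₀, hφ₁⟩
  have hmono : ∀ θ, StrictMono (R θ) ∨ StrictAnti (R θ) := fun θ =>
    Continuous.strictMono_of_inj (f := R θ) (hR.comp (Continuous.prodMk_right θ))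
      (Function.LeftInverse.injective (g := R₁ (φ₀ θ)) fun r => (hinv θ r).2)
  have hRθ : ∀ θ, Continuous (R θ) := fun θ => hR.comp (Continuous.prodMk_right θ)
  have himg : ∀ θ r₁ r₂, r₁ ≤ r₂ → volume (R θ '' Icc r₁ r₂) =
      ENNReal.ofReal |R θ r₂ - R θ r₁| := by
    intro θ r₁ r₂ hr
    rcases hmono θ with hm | hm
    · rw [(hRθ θ).continuousOn.image_Icc_of_monotoneOn hr (hm.monotone.monotoneOn _),
        Real.volume_Icc, abs_of_nonneg (sub_nonneg.2 (hm.monotone hr))]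
    · rw [(hRθ θ).continuousOn.image_Icc_of_antitoneOn hr (hm.antitone.antitoneOn _),
        Real.volume_Icc, abs_of_nonpos (sub_nonpos.2 (hm.antitone hr)), neg_sub]
  obtain ⟨ψ, hψ, hTψ⟩ := h.area
  have hψv : ∀ θ r, ψ (θ, r) = (φ θ, R θ r) := fun θ r => by
    have := hTψ (θ, r, 0)
    rw [hT] at this
    exact this.symm
  have harea : ∀ r₁ r₂, r₁ ≤ r₂ → ∀ B : Set S1, MeasurableSet B →
      ∫⁻ θ in B, ENNReal.ofReal |R (φ.symm θ) r₂ - R (φ.symm θ) r₁| =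
        volume (φ.symm '' B) * ENNReal.ofReal (r₂ - r₁) := by
    intro r₁ r₂ hr B hB
    have hB' : MeasurableSet (φ.symm '' B) := φ.symm.measurableEmbedding.measurableSet_image.2 hB
    set E : Set (S1 × ℝ) := (φ.symm '' B) ×ˢ Icc r₁ r₂ with hE
    have hEm : MeasurableSet E := hB'.prod measurableSet_Icc
    have hZm : MeasurableSet (ψ '' E) := ψ.measurableEmbedding.measurableSet_image.2 hEm
    have h1 : volume (ψ '' E) = volume E := by
      conv_lhs => rw [← hψ]
      rw [Measure.map_apply ψ.measurable hZm, preimage_image_eq _ ψ.injective]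
    rw [hE, Measure.volume_eq_prod, Measure.prod_prod, Real.volume_Icc, ← hE,
      Measure.prod_apply hZm] at h1
    rw [← h1, ← lintegral_indicator hB]
    refine lintegral_congr fun θ => ?_
    by_cases hθ : θ ∈ B
    · rw [indicator_of_mem hθ, ← himg _ _ _ hr]
      congr 1
      ext q
      constructor
      · rintro ⟨r, hr, rfl⟩
        refine ⟨(φ.symm θ, r), ⟨mem_image_of_mem _ hθ, hr⟩, ?_⟩
        rw [hψv, φ.apply_symm_apply]
      · rintro ⟨⟨θ', r⟩, ⟨-, hr⟩, e⟩
        rw [hψv] at e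
        obtain ⟨e1, e2⟩ := Prod.mk.inj e
        exact ⟨r, hr, by rw [← e1, φ.symm_apply_apply]; exact e2⟩
    · rw [indicator_of_notMem hθ]
      have : Prod.mk θ ⁻¹' (ψ '' E) = ∅ := by
        refine eq_empty_of_forall_notMem fun q => ?_
        rintro ⟨⟨θ', r⟩, ⟨⟨θ'', h1, h2⟩, -⟩, e⟩
        rw [hψv] at e
        obtain ⟨e1, -⟩ := Prod.mk.inj e
        simp only at h2
        rw [← h2, φ.apply_symm_apply] at e1
        exact hθ (e1 ▸ h1)
      rw [this, measure_empty]
  have hcont : ∀ r₁ r₂, Continuous fun θ => |R (φ.symm θ) r₂ - R (φ.symm θ) r₁| := by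
    intro r₁ r₂
    have hc := φ.symm.continuous
    have h1 : ∀ q, Continuous fun θ => R (φ.symm θ) q := fun q =>
      hR.comp (hc.prodMk continuous_const)
    exact ((h1 r₂).sub (h1 r₁)).abs
  set α : S1 → ℝ := fun θ => R θ 1 - R θ 0 with hα
  have hαne : ∀ θ, α θ ≠ 0 := fun θ => by
    rcases hmono θ with hm | hm
    · exact (sub_pos.2 (hm zero_lt_one)).ne'
    · exact (sub_neg.2 (hm zero_lt_one)).ne
  have hvol : ∀ B : Set S1, MeasurableSet B →
      volume (φ.symm '' B) = ∫⁻ θ in B, ENNReal.ofReal |α (φ.symm θ)| := by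
    intro B hB
    have := harea 0 1 zero_le_one B hB
    rw [sub_zero, ENNReal.ofReal_one, mul_one] at this
    exact this.symm
  -- Equality of the integrals over all measurable sets gives equality of the densities almost
  -- everywhere, and continuity makes it hold everywhere.
  have habs : ∀ r₁ r₂, r₁ ≤ r₂ → ∀ θ, |R θ r₂ - R θ r₁| = |α θ| * (r₂ - r₁) := by
    intro r₁ r₂ hr θ
    have h1 := ae_eq_of_forall_setLIntegral_eq_of_sigmaFinite (μ := (volume : Measure S1))
      (f := fun θ => ENNReal.ofReal |R (φ.symm θ) r₂ - R (φ.symm θ) r₁|)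
      (g := fun θ => ENNReal.ofReal (|α (φ.symm θ)| * (r₂ - r₁)))
      (hcont r₁ r₂).measurable.ennreal_ofReal
      ((hcont 0 1).mul continuous_const).measurable.ennreal_ofReal (by
        intro B hB _
        rw [harea _ _ hr B hB, hvol B hB]
        simp only [ENNReal.ofReal_mul (abs_nonneg _)]
        rw [lintegral_mul_const _ (hcont 0 1).measurable.ennreal_ofReal])
    have hc₁ : Continuous fun θ => ENNReal.ofReal |R (φ.symm θ) r₂ - R (φ.symm θ) r₁| :=
      ENNReal.continuous_ofReal.comp (hcont r₁ r₂)
    have hc₂ : Continuous fun θ => ENNReal.ofReal (|α (φ.symm θ)| * (r₂ - r₁)) :=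
      ENNReal.continuous_ofReal.comp ((hcont 0 1).mul continuous_const)
    replace h1 := (Continuous.ae_eq_iff_eq volume hc₁ hc₂).1 h1
    have h2 := congrFun h1 (φ θ)
    simp only [φ.symm_apply_apply] at h2
    exact (ENNReal.ofReal_eq_ofReal_iff (abs_nonneg _)
      (mul_nonneg (abs_nonneg _) (sub_nonneg.2 hr))).1 h2
  have haff : ∀ r₁ r₂, r₁ ≤ r₂ → ∀ θ, R θ r₂ - R θ r₁ = α θ * (r₂ - r₁) := by
    intro r₁ r₂ hr θ
    have h1 := habs r₁ r₂ hr θ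
    rcases hmono θ with hm | hm
    · rwa [abs_of_nonneg (sub_nonneg.2 (hm.monotone hr)),
        abs_of_nonneg (sub_nonneg.2 (hm.monotone zero_le_one))] at h1
    · rw [abs_of_nonpos (sub_nonpos.2 (hm.antitone hr)),
        abs_of_nonpos (sub_nonpos.2 (hm.antitone zero_le_one))] at h1
      linarith
  have hcR : ∀ q, Continuous fun θ => R θ q := fun q => hR.comp (Continuous.prodMk_left q)
  refine ⟨φ, α, fun θ => R θ 0, H, (hcR 1).sub (hcR 0), hcR 0, hH, hαne, fun θ r f => ?_, hvol⟩
  rw [hT]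
  refine Prod.ext rfl (Prod.ext ?_ rfl)
  change R θ r = α θ * r + R θ 0
  rcases le_total 0 r with hr | hr
  · have := haff 0 r hr θ
    linarith
  · have := haff r 0 hr θ
    linarith

end IsJetTransfer

end

noncomputable section

/-! ### Regularity of solutions of cohomological equations -/

/-- Iterate the inequality: the product of the factors `1 + A ζ ^ k` is at most `exp (A / (1 - ζ))`,
the inhomogeneous terms form a geometric series, and the remaining term tends to zero with `D`. -/
theorem le_of_contracting_recursion {A ζ E : ℝ} {D : ℕ → ℝ} (hA : 0 ≤ A) (hζ : 0 ≤ ζ) (hζ1 : ζ < 1)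
    (hE : 0 ≤ E) (hD0 : ∀ n, 0 ≤ D n) (hlim : Tendsto D atTop (𝓝 0))
    (h : ∀ n, D n ≤ (1 + A * ζ ^ n) * D (n + 1) + E * ζ ^ n) :
    D 0 ≤ Real.exp (A / (1 - ζ)) / (1 - ζ) * E := by
  have h1ζ : 0 < 1 - ζ := by linarith
  have hgeom : ∀ n, ∑ k ∈ Finset.range n, ζ ^ k ≤ (1 - ζ)⁻¹ := fun n => by
    rw [← tsum_geometric_of_lt_one hζ hζ1]
    exact (summable_geometric_of_lt_one hζ hζ1).sum_le_tsum _ fun k _ => pow_nonneg hζ k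
  set P := Real.exp (A / (1 - ζ)) with hP
  have hprod : ∀ n, ∏ k ∈ Finset.range n, (1 + A * ζ ^ k) ≤ P := fun n => by
    calc ∏ k ∈ Finset.range n, (1 + A * ζ ^ k)
        ≤ ∏ k ∈ Finset.range n, Real.exp (A * ζ ^ k) := by
          refine Finset.prod_le_prod (fun k _ => by positivity) fun k _ => ?_
          linarith [Real.add_one_le_exp (A * ζ ^ k)]
      _ = Real.exp (A * ∑ k ∈ Finset.range n, ζ ^ k) := by
          rw [← Real.exp_sum, Finset.mul_sum]
      _ ≤ P := by
          rw [hP, div_eq_mul_inv]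
          exact Real.exp_le_exp.2 (mul_le_mul_of_nonneg_left (hgeom n) hA)
  have hprod0 : ∀ n, 0 ≤ ∏ k ∈ Finset.range n, (1 + A * ζ ^ k) := fun n =>
    Finset.prod_nonneg fun k _ => by positivity
  have hmain : ∀ n, D 0 ≤ (∏ k ∈ Finset.range n, (1 + A * ζ ^ k)) * D n +
      P * E * ∑ k ∈ Finset.range n, ζ ^ k := by
    intro n
    induction n with
    | zero => simp
    | succ n ih =>
      rw [Finset.prod_range_succ, Finset.sum_range_succ]
      have h1 := mul_le_mul_of_nonneg_left (h n) (hprod0 n)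
      have h2 : (∏ k ∈ Finset.range n, (1 + A * ζ ^ k)) * (E * ζ ^ n) ≤ P * (E * ζ ^ n) :=
        mul_le_mul_of_nonneg_right (hprod n) (by positivity)
      linarith
  have hbd : ∀ n, D 0 ≤ P * D n + P / (1 - ζ) * E := fun n => by
    have h1 := mul_le_mul_of_nonneg_right (hprod n) (hD0 n)
    have h2 : P * E * ∑ k ∈ Finset.range n, ζ ^ k ≤ P * E * (1 - ζ)⁻¹ :=
      mul_le_mul_of_nonneg_left (hgeom n) (mul_nonneg (Real.exp_pos _).le hE)
    have h3 : P * E * (1 - ζ)⁻¹ = P / (1 - ζ) * E := by rw [div_eq_mul_inv]; ring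
    linarith [hmain n]
  have hl : Tendsto (fun n => P * D n + P / (1 - ζ) * E) atTop (𝓝 (P * 0 + P / (1 - ζ) * E)) :=
    (hlim.const_mul P).add_const _
  have := ge_of_tendsto hl (Eventually.of_forall hbd)
  simpa using this

/-- A continuous solution of `u = m · (u ∘ φ) + W`, with Hölder coefficients, is Hölder where the
iterates of `φ` contract to a fixed point at which `|m| ≤ 1`. -/
theorem ContractsTo.holderNear {φ : S1 → S1} {p q : S1} (hφ : ContractsTo φ p q) {u m W : S1 → ℝ}
    (hu : Continuous u) (hm : IsHolder m) (hW : IsHolder W) (hp : |m p| ≤ 1)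
    (h : ∀ θ, u θ = m θ * u (φ θ) + W θ) {x : S1} (hx : x ≠ q) : HolderNear u x := by
  have hG : IsHolder fun θ => (m θ, W θ) :=
    isHolder_of_holderNear fun θ => (hm.holderNear θ).prodMk (hW.holderNear θ)
  obtain ⟨C', r', hC', hr', hG⟩ := hG.exists_dist_le_real
  have hmd : ∀ y z, |m y - m z| ≤ C' * dist y z ^ r' := fun y z => by
    rw [← Real.dist_eq]
    exact (le_max_left _ _).trans (hG y z)
  have hWd : ∀ y z, |W y - W z| ≤ C' * dist y z ^ r' := fun y z => by
    rw [← Real.dist_eq]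
    exact (le_max_right _ _).trans (hG y z)
  obtain ⟨B, hB⟩ := isCompact_univ.exists_bound_of_continuousOn hu.continuousOn
  replace hB : ∀ y, |u y| ≤ B := fun y => hB y (mem_univ y)
  have hB0 : 0 ≤ B := (abs_nonneg _).trans (hB x)
  obtain ⟨N, hN, hpN, C, η, r, hC, hη, hη1, hr, hc⟩ := hφ.contr x hx
  have hpfix : ∀ n, φ^[n] p = p := fun n => Function.iterate_fixed hφ.fixed n
  set ζ := η ^ r' with hζ
  have hζ0 : 0 ≤ ζ := Real.rpow_nonneg hη.le _
  have hζ1 : ζ < 1 := Real.rpow_lt_one hη.le hη1 hr'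
  have hpow : ∀ n, ∀ y ∈ N, ∀ z ∈ N,
      dist (φ^[n] y) (φ^[n] z) ^ r' ≤ C ^ r' * ζ ^ n * dist y z ^ (r * r') := by
    intro n y hy z hz
    refine (Real.rpow_le_rpow dist_nonneg (hc n y hy z hz) hr'.le).trans (le_of_eq ?_)
    have hd : 0 ≤ dist y z ^ r := Real.rpow_nonneg dist_nonneg _
    rw [Real.mul_rpow (by positivity) hd, Real.mul_rpow hC (by positivity),
      ← Real.rpow_mul dist_nonneg, hζ, ← Real.rpow_natCast, ← Real.rpow_mul hη.le,
      ← Real.rpow_natCast, ← Real.rpow_mul hη.le, mul_comm (n : ℝ)]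
  have hd1 : ∀ y z : S1, dist y z ^ (r * r') ≤ 1 := fun y z => by
    refine Real.rpow_le_one dist_nonneg ?_ (by positivity)
    linarith [S1.dist_le_half y z]
  set A := C' * C ^ r' with hA
  have hA0 : 0 ≤ A := mul_nonneg hC' (Real.rpow_nonneg hC _)
  -- The orbit approaches `p` exponentially and `|m p| ≤ 1`, so along it the multiplier exceeds one
  -- by a summable amount only. The neutral case `|m p| = 1`, which occurs for `α`, is thereby
  -- included.
  have hml : ∀ n, ∀ y ∈ N, |m (φ^[n] y)| ≤ 1 + A * ζ ^ n := by
    intro n y hy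
    have h1 := hmd (φ^[n] y) p
    have h2 := hpow n y hy p hpN
    rw [hpfix] at h2
    have h3 := abs_sub_abs_le_abs_sub (m (φ^[n] y)) (m p)
    have h4 : C' * dist (φ^[n] y) p ^ r' ≤ C' * (C ^ r' * ζ ^ n * 1) := by
      refine mul_le_mul_of_nonneg_left (h2.trans ?_) hC'
      exact mul_le_mul_of_nonneg_left (hd1 y p)
        (mul_nonneg (Real.rpow_nonneg hC _) (pow_nonneg hζ0 n))
    have h5 : C' * (C ^ r' * ζ ^ n * 1) = A * ζ ^ n := by rw [hA]; ring
    linarith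
  refine ⟨N, hN, Real.exp (A / (1 - ζ)) / (1 - ζ) * ((B + 1) * A), r * r',
    mul_nonneg (div_nonneg (Real.exp_pos _).le (by linarith)) (by positivity), by positivity,
    fun y hy z hz => ?_⟩
  have huc := CompactSpace.uniformContinuous_of_continuous hu
  have hdist : Tendsto (fun n => dist (φ^[n] y) (φ^[n] z)) atTop (𝓝 0) := by
    refine squeeze_zero (fun n => dist_nonneg) (fun n => hc n y hy z hz) ?_
    have := ((tendsto_pow_atTop_nhds_zero_of_lt_one hη.le hη1).const_mul C).mul_const
      (dist y z ^ r)
    simpa using this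
  have hlim : Tendsto (fun n => |u (φ^[n] y) - u (φ^[n] z)|) atTop (𝓝 0) := by
    rw [Metric.tendsto_atTop] at hdist ⊢
    intro ε hε
    obtain ⟨δ, hδ, hu'⟩ := Metric.uniformContinuous_iff.1 huc ε hε
    obtain ⟨n₀, hn₀⟩ := hdist δ hδ
    refine ⟨n₀, fun n hn => ?_⟩
    have h1 := hn₀ n hn
    rw [Real.dist_eq, sub_zero, abs_of_nonneg dist_nonneg] at h1
    have h2 := hu' h1
    rw [Real.dist_eq] at h2
    rwa [Real.dist_eq, sub_zero, abs_abs]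
  have hE : 0 ≤ (B + 1) * A * dist y z ^ (r * r') :=
    mul_nonneg (by positivity) (Real.rpow_nonneg dist_nonneg _)
  have := le_of_contracting_recursion (D := fun n => |u (φ^[n] y) - u (φ^[n] z)|) hA0 hζ0 hζ1 hE
    (fun n => abs_nonneg _) hlim (fun n => ?_)
  · rw [Real.dist_eq]
    refine (show _ ≤ _ from this).trans (le_of_eq (by ring))
  -- The difference of the two equations is arranged so that the increment of `u` is multiplied by
  -- `m` at the orbit of `y`; the other terms are bounded by Hölder continuity and by the bound `B`
  -- of `u`.
  · have e : u (φ^[n] y) - u (φ^[n] z) =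
        m (φ^[n] y) * (u (φ^[n + 1] y) - u (φ^[n + 1] z)) +
          ((m (φ^[n] y) - m (φ^[n] z)) * u (φ^[n + 1] z) + (W (φ^[n] y) - W (φ^[n] z))) := by
      rw [h (φ^[n] y), h (φ^[n] z), Function.iterate_succ_apply', Function.iterate_succ_apply']
      ring
    have h1 := hpow n y hy z hz
    have h2 : |m (φ^[n] y) - m (φ^[n] z)| * |u (φ^[n + 1] z)| ≤
        C' * (C ^ r' * ζ ^ n * dist y z ^ (r * r')) * B :=
      mul_le_mul ((hmd _ _).trans (mul_le_mul_of_nonneg_left h1 hC')) (hB _) (abs_nonneg _)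
        (mul_nonneg hC' (mul_nonneg (mul_nonneg (Real.rpow_nonneg hC _) (pow_nonneg hζ0 n))
          (Real.rpow_nonneg dist_nonneg _)))
    have h3 := (hWd (φ^[n] y) (φ^[n] z)).trans (mul_le_mul_of_nonneg_left h1 hC')
    have h4 := mul_le_mul_of_nonneg_right (hml n y hy) (abs_nonneg (u (φ^[n + 1] y) - u (φ^[n + 1] z)))
    change |u (φ^[n] y) - u (φ^[n] z)| ≤ (1 + A * ζ ^ n) * |u (φ^[n + 1] y) - u (φ^[n + 1] z)| +
      (B + 1) * A * dist y z ^ (r * r') * ζ ^ n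
    rw [e]
    refine (abs_add_le _ _).trans ?_
    rw [abs_mul]
    have h5 := abs_add_le ((m (φ^[n] y) - m (φ^[n] z)) * u (φ^[n + 1] z)) (W (φ^[n] y) - W (φ^[n] z))
    rw [abs_mul] at h5
    have h6 : (B + 1) * A * dist y z ^ (r * r') * ζ ^ n =
      C' * (C ^ r' * ζ ^ n * dist y z ^ (r * r')) * B +
        C' * (C ^ r' * ζ ^ n * dist y z ^ (r * r')) := by rw [hA]; ring
    linarith

theorem norm_coe_localRep (φ : S1 → S1) (θ : S1) (x : ℝ) :
    |localRep φ θ x| = dist (φ (θ + (x : S1))) (φ θ) := by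
  have h := (AddCircle.equivIoc (1 : ℝ) (-(1 / 2)) (φ (θ + (x : S1)) - φ θ)).2
  have h1 : |localRep φ θ x| ≤ 1 / 2 := by
    rw [abs_le]
    refine ⟨h.1.le, ?_⟩
    have := h.2
    change localRep φ θ x ≤ _ at this
    linarith
  rw [dist_eq_norm, ← coe_localRep, S1.norm_coe_of_abs_le h1]

/-- With a derivative larger than one in modulus, points close to `p` would not come nearer to `p`
under `φ`, which contradicts convergence of the orbits. Injectivity excludes that an orbit reaches
`p` in finite time. -/
theorem ContractsTo.abs_cderiv_le {φ : S1 → S1} {p q : S1} (hφ : ContractsTo φ p q)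
    (hC : IsC1hMap φ) (hinj : Function.Injective φ) : |cderiv φ p| ≤ 1 := by
  by_contra! hlt
  have hd := hC.hasDerivAt p
  have h1 : ∀ᶠ x : ℝ in 𝓝 0, |x| ≤ |localRep φ p x| := by
    have := (hasDerivAt_iff_isLittleO.1 hd).def (show 0 < |cderiv φ p| - 1 by linarith)
    filter_upwards [this] with x hx
    rw [localRep_zero, sub_zero, sub_zero, smul_eq_mul, Real.norm_eq_abs, Real.norm_eq_abs] at hx
    have h2 := abs_sub_abs_le_abs_sub (x * cderiv φ p) (localRep φ p x)
    rw [abs_sub_comm, abs_mul] at h2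
    nlinarith [abs_nonneg x]
  obtain ⟨δ, hδ, hδ1⟩ := Metric.eventually_nhds_iff.1 h1
  have hexp : ∀ y, dist y p < δ → dist y p ≤ dist (φ y) p := by
    intro y hy
    obtain ⟨x, hx⟩ := S1.coe_surjective (y - p)
    have hx2 : ((x - round x : ℝ) : S1) = y - p := by
      rw [← hx]
      exact S1.coe_eq_coe_iff.2 ⟨-round x, by push_cast; ring⟩
    have hn : |x - round x| = dist y p := by
      rw [dist_eq_norm, ← hx2, S1.norm_coe_of_abs_le (abs_sub_round x)]
    have h3 := hδ1 (y := x - round x) (by rw [Real.dist_eq, sub_zero, hn]; exact hy)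
    rw [norm_coe_localRep, hx2, add_sub_cancel, hφ.fixed, hn] at h3
    exact h3
  obtain ⟨N, hN, hpN, C, η, r, hC', hη, hη1, hr, hc⟩ := hφ.contr p hφ.ne
  obtain ⟨y, hyN, hyp⟩ : ∃ y ∈ N, y ≠ p := by
    have : (𝓝[≠] p).NeBot := inferInstance
    obtain ⟨y, hy⟩ := this.nonempty_of_mem (inter_mem (mem_nhdsWithin_of_mem_nhds hN)
      self_mem_nhdsWithin)
    exact ⟨y, hy.1, hy.2⟩
  have hlim : Tendsto (fun n => dist (φ^[n] y) p) atTop (𝓝 0) := by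
    refine squeeze_zero (g := fun n => C * η ^ n * dist y p ^ r) (fun n => dist_nonneg) (fun n => ?_) ?_
    · have := hc n y hyN p hpN
      rwa [Function.iterate_fixed hφ.fixed] at this
    · have := ((tendsto_pow_atTop_nhds_zero_of_lt_one hη.le hη1).const_mul C).mul_const
        (dist y p ^ r)
      simpa using this
  obtain ⟨n₀, hn₀⟩ := eventually_atTop.1 (hlim.eventually_lt_const hδ)
  have hmono : ∀ k, dist (φ^[n₀] y) p ≤ dist (φ^[n₀ + k] y) p := by
    intro k
    induction k with
    | zero => exact le_rfl
    | succ k ih =>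
      refine ih.trans ?_
      rw [← add_assoc, Function.iterate_succ_apply']
      exact hexp _ (hn₀ _ (Nat.le_add_right _ _))
  have h2 : dist (φ^[n₀] y) p ≤ 0 := by
    refine ge_of_tendsto ((tendsto_add_atTop_iff_nat n₀).2 hlim) (Eventually.of_forall fun k => ?_)
    rw [add_comm k]
    exact hmono k
  have h3 : φ^[n₀] y = p := dist_le_zero.1 h2
  refine hyp (hinj.iterate n₀ ?_)
  rw [h3, Function.iterate_fixed hφ.fixed]

/-- A continuous solution of a cohomological equation over a north-south diffeomorphism is
Hölder. -/
theorem IsNorthSouth.isHolder {φ : S1 ≃ₜ S1} (hφ : IsNorthSouth φ) {u m W m' W' : S1 → ℝ}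
    (hu : Continuous u) (hm : IsHolder m) (hW : IsHolder W) (hm' : IsHolder m') (hW' : IsHolder W')
    (hp : ∀ p q, ContractsTo φ p q → |m p| ≤ 1) (hp' : ∀ p q, ContractsTo φ.symm p q → |m' p| ≤ 1)
    (h : ∀ θ, u θ = m θ * u (φ θ) + W θ) (h' : ∀ θ, u θ = m' θ * u (φ.symm θ) + W' θ) :
    IsHolder u := by
  obtain ⟨p, q, h1, h2⟩ := hφ
  refine isHolder_of_holderNear fun θ => ?_
  rcases eq_or_ne θ q with rfl | hθ
  · exact h2.holderNear hu hm' hW' (hp' _ _ h2) h' h2.ne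
  · exact h1.holderNear hu hm hW (hp _ _ h1) h hθ

end

noncomputable section

/-! ### Regularity of the homeomorphisms that conjugate two actions -/

theorem IsHolder.inv₀ {f : S1 → ℝ} (hf : IsHolder f) (h0 : ∀ θ, f θ ≠ 0) :
    IsHolder fun θ => (f θ)⁻¹ := by
  obtain ⟨x₀, -, hx₀⟩ := isCompact_univ.exists_isMinOn univ_nonempty hf.cont.abs.continuousOn
  set δ := |f x₀| with hδ
  have hδ0 : 0 < δ := abs_pos.2 (h0 x₀)
  have hle : ∀ θ, δ ≤ |f θ| := fun θ => hx₀ (mem_univ θ)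
  obtain ⟨C, r, hC, hr, h⟩ := hf.exists_dist_le_real
  refine isHolder_of_dist_le (C := δ⁻¹ * δ⁻¹ * C) (by positivity) hr fun y z => ?_
  have h1 : (f y)⁻¹ - (f z)⁻¹ = (f y)⁻¹ * (f z)⁻¹ * (f z - f y) := by
    have := h0 y
    have := h0 z
    field_simp
  have h2 := h y z
  rw [Real.dist_eq] at h2
  rw [Real.dist_eq, h1, abs_mul, abs_mul, abs_inv, abs_inv, abs_sub_comm, mul_assoc _ C]
  gcongr
  · exact hle y
  · exact hle z

theorem isHolder_of_hasDerivAt_lift {χ : S1 → S1} {F D : ℝ → ℝ} {B : ℝ}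
    (hF : ∀ x, HasDerivAt F (D x) x) (hB : ∀ x, |D x| ≤ B)
    (hl : ∀ x : ℝ, ((F x : ℝ) : S1) = χ (x : S1)) : IsHolder χ := by
  have hB0 : 0 ≤ B := (abs_nonneg _).trans (hB 0)
  have hL : LipschitzWith B.toNNReal F :=
    lipschitzWith_of_nnnorm_deriv_le (fun x => (hF x).differentiableAt) fun x => by
      rw [← NNReal.coe_le_coe, coe_nnnorm, Real.norm_eq_abs, Real.coe_toNNReal B hB0, (hF x).deriv]
      exact hB _
  refine isHolder_of_dist_le hB0 one_pos fun θ η => ?_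
  rw [Real.rpow_one]
  obtain ⟨x, rfl⟩ := S1.coe_surjective θ
  obtain ⟨y, rfl⟩ := S1.coe_surjective η
  have e : ((y : ℝ) : S1) = ((y + round (x - y) : ℝ) : S1) :=
    S1.coe_eq_coe_iff.2 ⟨-round (x - y), by push_cast; ring⟩
  have e1 : dist ((x : ℝ) : S1) ((y : ℝ) : S1) = |x - (y + round (x - y))| := by
    rw [dist_eq_norm, ← AddCircle.coe_sub, UnitAddCircle.norm_eq]
    congr 1
    ring
  rw [e1, e, ← hl, ← hl]
  have h1 := hL.dist_le_mul x (y + round (x - y))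
  rw [Real.dist_eq, Real.dist_eq, Real.coe_toNNReal B hB0] at h1
  refine le_trans ?_ h1
  rw [← Real.dist_eq]
  exact S1.dist_coe_le _ _

theorem cderiv_eq_of_lift {χ : S1 → S1} {F : ℝ → ℝ} {D : S1 → ℝ}
    (hF : ∀ x : ℝ, HasDerivAt F (D x) x) (hl : ∀ x : ℝ, ((F x : ℝ) : S1) = χ (x : S1)) :
    cderiv χ = D := by
  funext θ
  obtain ⟨x, rfl⟩ := S1.coe_surjective θ
  exact (hasDerivAt_localRep hl (hF x)).deriv

theorem IsC1hMap.of_lift {χ : S1 → S1} {F : ℝ → ℝ} {D : S1 → ℝ} (hD : IsHolder D)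
    (hF : ∀ x : ℝ, HasDerivAt F (D x) x) (hl : ∀ x : ℝ, ((F x : ℝ) : S1) = χ (x : S1)) :
    IsC1hMap χ := by
  refine ⟨⟨F, ?_, hl⟩, ?_⟩
  · rw [contDiff_one_iff_deriv]
    refine ⟨fun x => (hF x).differentiableAt, ?_⟩
    have : deriv F = fun x : ℝ => D x := funext fun x => (hF x).deriv
    rw [this]
    exact hD.cont.comp S1.continuous_coe
  · rw [cderiv_eq_of_lift hF hl]
    exact hD

theorem cderiv_mul_symm (φ : DiffH) (s : S1) :
    cderiv φ.1 (φ.1.symm s) * cderiv φ.1.symm s = 1 := by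
  have := cderiv_symm_mul φ (φ.1.symm s)
  rwa [φ.1.apply_symm_apply, mul_comm] at this

namespace IsJetTransfer

variable {T : Jet ≃ₜ Jet}

/-- A transfer which conjugates two jet maps, the first of which has north-south dynamics on the
circle, covers a diffeomorphism of the circle of class `C^{1,h}`. -/
theorem exists_diffH_form (h : IsJetTransfer T) {G G' : JetGroup} (hG : IsNorthSouth G.right.1)
    (hT : ∀ x, T (jetMap G x) = jetMap G' (T x)) :
    ∃ (φ : DiffH) (ε : ℝ) (β H : S1 → ℝ), (ε = 1 ∨ ε = -1) ∧ Continuous β ∧ Continuous H ∧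
      ∀ θ q f, T (θ, q, f) = (φ.1 θ, ε * cderiv φ.1.symm (φ.1 θ) * q + β θ, f + H θ) := by
  obtain ⟨φ, α, β, H, hα, hβ, hH, hα0, hTf, hvol⟩ := h.exists_affine_form
  obtain ⟨φ', α', β', H', hα', hβ', hH', hα0', hTf', hvol'⟩ := h.symm.exists_affine_form
  have hφ' : φ' = φ.symm := by
    refine Homeomorph.ext fun θ => ?_
    have := T.symm_apply_apply (φ.symm θ, 0, 0)
    rw [hTf, hTf', φ.apply_symm_apply] at this
    exact congrArg Prod.fst this
  subst hφ'
  have hαα : ∀ θ, α' (φ θ) * α θ = 1 := by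
    intro θ
    have h1 := T.symm_apply_apply (θ, 1, 0)
    have h0 := T.symm_apply_apply (θ, 0, 0)
    rw [hTf, hTf'] at h1 h0
    have e1 := congrArg (fun x : Jet => x.2.1) h1
    have e0 := congrArg (fun x : Jet => x.2.1) h0
    simp only at e1 e0
    linear_combination e1 - e0
  -- lifts of `φ` and of its inverse
  have hw : Continuous fun θ => |α (φ.symm θ)| := (hα.comp φ.symm.continuous).abs
  have hw' : Continuous fun θ => |α' (φ θ)| := (hα'.comp φ.continuous).abs
  obtain ⟨ε₁, F₁, hε₁, hF₁, hl₁⟩ := exists_lift_of_volume_image (χ := φ.symm) hw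
    (fun θ => abs_pos.2 (hα0 _)) fun B hB => hvol B hB.measurableSet
  obtain ⟨ε₂, F₂, hε₂, hF₂, hl₂⟩ := exists_lift_of_volume_image (χ := φ) hw'
    (fun θ => abs_pos.2 (hα0' _)) fun B hB => hvol' B hB.measurableSet
  have hφh : IsHolder φ := by
    obtain ⟨B, hB⟩ := isCompact_univ.exists_bound_of_continuousOn hw'.continuousOn
    refine isHolder_of_hasDerivAt_lift hF₂ (B := B) (fun x => ?_) hl₂
    have := hB x (mem_univ _)
    rw [Real.norm_eq_abs] at this
    rw [abs_mul]
    rcases hε₂ with e | e <;> simpa [e] using this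
  have hφh' : IsHolder φ.symm := by
    obtain ⟨B, hB⟩ := isCompact_univ.exists_bound_of_continuousOn hw.continuousOn
    refine isHolder_of_hasDerivAt_lift hF₁ (B := B) (fun x => ?_) hl₁
    have := hB x (mem_univ _)
    rw [Real.norm_eq_abs] at this
    rw [abs_mul]
    rcases hε₁ with e | e <;> simpa [e] using this
  -- the equivariance gives a cohomological equation
  have hconj : ∀ θ, φ (G.right.1 θ) = G'.right.1 (φ θ) := fun θ => by
    have := hT (θ, 0, 0)
    rw [hTf] at this
    simp only [jetMap] at this
    rw [hTf] at this
    exact congrArg Prod.fst this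
  -- The equivariance is affine in the momentum `q`; its linear coefficient is extracted from the
  -- values at `1` and `0`.
  have hcoh : ∀ θ, α (G.right.1 θ) * cderiv G.right.1.symm (G.right.1 θ) =
      α θ * cderiv G'.right.1.symm (G'.right.1 (φ θ)) := by
    intro θ
    have key : ∀ q, α (G.right.1 θ) * (q * cderiv G.right.1.symm (G.right.1 θ) +
        sderiv G.fn (G.right.1 θ)) + β (G.right.1 θ) =
        (α θ * q + β θ) * cderiv G'.right.1.symm (G'.right.1 (φ θ)) +
          sderiv G'.fn (G'.right.1 (φ θ)) := fun q => by
      have := hT (θ, q, 0)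
      rw [hTf] at this
      simp only [jetMap] at this
      rw [hTf] at this
      exact congrArg (fun x : Jet => x.2.1) this
    linear_combination key 1 - key 0
  have e1 : ∀ θ, α θ = cderiv G.right.1.symm (G.right.1 θ) * cderiv G'.right.1 (φ θ) *
      α (G.right.1 θ) + 0 := fun θ => by
    have h1 := cderiv_symm_mul G'.right (φ θ)
    linear_combination (-α θ) * h1 - cderiv G'.right.1 (φ θ) * hcoh θ
  have e2 : ∀ θ, α θ = cderiv G.right.1 (G.right.1.symm θ) * cderiv G'.right.1.symm (φ θ) *
      α (G.right.1.symm θ) + 0 := fun θ => by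
    have h1 := hcoh (G.right.1.symm θ)
    have h2 := cderiv_mul_symm G.right θ
    rw [← hconj, G.right.1.apply_symm_apply] at h1
    linear_combination (-α θ) * h2 + cderiv G.right.1 (G.right.1.symm θ) * h1
  have hαh : IsHolder α := by
    have hz : IsHolder fun _ : S1 => (0 : ℝ) := ⟨0, 1, one_pos, HolderWith.const⟩
    refine hG.isHolder (m := fun θ => cderiv G.right.1.symm (G.right.1 θ) * cderiv G'.right.1 (φ θ))
      (m' := fun θ => cderiv G.right.1 (G.right.1.symm θ) * cderiv G'.right.1.symm (φ θ)) hα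
      ((G.right.2.2.2.comp' G.right.2.1.lipschitz).mul' (G'.right.2.1.2.comp' hφh)) hz
      ((G.right.2.1.2.comp' G.right.2.2.lipschitz).mul' (G'.right.2.2.2.comp' hφh)) hz ?_ ?_ e1 e2
    -- At a fixed point the equation reads `α p = m p * α p` with `α p ≠ 0`, so the multiplier is
    -- exactly one.
    · intro p q hpq
      have := e1 p
      rw [hpq.fixed, add_zero] at this
      have h1 := mul_right_cancel₀ (hα0 p) ((one_mul _).trans this)
      rw [hpq.fixed, ← h1, abs_one]
    · intro p q hpq
      have := e2 p
      rw [hpq.fixed, add_zero] at this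
      have h1 := mul_right_cancel₀ (hα0 p) ((one_mul _).trans this)
      rw [hpq.fixed, ← h1, abs_one]
  -- The function `α` has constant sign on the connected circle. This sign and the orientation `ε₁`
  -- of `φ⁻¹` combine to the sign of the conclusion.
  obtain ⟨s, hs, hsα⟩ : ∃ s : ℝ, (s = 1 ∨ s = -1) ∧ ∀ θ, |α θ| = s * α θ := by
    rcases pos_or_neg_of_ne_zero hα hα0 with hp | hn
    · exact ⟨1, Or.inl rfl, fun θ => by rw [abs_of_pos (hp θ), one_mul]⟩
    · exact ⟨-1, Or.inr rfl, fun θ => by rw [abs_of_neg (hn θ), neg_one_mul]⟩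
  have hc : ∀ c : ℝ, IsHolder fun _ : S1 => c := fun c => ⟨0, 1, one_pos, HolderWith.const⟩
  have hd₁ : IsHolder fun θ => ε₁ * |α (φ.symm θ)| := by
    simp only [hsα]
    exact (hc ε₁).mul' ((hc s).mul' (hαh.comp' hφh'))
  have hd₂ : IsHolder fun θ => ε₂ * |α' (φ θ)| := by
    have : ∀ θ, α' (φ θ) = (α θ)⁻¹ := fun θ => eq_inv_of_mul_eq_one_left (hαα θ)
    simp only [this, abs_inv, hsα, mul_inv]
    exact (hc ε₂).mul' ((hc s⁻¹).mul' (hαh.inv₀ hα0))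
  have hC₁ : IsC1hMap φ.symm := IsC1hMap.of_lift hd₁ hF₁ hl₁
  have hC₂ : IsC1hMap φ := IsC1hMap.of_lift hd₂ hF₂ hl₂
  have hcd : cderiv φ.symm = fun θ => ε₁ * |α (φ.symm θ)| := cderiv_eq_of_lift hF₁ hl₁
  refine ⟨⟨φ, hC₂, hC₁⟩, s * ε₁, β, H, ?_, hβ, hH, fun θ q f => ?_⟩
  · rcases hs with e | e <;> rcases hε₁ with e' | e' <;> simp [e, e']
  · rw [hTf]
    refine Prod.ext rfl (Prod.ext ?_ rfl)
    change α θ * q + β θ = s * ε₁ * cderiv φ.symm (φ θ) * q + β θ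
    rw [hcd]
    simp only [φ.symm_apply_apply, hsα]
    rcases hs with e | e <;> rcases hε₁ with e' | e' <;> simp [e, e']

end IsJetTransfer

end

noncomputable section

/-! ### Rigidity of the transfers that fix the circle -/

theorem hasDerivAt_coe_of_shift {g : S1 → ℝ} {d x : ℝ}
    (h : HasDerivAt (fun y : ℝ => g ((x : S1) + (y : S1))) d 0) :
    HasDerivAt (fun y : ℝ => g (y : S1)) d x := by
  have h2 : HasDerivAt (fun y : ℝ => g ((x + y : ℝ) : S1)) d 0 := by
    simpa only [AddCircle.coe_add] using h
  have h3 : HasDerivAt (fun y : ℝ => g ((x + (y - x) : ℝ) : S1)) d x := by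
    refine HasDerivAt.comp_sub_const (f := fun y : ℝ => g ((x + y : ℝ) : S1)) x x ?_
    rwa [sub_self]
  simpa using h3

theorem IsC1hMap.exists_lift {φ : S1 → S1} (h : IsC1hMap φ) : ∃ F : ℝ → ℝ,
    (∀ x : ℝ, HasDerivAt F (cderiv φ x) x) ∧ ∀ x : ℝ, ((F x : ℝ) : S1) = φ (x : S1) := by
  obtain ⟨⟨F, hF, hl⟩, -⟩ := h
  refine ⟨F, fun x => ?_, hl⟩
  have h1 := (hF.differentiable one_ne_zero x).hasDerivAt
  have h2 : cderiv φ x = deriv F x := (hasDerivAt_localRep hl h1).deriv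
  rwa [h2]

/-- Lifts of injective maps of the circle send intervals of length less than one to intervals of
length at most one. -/
theorem abs_sub_le_one_of_lift {φ : S1 → S1} (hφ : Function.Injective φ) {F : ℝ → ℝ}
    (hF : Continuous F) (hl : ∀ x : ℝ, ((F x : ℝ) : S1) = φ (x : S1)) {x y : ℝ} (hxy : x < y)
    (hy : y < x + 1) : |F y - F x| ≤ 1 := by
  by_contra! hlt
  have key : ∀ e : ℝ, (e = 1 ∨ e = -1) → F x + e ∉ F '' Ioo x y := by
    rintro e he ⟨z, hz, hFz⟩
    have h1 : φ (z : S1) = φ (x : S1) := by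
      rw [← hl, ← hl, hFz]
      refine S1.coe_eq_coe_iff.2 ?_
      rcases he with rfl | rfl
      · exact ⟨1, by push_cast; ring⟩
      · exact ⟨-1, by push_cast; ring⟩
    have h2 := S1.coe_inj (x := z) (y := x)
      (abs_lt.2 ⟨by linarith [hz.1], by linarith [hz.2]⟩) (hφ h1)
    linarith [hz.1]
  rcases lt_abs.1 hlt with h | h
  · exact key 1 (Or.inl rfl) (intermediate_value_Ioo hxy.le hF.continuousOn
      ⟨by linarith, by linarith⟩)
  · exact key (-1) (Or.inr rfl) (intermediate_value_Ioo' hxy.le hF.continuousOn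
      ⟨by linarith, by linarith⟩)

/-- A continuous function on the circle, up to a linear term. -/
theorem exists_periodic_part {β H : S1 → ℝ} (hβ : Continuous β) (hH : Continuous H) :
    ∃ (P : S1 → ℝ) (c : ℝ), Continuous P ∧
      ∀ x : ℝ, (∫ y in (0 : ℝ)..x, β (y : S1)) - H (x : S1) = P (x : S1) + c * x := by
  set c := ∫ y in (0 : ℝ)..1, β (y : S1) with hc
  have hβc : Continuous fun y : ℝ => β (y : S1) := hβ.comp S1.continuous_coe
  set Q : ℝ → ℝ := fun x => (∫ y in (0 : ℝ)..x, β (y : S1)) - H (x : S1) - c * x with hQ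
  have hper : Function.Periodic Q 1 := by
    intro x
    have h1 : Function.Periodic (fun y : ℝ => β (y : S1)) 1 := fun y => by
      simp only [AddCircle.coe_add, AddCircle.coe_period, add_zero]
    have h2 := h1.intervalIntegral_add_eq x 0
    rw [zero_add] at h2
    have h3 := intervalIntegral.integral_add_adjacent_intervals (hβc.intervalIntegrable 0 x)
      (hβc.intervalIntegrable (μ := volume) x (x + 1))
    simp only [hQ, AddCircle.coe_add, AddCircle.coe_period, add_zero]
    rw [← h3, h2, ← hc]
    ring
  have hQc : Continuous Q := by
    have h1 : Continuous fun x : ℝ => ∫ y in (0 : ℝ)..x, β (y : S1) :=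
      intervalIntegral.continuous_primitive (fun a b => hβc.intervalIntegrable a b) 0
    exact (h1.sub (hH.comp S1.continuous_coe)).sub (continuous_const.mul continuous_id)
  refine ⟨hper.lift, c, continuous_coinduced_dom.2 (by exact hQc), fun x => ?_⟩
  rw [Function.Periodic.lift_coe]
  simp only [hQ]
  ring

/-- Multiplying the equation `e₁` by the derivative of `a` makes it the differential of `∫β ∘ F - ∫β
= k ∘ a - ε h ∘ a + c`. Subtracting `e₀`, the equation for `H`, leaves a multiple of `h` that
disappears when `ε = 1`. -/
theorem exists_primitive_cocycle {a : DiffH} {β H h k : S1 → ℝ} {ε : ℝ} (hβ : Continuous β)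
    (hh : IsC1hFun h) (hk : IsC1hFun k)
    (e₀ : ∀ θ, H (a.1 θ) + h (a.1 θ) = H θ + k (a.1 θ))
    (e₁ : ∀ θ, ε * sderiv h (a.1 θ) + β (a.1 θ) =
      β θ * cderiv a.1.symm (a.1 θ) + sderiv k (a.1 θ))
    {F : ℝ → ℝ} (hF : ∀ x : ℝ, HasDerivAt F (cderiv a.1 x) x)
    (hl : ∀ x : ℝ, ((F x : ℝ) : S1) = a.1 (x : S1)) :
    ∃ c, ∀ x : ℝ, ((∫ y in (0 : ℝ)..F x, β (y : S1)) - H (F x : S1)) -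
      ((∫ y in (0 : ℝ)..x, β (y : S1)) - H (x : S1)) = (1 - ε) * h (a.1 (x : S1)) + c := by
  have hβc : Continuous fun y : ℝ => β (y : S1) := hβ.comp S1.continuous_coe
  have hB : ∀ x : ℝ, HasDerivAt (fun x : ℝ => ∫ y in (0 : ℝ)..x, β (y : S1)) (β (x : S1)) x :=
    fun x => intervalIntegral.integral_hasDerivAt_right (hβc.intervalIntegrable 0 x)
      (hβc.stronglyMeasurableAtFilter volume (𝓝 x)) hβc.continuousAt
  set D : ℝ → ℝ := fun x => (∫ y in (0 : ℝ)..F x, β (y : S1)) - (∫ y in (0 : ℝ)..x, β (y : S1)) -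
    (k (a.1 (x : S1)) - ε * h (a.1 (x : S1))) with hD
  have hD0 : ∀ x, HasDerivAt D 0 x := by
    intro x
    have h1 := (hB (F x)).comp x (hF x)
    have h2 := hasDerivAt_coe_of_shift (g := fun θ => k (a.1 θ)) (sderiv_comp hk a.2.1 (x : S1))
    have h3 := hasDerivAt_coe_of_shift (g := fun θ => h (a.1 θ)) (sderiv_comp hh a.2.1 (x : S1))
    refine ((h1.sub (hB x)).sub (h2.sub (h3.const_mul ε))).congr_deriv ?_
    rw [hl]
    have h4 := cderiv_symm_mul a (x : S1)
    linear_combination (cderiv a.1 (x : S1)) * e₁ x + β (x : S1) * h4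
  have hDc : ∀ x, D x = D 0 := fun x =>
    is_const_of_deriv_eq_zero (fun x => (hD0 x).differentiableAt) (fun x => (hD0 x).deriv) x 0
  refine ⟨D 0, fun x => ?_⟩
  rw [← hDc x, hD]
  simp only [hl]
  linear_combination -e₀ x

/-- A continuous function all of whose increments are close to integral multiples of `c` is
constant. -/
theorem eq_of_forall_exists_int {K : ℝ → ℝ} (hK : Continuous K) {c : ℝ}
    (h : ∀ x y, ∀ δ > 0, ∃ k : ℤ, |K x - K y - c * k| < δ) (x y : ℝ) : K x = K y := by
  rcases eq_or_ne c 0 with rfl | hc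
  · refine eq_of_abs_sub_eq_zero (le_antisymm (le_of_forall_pos_lt_add fun δ hδ => ?_)
      (abs_nonneg _))
    obtain ⟨k, hk⟩ := h x y δ hδ
    simpa using hk
  set g : ℝ → ℝ := fun z => (K z - K y) / c with hg
  -- Being arbitrarily close to integers, the normalised increments are integers; a continuous
  -- function with integral values is constant.
  have hint : ∀ z, g z = round (g z) := by
    intro z
    refine eq_of_abs_sub_eq_zero (le_antisymm (le_of_forall_pos_lt_add fun δ hδ => ?_)
      (abs_nonneg _))
    obtain ⟨k, hk⟩ := h z y (δ * |c|) (mul_pos hδ (abs_pos.2 hc))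
    rw [zero_add]
    refine (round_le (g z) k).trans_lt ?_
    have : g z - k = (K z - K y - c * k) / c := by
      simp only [hg]
      field_simp
    rw [this, abs_div, div_lt_iff₀ (abs_pos.2 hc)]
    exact hk
  have hgc : Continuous g := (hK.sub continuous_const).div_const c
  have hgy : g y = 0 := by simp [hg]
  suffices hgx : g x = 0 by
    simp only [hg, div_eq_zero_iff, hc, or_false] at hgx
    linarith
  by_contra hgx
  have hr : (round (g x) : ℤ) ≠ 0 := fun e => hgx (by rw [hint x, e, Int.cast_zero])
  rcases lt_or_gt_of_ne hr with hlt | hgt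
  · have h1 : g x ≤ -1 := by
      rw [hint x]
      exact_mod_cast Int.le_sub_one_of_lt hlt
    obtain ⟨z, hz⟩ := mem_range_of_exists_le_of_exists_ge (c := (-1 / 2 : ℝ)) hgc
      ⟨x, by linarith⟩ ⟨y, by linarith⟩
    have h2 := hint z
    rw [hz] at h2
    have h3 : ((2 * round (-1 / 2 : ℝ) : ℤ) : ℝ) = ((-1 : ℤ) : ℝ) := by push_cast; linarith
    have h4 := Int.cast_injective h3
    omega
  · have h1 : 1 ≤ g x := by
      rw [hint x]
      exact_mod_cast hgt
    obtain ⟨z, hz⟩ := mem_range_of_exists_le_of_exists_ge (c := (1 / 2 : ℝ)) hgc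
      ⟨y, by linarith⟩ ⟨x, by linarith⟩
    have h2 := hint z
    rw [hz] at h2
    have h3 : ((2 * round (1 / 2 : ℝ) : ℤ) : ℝ) = ((1 : ℤ) : ℝ) := by push_cast; linarith
    have h4 := Int.cast_injective h3
    omega

namespace ConjugationData.NormalForm

variable {Γ : Type*} [Group Γ] {κ : S1 ≃ₜ S1} {M : Type*} [TopologicalSpace M] [AddAction ℝ M]
  {X : ConjugationData Γ κ M} {v : M → ℝ} {r : S1 × S1 → ℝ}

/-- Along an expanding sequence the cocycle is not bounded near the expanded point. -/
theorem not_bounded_cocycle (N : X.NormalForm v r) {γ : ℕ → Γ} {l : Ultrafilter ℕ} {s a B : S1}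
    (hE : IsExpanding X γ l s a B) (hT : Tendsto (fun n : ℕ => (n : ℝ)) l atTop) {x : M}
    (hx : X.bundle.proj x ∈ {y : S1 × S1 | y.1 ≠ s ∧ y.2 = κ s}) {C : ℝ}
    (hC : ∀ n : ℕ, |v (X.act (γ n) x) + n| ≤ C) : False := by
  obtain ⟨hx1, hx2⟩ := hx
  have hD : (B, κ a) ∈ annulus κ := fun e => hE.ne (κ.injective e).symm
  obtain ⟨Q, hQ, hBQ, hQD⟩ := exists_compact_subset (isOpen_annulus κ.continuous) hD
  have hcomp : IsCompact ((fun q : (S1 × S1) × ℝ => N.pt q.1 q.2) '' (Q ×ˢ Icc (-C) C)) :=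
    (hQ.prod isCompact_Icc).image_of_continuousOn
      (N.continuousOn_pt.mono fun q hq => hQD hq.1)
  refine hx1 (N.eq_of_recurrent hT hcomp ?_ hE.tendsto)
  -- The images of a point over `(s', κ s)` tend to `(B, κ a)`, which lies in the annulus since `a ≠
  -- B`. If `v` were comparable with `-n` there, the flowed point would recur to a compact set
  -- although `s'` is not the repelling point.
  have h1 : Tendsto (fun n => ((X.ρ₁ (γ n)).1 (X.bundle.proj x).1,
      κ ((X.ρ₁ (γ n)).1 s))) l (𝓝 (B, κ a)) :=
    (hE.tendsto _ hx1).prodMk_nhds ((κ.continuous.tendsto a).comp hE.tendsto_self)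
  filter_upwards [h1 (mem_interior_iff_mem_nhds.1 hBQ)] with n hn
  refine ⟨(X.bundle.proj (X.act (γ n) ((n : ℝ) +ᵥ x)), v (X.act (γ n) ((n : ℝ) +ᵥ x))),
    ⟨?_, ?_⟩, N.eq_pt _⟩
  · change X.bundle.proj (X.act (γ n) ((n : ℝ) +ᵥ x)) ∈ Q
    rw [(X.act_regular (γ n)).proj_map, X.bundle.proj_vadd, hx2, X.conjugate]
    exact hn
  · change v (X.act (γ n) ((n : ℝ) +ᵥ x)) ∈ Icc (-C) C
    rw [(X.act_regular (γ n)).map_vadd, N.isCoord.vadd]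
    exact abs_le.1 (hC n)

theorem isJetTransfer (N : X.NormalForm v r) {ρ₀ : Γ →* JetGroup}
    (h₀ : X.IsConjugation N.jetHomeo ρ₀) {Ψ : M ≃ₜ Jet} {ρ : Γ →* JetGroup}
    (h : X.IsConjugation Ψ ρ) : IsJetTransfer (N.jetHomeo.symm.trans Ψ) := by
  obtain ⟨ψ₀, hψ₀, hp₀⟩ := h₀.area_preserving
  obtain ⟨ψ, hψ, hp⟩ := h.area_preserving
  refine ⟨⟨ψ₀.symm.trans ψ, ?_, fun x => ?_⟩, fun t x => ?_, fun θ f => ?_⟩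
  · have e : ψ₀.symm.trans ψ ∘ ψ₀ = ψ := funext fun x => by simp
    conv_lhs => rw [← hψ₀]
    rw [Measure.map_map (Homeomorph.measurable _) ψ₀.measurable, e, hψ]
  · obtain ⟨m, rfl⟩ := N.jetHomeo.surjective x
    simp only [Homeomorph.trans_apply, Homeomorph.symm_apply_apply, hp, hp₀]
  · obtain ⟨m, rfl⟩ := N.jetHomeo.surjective x
    simp only [Homeomorph.trans_apply, Homeomorph.symm_apply_apply, ← h₀.flow, ← h.flow]
  · obtain ⟨t₀, ht₀⟩ := S1.coe_surjective (κ θ)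
    have hc : ∀ t ∈ Ioo t₀ (t₀ + 1), X.bundle.proj (N.pt (θ, (t : S1)) f) = (θ, (t : S1)) ∧
        v (N.pt (θ, (t : S1)) f) = f := fun t ht =>
      ⟨N.proj_pt (mem_annulus_of_Ioo ht₀ ht), N.coord_pt (mem_annulus_of_Ioo ht₀ ht)⟩
    obtain ⟨q, ⟨θ', f', rfl⟩, hq⟩ := h.leaves (fun t : ℝ => N.pt (θ, (t : S1)) f, Ioo t₀ (t₀ + 1))
      ((N.mem_leaves_iff _).2 ⟨θ, t₀, f, ht₀, rfl, hc⟩)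
    refine ⟨θ', f', ?_⟩
    rw [← N.jetHomeo_image_leaf ht₀ hc]
    rw [image_univ] at hq
    rw [← hq, image_image, image_image, image_image]
    simp only [Homeomorph.trans_apply, Homeomorph.symm_apply_apply]

end ConjugationData.NormalForm

end

/-! ### Uniqueness up to the jet group -/

noncomputable section

namespace ConjugationData.NormalForm

variable {Γ : Type*} [Group Γ] {κ : S1 ≃ₜ S1} {M : Type*} [TopologicalSpace M] [AddAction ℝ M]
  {X : ConjugationData Γ κ M} {v : M → ℝ} {r : S1 × S1 → ℝ}

/-- A transfer over the identity of the circle between the jet space of the normal form and another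
one is the prolongation of the addition of a function of class `C^{1,h}`. -/
theorem transfer_eq (N : X.NormalForm v r) {ρ₀ : Γ →* JetGroup}
    (h₀ : X.IsConjugation N.jetHomeo ρ₀) (hr : ∀ γ, (ρ₀ γ).right = X.ρ₁ γ) {T : Jet → Jet} {ε : ℝ}
    {β H : S1 → ℝ} (hε : ε = 1 ∨ ε = -1) (hβ : Continuous β) (hH : Continuous H)
    (hT : ∀ θ q f, T (θ, q, f) = (θ, ε * q + β θ, f + H θ)) {G : Γ → JetGroup}
    (hG : ∀ γ x, T (jetMap (ρ₀ γ) x) = jetMap (G γ) (T x)) :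
    ε = 1 ∧ IsC1hFun H ∧ sderiv H = β := by
  have hfn : ∀ g : JetGroup, IsC1hFun g.fn := fun g => (Multiplicative.toAdd g.left).2
  have hright : ∀ γ, (G γ).right = X.ρ₁ γ := fun γ => by
    refine Subtype.ext (Homeomorph.ext fun θ => ?_)
    have := hG γ (θ, 0, 0)
    simp only [jetMap, hT, hr] at this
    exact (congrArg Prod.fst this).symm
  have e₀ : ∀ γ θ, H ((X.ρ₁ γ).1 θ) + (ρ₀ γ).fn ((X.ρ₁ γ).1 θ) =
      H θ + (G γ).fn ((X.ρ₁ γ).1 θ) := fun γ θ => by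
    have := hG γ (θ, 0, 0)
    simp only [jetMap, hT, hr, hright] at this
    have := congrArg (fun x : Jet => x.2.2) this
    simp only at this
    linarith
  have e₁ : ∀ γ θ, ε * sderiv (ρ₀ γ).fn ((X.ρ₁ γ).1 θ) + β ((X.ρ₁ γ).1 θ) =
      β θ * cderiv (X.ρ₁ γ).1.symm ((X.ρ₁ γ).1 θ) + sderiv (G γ).fn ((X.ρ₁ γ).1 θ) :=
    fun γ θ => by
    have := hG γ (θ, 0, 0)
    simp only [jetMap, hT, hr, hright] at this
    have := congrArg (fun x : Jet => x.2.1) this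
    simp only at this
    linarith
  -- the function `β` is Hölder
  have hβh : IsHolder β := by
    obtain ⟨γ, hγ⟩ := N.exists_isNorthSouth
    have hc : ∀ c : ℝ, IsHolder fun _ : S1 => c := fun c => ⟨0, 1, one_pos, HolderWith.const⟩
    have hW : IsHolder fun θ => sderiv (G γ).fn θ + -(ε * sderiv (ρ₀ γ).fn θ) :=
      (hfn (G γ)).2.add' ((hc ε).mul' (hfn (ρ₀ γ)).2).neg'
    -- The multipliers are the derivatives of the map and of its inverse, of modulus at most one at
    -- the respective attracting fixed points.
    refine hγ.isHolder (m := cderiv (X.ρ₁ γ).1) (m' := cderiv (X.ρ₁ γ).1.symm) hβ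
      (X.ρ₁ γ).2.1.2 ((X.ρ₁ γ).2.1.2.mul' (hW.comp' (X.ρ₁ γ).2.1.lipschitz).neg')
      (X.ρ₁ γ).2.2.2 hW (fun p q h => h.abs_cderiv_le (X.ρ₁ γ).2.1 (X.ρ₁ γ).1.injective)
      (fun p q h => h.abs_cderiv_le (X.ρ₁ γ).2.2 (X.ρ₁ γ).1.symm.injective)
      (fun θ => ?_) (fun θ => ?_)
    · have h1 := e₁ γ θ
      have h2 := cderiv_symm_mul (X.ρ₁ γ) θ
      linear_combination (-β θ) * h2 - cderiv (X.ρ₁ γ).1 θ * h1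
    · have h1 := e₁ γ ((X.ρ₁ γ).1.symm θ)
      rw [(X.ρ₁ γ).1.apply_symm_apply] at h1
      linear_combination h1
  choose F hF hl using fun γ => (X.ρ₁ γ).2.1.exists_lift
  have hFc : ∀ γ, Continuous (F γ) := fun γ =>
    continuous_iff_continuousAt.2 fun x => (hF γ x).continuousAt
  choose c hc using fun γ => exists_primitive_cocycle hβ (hfn (ρ₀ γ)) (hfn (G γ)) (e₀ γ) (e₁ γ)
    (hF γ) (hl γ)
  obtain ⟨P, c₁, hP, hPc⟩ := exists_periodic_part hβ hH
  simp only [hPc] at hc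
  simp only [hl] at hc
  obtain ⟨R, hR⟩ := isCompact_univ.exists_bound_of_continuousOn hP.continuousOn
  replace hR : ∀ y, |P y| ≤ R := fun y => hR y (mem_univ y)
  -- For `ε = -1` the primitive relation determines twice the cocycle through `K = ∫β - H`, which is
  -- bounded up to the linear term `c₁ x`. Since lifts move `0` and `1 / 2` to points at distance at
  -- most one, the cocycles at these two points differ boundedly. At `0` the cocycle is `-n` up to a
  -- constant, hence also at `1 / 2`, against `not_bounded_cocycle`.
  have hε1 : ε = 1 := by
    refine hε.resolve_right fun hε => ?_
    subst hε
    obtain ⟨γ, l, a, B, hE, hlim, C, hC⟩ := N.exists_expanding 0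
    have hhalf : ((1 / 2 : ℝ) : S1) ≠ 0 := S1.coe_ne_zero ⟨by norm_num, by norm_num⟩
    obtain ⟨m₀, hm₀⟩ := X.bundle.exists_proj_eq (antipodal_mem_annulus κ 0)
    obtain ⟨x, hx⟩ := X.bundle.exists_proj_eq (x := (((1 / 2 : ℝ) : S1), κ 0))
      (fun e => hhalf (κ.injective e))
    have hv : ∀ γ m, v (X.act γ m) = v m + (ρ₀ γ).fn ((X.ρ₁ γ).1 (X.bundle.proj m).1) := by
      intro γ m
      have := h₀.equivariant γ m
      change _ = jetMap (ρ₀ γ) (N.jetHomeo m) at this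
      rw [jetHomeo_apply, jetHomeo_apply] at this
      simp only [jetMap, hr, jetChart] at this
      exact congrArg (fun x : Jet => x.2.2) this
    refine N.not_bounded_cocycle hE hlim (x := x) (C := C + |v x| + (4 * R + 2 * |c₁|) / 2)
      (by rw [hx]; exact ⟨hhalf, rfl⟩) fun n => ?_
    have h1 := hC m₀ (by rw [hm₀]) n
    have h2 := hc (γ n) (1 / 2)
    have h3 := hc (γ n) 0
    have h4 := abs_sub_le_one_of_lift (X.ρ₁ (γ n)).1.injective (hFc (γ n)) (hl (γ n))
      (show (0 : ℝ) < 1 / 2 by norm_num) (by norm_num)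
    rw [hv, hm₀] at h1
    rw [hv, hx]
    change |v m₀ + (ρ₀ (γ n)).fn ((X.ρ₁ (γ n)).1 0) - v m₀ + n| ≤ C at h1
    change |v x + (ρ₀ (γ n)).fn ((X.ρ₁ (γ n)).1 ((1 / 2 : ℝ) : S1)) + n| ≤ _
    set y₁ := (X.ρ₁ (γ n)).1 ((1 / 2 : ℝ) : S1)
    rw [AddCircle.coe_zero] at h3
    set y₀ := (X.ρ₁ (γ n)).1 0
    have p1 := abs_le.1 (hR y₁)
    have p2 := abs_le.1 (hR y₀)
    have p3 := abs_le.1 (hR ((1 / 2 : ℝ) : S1))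
    have p4 := abs_le.1 (hR 0)
    have p5 : |c₁ * (F (γ n) (1 / 2) - F (γ n) 0)| ≤ |c₁| := by
      rw [abs_mul]
      exact mul_le_of_le_one_right (abs_nonneg _) h4
    rw [mul_sub] at p5
    have p5 := abs_le.1 p5
    have p6 := abs_le.1 h1
    have p7 := neg_abs_le (v x)
    have p8 := le_abs_self (v x)
    have p9 := neg_abs_le c₁
    have p10 := le_abs_self c₁
    rw [abs_le]
    constructor <;> linarith
  subst hε1
  simp only [sub_self, zero_mul, zero_add] at hc
  have hK : Continuous fun x : ℝ => P (x : S1) + c₁ * x :=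
    (hP.comp S1.continuous_coe).add (continuous_const.mul continuous_id)
  -- the primitive of `β` is the lift of `H`
  have hconst := eq_of_forall_exists_int hK (c := c₁) fun x y δ hδ => by
    -- Now `K ∘ F - K` is constant, so increments of `K` are unchanged by the lifts. A sequence
    -- expanding at a third point brings the images of `x` and `y` together on the circle, and the
    -- increment becomes close to `c₁` times an integer.
    obtain ⟨s, hs⟩ := Infinite.exists_notMem_finset ({(x : S1), (y : S1)} : Finset S1)
    rw [Finset.mem_insert, Finset.mem_singleton, not_or] at hs
    obtain ⟨γ, l, a, B, hE, -⟩ := N.exists_expanding s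
    have hx := hE.tendsto x (Ne.symm hs.1)
    have hy := hE.tendsto y (Ne.symm hs.2)
    have h1 : Tendsto (fun n => P ((X.ρ₁ (γ n)).1 x) - P ((X.ρ₁ (γ n)).1 y)) l (𝓝 0) := by
      have := ((hP.tendsto B).comp hx).sub ((hP.tendsto B).comp hy)
      rwa [sub_self] at this
    have h2 : Tendsto (fun n => dist ((X.ρ₁ (γ n)).1 x) ((X.ρ₁ (γ n)).1 y)) l (𝓝 0) := by
      have := hx.dist hy
      rwa [dist_self] at this
    have h3 : Tendsto (fun n => |P ((X.ρ₁ (γ n)).1 x) - P ((X.ρ₁ (γ n)).1 y)| +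
        |c₁| * dist ((X.ρ₁ (γ n)).1 x) ((X.ρ₁ (γ n)).1 y)) l (𝓝 0) := by
      have := h1.abs.add (h2.const_mul |c₁|)
      simpa using this
    obtain ⟨n, hn⟩ := (h3.eventually_lt_const hδ).exists
    refine ⟨round (F (γ n) x - F (γ n) y), ?_⟩
    have e1 := hc (γ n) x
    have e2 := hc (γ n) y
    have e3 : dist ((X.ρ₁ (γ n)).1 x) ((X.ρ₁ (γ n)).1 y) =
        |F (γ n) x - F (γ n) y - round (F (γ n) x - F (γ n) y)| := by
      rw [← hl, ← hl, dist_eq_norm, ← AddCircle.coe_sub, UnitAddCircle.norm_eq]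
    rw [e3, ← abs_mul] at hn
    refine lt_of_le_of_lt (le_trans (le_of_eq ?_) (abs_add_le _ _)) hn
    congr 1
    linear_combination e2 - e1
  have hHd : ∀ s, HasDerivAt (fun x : ℝ => H (s + (x : S1))) (β s) 0 := by
    intro s
    obtain ⟨x₀, rfl⟩ := S1.coe_surjective s
    have hβc : Continuous fun y : ℝ => β (y : S1) := hβ.comp S1.continuous_coe
    have h1 : ∀ x : ℝ, H (x : S1) = (∫ y in (0 : ℝ)..x, β (y : S1)) - (P ((0 : ℝ) : S1) + c₁ * 0) :=
      fun x => by
        have := hPc x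
        have h2 := hconst x 0
        linarith
    have h2 : HasDerivAt (fun x : ℝ => H (x : S1)) (β (x₀ : S1)) (x₀ + 0) := by
      rw [add_zero]
      simp only [h1]
      exact (intervalIntegral.integral_hasDerivAt_right (hβc.intervalIntegrable 0 x₀)
        (hβc.stronglyMeasurableAtFilter volume (𝓝 x₀)) hβc.continuousAt).sub_const _
    simpa only [AddCircle.coe_add] using h2.comp_const_add x₀ 0
  exact ⟨rfl, IsC1hFun.of_hasDerivAt hβh hHd, funext fun s => (hHd s).deriv⟩

/-- Every identification differs from the normal form by an element of the jet group. -/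
theorem exists_eq_jetHom (N : X.NormalForm v r) {ρ₀ : Γ →* JetGroup}
    (h₀ : X.IsConjugation N.jetHomeo ρ₀) (hr : ∀ γ, (ρ₀ γ).right = X.ρ₁ γ) {Ψ : M ≃ₜ Jet}
    {ρ : Γ →* JetGroup} (h : X.IsConjugation Ψ ρ) :
    ∃ g : JetGroup, ∀ m, Ψ m = jetHom g (N.jetHomeo m) := by
  have hTr := N.isJetTransfer h₀ h
  have heq : ∀ γ x, (N.jetHomeo.symm.trans Ψ) (jetMap (ρ₀ γ) x) =
      jetMap (ρ γ) ((N.jetHomeo.symm.trans Ψ) x) := by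
    intro γ x
    obtain ⟨m, rfl⟩ := N.jetHomeo.surjective x
    have h1 : jetMap (ρ₀ γ) (N.jetHomeo m) = N.jetHomeo (X.act γ m) := (h₀.equivariant γ m).symm
    rw [h1]
    simp only [Homeomorph.trans_apply, Homeomorph.symm_apply_apply]
    exact h.equivariant γ m
  obtain ⟨γ₀, hγ₀⟩ := N.exists_isNorthSouth
  -- The transfer is first divided by the diffeomorphism `φ`, which reduces it to one over the
  -- identity of the circle; `transfer_eq` shows that the quotient is the addition of the function
  -- `H`.
  obtain ⟨φ, ε, β, H, hε, hβ, hH, hform⟩ := hTr.exists_diffH_form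
    (G := ρ₀ γ₀) (by rw [hr]; exact hγ₀) (heq γ₀)
  set g₁ : JetGroup := SemidirectProduct.inr φ with hg₁
  have hinv : ∀ θ q f, jetMap g₁⁻¹ ((N.jetHomeo.symm.trans Ψ) (θ, q, f)) =
      (θ, ε * q + β θ * cderiv φ.1 θ, f + H θ) := by
    intro θ q f
    have h1 : (N.jetHomeo.symm.trans Ψ) (θ, q, f) =
        jetMap g₁ (θ, ε * q + β θ * cderiv φ.1 θ, f + H θ) := by
      have h2 := cderiv_symm_mul φ θ
      have h3 : sderiv g₁.fn (φ.1 θ) = 0 := by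
        have : g₁.fn = fun _ => (0 : ℝ) := rfl
        rw [this]
        simp [sderiv]
      rw [hform]
      refine Prod.ext rfl (Prod.ext ?_ ?_)
      · change _ = (ε * q + β θ * cderiv φ.1 θ) * cderiv φ.1.symm (φ.1 θ) + sderiv g₁.fn (φ.1 θ)
        rw [h3]
        simp only
        linear_combination (-β θ) * h2
      · change f + H θ = f + H θ + 0
        rw [add_zero]
    rw [h1, ← jetMap_mul, inv_mul_cancel, jetMap_one]
  obtain ⟨rfl, hHc, hHd⟩ := N.transfer_eq h₀ hr
    (T := fun x => jetMap g₁⁻¹ ((N.jetHomeo.symm.trans Ψ) x))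
    (β := fun θ => β θ * cderiv φ.1 θ) hε (hβ.mul φ.2.1.2.cont) hH hinv
    (G := fun γ => g₁⁻¹ * ρ γ * g₁) fun γ x => by
      simp only [heq]
      rw [← jetMap_mul, ← jetMap_mul]
      congr 1
      group
  set g₂ : JetGroup := SemidirectProduct.inl (Multiplicative.ofAdd ⟨H, hHc⟩) with hg₂
  refine ⟨g₁ * g₂, fun m => ?_⟩
  have h1 := hinv (X.bundle.proj m).1 (r (X.bundle.proj m)) (v m)
  have h2 : jetMap g₂ (N.jetHomeo m) = jetMap g₁⁻¹ (Ψ m) := by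
    have h3 : (N.jetHomeo.symm.trans Ψ) ((X.bundle.proj m).1, r (X.bundle.proj m), v m) = Ψ m := by
      change Ψ (N.jetHomeo.symm (N.jetHomeo m)) = Ψ m
      rw [N.jetHomeo.symm_apply_apply]
    rw [h3] at h1
    rw [h1]
    refine Prod.ext rfl (Prod.ext ?_ rfl)
    change r (X.bundle.proj m) * cderiv id (X.bundle.proj m).1 + sderiv H (X.bundle.proj m).1 =
      1 * r (X.bundle.proj m) + _
    rw [cderiv_id, hHd]
    ring
  change Ψ m = jetMap (g₁ * g₂) (N.jetHomeo m)
  rw [jetMap_mul, h2, ← jetMap_mul, mul_inv_cancel, jetMap_one]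

end ConjugationData.NormalForm

end

noncomputable section

/-! ### The jet group preserves the structures of the jet space -/

/-- Change of variables on `(0, 1)` for the displacement of the diffeomorphism from its value at
`0`, followed by invariance of Lebesgue measure under rotation. -/
theorem lintegral_diffH (b : DiffH) (G : S1 → ENNReal) :
    ∫⁻ θ, ENNReal.ofReal |cderiv b.1 θ| * G (b.1 θ) = ∫⁻ θ, G θ := by
  obtain ⟨F, hF, hl⟩ := b.2.1.exists_lift
  obtain ⟨c, hc⟩ := S1.coe_surjective (b.1 0)
  have hd : ∀ x ∈ Ioo (0 : ℝ) 1, HasDerivAt (disp b.1) (cderiv b.1 (x : S1)) x := fun x hx =>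
    ((hF x).sub_const c).of_coe_eq
      ((continuousOn_disp b.1).continuousAt (isOpen_Ioo.mem_nhds hx))
      (Eventually.of_forall fun y => by rw [coe_disp, AddCircle.coe_sub, hl, hc])
  have himg : disp b.1 '' Ioo 0 1 = Ioo 0 1 := by
    refine Subset.antisymm ?_ (disp_surjOn b.1)
    rintro _ ⟨x, hx, rfl⟩
    exact disp_mem b.1 hx
  have h1 := lintegral_image_eq_lintegral_abs_deriv_mul measurableSet_Ioo
    (fun x hx => (hd x hx).hasDerivWithinAt) (injOn_disp b.1) fun y : ℝ => G (b.1 0 + (y : S1))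
  rw [himg] at h1
  have h2 : ∫⁻ θ, G θ = ∫⁻ y in Ioo (0 : ℝ) 1, G (b.1 0 + (y : S1)) := by
    rw [← lintegral_add_left_eq_self G (b.1 0), ← UnitAddCircle.lintegral_preimage 0, zero_add,
      restrict_Ioo_eq_restrict_Ioc]
  rw [h2, h1, ← UnitAddCircle.lintegral_preimage 0, zero_add, restrict_Ioo_eq_restrict_Ioc]
  refine lintegral_congr fun x => ?_
  rw [coe_disp, add_sub_cancel]

/-- The area preserving homeomorphism of the cotangent bundle that an element of the jet group
covers. -/
def cotangentHomeo (g : JetGroup) : S1 × ℝ ≃ₜ S1 × ℝ where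
  toFun x := jetToCotangent (jetHom g (x.1, x.2, 0))
  invFun x := jetToCotangent (jetHom g⁻¹ (x.1, x.2, 0))
  left_inv x := by
    have h := (jetHom g).symm_apply_apply (x.1, x.2, 0)
    have h1 : (jetHom g).symm = jetHom g⁻¹ := by rw [map_inv]; rfl
    rw [h1] at h
    exact congrArg jetToCotangent h
  right_inv x := by
    have h := (jetHom g).apply_symm_apply (x.1, x.2, 0)
    have h1 : (jetHom g).symm = jetHom g⁻¹ := by rw [map_inv]; rfl
    rw [h1] at h
    exact congrArg jetToCotangent h
  continuous_toFun := by
    have h : Continuous jetToCotangent := by unfold jetToCotangent; fun_prop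
    exact h.comp ((jetHom g).continuous.comp (by fun_prop))
  continuous_invFun := by
    have h : Continuous jetToCotangent := by unfold jetToCotangent; fun_prop
    exact h.comp ((jetHom g⁻¹).continuous.comp (by fun_prop))

/-- On fibres the map is affine with slope the derivative of the inverse, which cancels the Jacobian
of the diffeomorphism of the base. -/
theorem volume_map_cotangentHomeo (g : JetGroup) :
    (volume : Measure (S1 × ℝ)).map (cotangentHomeo g) = volume := by
  refine Measure.ext fun E hE => ?_
  rw [Measure.map_apply (cotangentHomeo g).measurable hE, Measure.volume_eq_prod,
    Measure.prod_apply ((cotangentHomeo g).measurable hE), Measure.prod_apply hE,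
    ← lintegral_diffH g.right fun θ => volume (Prod.mk θ ⁻¹' E)]
  refine lintegral_congr fun θ => ?_
  set c := cderiv g.right.1.symm (g.right.1 θ) with hc
  have h1 : c * cderiv g.right.1 θ = 1 := cderiv_symm_mul g.right θ
  have hc0 : c ≠ 0 := left_ne_zero_of_mul_eq_one h1
  have h2 : Prod.mk θ ⁻¹' (cotangentHomeo g ⁻¹' E) = (· * c) ⁻¹'
      ((· + sderiv g.fn (g.right.1 θ)) ⁻¹' (Prod.mk (g.right.1 θ) ⁻¹' E)) := rfl
  rw [h2, Real.volume_preimage_mul_right hc0, measure_preimage_add_right,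
    ← eq_inv_of_mul_eq_one_right h1]

namespace ConjugationData

variable {Γ : Type*} [Group Γ] {κ : S1 ≃ₜ S1} {M : Type*} [TopologicalSpace M] [AddAction ℝ M]
  {X : ConjugationData Γ κ M}

theorem IsConjugation.comp_jetHom {Ψ : M ≃ₜ Jet} {ρ : Γ →* JetGroup} (h : X.IsConjugation Ψ ρ)
    {g : JetGroup} {Ψ' : M ≃ₜ Jet} {ρ' : Γ →* JetGroup} (hΨ : ∀ m, Ψ' m = jetHom g (Ψ m))
    (hρ : ∀ γ, ρ' γ = g * ρ γ * g⁻¹) : X.IsConjugation Ψ' ρ' := by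
  obtain ⟨ψ, hψ, hp⟩ := h.area_preserving
  refine ⟨⟨ψ.trans (cotangentHomeo g), ?_, fun m => ?_⟩, fun t m => ?_, fun p hp => ?_,
    fun γ m => ?_⟩
  · have e : ⇑(ψ.trans (cotangentHomeo g)) = cotangentHomeo g ∘ ψ := rfl
    rw [e, ← Measure.map_map (cotangentHomeo g).measurable ψ.measurable, hψ,
      volume_map_cotangentHomeo]
  · rw [hΨ, Homeomorph.trans_apply, ← hp]
    rfl
  · rw [hΨ, hΨ, h.flow]
    refine Prod.ext rfl (Prod.ext rfl ?_)
    change (Ψ m).2.2 + t + g.fn (g.right.1 (Ψ m).1) = (Ψ m).2.2 + g.fn (g.right.1 (Ψ m).1) + t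
    ring
  · obtain ⟨q, ⟨θ, f, rfl⟩, hq⟩ := h.leaves p hp
    refine ⟨_, ⟨g.right.1 θ, f + g.fn (g.right.1 θ), rfl⟩, ?_⟩
    have e : ⇑Ψ' = jetHom g ∘ Ψ := funext hΨ
    rw [e, image_comp, hq, image_univ, image_univ, ← range_comp]
    have hc0 : cderiv g.right.1.symm (g.right.1 θ) ≠ 0 :=
      left_ne_zero_of_mul_eq_one (cderiv_symm_mul g.right θ)
    ext x
    constructor
    · rintro ⟨y, rfl⟩
      exact ⟨_, rfl⟩
    · rintro ⟨y, rfl⟩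
      refine ⟨(y - sderiv g.fn (g.right.1 θ)) / cderiv g.right.1.symm (g.right.1 θ), ?_⟩
      refine Prod.ext rfl (Prod.ext ?_ rfl)
      change (y - sderiv g.fn (g.right.1 θ)) / cderiv g.right.1.symm (g.right.1 θ) *
        cderiv g.right.1.symm (g.right.1 θ) + sderiv g.fn (g.right.1 θ) = y
      field_simp
      ring
  · rw [hΨ, hΨ, h.equivariant, hρ, ← Homeomorph.mul_apply, ← map_mul, ← Homeomorph.mul_apply,
      ← map_mul, inv_mul_cancel_right]

theorem exists_normalForm (X : ConjugationData Γ κ M) : ∃ v r, X.NormalForm v r := by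
  obtain ⟨U, a, b, hU⟩ := X.conn.exists_isCoord κ.continuous
  exact ⟨_, _, X.normalForm hU⟩

/-- Both identifications differ from the normal form by elements of the jet group, hence from each
other. The relation between the homomorphisms is then forced by faithfulness of the action. -/
theorem IsConjugation.isConjugation_iff {Ψ : M ≃ₜ Jet} {ρ : Γ →* JetGroup}
    (h : X.IsConjugation Ψ ρ) {Ψ' : M ≃ₜ Jet} {ρ' : Γ →* JetGroup} :
    X.IsConjugation Ψ' ρ' ↔
      ∃ g : JetGroup, (∀ m, Ψ' m = jetHom g (Ψ m)) ∧ ∀ γ, ρ' γ = g * ρ γ * g⁻¹ := by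
  refine ⟨fun h' => ?_, fun ⟨g, hΨ, hρ⟩ => h.comp_jetHom hΨ hρ⟩
  obtain ⟨v, r, N⟩ := X.exists_normalForm
  obtain ⟨ρ₀, h₀, hr⟩ := N.exists_isConjugation
  obtain ⟨g₁, hg₁⟩ := N.exists_eq_jetHom h₀ hr h
  obtain ⟨g₂, hg₂⟩ := N.exists_eq_jetHom h₀ hr h'
  have hΨ : ∀ m, Ψ' m = jetHom (g₂ * g₁⁻¹) (Ψ m) := fun m => by
    rw [hg₂, hg₁, ← Homeomorph.mul_apply, ← map_mul, inv_mul_cancel_right]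
  refine ⟨g₂ * g₁⁻¹, hΨ, fun γ => ?_⟩
  rw [eq_mul_inv_iff_mul_eq]
  refine jetMap_injective fun x => ?_
  obtain ⟨m, rfl⟩ := Ψ.surjective x
  change jetHom (ρ' γ * (g₂ * g₁⁻¹)) (Ψ m) = jetHom (g₂ * g₁⁻¹ * ρ γ) (Ψ m)
  rw [map_mul, map_mul _ _ (ρ γ), Homeomorph.mul_apply, Homeomorph.mul_apply, ← hΨ,
    ← h.equivariant, ← h'.equivariant, hΨ]

end ConjugationData

end

noncomputable section

/-! ### Transport of the Anosov property -/

section transport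

variable {Γ X Y : Type*} [Group Γ] [TopologicalSpace X] [TopologicalSpace Y]
  {A : Γ →* (X ≃ₜ X)} {A' : Γ →* (Y ≃ₜ Y)}

theorem CompactQuotient.transport (E : X ≃ₜ Y) (hE : ∀ γ x, E (A γ x) = A' γ (E x))
    (h : CompactQuotient A) : CompactQuotient A' := by
  obtain ⟨h1, h2⟩ := h
  have H : ∀ x y, (orbitSetoid A).r x y → (orbitSetoid A').r (E x) (E y) := by
    rintro x y ⟨γ, rfl⟩
    exact ⟨γ, (hE γ x).symm⟩
  have H' : ∀ x y, (orbitSetoid A').r x y → (orbitSetoid A).r (E.symm x) (E.symm y) := by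
    rintro x y ⟨γ, rfl⟩
    exact ⟨γ, by rw [E.eq_symm_apply, hE, E.apply_symm_apply]⟩
  let e : Quotient (orbitSetoid A) ≃ₜ Quotient (orbitSetoid A') :=
    { toFun := Quotient.map' E H
      invFun := Quotient.map' E.symm H'
      left_inv := by
        rintro ⟨x⟩
        exact congrArg _ (E.symm_apply_apply x)
      right_inv := by
        rintro ⟨x⟩
        exact congrArg _ (E.apply_symm_apply x)
      continuous_toFun := E.continuous.quotient_map' H
      continuous_invFun := E.symm.continuous.quotient_map' H' }
  exact ⟨e.compactSpace, e.t2Space⟩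

variable {φ : ℝ → X → X} {φ' : ℝ → Y → Y} {𝒞 : Set ((ℝ → X) × Set ℝ)}
  {𝒞' : Set ((ℝ → Y) × Set ℝ)}

/-- The homeomorphism `E` transports leafwise distances to leafwise distances. -/
def TransportsLeaves (E : X ≃ₜ Y) (𝒞 : Set ((ℝ → X) × Set ℝ)) (𝒞' : Set ((ℝ → Y) × Set ℝ)) :
    Prop :=
  ∀ m : X → ℝ, Continuous m → (∀ x, 0 < m x) → ∃ m' : Y → ℝ, Continuous m' ∧ (∀ y, 0 < m' y) ∧
    ∀ x y d, LeafDist 𝒞 m x y d ↔ LeafDist 𝒞' m' (E x) (E y) d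

theorem IsLeafMetric.transport {E : X ≃ₜ Y} (hE : ∀ γ x, E (A γ x) = A' γ (E x)) {m : X → ℝ}
    {m' : Y → ℝ} (h : IsLeafMetric A 𝒞 m) (hc : Continuous m') (hp : ∀ y, 0 < m' y)
    (hL : ∀ x y d, LeafDist 𝒞 m x y d ↔ LeafDist 𝒞' m' (E x) (E y) d) :
    IsLeafMetric A' 𝒞' m' := by
  refine ⟨hc, hp, fun γ x y d hd => ?_⟩
  obtain ⟨x, rfl⟩ := E.surjective x
  obtain ⟨y, rfl⟩ := E.surjective y
  rw [← hE, ← hE, ← hL]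
  exact h.invariant γ x y d ((hL x y d).2 hd)

theorem ContractsLeaves.transport {E : X ≃ₜ Y} (hE : ∀ γ x, E (A γ x) = A' γ (E x))
    (hφ : ∀ t x, E (φ t x) = φ' t (E x)) (hT : TransportsLeaves E 𝒞 𝒞')
    (h : ContractsLeaves A φ 𝒞) : ContractsLeaves A' φ' 𝒞' := by
  obtain ⟨m, hm, h⟩ := h
  obtain ⟨m', hc, hp, hL⟩ := hT m hm.continuous hm.pos
  refine ⟨m', hm.transport hE hc hp hL, fun ε hε => ?_⟩
  obtain ⟨α, hα, t₀, h⟩ := h ε hε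
  refine ⟨α, hα, t₀, fun t ht x y d hd hdα => ?_⟩
  obtain ⟨x, rfl⟩ := E.surjective x
  obtain ⟨y, rfl⟩ := E.surjective y
  obtain ⟨d', hd', h'⟩ := h t ht x y d ((hL x y d).2 hd) hdα
  refine ⟨d', hd', ?_⟩
  rw [← hφ, ← hφ, ← hL]
  exact h'

theorem StronglyContractsLeaves.transport {E : X ≃ₜ Y} (hE : ∀ γ x, E (A γ x) = A' γ (E x))
    (hφ : ∀ t x, E (φ t x) = φ' t (E x)) (hT : TransportsLeaves E 𝒞 𝒞')
    (h : StronglyContractsLeaves A φ 𝒞) : StronglyContractsLeaves A' φ' 𝒞' := by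
  obtain ⟨m, hm, α, hα, h⟩ := h
  obtain ⟨m', hc, hp, hL⟩ := hT m hm.continuous hm.pos
  refine ⟨m', hm.transport hE hc hp hL, α, hα, fun ε hε => ?_⟩
  obtain ⟨t₀, h⟩ := h ε hε
  refine ⟨t₀, fun t ht x y d hd hdα => ?_⟩
  obtain ⟨x, rfl⟩ := E.surjective x
  obtain ⟨y, rfl⟩ := E.surjective y
  obtain ⟨d', hd', h'⟩ := h t ht x y d ((hL x y d).2 hd) hdα
  refine ⟨d', hd', ?_⟩
  rw [← hφ, ← hφ, ← hL]
  exact h'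

end transport

theorem leafDist_jetLeaves_iff {m : Jet → ℝ} {x y : Jet} {d : ℝ} :
    LeafDist jetLeaves m x y d ↔ y.1 = x.1 ∧ y.2.2 = x.2.2 ∧
      d = |∫ q in x.2.1..y.2.1, m (x.1, q, x.2.2)| := by
  constructor
  · rintro ⟨_, ⟨θ, f, rfl⟩, q₁, -, q₂, -, rfl, rfl, hd⟩
    exact ⟨rfl, rfl, hd⟩
  · obtain ⟨θ, q₁, f⟩ := x
    obtain ⟨θ', q₂, f'⟩ := y
    rintro ⟨h1, h2, hd⟩
    simp only at h1 h2 hd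
    subst h1 h2
    exact ⟨_, ⟨θ', f', rfl⟩, q₁, mem_univ _, q₂, mem_univ _, rfl, rfl, hd⟩

/-- On each leaf the map is affine, and the pushed forward metric is divided by its slope: the
factor is the derivative of the diffeomorphism, inverse to that slope. -/
theorem transportsLeaves_jetHom (g : JetGroup) :
    TransportsLeaves (jetHom g) jetLeaves jetLeaves := by
  intro m hm hpos
  have hb := g.right.1.symm.continuous
  refine ⟨fun y => m ((jetHom g).symm y) * |cderiv g.right.1 (g.right.1.symm y.1)|,
    (hm.comp (jetHom g).symm.continuous).mul
      (g.right.2.1.2.cont.comp (hb.comp continuous_fst)).abs,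
    fun y => mul_pos (hpos _) (abs_pos.2 (cderiv_ne_zero _ _)), fun x y d => ?_⟩
  rw [leafDist_jetLeaves_iff, leafDist_jetLeaves_iff]
  obtain ⟨θ, q₁, f⟩ := x
  obtain ⟨θ', q₂, f'⟩ := y
  change θ' = θ ∧ f' = f ∧ _ ↔ g.right.1 θ' = g.right.1 θ ∧
    f' + g.fn (g.right.1 θ') = f + g.fn (g.right.1 θ) ∧ _
  rw [g.right.1.injective.eq_iff]
  refine and_congr_right fun h => ?_
  subst h
  rw [add_left_inj]
  refine and_congr_right fun h => ?_
  subst h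
  refine Eq.congr_right ?_
  set c := cderiv g.right.1.symm (g.right.1 θ') with hc
  set e := sderiv g.fn (g.right.1 θ') with he
  have h1 : c * cderiv g.right.1 θ' = 1 := cderiv_symm_mul g.right θ'
  have hc0 : c ≠ 0 := left_ne_zero_of_mul_eq_one h1
  set I₂ := ∫ q in q₁ * c + e..q₂ * c + e,
    m ((jetHom g).symm (g.right.1 θ', q, f' + g.fn (g.right.1 θ'))) with hI₂
  have h2 : ∫ q in q₁..q₂, m (θ', q, f') = c⁻¹ * I₂ := by
    have h3 : ∀ q, (jetHom g).symm (g.right.1 θ', c * q + e, f' + g.fn (g.right.1 θ')) =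
        (θ', q, f') := fun q => by
      rw [mul_comm]
      exact (jetHom g).symm_apply_apply (θ', q, f')
    rw [hI₂, ← smul_eq_mul, mul_comm q₁, mul_comm q₂, ← intervalIntegral.integral_comp_mul_add _ hc0 e]
    simp only [h3]
  have h4 : (∫ q in q₁ * c + e..q₂ * c + e,
      m ((jetHom g).symm (g.right.1 θ', q, f' + g.fn (g.right.1 θ'))) *
        abs (cderiv g.right.1 (g.right.1.symm (g.right.1 θ')))) = I₂ * |cderiv g.right.1 θ'| := by
    rw [intervalIntegral.integral_mul_const, g.right.1.symm_apply_apply]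
  change |∫ q in q₁..q₂, m (θ', q, f')| = |∫ q in q₁ * c + e..q₂ * c + e,
      m ((jetHom g).symm (g.right.1 θ', q, f' + g.fn (g.right.1 θ'))) *
        abs (cderiv g.right.1 (g.right.1.symm (g.right.1 θ')))|
  rw [h2, h4, ← eq_inv_of_mul_eq_one_right h1, abs_mul, abs_mul, abs_abs, mul_comm]

namespace ConjugationData

variable {Γ : Type*} [Group Γ] {κ : S1 ≃ₜ S1} {M : Type*} [TopologicalSpace M] [AddAction ℝ M]
  {X : ConjugationData Γ κ M} {v : M → ℝ} {r : S1 × S1 → ℝ}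

/-- Along a leaf `dr = ±f dt`, so the metric `m dt` becomes `(m / f) dr`, up to a sign that the
absolute value removes. -/
theorem NormalForm.transportsLeaves (N : X.NormalForm v r) :
    TransportsLeaves N.jetHomeo (PrincipalBundle.leaves X.conn) jetLeaves := by
  intro m hm hpos
  have hpr : Continuous fun y => X.bundle.proj (N.jetHomeo.symm y) :=
    X.bundle.continuous_proj.comp N.jetHomeo.symm.continuous
  have hf : Continuous fun y => X.f (X.bundle.proj (N.jetHomeo.symm y)) :=
    X.continuousOn_f.comp_continuous hpr fun y => X.bundle.proj_mem _
  have hf0 : ∀ y, 0 < X.f (X.bundle.proj (N.jetHomeo.symm y)) := fun y =>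
    X.f_pos _ (X.bundle.proj_mem _)
  set m' : Jet → ℝ := fun y => m (N.jetHomeo.symm y) / X.f (X.bundle.proj (N.jetHomeo.symm y))
    with hm'
  have hm'c : Continuous m' := (hm.comp N.jetHomeo.symm.continuous).div hf fun y => (hf0 y).ne'
  have key : ∀ (s : S1) (t₀ v₀ : ℝ), (t₀ : S1) = κ s → ∀ τ₁ ∈ Ioo t₀ (t₀ + 1),
      ∀ τ₂ ∈ Ioo t₀ (t₀ + 1), |∫ q in r (s, (τ₁ : S1))..r (s, (τ₂ : S1)), m' (s, q, v₀)| =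
        |∫ τ in τ₁..τ₂, m (N.pt (s, (τ : S1)) v₀)| := by
    intro s t₀ v₀ h₀ τ₁ h₁ τ₂ h₂
    have hsub : uIcc τ₁ τ₂ ⊆ Ioo t₀ (t₀ + 1) := OrdConnected.uIcc_subset ordConnected_Ioo h₁ h₂
    have hann : ∀ τ ∈ uIcc τ₁ τ₂, (s, (τ : S1)) ∈ annulus κ := fun τ hτ =>
      mem_annulus_of_Ioo h₀ (hsub hτ)
    have hcf : ContinuousOn (fun τ : ℝ => X.sgn * X.f (s, (τ : S1))) (uIcc τ₁ τ₂) :=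
      continuousOn_const.mul (X.continuousOn_f.comp
        (continuous_const.prodMk S1.continuous_coe).continuousOn hann)
    have h3 := intervalIntegral.integral_comp_mul_deriv (f := fun τ : ℝ => r (s, (τ : S1)))
      (f' := fun τ : ℝ => X.sgn * X.f (s, (τ : S1))) (g := fun q => m' (s, q, v₀))
      (a := τ₁) (b := τ₂) (fun τ hτ => by
        obtain ⟨x, rfl⟩ := S1.coe_surjective s
        exact N.hasDerivAt x τ (hann τ hτ)) hcf
      (hm'c.comp (by fun_prop))
    rw [← h3]
    have h4 : ∫ τ in τ₁..τ₂, ((fun q => m' (s, q, v₀)) ∘ fun τ : ℝ => r (s, (τ : S1))) τ *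
        (X.sgn * X.f (s, (τ : S1))) = X.sgn * ∫ τ in τ₁..τ₂, m (N.pt (s, (τ : S1)) v₀) := by
      rw [← intervalIntegral.integral_const_mul]
      refine intervalIntegral.integral_congr fun τ hτ => ?_
      have h5 : N.jetHomeo.symm (s, r (s, (τ : S1)), v₀) = N.pt (s, (τ : S1)) v₀ := by
        rw [Homeomorph.symm_apply_eq, N.jetHomeo_apply, ConjugationData.jetChart,
          N.proj_pt (hann τ hτ), N.coord_pt (hann τ hτ)]
      have h6 := (X.f_pos _ (hann τ hτ)).ne'
      simp only [Function.comp, hm', h5, N.proj_pt (hann τ hτ)]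
      field_simp
    rw [h4, abs_mul]
    rcases X.sgn_eq with h | h <;> simp [h]
  refine ⟨m', hm'c, fun y => div_pos (hpos _) (hf0 y), fun x y d => ?_⟩
  rw [N.leafDist_iff, leafDist_jetLeaves_iff]
  constructor
  · rintro ⟨s, t₀, v₀, h₀, τ₁, h₁, τ₂, h₂, rfl, rfl, hd⟩
    have e : ∀ τ ∈ Ioo t₀ (t₀ + 1), N.jetHomeo (N.pt (s, (τ : S1)) v₀) =
        (s, r (s, (τ : S1)), v₀) := fun τ hτ => by
      rw [N.jetHomeo_apply, ConjugationData.jetChart, N.proj_pt (mem_annulus_of_Ioo h₀ hτ),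
        N.coord_pt (mem_annulus_of_Ioo h₀ hτ)]
    rw [e _ h₁, e _ h₂]
    exact ⟨rfl, rfl, hd.trans (key s t₀ v₀ h₀ τ₁ h₁ τ₂ h₂).symm⟩
  · rintro ⟨h1, h2, hd⟩
    change (X.bundle.proj y).1 = (X.bundle.proj x).1 at h1
    change v y = v x at h2
    change d = |∫ q in r (X.bundle.proj x)..r (X.bundle.proj y),
      m' ((X.bundle.proj x).1, q, v x)| at hd
    obtain ⟨t₀, h₀⟩ := S1.coe_surjective (κ (X.bundle.proj x).1)
    obtain ⟨τ₁, hτ₁, e₁⟩ := exists_lift_Ioo (t := (X.bundle.proj x).2) (t₀ := t₀)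
      (by rw [h₀]; exact X.bundle.proj_mem x)
    obtain ⟨τ₂, hτ₂, e₂⟩ := exists_lift_Ioo (t := (X.bundle.proj y).2) (t₀ := t₀)
      (by rw [h₀, ← h1]; exact X.bundle.proj_mem y)
    have p₁ : ((X.bundle.proj x).1, (τ₁ : S1)) = X.bundle.proj x := by rw [e₁]
    have p₂ : ((X.bundle.proj x).1, (τ₂ : S1)) = X.bundle.proj y := by rw [e₂, ← h1]
    refine ⟨_, t₀, v x, h₀, τ₁, hτ₁, τ₂, hτ₂, ?_, ?_, ?_⟩
    · rw [p₁, N.eq_pt]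
    · rw [p₂, ← h2, N.eq_pt]
    · rw [hd, ← key _ t₀ (v x) h₀ τ₁ hτ₁ τ₂ hτ₂, p₁, p₂]

theorem _root_.IsHolder.comp_S1 {f g : S1 → S1} (hf : IsHolder f) (hg : IsHolder g) :
    IsHolder (f ∘ g) := by
  obtain ⟨C, r, hr, hC⟩ := hf
  obtain ⟨D, s, hs, hD⟩ := hg
  exact ⟨_, r * s, mul_pos hr hs, hC.comp hD⟩

theorem _root_.IsHFuchsian.conj {ρ ρ' : Γ →* DiffH} (h : IsHFuchsian ρ) (b : DiffH)
    (hρ : ∀ γ, ρ' γ = b * ρ γ * b⁻¹) : IsHFuchsian ρ' := by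
  obtain ⟨j, hj, χ, h1, h2, h3⟩ := h
  refine ⟨j, hj, b.1.symm.trans χ, h1.comp_S1 b.2.2.lipschitz, b.2.1.lipschitz.comp_S1 h2,
    fun γ s => ?_⟩
  rw [hρ]
  change circleToRP1 (χ (b.1.symm (b.1 ((ρ γ).1 (b.1.symm s))))) =
    j γ • circleToRP1 (χ (b.1.symm s))
  rw [b.1.symm_apply_apply, h3]

/-- All parts of the property are carried from the bundle to the normal form and from there, by an
element `g` of the jet group, to the given identification. The circle action is the conjugate of
`ρ₁` by the diffeomorphism part of `g`. -/
theorem IsConjugation.isAnosov {Ψ : M ≃ₜ Jet} {ρ : Γ →* JetGroup} (h : X.IsConjugation Ψ ρ) :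
    IsAnosov ρ ∧
      (StronglyContractsLeaves X.act (fun t m => t +ᵥ m) (PrincipalBundle.leaves X.conn) →
        StronglyContractsLeaves (jetHom.comp ρ) jetFlow jetLeaves) := by
  obtain ⟨v, r, N⟩ := X.exists_normalForm
  obtain ⟨ρ₀, h₀, hr⟩ := N.exists_isConjugation
  obtain ⟨g, -, hg⟩ := h₀.isConjugation_iff.1 h
  have hflow : ∀ t x, jetHom g (jetFlow t x) = jetFlow t (jetHom g x) := fun t x => by
    refine Prod.ext rfl (Prod.ext rfl ?_)
    change x.2.2 + t + g.fn (g.right.1 x.1) = x.2.2 + g.fn (g.right.1 x.1) + t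
    ring
  have hequiv : ∀ γ x, jetHom g ((jetHom.comp ρ₀) γ x) = (jetHom.comp ρ) γ (jetHom g x) := by
    intro γ x
    simp only [MonoidHom.comp_apply]
    rw [← Homeomorph.mul_apply, ← Homeomorph.mul_apply, ← map_mul, ← map_mul, hg,
      inv_mul_cancel_right]
  have hequiv₀ : ∀ γ m, N.jetHomeo (X.act γ m) = (jetHom.comp ρ₀) γ (N.jetHomeo m) :=
    h₀.equivariant
  have hflow₀ : ∀ (t : ℝ) m, N.jetHomeo (t +ᵥ m) = jetFlow t (N.jetHomeo m) := h₀.flow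
  refine ⟨⟨(X.compact.transport N.jetHomeo hequiv₀).transport (jetHom g) hequiv,
    (X.contracts.transport hequiv₀ hflow₀ N.transportsLeaves).transport hequiv hflow
      (transportsLeaves_jetHom g), X.hFuchsian₁.conj g.right fun γ => ?_⟩,
    fun hS => (hS.transport hequiv₀ hflow₀ N.transportsLeaves).transport hequiv hflow
      (transportsLeaves_jetHom g)⟩
  rw [← hr, MonoidHom.comp_apply, hg, map_mul, map_mul, map_inv]
  rfl

end ConjugationData

end

noncomputable section

/-! ### Continuous dependence on parameters -/

theorem continuousOn_integral_Icc {Z : Type*} [TopologicalSpace Z] {A : Set Z} {Φ : Z → ℝ → ℝ}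
    {c d : ℝ} (hcd : c ≤ d) (h : ContinuousOn (fun q : Z × ℝ => Φ q.1 q.2) (A ×ˢ Icc c d)) :
    ContinuousOn (fun z => ∫ y in c..d, Φ z y) A := by
  have e : ∀ z, ∫ y in c..d, Φ z y = (d - c) * ∫ y in (0 : ℝ)..1, Φ z ((d - c) * y + c) := by
    intro z
    have := intervalIntegral.mul_integral_comp_mul_add (f := Φ z) (a := 0) (b := 1) (d - c) c
    rw [this]
    congr 1 <;> ring
  simp only [e]
  refine continuousOn_const.mul (continuousOn_integral_unit ?_)
  refine h.comp (f := fun q : Z × ℝ => (q.1, (d - c) * q.2 + c)) (by fun_prop) ?_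
  rintro ⟨z, y⟩ ⟨hz, hy0, hy1⟩
  exact ⟨hz, by nlinarith, by nlinarith⟩

section family

variable {Λ : Type*} [TopologicalSpace Λ] {κ : Λ → (S1 ≃ₜ S1)}

theorem continuousOn_disp_family (hκ : Continuous fun q : Λ × S1 => κ q.1 q.2) :
    ContinuousOn (fun q : Λ × ℝ => disp (κ q.1) q.2) (univ ×ˢ Ioo (0 : ℝ) 1) := by
  rintro ⟨l, x⟩ ⟨-, hx⟩
  have h : κ l (x : S1) - κ l 0 ≠ 0 := sub_ne_zero.2 ((κ l).injective.ne (S1.coe_ne_zero hx))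
  refine ContinuousAt.continuousWithinAt (ContinuousAt.comp
    (f := fun q : Λ × ℝ => κ q.1 (q.2 : S1) - κ q.1 0) (continuousAt_rep01 h) ?_)
  have h1 : Continuous fun q : Λ × ℝ => κ q.1 (q.2 : S1) :=
    hκ.comp (continuous_fst.prodMk (S1.continuous_coe.comp continuous_snd))
  have h2 : Continuous fun q : Λ × ℝ => κ q.1 0 := hκ.comp (continuous_fst.prodMk continuous_const)
  exact (h1.sub h2).continuousAt

/-- The displacement jumps at the ends of the interval, so it is not jointly continuous on `[0, 1]`.
Integrals over `[δ, 1 - δ]` are continuous in the parameter and approximate the full integral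
uniformly. -/
theorem continuous_integral_disp (hκ : Continuous fun q : Λ × S1 => κ q.1 q.2) :
    Continuous fun l => ∫ x in (0 : ℝ)..1, disp (κ l) x := by
  refine continuous_of_uniform_approx_of_continuous fun u hu => ?_
  obtain ⟨ε, hε, hεu⟩ := Metric.mem_uniformity_dist.1 hu
  -- The two omitted pieces contribute at most `2 * δ ≤ ε / 2`; the bound `1 / 4` keeps the middle
  -- interval nondegenerate.
  set δ := min (ε / 4) (1 / 4) with hδ
  have hδ0 : 0 < δ := by positivity
  have hδ1 : δ ≤ 1 / 4 := min_le_right _ _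
  have hδε : δ ≤ ε / 4 := min_le_left _ _
  have hc : ContinuousOn (fun l => ∫ x in δ..1 - δ, disp (κ l) x) univ := by
    refine continuousOn_integral_Icc (by linarith) ((continuousOn_disp_family hκ).mono ?_)
    rintro ⟨l, x⟩ ⟨-, h0, h1⟩
    exact ⟨mem_univ _, by linarith, by linarith⟩
  refine ⟨_, continuousOn_univ.1 hc, fun l => hεu ?_⟩
  have i1 := intervalIntegrable_disp (κ l) (a := 0) (b := δ) (by simp) ⟨by linarith, by linarith⟩
    (by linarith)
  have i2 := intervalIntegrable_disp (κ l) (a := δ) (b := 1 - δ) ⟨by linarith, by linarith⟩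
    ⟨by linarith, by linarith⟩ (by linarith)
  have i3 := intervalIntegrable_disp (κ l) (a := 1 - δ) (b := 1) ⟨by linarith, by linarith⟩
    (by simp) (by linarith)
  have hb : ∀ x, ‖disp (κ l) x‖ ≤ 1 := fun x => by
    have h1 : 0 ≤ disp (κ l) x := rep01_nonneg _
    rw [Real.norm_eq_abs, abs_of_nonneg h1]
    exact (rep01_lt_one _).le
  have b1 := intervalIntegral.norm_integral_le_of_norm_le_const (a := 0) (b := δ)
    (f := disp (κ l)) fun x _ => hb x
  have b3 := intervalIntegral.norm_integral_le_of_norm_le_const (a := 1 - δ) (b := 1)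
    (f := disp (κ l)) fun x _ => hb x
  rw [Real.norm_eq_abs, sub_zero, abs_of_pos hδ0] at b1
  rw [Real.norm_eq_abs, sub_sub_cancel, abs_of_pos hδ0] at b3
  rw [← intervalIntegral.integral_add_adjacent_intervals (i1.trans i2) i3,
    ← intervalIntegral.integral_add_adjacent_intervals i1 i2, Real.dist_eq]
  have e : ∀ p q r : ℝ, p + q + r - q = p + r := fun p q r => by ring
  rw [e]
  refine (abs_add_le _ _).trans_lt ?_
  linarith

/-- The degree is decided by a strict inequality between two values that depend continuously on the
parameter, hence it is locally constant. -/
theorem continuous_circleDeg (hκ : Continuous fun q : Λ × S1 => κ q.1 q.2) :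
    Continuous fun l => circleDeg (κ l) := by
  have h : ∀ x ∈ Ioo (0 : ℝ) 1, Continuous fun l => disp (κ l) x := fun x hx =>
    (continuousOn_disp_family hκ).comp_continuous (continuous_id.prodMk continuous_const)
      fun l => ⟨mem_univ _, hx⟩
  have h1 := h (1 / 3) ⟨by norm_num, by norm_num⟩
  have h2 := h (2 / 3) ⟨by norm_num, by norm_num⟩
  rw [continuous_iff_continuousAt]
  intro l
  rcases disp_mono_or_anti (κ l) with ⟨hl, -⟩ | ⟨hl, -⟩
  · refine (continuousAt_const (y := (1 : ℤ))).congr ?_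
    filter_upwards [h1.continuousAt.eventually_lt h2.continuousAt hl] with l' hl'
    rw [circleDeg, if_pos hl']
  · refine (continuousAt_const (y := (-1 : ℤ))).congr ?_
    filter_upwards [h2.continuousAt.eventually_lt h1.continuousAt hl] with l' hl'
    rw [circleDeg, if_neg hl'.not_gt]

theorem continuous_antipodal_family (hκ : Continuous fun q : Λ × S1 => κ q.1 q.2) :
    Continuous fun q : Λ × S1 => antipodal (κ q.1) q.2 := by
  have h1 : Continuous fun q : Λ × S1 => κ q.1 0 := hκ.comp (continuous_fst.prodMk continuous_const)
  have h2 := (continuous_circleDeg hκ).comp (continuous_fst (X := Λ) (Y := S1))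
  have h3 := (continuous_integral_disp hκ).comp (continuous_fst (X := Λ) (Y := S1))
  exact (h2.smul continuous_snd).add (h1.add (S1.continuous_coe.comp h3))

theorem continuousOn_fiberCoord_family (hκ : Continuous fun q : Λ × S1 => κ q.1 q.2) :
    ContinuousOn (fun q : Λ × (S1 × S1) => fiberCoord (κ q.1) q.2)
      {q | q.2 ∈ annulus (κ q.1)} := by
  have h1 : Continuous fun q : Λ × (S1 × S1) => κ q.1 q.2.1 :=
    hκ.comp (f := fun q : Λ × (S1 × S1) => (q.1, q.2.1)) (by fun_prop)
  have h2 : Continuous fun q : Λ × (S1 × S1) => antipodal (κ q.1) q.2.1 :=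
    (continuous_antipodal_family hκ).comp (f := fun q : Λ × (S1 × S1) => (q.1, q.2.1)) (by fun_prop)
  rintro ⟨l, x⟩ hx
  refine ContinuousAt.continuousWithinAt (ContinuousAt.sub ?_ ?_)
  · refine ContinuousAt.comp (f := fun q : Λ × (S1 × S1) => q.2.2 - κ q.1 q.2.1)
      (continuousAt_rep01 ((mem_annulus_iff (κ l) x).1 hx)) ?_
    exact ((continuous_snd.comp continuous_snd).sub h1).continuousAt
  · refine ContinuousAt.comp (f := fun q : Λ × (S1 × S1) => antipodal (κ q.1) q.2.1 - κ q.1 q.2.1)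
      (continuousAt_rep01 (sub_ne_zero.2 (antipodal_ne (κ l) _))) ?_
    exact (h2.sub h1).continuousAt

theorem continuousOn_vint_family (hκ : Continuous fun q : Λ × S1 => κ q.1 q.2)
    {b : Λ → S1 × S1 → ℝ} (hb : ContinuousOn (fun q : Λ × (S1 × S1) => b q.1 q.2)
      {q | q.2 ∈ annulus (κ q.1)}) :
    ContinuousOn (fun q : Λ × (S1 × S1) => vint (κ q.1) (b q.1) q.2)
      {q | q.2 ∈ annulus (κ q.1)} := by
  have hF := continuousOn_fiberCoord_family hκ
  have e : (fun q : Λ × (S1 × S1) => vint (κ q.1) (b q.1) q.2) = fun q => fiberCoord (κ q.1) q.2 *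
      ∫ y in (0 : ℝ)..1,
        b q.1 (q.2.1, antipodal (κ q.1) q.2.1 + ((y * fiberCoord (κ q.1) q.2 : ℝ) : S1)) := by
    funext q
    exact integral_zero_eq_unit
      (fun y => b q.1 (q.2.1, antipodal (κ q.1) q.2.1 + (y : S1))) _
  rw [e]
  refine hF.mul (continuousOn_integral_unit ?_)
  refine hb.comp (f := fun q : (Λ × (S1 × S1)) × ℝ => (q.1.1, (q.1.2.1,
    antipodal (κ q.1.1) q.1.2.1 + ((q.2 * fiberCoord (κ q.1.1) q.1.2 : ℝ) : S1)))) ?_ ?_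
  · refine ContinuousOn.prodMk (by fun_prop) (ContinuousOn.prodMk (by fun_prop)
      (ContinuousOn.add ?_ ?_))
    · exact ((continuous_antipodal_family hκ).comp
        (f := fun q : (Λ × (S1 × S1)) × ℝ => (q.1.1, q.1.2.1)) (by fun_prop)).continuousOn
    · refine S1.continuous_coe.comp_continuousOn (continuousOn_snd.mul ?_)
      exact hF.comp continuousOn_fst fun q hq => hq.1
  · rintro ⟨⟨l, x⟩, y⟩ ⟨hx, hy⟩
    exact segment_mem_annulus (κ l) hx (mul_mem_uIcc hy)

variable {a b : Λ → S1 × S1 → ℝ}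

theorem continuous_sectionForm_family (hκ : Continuous fun q : Λ × S1 => κ q.1 q.2)
    (ha : ContinuousOn (fun q : Λ × (S1 × S1) => a q.1 q.2) {q | q.2 ∈ annulus (κ q.1)})
    (hb : ContinuousOn (fun q : Λ × (S1 × S1) => b q.1 q.2) {q | q.2 ∈ annulus (κ q.1)}) :
    Continuous fun q : Λ × ℝ => sectionForm (κ q.1) (a q.1) (b q.1) q.2 := by
  have h : Continuous fun q : Λ × ℝ => (q.1, ((q.2 : S1), antipodal (κ q.1) (q.2 : S1))) := by
    have h1 : Continuous fun q : Λ × ℝ => (q.1, (q.2 : S1)) :=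
      continuous_fst.prodMk (S1.continuous_coe.comp continuous_snd)
    have h2 : Continuous fun q : Λ × ℝ => antipodal (κ q.1) (q.2 : S1) :=
      Continuous.comp (g := fun q : Λ × S1 => antipodal (κ q.1) q.2)
        (f := fun q : Λ × ℝ => (q.1, (q.2 : S1))) (continuous_antipodal_family hκ) h1
    have h3 : Continuous fun q : Λ × ℝ => (q.2 : S1) := S1.continuous_coe.comp continuous_snd
    exact continuous_fst.prodMk (h3.prodMk h2)
  have hz : Continuous fun n : ℤ => (n : ℝ) := continuous_of_discreteTopology
  have hd : Continuous fun q : Λ × ℝ => ((circleDeg (κ q.1) : ℤ) : ℝ) :=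
    hz.comp ((continuous_circleDeg hκ).comp continuous_fst)
  have hm : ∀ q : Λ × ℝ, (q.1, ((q.2 : S1), antipodal (κ q.1) (q.2 : S1))) ∈
      {q : Λ × (S1 × S1) | q.2 ∈ annulus (κ q.1)} := fun q => antipodal_mem_annulus (κ q.1) _
  have ha' : Continuous fun q : Λ × ℝ => a q.1 ((q.2 : S1), antipodal (κ q.1) (q.2 : S1)) :=
    ha.comp_continuous h hm
  have hb' : Continuous fun q : Λ × ℝ => b q.1 ((q.2 : S1), antipodal (κ q.1) (q.2 : S1)) :=
    hb.comp_continuous h hm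
  unfold sectionForm
  exact ha'.add (hd.mul hb')

theorem continuous_sectionHol_family (hκ : Continuous fun q : Λ × S1 => κ q.1 q.2)
    (ha : ContinuousOn (fun q : Λ × (S1 × S1) => a q.1 q.2) {q | q.2 ∈ annulus (κ q.1)})
    (hb : ContinuousOn (fun q : Λ × (S1 × S1) => b q.1 q.2) {q | q.2 ∈ annulus (κ q.1)}) :
    Continuous fun l => sectionHol (κ l) (a l) (b l) :=
  continuousOn_univ.1
    (continuousOn_integral_unit (continuous_sectionForm_family hκ ha hb).continuousOn)

/-- The representative `rep01` jumps at `0`, but the primitive is periodic. Continuity is checked on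
the cover `Λ × ℝ`, which maps to `Λ × S1` by an open quotient map. -/
theorem continuous_sectionPrim_family (hκ : Continuous fun q : Λ × S1 => κ q.1 q.2)
    (ha : ContinuousOn (fun q : Λ × (S1 × S1) => a q.1 q.2) {q | q.2 ∈ annulus (κ q.1)})
    (hb : ContinuousOn (fun q : Λ × (S1 × S1) => b q.1 q.2) {q | q.2 ∈ annulus (κ q.1)}) :
    Continuous fun q : Λ × S1 => sectionPrim (κ q.1) (a q.1) (b q.1) (rep01 q.2) := by
  have hslice : ∀ {g : Λ → S1 × S1 → ℝ}, ContinuousOn (fun q : Λ × (S1 × S1) => g q.1 q.2)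
      {q | q.2 ∈ annulus (κ q.1)} → ∀ l, ContinuousOn (g l) (annulus (κ l)) := fun hg l =>
    hg.comp (f := fun x : S1 × S1 => (l, x)) (by fun_prop) fun x hx => hx
  have hq : IsOpenQuotientMap (Prod.map (id : Λ → Λ) fun x : ℝ => (x : S1)) :=
    IsOpenQuotientMap.id.prodMap S1.isOpenQuotientMap_coe
  rw [hq.isQuotientMap.continuous_iff]
  have e : (fun q : Λ × S1 => sectionPrim (κ q.1) (a q.1) (b q.1) (rep01 q.2)) ∘
      Prod.map (id : Λ → Λ) (fun x : ℝ => (x : S1)) =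
      fun q : Λ × ℝ => q.2 * (∫ y in (0 : ℝ)..1, sectionForm (κ q.1) (a q.1) (b q.1) (y * q.2)) -
        sectionHol (κ q.1) (a q.1) (b q.1) * q.2 := by
    funext q
    rw [← integral_zero_eq_unit]
    exact sectionPrim_rep01 (κ q.1) (hslice ha q.1) (hslice hb q.1) q.2
  rw [e]
  have h1 : Continuous fun q : Λ × ℝ =>
      ∫ y in (0 : ℝ)..1, sectionForm (κ q.1) (a q.1) (b q.1) (y * q.2) := by
    refine continuousOn_univ.1 (continuousOn_integral_unit (Continuous.continuousOn ?_))
    exact (continuous_sectionForm_family hκ ha hb).comp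
      (f := fun q : (Λ × ℝ) × ℝ => (q.1.1, q.2 * q.1.2)) (by fun_prop)
  exact (continuous_snd.mul h1).sub
    (((continuous_sectionHol_family hκ ha hb).comp continuous_fst).mul continuous_snd)

end family

end

noncomputable section

section family

variable {Λ : Type*} [TopologicalSpace Λ] {κ : Λ → (S1 ≃ₜ S1)}

/-- A fixed rectangle that stays in the annuli of all nearby parameters: the condition is open and
holds at a point of the antipodal section. -/
theorem exists_rectangle (hκ : Continuous fun q : Λ × S1 => κ q.1 q.2) (l₀ : Λ) :
    ∃ y₀ δ : ℝ, 0 < δ ∧ ∀ᶠ l in 𝓝 l₀, ∀ s ∈ Icc 0 δ, ∀ t ∈ Icc y₀ (y₀ + δ),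
      toTorus (s, t) ∈ annulus (κ l) := by
  obtain ⟨y₀, hy₀⟩ := S1.coe_surjective (antipodal (κ l₀) 0)
  have hop : IsOpen {q : Λ × (ℝ × ℝ) | toTorus q.2 ∈ annulus (κ q.1)} := by
    have h1 : Continuous fun q : Λ × (ℝ × ℝ) => κ q.1 (q.2.1 : S1) :=
      Continuous.comp (g := fun q : Λ × S1 => κ q.1 q.2)
        (f := fun q : Λ × (ℝ × ℝ) => (q.1, (q.2.1 : S1))) hκ
        (continuous_fst.prodMk (S1.continuous_coe.comp (continuous_fst.comp continuous_snd)))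
    have h2 : Continuous fun q : Λ × (ℝ × ℝ) => (q.2.2 : S1) :=
      S1.continuous_coe.comp (continuous_snd.comp continuous_snd)
    exact isOpen_ne_fun h1 h2
  have hmem : (l₀, ((0 : ℝ), y₀)) ∈ {q : Λ × (ℝ × ℝ) | toTorus q.2 ∈ annulus (κ q.1)} := by
    have h1 := antipodal_mem_annulus (κ l₀) 0
    rw [← hy₀] at h1
    exact h1
  obtain ⟨V, hV, W, hW, hVW⟩ := mem_nhds_prod_iff.1 (hop.mem_nhds hmem)
  obtain ⟨δ, hδ, hδW⟩ := Metric.mem_nhds_iff.1 hW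
  refine ⟨y₀, δ / 2, by positivity, ?_⟩
  filter_upwards [hV] with l hl s hs t ht
  refine hVW (show (l, (s, t)) ∈ V ×ˢ W from ⟨hl, hδW ?_⟩)
  rw [Metric.mem_ball, Prod.dist_eq, max_lt_iff, Real.dist_eq, Real.dist_eq, abs_lt, abs_lt]
  exact ⟨⟨by linarith [hs.1], by linarith [hs.2]⟩, by linarith [ht.1], by linarith [ht.2]⟩

theorem continuousOn_momentum_family {a b F : Λ → S1 × S1 → ℝ}
    (hκ : Continuous fun q : Λ × S1 => κ q.1 q.2)
    (ha : ContinuousOn (fun q : Λ × (S1 × S1) => a q.1 q.2) {q | q.2 ∈ annulus (κ q.1)})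
    (hb : ContinuousOn (fun q : Λ × (S1 × S1) => b q.1 q.2) {q | q.2 ∈ annulus (κ q.1)})
    (hF : ContinuousOn (fun q : Λ × (S1 × S1) => F q.1 q.2) {q | q.2 ∈ annulus (κ q.1)}) :
    ContinuousOn (fun q : Λ × (S1 × S1) => momentum (κ q.1) (a q.1) (b q.1) (F q.1) q.2)
      {q | q.2 ∈ annulus (κ q.1)} :=
  (continuousOn_vint_family hκ hF).sub ((continuous_sectionHol_family hκ ha hb).comp
    (continuous_fst (X := Λ) (Y := S1 × S1))).continuousOn

theorem continuousOn_potential_family {a b : Λ → S1 × S1 → ℝ}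
    (hκ : Continuous fun q : Λ × S1 => κ q.1 q.2)
    (ha : ContinuousOn (fun q : Λ × (S1 × S1) => a q.1 q.2) {q | q.2 ∈ annulus (κ q.1)})
    (hb : ContinuousOn (fun q : Λ × (S1 × S1) => b q.1 q.2) {q | q.2 ∈ annulus (κ q.1)}) :
    ContinuousOn (fun q : Λ × (S1 × S1) => potential (κ q.1) (a q.1) (b q.1) q.2)
      {q | q.2 ∈ annulus (κ q.1)} := by
  have h : Continuous fun q : Λ × (S1 × S1) =>
      sectionPrim (κ q.1) (a q.1) (b q.1) (rep01 q.2.1) :=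
    Continuous.comp (g := fun q : Λ × S1 => sectionPrim (κ q.1) (a q.1) (b q.1) (rep01 q.2))
      (f := fun q : Λ × (S1 × S1) => (q.1, q.2.1)) (continuous_sectionPrim_family hκ ha hb)
      (by fun_prop)
  exact h.continuousOn.add (continuousOn_vint_family hκ hb)

/-- A map to the jet space that is given by continuous families of functions on the annuli. -/
theorem continuousOn_jet_family {R P : Λ → S1 × S1 → ℝ}
    (hR : ContinuousOn (fun q : Λ × (S1 × S1) => R q.1 q.2) {q | q.2 ∈ annulus (κ q.1)})
    (hP : ContinuousOn (fun q : Λ × (S1 × S1) => P q.1 q.2) {q | q.2 ∈ annulus (κ q.1)}) :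
    ContinuousOn (fun q : Λ × ((S1 × S1) × ℝ) =>
      ((q.2.1.1, R q.1 q.2.1, q.2.2 + P q.1 q.2.1) : Jet)) {q | q.2.1 ∈ annulus (κ q.1)} := by
  have hproj : ContinuousOn (fun q : Λ × ((S1 × S1) × ℝ) => (q.1, q.2.1))
      {q | q.2.1 ∈ annulus (κ q.1)} := by fun_prop
  have hmaps : MapsTo (fun q : Λ × ((S1 × S1) × ℝ) => (q.1, q.2.1))
      {q | q.2.1 ∈ annulus (κ q.1)} {q : Λ × (S1 × S1) | q.2 ∈ annulus (κ q.1)} := fun q hq => hq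
  exact ContinuousOn.prodMk (by fun_prop) ((hR.comp hproj hmaps).prodMk
    (ContinuousOn.add (by fun_prop) (hP.comp hproj hmaps)))

variable {Γ : Type*} [Group Γ] {M : Λ → Type*} [∀ l, TopologicalSpace (M l)]
  [∀ l, AddAction ℝ (M l)] {X : ∀ l, ConjugationData Γ (κ l) (M l)}
  {e : ∀ l, Bundle.Trivialization ℝ (X l).bundle.proj}

/-- The sign of the curvature is locally constant. -/
theorem continuous_sgn (he : ∀ l, e l ∈ (X l).bundle.atlas)
    (hb : ∀ l, (e l).baseSet = annulus (κ l)) (hκ : Continuous fun q : Λ × S1 => κ q.1 q.2)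
    (ha : ContinuousOn (fun q : Λ × (S1 × S1) => (X q.1).conn.a (e q.1) q.2)
      {q | q.2 ∈ annulus (κ q.1)})
    (hb' : ContinuousOn (fun q : Λ × (S1 × S1) => (X q.1).conn.b (e q.1) q.2)
      {q | q.2 ∈ annulus (κ q.1)})
    (hf : ContinuousOn (fun q : Λ × (S1 × S1) => (X q.1).f q.2) {q | q.2 ∈ annulus (κ q.1)}) :
    Continuous fun l => (X l).sgn := by
  rw [continuous_iff_continuousAt]
  intro l₀
  obtain ⟨y₀, δ, hδ, hR⟩ := exists_rectangle hκ l₀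
  set V := {l | ∀ s ∈ Icc 0 δ, ∀ t ∈ Icc y₀ (y₀ + δ), toTorus (s, t) ∈ annulus (κ l)} with hV
  have h0δ : (0 : ℝ) ∈ Icc 0 δ := ⟨le_rfl, hδ.le⟩
  have hδδ : δ ∈ Icc 0 δ := ⟨hδ.le, le_rfl⟩
  have hy₀ : y₀ ∈ Icc y₀ (y₀ + δ) := ⟨le_rfl, by linarith⟩
  have hy₁ : y₀ + δ ∈ Icc y₀ (y₀ + δ) := ⟨by linarith, le_rfl⟩
  have hs : ∀ (g : Λ → S1 × S1 → ℝ), ContinuousOn (fun q : Λ × (S1 × S1) => g q.1 q.2)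
      {q | q.2 ∈ annulus (κ q.1)} → ∀ t ∈ Icc y₀ (y₀ + δ),
      ContinuousOn (fun l => ∫ s in (0 : ℝ)..δ, g l (toTorus (s, t))) V := fun g hg t ht =>
    continuousOn_integral_Icc hδ.le (hg.comp (f := fun q : Λ × ℝ => (q.1, toTorus (q.2, t)))
      (continuous_fst.prodMk (continuous_toTorus.comp
        (continuous_snd.prodMk continuous_const))).continuousOn fun q hq => hq.1 q.2 hq.2 t ht)
  have ht : ∀ (g : Λ → S1 × S1 → ℝ), ContinuousOn (fun q : Λ × (S1 × S1) => g q.1 q.2)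
      {q | q.2 ∈ annulus (κ q.1)} → ∀ s ∈ Icc 0 δ,
      ContinuousOn (fun l => ∫ t in y₀..y₀ + δ, g l (toTorus (s, t))) V := fun g hg s hs =>
    continuousOn_integral_Icc (by linarith) (hg.comp
      (f := fun q : Λ × ℝ => (q.1, toTorus (s, q.2)))
      (continuous_fst.prodMk (continuous_toTorus.comp
        (continuous_const.prodMk continuous_snd))).continuousOn fun q hq => hq.1 s hs q.2 hq.2)
  have hin : ContinuousOn (fun q : Λ × ℝ => ∫ t in y₀..y₀ + δ, (X q.1).f (toTorus (q.2, t)))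
      (V ×ˢ Icc 0 δ) := by
    refine continuousOn_integral_Icc (Φ := fun (q : Λ × ℝ) t => (X q.1).f (toTorus (q.2, t)))
      (by linarith) (hf.comp (f := fun q : (Λ × ℝ) × ℝ => (q.1.1, toTorus (q.1.2, q.2))) ?_ ?_)
    · refine Continuous.continuousOn (Continuous.prodMk (by fun_prop)
        (continuous_toTorus.comp (by fun_prop)))
    · rintro ⟨⟨l, s⟩, t⟩ ⟨⟨hl, hs⟩, ht⟩
      exact hl s hs t ht
  have hout : ContinuousOn
      (fun l => ∫ s in (0 : ℝ)..δ, ∫ t in y₀..y₀ + δ, (X l).f (toTorus (s, t))) V :=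
    continuousOn_integral_Icc hδ.le hin
  have hpos : ∀ l ∈ V, 0 < ∫ s in (0 : ℝ)..δ, ∫ t in y₀..y₀ + δ, (X l).f (toTorus (s, t)) := by
    intro l hl
    have h1 : ContinuousOn (fun s => ∫ t in y₀..y₀ + δ, (X l).f (toTorus (s, t))) (Icc 0 δ) :=
      hin.comp (f := fun s : ℝ => (l, s)) (by fun_prop) fun s hs => ⟨hl, hs⟩
    refine intervalIntegral.intervalIntegral_pos_of_pos_on
      (h1.intervalIntegrable_of_Icc hδ.le) (fun s hs => ?_) hδ
    have h2 : ContinuousOn (fun t => (X l).f (toTorus (s, t))) (Icc y₀ (y₀ + δ)) :=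
      hf.comp (f := fun t : ℝ => (l, toTorus (s, t)))
        (continuous_const.prodMk (continuous_toTorus.comp
          (continuous_const.prodMk continuous_id))).continuousOn
        fun t ht => hl s (Ioo_subset_Icc_self hs) t ht
    exact intervalIntegral.intervalIntegral_pos_of_pos_on
      (h2.intervalIntegrable_of_Icc (by linarith))
      (fun t ht => (X l).f_pos _ (hl s (Ioo_subset_Icc_self hs) t (Ioo_subset_Icc_self ht)))
      (by linarith)
  set a := fun l => (X l).conn.a (e l)
  set b := fun l => (X l).conn.b (e l)
  -- By the Stokes formula the sign is the circulation of the connection form around the rectangle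
  -- divided by its area for `f`. Both depend continuously on the parameter, and the area does not
  -- vanish.
  have key := ((((hs a ha y₀ hy₀).add (ht b hb' δ hδδ)).sub (hs a ha (y₀ + δ) hy₁)).sub
    (ht b hb' 0 h0δ)).div hout fun l hl => (hpos l hl).ne'
  refine (key.congr fun l hl => ?_).continuousAt hR
  have h1 := (X l).curvature (e l) (he l) 0 δ y₀ (y₀ + δ) hδ.le (by linarith)
    fun s hs t ht => by rw [hb]; exact hl s hs t ht
  simp only [intervalIntegral.integral_const_mul] at h1
  exact eq_div_of_mul_eq (hpos l hl).ne' h1.symm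

/-- The identifications given by the normal form depend continuously on a parameter. -/
theorem exists_continuousOn_isConjugation (he : ∀ l, e l ∈ (X l).bundle.atlas)
    (hb : ∀ l, (e l).baseSet = annulus (κ l)) (hκ : Continuous fun q : Λ × S1 => κ q.1 q.2)
    (ha : ContinuousOn (fun q : Λ × (S1 × S1) => (X q.1).conn.a (e q.1) q.2)
      {q | q.2 ∈ annulus (κ q.1)})
    (hb' : ContinuousOn (fun q : Λ × (S1 × S1) => (X q.1).conn.b (e q.1) q.2)
      {q | q.2 ∈ annulus (κ q.1)})
    (hf : ContinuousOn (fun q : Λ × (S1 × S1) => (X q.1).f q.2) {q | q.2 ∈ annulus (κ q.1)}) :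
    ∃ Ψ : ∀ l, M l ≃ₜ Jet, (∀ l, ∃ ρ : Γ →* JetGroup, (X l).IsConjugation (Ψ l) ρ) ∧
      ContinuousOn
        (fun q : Λ × ((S1 × S1) × ℝ) => Ψ q.1 ((e q.1).toOpenPartialHomeomorph.symm q.2))
        {q | q.2.1 ∈ annulus (κ q.1)} := by
  -- The normal forms start from the given trivialisations, so the momentum and the potential are
  -- the explicit integrals whose continuity in the parameter is known.
  have N := fun l => (X l).normalForm ((X l).conn.isCoord_of_mem_atlas (he l) (hb l))
  refine ⟨fun l => (N l).jetHomeo, fun l => ?_, ?_⟩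
  · obtain ⟨ρ, hρ, -⟩ := (N l).exists_isConjugation
    exact ⟨ρ, hρ⟩
  have hF : ContinuousOn (fun q : Λ × (S1 × S1) => (X q.1).sgn * (X q.1).f q.2)
      {q | q.2 ∈ annulus (κ q.1)} :=
    ((continuous_sgn he hb hκ ha hb' hf).comp continuous_fst).continuousOn.mul hf
  have hmain := continuousOn_jet_family (κ := κ)
    (R := fun l => momentum (κ l) ((X l).conn.a (e l)) ((X l).conn.b (e l))
      fun x => (X l).sgn * (X l).f x)
    (P := fun l => potential (κ l) ((X l).conn.a (e l)) ((X l).conn.b (e l)))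
    (continuousOn_momentum_family (a := fun l => (X l).conn.a (e l))
      (b := fun l => (X l).conn.b (e l)) (F := fun l x => (X l).sgn * (X l).f x) hκ ha hb' hF)
    (continuousOn_potential_family (a := fun l => (X l).conn.a (e l))
      (b := fun l => (X l).conn.b (e l)) hκ ha hb')
  refine hmain.congr fun q hq => ?_
  have hq' : q.2 ∈ (e q.1).target := by
    rw [(e q.1).mem_target, hb]
    exact hq
  have h1 : (X q.1).bundle.proj ((e q.1).toOpenPartialHomeomorph.symm q.2) = q.2.1 :=
    (e q.1).proj_symm_apply hq'
  have h2 : ((e q.1) ((e q.1).toOpenPartialHomeomorph.symm q.2)).2 = q.2.2 :=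
    congrArg Prod.snd ((e q.1).apply_symm_apply hq')
  simp only [ConjugationData.NormalForm.jetHomeo_apply, ConjugationData.jetChart, h1, h2]

end family

end

theorem theorem8p1 {S : Type*} [TopologicalSpace S] [T2Space S] [CompactSpace S] [ConnectedSpace S]
    [ChartedSpace (EuclideanSpace ℝ (Fin 2)) S] (x₀ : S) :
    -- existence, the Anosov property, and uniqueness
    (∀ (κ : S1 ≃ₜ S1) (M : Type*) [TopologicalSpace M] [AddAction ℝ M]
        (X : ConjugationData (FundamentalGroup S x₀) κ M),
      (∃ (Ψ : M ≃ₜ Jet) (ρ : FundamentalGroup S x₀ →* JetGroup), X.IsConjugation Ψ ρ) ∧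
      (∀ (Ψ : M ≃ₜ Jet) (ρ : FundamentalGroup S x₀ →* JetGroup), X.IsConjugation Ψ ρ →
        IsAnosov ρ ∧
        (StronglyContractsLeaves X.act (fun t m => t +ᵥ m) (PrincipalBundle.leaves X.conn) →
          StronglyContractsLeaves (jetHom.comp ρ) jetFlow jetLeaves) ∧
        ∀ (Ψ' : M ≃ₜ Jet) (ρ' : FundamentalGroup S x₀ →* JetGroup),
          X.IsConjugation Ψ' ρ' ↔
            ∃ g : JetGroup, (∀ m, Ψ' m = jetHom g (Ψ m)) ∧ ∀ γ, ρ' γ = g * ρ γ * g⁻¹)) ∧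
    -- continuous dependence on a parameter
    (∀ (Λ : Type*) [TopologicalSpace Λ] (κ : Λ → (S1 ≃ₜ S1)) (M : Λ → Type*)
        [∀ l, TopologicalSpace (M l)] [∀ l, AddAction ℝ (M l)]
        (X : ∀ l, ConjugationData (FundamentalGroup S x₀) (κ l) (M l))
        (e : ∀ l, Bundle.Trivialization ℝ (X l).bundle.proj),
      (∀ l, e l ∈ (X l).bundle.atlas) → (∀ l, (e l).baseSet = annulus (κ l)) →
      Continuous (fun q : Λ × S1 => κ q.1 q.2) →
      ContinuousOn (fun q : Λ × (S1 × S1) => (X q.1).conn.a (e q.1) q.2)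
        {q | q.2 ∈ annulus (κ q.1)} →
      ContinuousOn (fun q : Λ × (S1 × S1) => (X q.1).conn.b (e q.1) q.2)
        {q | q.2 ∈ annulus (κ q.1)} →
      ContinuousOn (fun q : Λ × (S1 × S1) => (X q.1).f q.2) {q | q.2 ∈ annulus (κ q.1)} →
      ∃ Ψ : ∀ l, M l ≃ₜ Jet,
        (∀ l, ∃ ρ : FundamentalGroup S x₀ →* JetGroup, (X l).IsConjugation (Ψ l) ρ) ∧
        ContinuousOn
          (fun q : Λ × ((S1 × S1) × ℝ) => Ψ q.1 ((e q.1).toOpenPartialHomeomorph.symm q.2))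
          {q | q.2.1 ∈ annulus (κ q.1)}) := by
  refine ⟨fun κ M _ _ X => ⟨?_, fun Ψ ρ h => ⟨h.isAnosov.1, h.isAnosov.2, fun Ψ' ρ' =>
    h.isConjugation_iff⟩⟩, ?_⟩
  · obtain ⟨v, r, N⟩ := X.exists_normalForm
    obtain ⟨ρ, h, -⟩ := N.exists_isConjugation
    exact ⟨_, ρ, h⟩
  · intro Λ _ κ M _ _ X e he hb hκ ha hb' hf
    exact exists_continuousOn_isConjugation he hb hκ ha hb' hf
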